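/- **Lemma 3.1.** Let $0<2\alpha<1$, $0<2\beta<1$, let $a,b,l>0$, and let $\Gamma:\ s\mapsto(x(s),y(s))$, $0\le s\le l$, be a simple plane curve parametrized by arc length ($x'^2+y'^2=1$) from $A=(a,0)$ to $B=(0,b)$ with $x(s)>0$, $y(s)>0$ for $0<s<l$, such that $x,y$ are twice continuously differentiable on $[0,l]$, $x'',y''$ satisfy a Hölder condition on $[0,l]$, and, for some constants $c$ and $0<\varepsilon<1$, the inequalities $|x'(s)|\le c\,y(s)^{1+\varepsilon}$ and $|y'(s)|\le c\,x(s)^{1+\varepsilon}$ hold for $s$ near $0$ and for $s$ near $l$. Let $\Omega\subset\{(x,y):x>0,\ y>0\}$ be a domain (a nonempty connected open set) whose boundary is $([0,a]\times\{0\})\cup(\{0\}\times[0,b])\cup\Gamma$. For $x_0,y_0\ge 0$ put $$q_1(x,y;x_0,y_0)=k_1\,(r^2)^{-\alpha-\beta}F_2(\alpha+\beta;\alpha,\beta;2\alpha,2\beta;\xi,\eta),\qquad k_1=\frac{2^{2\alpha+2\beta}}{4\pi}\,\frac{\Gamma(\alpha)\Gamma(\beta)\Gamma(\alpha+\beta)}{\Gamma(2\alpha)\Gamma(2\beta)},$$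 $$r^2=(x-x_0)^2+(y-y_0)^2,\quad r_1^2=(x+x_0)^2+(y-y_0)^2,\quad r_2^2=(x-x_0)^2+(y+y_0)^2,\quad \xi=\frac{r^2-r_1^2}{r^2},\quad \eta=\frac{r^2-r_2^2}{r^2},$$ where $F_2$ is Appell's hypergeometric function $$F_2(A;b_1,b_2;c_1,c_2;\xi,\eta)=\sum_{m,n\ge 0}\frac{(A)_{m+n}(b_1)_m(b_2)_n}{(c_1)_m(c_2)_n\,m!\,n!}\,\xi^m\eta^n\qquad(|\xi|+|\eta|<1),$$ continued analytically along the segment from $(0,0)$ to $(\xi,\eta)$. Let $\partial/\partial n=\frac{dy}{ds}\frac{\partial}{\partial x}-\frac{dx}{ds}\frac{\partial}{\partial y}$ denote the derivative along the exterior normal of $\Gamma$, acting on the variables $(x,y)$. Then, for every point $(x_0,y_0)$ with $x_0\ge 0$, $y_0\ge 0$ of one of the three kinds below, the following integral (the double layer potential $w^{(1)}$ with density $1$) converges absolutely, and $$\int_0^l x(s)^{2\alpha}y(s)^{2\beta}\,\frac{\partial q_1(x(s),y(s);x_0,y_0)}{\partial n}\,ds=\begin{cases}-1,&(x_0,y_0)\in\Omega,\\[2pt]-\tfrac12,&(x_0,y_0)\in\Gamma,\\[2pt]0,&(x_0,y_0)\notin\overline\Omega.\end{cases}$$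 -/

import Mathlib

open Set Filter Topology

namespace GASPT

/-- The general term of the Appell double series `F₂(a; b₁, b₂; c₁, c₂; ξ, η)`,
`(a)_{m+n} (b₁)_m (b₂)_n / ((c₁)_m (c₂)_n m! n!) ξ^m η^n`. -/
noncomputable def appellF2Term (a b₁ b₂ c₁ c₂ ξ η : ℝ) (p : ℕ × ℕ) : ℝ :=
  (ascPochhammer ℝ (p.1 + p.2)).eval a * (ascPochhammer ℝ p.1).eval b₁
      * (ascPochhammer ℝ p.2).eval b₂
    / ((ascPochhammer ℝ p.1).eval c₁ * (ascPochhammer ℝ p.2).eval c₂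
      * (p.1.factorial : ℝ) * (p.2.factorial : ℝ)) * ξ ^ p.1 * η ^ p.2

/-- The sum of the Appell double series; it converges absolutely for `|ξ| + |η| < 1`. -/
noncomputable def appellF2Series (a b₁ b₂ c₁ c₂ ξ η : ℝ) : ℝ :=
  ∑' p : ℕ × ℕ, appellF2Term a b₁ b₂ c₁ c₂ ξ η p

/-- `g` is an analytic continuation of `t ↦ F₂(a; b₁, b₂; c₁, c₂; t ξ, t η)` along `0 ≤ t ≤ 1`:
it is real-analytic in a neighbourhood of `[0, 1]` and equals the sum of the double series for all
`t` near `0`. -/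
def IsAppellF2Continuation (a b₁ b₂ c₁ c₂ ξ η : ℝ) (g : ℝ → ℝ) : Prop :=
  AnalyticOnNhd ℝ g (Icc 0 1) ∧
    ∀ᶠ t in 𝓝 (0 : ℝ), g t = appellF2Series a b₁ b₂ c₁ c₂ (t * ξ) (t * η)

open Classical in
/-- Appell's hypergeometric function `F₂(a; b₁, b₂; c₁, c₂; ξ, η)` of real arguments: the double
series, continued analytically along the segment from `(0, 0)` to `(ξ, η)`. The continuation is
needed because the fundamental solution evaluates `F₂` at arbitrarily large negative `ξ` and `η`,
where the series diverges. (The value is `0` if there is no continuation along that segment.) -/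
noncomputable def appellF2 (a b₁ b₂ c₁ c₂ ξ η : ℝ) : ℝ :=
  if h : ∃ g : ℝ → ℝ, IsAppellF2Continuation a b₁ b₂ c₁ c₂ ξ η g then h.choose 1 else 0

/-- The value of `appellF2` does not depend on the chosen continuation. -/
theorem IsAppellF2Continuation.appellF2_eq {a b₁ b₂ c₁ c₂ ξ η : ℝ} {g : ℝ → ℝ}
    (hg : IsAppellF2Continuation a b₁ b₂ c₁ c₂ ξ η g) :
    appellF2 a b₁ b₂ c₁ c₂ ξ η = g 1 := by
  have h : ∃ g : ℝ → ℝ, IsAppellF2Continuation a b₁ b₂ c₁ c₂ ξ η g := ⟨g, hg⟩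
  have hc := h.choose_spec
  rw [appellF2, dif_pos h]
  refine hc.1.eqOn_of_preconnected_of_eventuallyEq hg.1 isPreconnected_Icc
    (left_mem_Icc.2 zero_le_one) ?_ (right_mem_Icc.2 zero_le_one)
  filter_upwards [hc.2, hg.2] with t h1 h2
  rw [h1, h2]

/-- `r² = (x - x₀)² + (y - y₀)²`. -/
def rSq (x y x₀ y₀ : ℝ) : ℝ := (x - x₀) ^ 2 + (y - y₀) ^ 2

/-- `r₁² = (x + x₀)² + (y - y₀)²`. -/
def r1Sq (x y x₀ y₀ : ℝ) : ℝ := (x + x₀) ^ 2 + (y - y₀) ^ 2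

/-- `r₂² = (x - x₀)² + (y + y₀)²`. -/
def r2Sq (x y x₀ y₀ : ℝ) : ℝ := (x - x₀) ^ 2 + (y + y₀) ^ 2

/-- `ξ = (r² - r₁²) / r²`. -/
noncomputable def xiVar (x y x₀ y₀ : ℝ) : ℝ :=
  (rSq x y x₀ y₀ - r1Sq x y x₀ y₀) / rSq x y x₀ y₀

/-- `η = (r² - r₂²) / r²`. -/
noncomputable def etaVar (x y x₀ y₀ : ℝ) : ℝ :=
  (rSq x y x₀ y₀ - r2Sq x y x₀ y₀) / rSq x y x₀ y₀

/-- `k₁ = 2^(2α+2β) / (4π) * Γ(α) Γ(β) Γ(α+β) / (Γ(2α) Γ(2β))`. -/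
noncomputable def k1 (α β : ℝ) : ℝ :=
  (2 : ℝ) ^ (2 * α + 2 * β) / (4 * Real.pi) *
    (Real.Gamma α * Real.Gamma β * Real.Gamma (α + β) /
      (Real.Gamma (2 * α) * Real.Gamma (2 * β)))

/-- The first fundamental solution
`q₁(x, y; x₀, y₀) = k₁ (r²)^(-α-β) F₂(α+β; α, β; 2α, 2β; ξ, η)` of
`u_xx + u_yy + (2α/x) u_x + (2β/y) u_y = 0` with pole `(x₀, y₀)`. -/
noncomputable def q1 (α β x y x₀ y₀ : ℝ) : ℝ :=
  k1 α β * rSq x y x₀ y₀ ^ (-α - β) *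
    appellF2 (α + β) α β (2 * α) (2 * β) (xiVar x y x₀ y₀) (etaVar x y x₀ y₀)

/-- The curve `Γ : s ↦ (x s, y s)`, `0 ≤ s ≤ l`: a simple arc, parametrized by arc length, from
`A = (a, 0)` to `B = (0, b)`, with all other points in the open first quadrant, satisfying the
regularity conditions below. -/
structure IsAdmissibleArc (a b l : ℝ) (x y : ℝ → ℝ) : Prop where
  a_pos : 0 < a
  b_pos : 0 < b
  l_pos : 0 < l
  start_x : x 0 = a
  start_y : y 0 = 0
  end_x : x l = 0
  end_y : y l = b
  x_pos : ∀ s ∈ Ioo 0 l, 0 < x s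
  y_pos : ∀ s ∈ Ioo 0 l, 0 < y s
  simple : InjOn (fun s => (x s, y s)) (Icc 0 l)
  contDiffOn_x : ContDiffOn ℝ 2 x (Icc 0 l)
  contDiffOn_y : ContDiffOn ℝ 2 y (Icc 0 l)
  /-- `s` is the arc length; in particular `x'` and `y'` do not vanish simultaneously. -/
  arcLength : ∀ s ∈ Icc 0 l,
    derivWithin x (Icc 0 l) s ^ 2 + derivWithin y (Icc 0 l) s ^ 2 = 1
  /-- `x''` is Hölder continuous on `[0, l]`. -/
  holder_x : ∃ C γ : NNReal, 0 < γ ∧ γ ≤ 1 ∧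
    HolderOnWith C γ (iteratedDerivWithin 2 x (Icc 0 l)) (Icc 0 l)
  /-- `y''` is Hölder continuous on `[0, l]`. -/
  holder_y : ∃ C γ : NNReal, 0 < γ ∧ γ ≤ 1 ∧
    HolderOnWith C γ (iteratedDerivWithin 2 y (Icc 0 l)) (Icc 0 l)
  /-- `|dx/ds| ≤ c y^(1+ε)` and `|dy/ds| ≤ c x^(1+ε)` near the two end points. -/
  near_ends : ∃ c ε δ : ℝ, 0 < ε ∧ ε < 1 ∧ 0 < δ ∧
    ∀ s ∈ Icc 0 l, (s < δ ∨ l - δ < s) →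
      |derivWithin x (Icc 0 l) s| ≤ c * y s ^ (1 + ε) ∧
      |derivWithin y (Icc 0 l) s| ≤ c * x s ^ (1 + ε)

/-- The set of points of the curve (including its end points). -/
def arcSet (l : ℝ) (x y : ℝ → ℝ) : Set (ℝ × ℝ) := (fun s => (x s, y s)) '' Icc 0 l

/-- `Ω` is a domain in the open first quadrant whose boundary consists of the interval from `(0, 0)`
to `(a, 0)`, the interval from `(0, 0)` to `(0, b)`, and the curve `Γ`. -/
structure IsDomainBoundedBy (Ω : Set (ℝ × ℝ)) (a b l : ℝ) (x y : ℝ → ℝ) : Prop where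
  isOpen : IsOpen Ω
  isConnected : IsConnected Ω
  subset_quadrant : Ω ⊆ Ioi 0 ×ˢ Ioi 0
  frontier_eq : frontier Ω = Icc 0 a ×ˢ {0} ∪ {0} ×ˢ Icc 0 b ∪ arcSet l x y

/-- The derivative `∂q₁/∂n = (dy/ds) ∂q₁/∂x - (dx/ds) ∂q₁/∂y` along the exterior normal at the
point of the curve with parameter `s`. -/
noncomputable def normalDerivQ1 (α β l : ℝ) (x y : ℝ → ℝ) (x₀ y₀ s : ℝ) : ℝ :=
  derivWithin y (Icc 0 l) s * deriv (fun t => q1 α β t (y s) x₀ y₀) (x s)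
    - derivWithin x (Icc 0 l) s * deriv (fun t => q1 α β (x s) t x₀ y₀) (y s)

/-- The integrand `x^(2α) y^(2β) μ(s) ∂q₁/∂n` of the double layer potential with density `μ`. -/
noncomputable def doubleLayerIntegrand (α β l : ℝ) (x y μ : ℝ → ℝ) (x₀ y₀ s : ℝ) : ℝ :=
  x s ^ (2 * α) * y s ^ (2 * β) * μ s * normalDerivQ1 α β l x y x₀ y₀ s

/-- The double layer potential `w⁽¹⁾(x₀, y₀)` with density `μ`. -/
noncomputable def doubleLayer (α β l : ℝ) (x y μ : ℝ → ℝ) (x₀ y₀ : ℝ) : ℝ :=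
  ∫ s in (0 : ℝ)..l, doubleLayerIntegrand α β l x y μ x₀ y₀ s

end GASPT

namespace GASPT

open MeasureTheory

/-! The fundamental solution is a time integral of a product of two one-dimensional heat kernels,
and the double layer form is then exact up to a multiple of the angle around the pole.

Euler's double integral represents F₂ at nonpositive arguments through two angular variables. A
Gamma integral turns the remaining power into exponentials, and the angles separate. With time
written as 1/(4t), the result is `q1_eq_integral`: the product of `besselHeat` in x (weight x^(2α))
and in y (weight y^(2β)), integrated against dt/(4t²). Each kernel has mass one and is a Gaussian
times the angular integral `besInt`, a rescaled modified Bessel function.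

Let F be the distribution function of the x-kernel and G that of the y-kernel. By the heat equation,
∂F/∂t is the flux of the x-kernel, and similarly for G. The function S = ∫ (∂F/∂t) G dt
(`heatStream`) therefore has as differential minus the double layer form, by one integration by
parts in t; S is defined off the line x = x₀. Exchanging the coordinates gives S' = ∫ F (∂G/∂t) dt,
whose differential is the form itself, off the line y = y₀. Moreover S + S' is the integral of
d(FG)/dt, that is, the limit of FG as t → ∞: it is 1 if x > x₀ and y > y₀, and 0 if x < x₀ or y <
y₀. So -S and S' are branches of one potential with period -1 around the pole. Adding arg/(2π) makes
the potential single-valued on the punctured quadrant (`fluxPotential`). For an interior pole S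
vanishes on x = 0 and S' on y = 0, so only arguments remain at the ends of the arc, and the integral
equals minus the index of the pole with respect to the arc closed up along the axes (`arcIndex`).

If the pole lies inside the arc, the form is -dθ/(2π) + o(1/r) near it. Hence the corrected
potential does not jump at the pole, and the same formula holds with an absolutely convergent angle
integral. At an end point no angle is needed: the arc meets the axis orthogonally, and S' tends to
1/2 along it (`tendsto_heatStream_half`). For a pole on an axis beyond the arc, S' has limit zero at
both ends.

The index is computed without the Jordan curve theorem. Off the arc it is an integer, locally
constant, and equal to 1 next to the base segment (0, a), hence 1 throughout Ω. On the arc twice the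
index is the sum of the values on the two sides, so it is an integer; it is continuous along the arc
and tends to 1 at the start, which gives 1/2. The values on the two sides therefore add up to 1.
Consequently "outside Ω the index is 0" propagates across the arc and, by connectedness, through the
whole quadrant. -/

/-! ### The angular measure -/

/-- The measure `sin^(2α-1) φ dφ` on `(0, π)`. -/
noncomputable def angMeasure (α : ℝ) : Measure ℝ :=
  (volume.restrict (Ioo 0 Real.pi)).withDensity
    (fun φ => ENNReal.ofReal (Real.sin φ ^ (2 * α - 1)))

theorem measurable_sin_rpow (r : ℝ) :
    Measurable (fun φ : ℝ => ENNReal.ofReal (Real.sin φ ^ r)) :=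
  ((Real.measurable_sin).pow_const r).ennreal_ofReal

theorem lintegral_angMeasure (α : ℝ) {f : ℝ → ENNReal} (hf : Measurable f) :
    ∫⁻ φ, f φ ∂angMeasure α
      = ∫⁻ φ in Ioo 0 Real.pi, ENNReal.ofReal (Real.sin φ ^ (2 * α - 1)) * f φ := by
  rw [angMeasure, lintegral_withDensity_eq_lintegral_mul _ (measurable_sin_rpow _) hf]
  rfl

theorem integral_angMeasure (α : ℝ) (f : ℝ → ℝ) :
    ∫ φ, f φ ∂angMeasure α
      = ∫ φ in Ioo 0 Real.pi, Real.sin φ ^ (2 * α - 1) * f φ := by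
  rw [angMeasure, integral_withDensity_eq_integral_toReal_smul (measurable_sin_rpow _)
    (by simp)]
  refine setIntegral_congr_fun measurableSet_Ioo fun φ hφ => ?_
  simp only [smul_eq_mul]
  rw [ENNReal.toReal_ofReal (Real.rpow_nonneg (Real.sin_pos_of_mem_Ioo hφ).le _)]

theorem ae_angMeasure (α : ℝ) : ∀ᵐ φ ∂angMeasure α, φ ∈ Ioo 0 Real.pi :=
  (withDensity_absolutelyContinuous _ _).ae_le (ae_restrict_mem measurableSet_Ioo)

theorem lintegral_gaussian {t : ℝ} (ht : 0 < t) (c : ℝ) :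
    ∫⁻ X : ℝ, ENNReal.ofReal (Real.exp (-t * (X - c) ^ 2))
      = ENNReal.ofReal √(Real.pi / t) := by
  rw [← integral_gaussian t, ← integral_sub_right_eq_self (fun X => Real.exp (-t * X ^ 2)) c,
    ofReal_integral_eq_lintegral_ofReal]
  · exact (integrable_exp_neg_mul_sq ht).comp_sub_right c
  · exact Eventually.of_forall fun x => (Real.exp_pos _).le

theorem lintegral_rpow_mul_gaussian {t q : ℝ} (ht : 0 < t) (hq : -1 < q) :
    ∫⁻ Y in Ioi (0 : ℝ), ENNReal.ofReal (Y ^ q * Real.exp (-t * Y ^ 2))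
      = ENNReal.ofReal (t ^ (-(q + 1) / 2) * (1 / 2) * Real.Gamma ((q + 1) / 2)) := by
  rw [← integral_rpow_mul_exp_neg_mul_rpow two_pos hq ht, ofReal_integral_eq_lintegral_ofReal]
  · simp
  · exact integrableOn_rpow_mul_exp_neg_mul_rpow hq two_pos ht
  · filter_upwards [ae_restrict_mem measurableSet_Ioi] with x hx
    exact mul_nonneg (Real.rpow_nonneg (le_of_lt hx) _) (Real.exp_pos _).le

/-- The mass of the weighted Gaussian centred at `x₀`, in polar coordinates. -/
theorem lintegral_polar_gaussian {α t : ℝ} (hα : 0 < α) (ht : 0 < t) (x₀ : ℝ) :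
    ∫⁻ s in Ioi (0 : ℝ), ENNReal.ofReal (s ^ (2 * α)) * ∫⁻ φ,
        ENNReal.ofReal (Real.exp (-t * (s ^ 2 + x₀ ^ 2 - 2 * s * x₀ * Real.cos φ))) ∂angMeasure α
      = ENNReal.ofReal (√(Real.pi / t) * (t ^ (-α) * (1 / 2) * Real.Gamma α)) := by
  -- In the half-plane with X = s cos φ, Y = s sin φ, the planar density Y^(2α-1) exp(-t((X - x₀)² +
  -- Y²)) together with the Jacobian s produces the weight s^(2α) sin^(2α-1) φ. In Cartesian
  -- coordinates it factors.
  set f : ℝ × ℝ → ENNReal := fun p => ENNReal.ofReal (Real.exp (-t * (p.1 - x₀) ^ 2)) *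
    (Ioi (0 : ℝ)).indicator
      (fun Y => ENNReal.ofReal (Y ^ (2 * α - 1) * Real.exp (-t * Y ^ 2))) p.2 with hf
  have hfm : Measurable f := by
    apply Measurable.mul
    · fun_prop
    · refine Measurable.comp (g := (Ioi (0 : ℝ)).indicator
        (fun Y => ENNReal.ofReal (Y ^ (2 * α - 1) * Real.exp (-t * Y ^ 2)))) ?_ measurable_snd
      exact Measurable.indicator (by fun_prop) measurableSet_Ioi
  have h1 : ∫⁻ p : ℝ × ℝ, f p
      = ENNReal.ofReal (√(Real.pi / t) * (t ^ (-α) * (1 / 2) * Real.Gamma α)) := by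
    simp only [hf]
    rw [Measure.volume_eq_prod, lintegral_prod_mul
      (f := fun X => ENNReal.ofReal (Real.exp (-t * (X - x₀) ^ 2)))
      (g := (Ioi (0 : ℝ)).indicator
        (fun Y => ENNReal.ofReal (Y ^ (2 * α - 1) * Real.exp (-t * Y ^ 2)))) (by fun_prop)
      (Measurable.indicator (by fun_prop) measurableSet_Ioi).aemeasurable,
      lintegral_gaussian ht, lintegral_indicator measurableSet_Ioi,
      lintegral_rpow_mul_gaussian ht (by linarith), ← ENNReal.ofReal_mul (by positivity)]
    congr 4
    · ring_nf
    · ring_nf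
  -- Polar coordinates use angles in (-π, π); the indicator of Y > 0 restricts them to (0, π).
  rw [← h1, ← lintegral_comp_polarCoord_symm, polarCoord_target, Measure.volume_eq_prod,
    ← Measure.prod_restrict, lintegral_prod]
  swap
  · apply Measurable.aemeasurable
    simp only [smul_eq_mul]
    exact (by fun_prop : Measurable fun p : ℝ × ℝ => ENNReal.ofReal p.1).mul
      (hfm.comp continuous_polarCoord_symm.measurable)
  refine setLIntegral_congr_fun measurableSet_Ioi fun s hs => ?_
  have hs : 0 < s := hs
  simp only
  rw [lintegral_angMeasure _ (by fun_prop), ← lintegral_const_mul _ (by fun_prop),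
    ← lintegral_indicator measurableSet_Ioo, ← lintegral_indicator measurableSet_Ioo]
  congr 1
  ext φ
  simp only [indicator_apply, hf, polarCoord_symm_apply, smul_eq_mul, mem_Ioo, mem_Ioi]
  by_cases h : 0 < φ ∧ φ < Real.pi
  · have hsin : 0 < Real.sin φ := Real.sin_pos_of_mem_Ioo h
    rw [if_pos h, if_pos ⟨by linarith, h.2⟩, if_pos (by positivity),
      ← ENNReal.ofReal_mul (by positivity), ← ENNReal.ofReal_mul (by positivity),
      ← ENNReal.ofReal_mul (by positivity), ← ENNReal.ofReal_mul (by positivity)]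
    congr 1
    have e1 : s ^ (2 * α) = s * s ^ (2 * α - 1) := by
      rw [← Real.rpow_one_add' hs.le (by linarith)]; ring_nf
    have e2 : Real.exp (-t * (s ^ 2 + x₀ ^ 2 - 2 * s * x₀ * Real.cos φ))
        = Real.exp (-t * (s * Real.cos φ - x₀) ^ 2) * Real.exp (-t * (s * Real.sin φ) ^ 2) := by
      rw [← Real.exp_add]
      congr 1
      linear_combination (-t * s ^ 2) * (-1 : ℝ) * Real.sin_sq_add_cos_sq φ
    rw [e1, e2, Real.mul_rpow hs.le hsin.le]
    ring
  -- For an angle in (-π, 0] the sine is not positive, so the indicator of Y > 0 vanishes.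
  · rw [if_neg h]
    split_ifs with h' h''
    · exfalso
      have : φ ≤ 0 := by
        by_contra h3
        exact h ⟨not_le.1 h3, h'.2⟩
      have := Real.sin_nonpos_of_nonpos_of_neg_pi_le this h'.1.le
      nlinarith
    · simp
    · rfl

/-- For α < 1/2 the density is singular at 0 and π. Finiteness is read off from the polar Gaussian
with x₀ = 0: there the angular mass is a factor under the radial integral, which has a finite value.
-/
instance isFiniteMeasure_angMeasure {α : ℝ} [hα : Fact (0 < α)] :
    IsFiniteMeasure (angMeasure α) := by
  constructor
  have h := lintegral_polar_gaussian hα.out one_pos 0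
  have h0 := hα.out
  simp only [mul_zero, zero_mul, sub_zero, ne_eq, OfNat.ofNat_ne_zero, not_false_eq_true, zero_pow,
    add_zero, lintegral_const] at h
  by_contra hc
  rw [not_lt, top_le_iff] at hc
  rw [hc] at h
  have h2 : ∫⁻ s in Ioi (0 : ℝ), ENNReal.ofReal (s ^ (2 * α)) *
      (ENNReal.ofReal (Real.exp (-1 * s ^ 2)) * ⊤) = ⊤ := by
    rw [setLIntegral_congr_fun (g := fun _ => ⊤) measurableSet_Ioi]
    · simp
    · intro s hs
      have hs : 0 < s := hs
      simp only
      rw [ENNReal.mul_top, ENNReal.mul_top]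
      · simp; positivity
      · simp; positivity
  rw [h2] at h
  exact ENNReal.ofReal_ne_top h.symm

theorem integrable_angMeasure_of_continuous {α : ℝ} (hα : 0 < α) {f : ℝ → ℝ} (hf : Continuous f) :
    Integrable f (angMeasure α) := by
  have := Fact.mk hα
  obtain ⟨C, hC⟩ := isCompact_Icc (a := (0 : ℝ)) (b := Real.pi) |>.exists_bound_of_continuousOn
    hf.continuousOn
  refine Integrable.mono' (integrable_const C) hf.aestronglyMeasurable ?_
  filter_upwards [ae_angMeasure α] with φ hφ using hC φ (Ioo_subset_Icc_self hφ)

theorem integrableOn_sin_rpow_mul {α : ℝ} (hα : 0 < α) {f : ℝ → ℝ} (hf : Continuous f) :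
    IntegrableOn (fun φ => Real.sin φ ^ (2 * α - 1) * f φ) (Ioo 0 Real.pi) := by
  have h := integrable_angMeasure_of_continuous hα hf
  rw [angMeasure, integrable_withDensity_iff_integrable_smul' (measurable_sin_rpow _) (by simp)]
    at h
  refine IntegrableOn.congr_fun h (fun φ hφ => ?_) measurableSet_Ioo
  simp only [smul_eq_mul]
  rw [ENNReal.toReal_ofReal (Real.rpow_nonneg (Real.sin_pos_of_mem_Ioo hφ).le _)]

/-- Integration by parts against the angular measure. -/
theorem integral_angMeasure_by_parts {α : ℝ} (hα : 0 < α) {g g' : ℝ → ℝ}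
    (hg : ∀ φ, HasDerivAt g (g' φ) φ) (hg' : Continuous g') :
    ∫ φ, (2 * α * Real.cos φ * g φ + Real.sin φ * g' φ) ∂angMeasure α = 0 := by
  have hgc : Continuous g := continuous_iff_continuousAt.2 fun φ => (hg φ).continuousAt
  rw [integral_angMeasure, ← integral_Ioc_eq_integral_Ioo,
    ← intervalIntegral.integral_of_le Real.pi_pos.le]
  -- The primitive sin^(2α) φ · g vanishes at both ends because α > 0.
  rw [intervalIntegral.integral_eq_sub_of_hasDerivAt_of_le
    (f := fun φ => Real.sin φ ^ (2 * α) * g φ) Real.pi_pos.le]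
  · simp [Real.zero_rpow (by linarith : 2 * α ≠ 0)]
  · apply Continuous.continuousOn
    exact (Real.continuous_sin.rpow_const fun _ => Or.inr (by linarith)).mul hgc
  · intro φ hφ
    have hs := Real.sin_pos_of_mem_Ioo hφ
    have := ((Real.hasDerivAt_sin φ).rpow_const (p := 2 * α) (Or.inl hs.ne')).mul (hg φ)
    refine this.congr_deriv ?_
    rw [show Real.sin φ ^ (2 * α) = Real.sin φ ^ (2 * α - 1) * Real.sin φ by
      rw [← Real.rpow_add_one hs.ne']; ring_nf]
    ring
  · rw [intervalIntegrable_iff_integrableOn_Ioo_of_le Real.pi_pos.le]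
    exact integrableOn_sin_rpow_mul hα (by fun_prop)

/-- The moments of `(1 - cos φ)/2` satisfy the recursion of the beta distribution. -/
theorem integral_half_one_sub_cos_pow_succ {α : ℝ} (hα : 0 < α) (m : ℕ) :
    (2 * α + m) * ∫ φ, ((1 - Real.cos φ) / 2) ^ (m + 1) ∂angMeasure α
      = (α + m) * ∫ φ, ((1 - Real.cos φ) / 2) ^ m ∂angMeasure α := by
  have h := integral_angMeasure_by_parts hα (g := fun φ => ((1 - Real.cos φ) / 2) ^ m)
    (g' := fun φ => m * ((1 - Real.cos φ) / 2) ^ (m - 1) * (Real.sin φ / 2)) (fun φ => by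
      have := (((Real.hasDerivAt_cos φ).const_sub 1).div_const 2).pow m
      exact this.congr_deriv (by simp)) (by fun_prop)
  have e : ∀ φ : ℝ, 2 * α * Real.cos φ * ((1 - Real.cos φ) / 2) ^ m
      + Real.sin φ * (m * ((1 - Real.cos φ) / 2) ^ (m - 1) * (Real.sin φ / 2))
      = (2 * (α + m)) * ((1 - Real.cos φ) / 2) ^ m
        - (2 * (2 * α + m)) * ((1 - Real.cos φ) / 2) ^ (m + 1) := by
    intro φ
    have hs := Real.sin_sq_add_cos_sq φ
    -- The exponent `m - 1` is truncated, so m = 0 is checked apart.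
    rcases m with _ | m
    · simp; ring
    · simp only [Nat.add_sub_cancel]
      push_cast
      rw [pow_succ, pow_succ, pow_succ]
      linear_combination (↑m + 1) / 2 * ((1 - Real.cos φ) / 2) ^ m * hs
  simp only [e] at h
  rw [integral_sub, integral_const_mul, integral_const_mul] at h
  · linarith
  · exact integrable_angMeasure_of_continuous hα (by fun_prop)
  · exact integrable_angMeasure_of_continuous hα (by fun_prop)

/-! ### Angular integrals of Bessel type -/

/-- `∫ (1 - cos φ)^k exp (-2w(1 - cos φ)) sin^(2α-1) φ dφ` over `(0, π)`. -/
noncomputable def besInt (k : ℕ) (α w : ℝ) : ℝ :=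
  ∫ φ, (1 - Real.cos φ) ^ k * Real.exp (-2 * w * (1 - Real.cos φ)) ∂angMeasure α

theorem integrable_besInt (k : ℕ) {α : ℝ} (hα : 0 < α) (w : ℝ) :
    Integrable (fun φ => (1 - Real.cos φ) ^ k * Real.exp (-2 * w * (1 - Real.cos φ)))
      (angMeasure α) :=
  integrable_angMeasure_of_continuous hα (by fun_prop)

theorem hasDerivAt_besInt (k : ℕ) {α : ℝ} (hα : 0 < α) (w : ℝ) :
    HasDerivAt (besInt k α) (-2 * besInt (k + 1) α w) w := by
  have := Fact.mk hα
  have h := (hasDerivAt_integral_of_dominated_loc_of_deriv_le (μ := angMeasure α) (𝕜 := ℝ)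
    (F := fun w φ => (1 - Real.cos φ) ^ k * Real.exp (-2 * w * (1 - Real.cos φ)))
    (F' := fun w φ => -2 * ((1 - Real.cos φ) ^ (k + 1) * Real.exp (-2 * w * (1 - Real.cos φ))))
    (x₀ := w) (s := Metric.ball w 1)
    -- On the unit ball around w the exponent is at most 4(|w| + 1), because 0 ≤ 1 - cos φ ≤ 2.
    (bound := fun _ => 2 * (2 ^ (k + 1) * Real.exp (4 * (|w| + 1))))
    (Metric.ball_mem_nhds w one_pos)
    (Eventually.of_forall fun w => (integrable_besInt k hα w).aestronglyMeasurable)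
    (integrable_besInt k hα w)
    ((integrable_besInt (k + 1) hα w).aestronglyMeasurable.const_mul _)
    (Eventually.of_forall fun φ v hv => ?_) (integrable_const _)
    (Eventually.of_forall fun φ v hv => ?_)).2
  · rw [integral_const_mul] at h
    exact h
  · have h1 : 0 ≤ 1 - Real.cos φ := by linarith [Real.cos_le_one φ]
    have h2 : 1 - Real.cos φ ≤ 2 := by linarith [Real.neg_one_le_cos φ]
    rw [Real.norm_eq_abs, abs_mul, abs_mul, abs_of_nonneg (pow_nonneg h1 _), Real.abs_exp]
    norm_num
    gcongr
    rw [Metric.mem_ball, Real.dist_eq] at hv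
    have h3 : |v| ≤ |w| + 1 := by
      have := abs_sub_abs_le_abs_sub v w
      linarith
    have := neg_abs_le v
    have h4 : -v * (1 - Real.cos φ) ≤ (|w| + 1) * 2 := by
      calc -v * (1 - Real.cos φ) ≤ |v| * (1 - Real.cos φ) := by gcongr; linarith
        _ ≤ (|w| + 1) * 2 := by gcongr
    linarith
  · have h1 : HasDerivAt (fun v : ℝ => -2 * v * (1 - Real.cos φ)) (-2 * (1 - Real.cos φ)) v := by
      simpa using ((hasDerivAt_id v).const_mul (-2)).mul_const (1 - Real.cos φ)
    exact (h1.exp.const_mul ((1 - Real.cos φ) ^ k)).congr_deriv (by ring)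

theorem continuous_besInt (k : ℕ) {α : ℝ} (hα : 0 < α) : Continuous (besInt k α) :=
  continuous_iff_continuousAt.2 fun w => (hasDerivAt_besInt k hα w).continuousAt

theorem besInt_nonneg (k : ℕ) (α w : ℝ) : 0 ≤ besInt k α w :=
  integral_nonneg fun φ => mul_nonneg (pow_nonneg (by linarith [Real.cos_le_one φ]) _)
    (Real.exp_pos _).le

theorem besInt_antitone (k : ℕ) {α : ℝ} (hα : 0 < α) : Antitone (besInt k α) := by
  intro w v hwv
  refine integral_mono (integrable_besInt k hα v) (integrable_besInt k hα w) fun φ => ?_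
  have h1 : 0 ≤ 1 - Real.cos φ := by linarith [Real.cos_le_one φ]
  have : -2 * v * (1 - Real.cos φ) ≤ -2 * w * (1 - Real.cos φ) := by nlinarith
  simp only
  gcongr

theorem besInt_succ_le (k : ℕ) {α : ℝ} (hα : 0 < α) (w : ℝ) :
    besInt (k + 1) α w ≤ 2 * besInt k α w := by
  rw [besInt, besInt, ← integral_const_mul]
  refine integral_mono (integrable_besInt _ hα w) ((integrable_besInt k hα w).const_mul _)
    fun φ => ?_
  have h1 : 0 ≤ 1 - Real.cos φ := by linarith [Real.cos_le_one φ]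
  have h2 : 1 - Real.cos φ ≤ 2 := by linarith [Real.neg_one_le_cos φ]
  simp only
  rw [pow_succ, mul_comm _ (1 - Real.cos φ), mul_assoc]
  gcongr

/-- Since z ≤ exp z with z = w(1 - cos φ), one factor z can be traded for half of the exponential
decay. This gives `besInt 1` one more power of decay than `besInt 0`. -/
theorem mul_besInt_one_le {α : ℝ} (hα : 0 < α) (w : ℝ) :
    w * besInt 1 α w ≤ besInt 0 α (w / 2) := by
  rw [besInt, besInt, ← integral_const_mul]
  refine integral_mono ((integrable_besInt _ hα w).const_mul _) (integrable_besInt _ hα _)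
    fun φ => ?_
  simp only [pow_one, pow_zero, one_mul]
  have e : Real.exp (-2 * (w / 2) * (1 - Real.cos φ))
      = Real.exp (w * (1 - Real.cos φ)) * Real.exp (-2 * w * (1 - Real.cos φ)) := by
    rw [← Real.exp_add]; congr 1; ring
  rw [e, ← mul_assoc]
  gcongr
  linarith [Real.add_one_le_exp (w * (1 - Real.cos φ))]

/-- The Bessel equation, in integrated form. -/
theorem besInt_relation {α : ℝ} (hα : 0 < α) (w : ℝ) :
    α * (besInt 0 α w - besInt 1 α w) = w * (2 * besInt 1 α w - besInt 2 α w) := by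
  have h := integral_angMeasure_by_parts hα (g := fun φ => Real.exp (-2 * w * (1 - Real.cos φ)))
    (g' := fun φ => Real.exp (-2 * w * (1 - Real.cos φ)) * (-2 * w * Real.sin φ)) (fun φ => by
      have := (((Real.hasDerivAt_cos φ).const_sub 1).const_mul (-2 * w)).exp
      exact this.congr_deriv (by simp)) (by fun_prop)
  -- By sin² φ = 2(1 - cos φ) - (1 - cos φ)², only powers of 1 - cos φ up to the second occur.
  have e : ∀ φ : ℝ, 2 * α * Real.cos φ * Real.exp (-2 * w * (1 - Real.cos φ)) +
      Real.sin φ * (Real.exp (-2 * w * (1 - Real.cos φ)) * (-2 * w * Real.sin φ))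
      = (2 * α) * ((1 - Real.cos φ) ^ 0 * Real.exp (-2 * w * (1 - Real.cos φ)))
      - (2 * α + 4 * w) * ((1 - Real.cos φ) ^ 1 * Real.exp (-2 * w * (1 - Real.cos φ)))
      + (2 * w) * ((1 - Real.cos φ) ^ 2 * Real.exp (-2 * w * (1 - Real.cos φ))) := by
    intro φ
    have hs := Real.sin_sq_add_cos_sq φ
    linear_combination (-2 * w * Real.exp (-2 * w * (1 - Real.cos φ))) * hs
  simp only [e] at h
  rw [integral_add, integral_sub, integral_const_mul, integral_const_mul, integral_const_mul] at h
  · simp only [← besInt.eq_1] at h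
    linarith
  · exact (integrable_besInt _ hα w).const_mul _
  · exact (integrable_besInt _ hα w).const_mul _
  · exact ((integrable_besInt _ hα w).const_mul _).sub ((integrable_besInt _ hα w).const_mul _)
  · exact (integrable_besInt _ hα w).const_mul _

/-! ### The one-dimensional kernel -/

/-- The normalizing constant of `besselHeat`. -/
noncomputable def heatNorm (α : ℝ) : ℝ := 2 / (Real.Gamma α * √Real.pi)

theorem heatNorm_pos {α : ℝ} (hα : 0 < α) : 0 < heatNorm α := by
  have := Real.Gamma_pos_of_pos hα
  have := Real.pi_pos
  unfold heatNorm
  positivity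

/-- The heat kernel of `∂ₓ² + (2α/x) ∂ₓ` at time `1/(4t)`. -/
noncomputable def besselHeat (α x₀ t x : ℝ) : ℝ :=
  heatNorm α * t ^ (α + 1 / 2) * Real.exp (-t * (x - x₀) ^ 2) * besInt 0 α (t * x * x₀)

/-- The derivative of `besselHeat` with respect to `t`. -/
noncomputable def besselHeatDeriv (α x₀ t x : ℝ) : ℝ :=
  heatNorm α * t ^ (α + 1 / 2) * Real.exp (-t * (x - x₀) ^ 2) *
    (((α + 1 / 2) / t - (x - x₀) ^ 2) * besInt 0 α (t * x * x₀)
      - 2 * (x * x₀) * besInt 1 α (t * x * x₀))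

/-- The flux `-x^(2α) ∂ₓ besselHeat / (4t²)`, which is the `t`-derivative of `heatCDF`. -/
noncomputable def heatFlux (α x₀ t x : ℝ) : ℝ :=
  heatNorm α / 2 * t ^ (α - 1 / 2) * x ^ (2 * α) * Real.exp (-t * (x - x₀) ^ 2) *
    ((x - x₀) * besInt 0 α (t * x * x₀) + x₀ * besInt 1 α (t * x * x₀))

/-- The distribution function of `besselHeat` with respect to `x^(2α) dx`. -/
noncomputable def heatCDF (α x₀ t x : ℝ) : ℝ :=
  ∫ s in (0 : ℝ)..x, s ^ (2 * α) * besselHeat α x₀ t s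

theorem besselHeat_nonneg {α t : ℝ} (hα : 0 < α) (ht : 0 ≤ t) (x₀ x : ℝ) :
    0 ≤ besselHeat α x₀ t x := by
  have := besInt_nonneg 0 α (t * x * x₀)
  have := heatNorm_pos hα
  unfold besselHeat
  positivity

theorem continuous_besselHeat {α : ℝ} (hα : 0 < α) (x₀ t : ℝ) :
    Continuous (besselHeat α x₀ t) := by
  unfold besselHeat
  have := continuous_besInt 0 hα
  fun_prop

/-- The identity (s - x₀)² + 2 s x₀ (1 - cos φ) = s² + x₀² - 2 s x₀ cos φ turns the kernel into the
angular integral of a planar Gaussian, whose mass is known in polar coordinates; `heatNorm` is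
chosen to normalize it. -/
theorem lintegral_rpow_mul_besselHeat {α t : ℝ} (hα : 0 < α) (ht : 0 < t) (x₀ : ℝ) :
    ∫⁻ s in Ioi (0 : ℝ), ENNReal.ofReal (s ^ (2 * α) * besselHeat α x₀ t s) = 1 := by
  have hN := heatNorm_pos hα
  have hG := Real.Gamma_pos_of_pos hα
  have h := lintegral_polar_gaussian hα ht x₀
  have e : ∀ s ∈ Ioi (0 : ℝ), ENNReal.ofReal (s ^ (2 * α) * besselHeat α x₀ t s)
      = ENNReal.ofReal (heatNorm α * t ^ (α + 1 / 2)) * (ENNReal.ofReal (s ^ (2 * α)) * ∫⁻ φ,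
        ENNReal.ofReal (Real.exp (-t * (s ^ 2 + x₀ ^ 2 - 2 * s * x₀ * Real.cos φ)))
          ∂angMeasure α) := by
    intro s hs
    have hs : 0 < s := hs
    rw [← ofReal_integral_eq_lintegral_ofReal
        (integrable_angMeasure_of_continuous hα (by fun_prop))
        (Eventually.of_forall fun φ => (Real.exp_pos _).le),
      ← ENNReal.ofReal_mul (by positivity), ← ENNReal.ofReal_mul (by positivity)]
    congr 1
    have e2 : ∀ φ : ℝ, Real.exp (-t * (s ^ 2 + x₀ ^ 2 - 2 * s * x₀ * Real.cos φ))
        = Real.exp (-t * (s - x₀) ^ 2) *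
          ((1 - Real.cos φ) ^ 0 * Real.exp (-2 * (t * s * x₀) * (1 - Real.cos φ))) := by
      intro φ
      rw [pow_zero, one_mul, ← Real.exp_add]
      congr 1
      ring
    simp only [e2]
    rw [integral_const_mul, ← besInt.eq_1, besselHeat]
    ring
  rw [setLIntegral_congr_fun measurableSet_Ioi e, lintegral_const_mul' _ _ ENNReal.ofReal_ne_top, h,
    ← ENNReal.ofReal_mul (by positivity), ← ENNReal.ofReal_one]
  congr 1
  rw [heatNorm, Real.sqrt_div Real.pi_pos.le, Real.rpow_add ht, Real.sqrt_eq_rpow t,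
    Real.rpow_neg ht.le]
  have := Real.pi_pos
  field_simp

theorem integrableOn_rpow_mul_besselHeat {α t : ℝ} (hα : 0 < α) (ht : 0 < t) (x₀ : ℝ) :
    IntegrableOn (fun s => s ^ (2 * α) * besselHeat α x₀ t s) (Ioi 0) := by
  have hm : AEStronglyMeasurable (fun s => s ^ (2 * α) * besselHeat α x₀ t s)
      (volume.restrict (Ioi 0)) := by
    have := continuous_besselHeat hα x₀ t
    exact (Measurable.mul (by fun_prop) this.measurable).aestronglyMeasurable
  refine ⟨hm, ?_⟩
  rw [hasFiniteIntegral_iff_ofReal, lintegral_rpow_mul_besselHeat hα ht]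
  · exact ENNReal.one_lt_top
  · filter_upwards [ae_restrict_mem measurableSet_Ioi] with x hx
    exact mul_nonneg (Real.rpow_nonneg (le_of_lt hx) _) (besselHeat_nonneg hα ht.le _ _)

theorem integral_rpow_mul_besselHeat {α t : ℝ} (hα : 0 < α) (ht : 0 < t) (x₀ : ℝ) :
    ∫ s in Ioi (0 : ℝ), s ^ (2 * α) * besselHeat α x₀ t s = 1 := by
  rw [integral_eq_lintegral_of_nonneg_ae, lintegral_rpow_mul_besselHeat hα ht]
  · simp
  · filter_upwards [ae_restrict_mem measurableSet_Ioi] with x hx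
    exact mul_nonneg (Real.rpow_nonneg (le_of_lt hx) _) (besselHeat_nonneg hα ht.le _ _)
  · exact (integrableOn_rpow_mul_besselHeat hα ht x₀).aestronglyMeasurable

/-- The total mass of the angular measure. -/
theorem besInt_zero_zero {α : ℝ} (hα : 0 < α) :
    besInt 0 α 0 = Real.Gamma α * √Real.pi / Real.Gamma (α + 1 / 2) := by
  -- For t = 1 and x₀ = 0 the kernel is a multiple of exp(-s²), so mass one can be compared with a
  -- Gamma integral.
  have h := integral_rpow_mul_besselHeat hα one_pos 0
  simp only [besselHeat, Real.one_rpow, mul_zero, sub_zero, mul_one] at h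
  have e : ∀ s : ℝ, s ^ (2 * α) * (heatNorm α * Real.exp (-1 * s ^ 2) * besInt 0 α 0)
      = (heatNorm α * besInt 0 α 0) * (s ^ (2 * α) * Real.exp (-1 * s ^ (2 : ℝ))) := by
    intro s
    rw [Real.rpow_two]
    ring
  simp only [e] at h
  rw [integral_const_mul, integral_rpow_mul_exp_neg_mul_rpow two_pos (by linarith) one_pos,
    Real.one_rpow, show (2 * α + 1) / 2 = α + 1 / 2 by ring, heatNorm] at h
  have := Real.Gamma_pos_of_pos hα
  have := Real.Gamma_pos_of_pos (show 0 < α + 1 / 2 by linarith)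
  have := Real.pi_pos
  field_simp at h ⊢
  linarith

theorem besInt_zero_zero_pos {α : ℝ} (hα : 0 < α) : 0 < besInt 0 α 0 := by
  rw [besInt_zero_zero hα]
  have := Real.Gamma_pos_of_pos hα
  have := Real.Gamma_pos_of_pos (show 0 < α + 1 / 2 by linarith)
  have := Real.pi_pos
  positivity

theorem besInt_zero_le {α w : ℝ} (hα : 0 < α) (hw : 0 ≤ w) : besInt 0 α w ≤ besInt 0 α 0 :=
  besInt_antitone 0 hα hw

theorem besInt_one_le {α w : ℝ} (hα : 0 < α) (hw : 0 ≤ w) : besInt 1 α w ≤ 2 * besInt 0 α 0 :=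
  (besInt_succ_le 0 hα w).trans (by linarith [besInt_zero_le hα hw])

/-- The decay of `besInt 0` that is forced by the total mass of the heat kernel. -/
theorem exists_besInt_zero_le_rpow {α : ℝ} (hα : 0 < α) :
    ∃ C, 0 < C ∧ ∀ w, 0 < w → besInt 0 α w ≤ C * w ^ (-α) := by
  have hN := heatNorm_pos hα
  -- Only the part of the mass on (X, X + 1] is kept, for t = 1 and pole X. There the Gaussian is at
  -- least exp(-1), the weight at least X^(2α), and `besInt` at least its value at X(X + 1).
  have key : ∀ X : ℝ, 1 ≤ X →
      heatNorm α * Real.exp (-1) * X ^ (2 * α) * besInt 0 α (X * (X + 1)) ≤ 1 := by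
    intro X hX
    refine le_of_le_of_eq ?_ (integral_rpow_mul_besselHeat hα one_pos X)
    have h1 : ∫ s in Ioc X (X + 1), heatNorm α * Real.exp (-1) * X ^ (2 * α) *
        besInt 0 α (X * (X + 1))
        = heatNorm α * Real.exp (-1) * X ^ (2 * α) * besInt 0 α (X * (X + 1)) := by
      simp
    rw [← h1]
    refine le_trans (setIntegral_mono_on (integrableOn_const (by simp))
      ((integrableOn_rpow_mul_besselHeat hα one_pos X).mono_set ?_) measurableSet_Ioc ?_)
      (setIntegral_mono_set (integrableOn_rpow_mul_besselHeat hα one_pos X) ?_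
      (LE.le.eventuallyLE (?_ : Ioc X (X + 1) ⊆ Ioi 0)))
    · exact fun s hs => lt_trans (by linarith) hs.1
    · intro s hs
      have h2 : X ^ (2 * α) ≤ s ^ (2 * α) :=
        Real.rpow_le_rpow (by linarith) hs.1.le (by linarith)
      have h3 : Real.exp (-1) ≤ Real.exp (-1 * (s - X) ^ 2) := by
        rw [Real.exp_le_exp]
        nlinarith [hs.1, hs.2]
      have h4 : besInt 0 α (X * (X + 1)) ≤ besInt 0 α (1 * s * X) :=
        besInt_antitone 0 hα (by nlinarith [hs.2])
      have := besInt_nonneg 0 α (X * (X + 1))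
      have : 0 ≤ X ^ (2 * α) := Real.rpow_nonneg (by linarith) _
      have h5 : heatNorm α * Real.exp (-1) * X ^ (2 * α) * besInt 0 α (X * (X + 1))
          ≤ heatNorm α * Real.exp (-1 * (s - X) ^ 2) * s ^ (2 * α) * besInt 0 α (1 * s * X) := by
        have : 0 ≤ s ^ (2 * α) := this.trans h2
        gcongr
      refine h5.trans (le_of_eq ?_)
      rw [besselHeat, Real.one_rpow]
      ring
    · filter_upwards [ae_restrict_mem measurableSet_Ioi] with x hx
      exact mul_nonneg (Real.rpow_nonneg (le_of_lt hx) _) (besselHeat_nonneg hα one_pos.le _ _)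
    · exact fun s hs => lt_trans (by linarith) hs.1
  have h0 := besInt_zero_zero_pos hα
  -- The first summand serves for w < 2, the second for w ≥ 2: with X = √(w/2) ≥ 1 one has X(X + 1)
  -- ≤ 2X² = w.
  refine ⟨2 ^ α * (besInt 0 α 0 + Real.exp 1 / heatNorm α), by positivity, fun w hw => ?_⟩
  have hw2 : w ^ (-α) * 2 ^ α = (w / 2) ^ (-α) := by
    rw [Real.div_rpow hw.le two_pos.le, Real.rpow_neg two_pos.le]
    field_simp
  rw [mul_right_comm, mul_comm (2 ^ α), hw2]
  rcases le_or_gt 2 w with h | h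
  · have hX : 1 ≤ √(w / 2) := by
      rw [Real.one_le_sqrt]; linarith
    have hX2 : √(w / 2) ^ 2 = w / 2 := Real.sq_sqrt (by linarith)
    have h1 := key _ hX
    have h2 : besInt 0 α w ≤ besInt 0 α (√(w / 2) * (√(w / 2) + 1)) :=
      besInt_antitone 0 hα (by nlinarith)
    have h3 : √(w / 2) ^ (2 * α) = (w / 2) ^ α := by
      rw [Real.rpow_mul (Real.sqrt_nonneg _), Real.rpow_two, hX2]
    rw [h3] at h1
    have hpos : 0 < (w / 2) ^ α := by positivity
    rw [Real.rpow_neg (by linarith)]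
    have h4 : besInt 0 α (√(w / 2) * (√(w / 2) + 1))
        ≤ ((w / 2) ^ α)⁻¹ * (Real.exp 1 / heatNorm α) := by
      rw [Real.exp_neg] at h1
      have := Real.exp_pos 1
      field_simp at h1 ⊢
      linarith
    refine (h2.trans h4).trans ?_
    gcongr
    linarith
  · have h1 : 1 ≤ (w / 2) ^ (-α) :=
      Real.one_le_rpow_of_pos_of_le_one_of_nonpos (by linarith) (by linarith) (by linarith)
    have h2 : 0 ≤ Real.exp 1 / heatNorm α := by positivity
    nlinarith [besInt_zero_le hα hw.le]

/-- The extra power comes from `mul_besInt_one_le`; the halved argument costs only the factor 2^α.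
-/
theorem exists_besInt_one_le_rpow {α : ℝ} (hα : 0 < α) :
    ∃ C, 0 < C ∧ ∀ w, 0 < w → besInt 1 α w ≤ C * w ^ (-α - 1) := by
  obtain ⟨C, hC, h⟩ := exists_besInt_zero_le_rpow hα
  refine ⟨C * 2 ^ α, by positivity, fun w hw => ?_⟩
  have h1 := (mul_besInt_one_le hα w).trans (h (w / 2) (by linarith))
  have e : w * (C * 2 ^ α * w ^ (-α - 1)) = C * (w / 2) ^ (-α) := by
    rw [Real.rpow_sub hw, Real.rpow_one, Real.div_rpow hw.le two_pos.le, Real.rpow_neg two_pos.le]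
    field_simp
  rw [← e] at h1
  exact le_of_mul_le_mul_left h1 hw

theorem hasDerivAt_besselHeat_left {α t : ℝ} (hα : 0 < α) (ht : 0 < t) (x₀ x : ℝ) :
    HasDerivAt (fun t => besselHeat α x₀ t x) (besselHeatDeriv α x₀ t x) t := by
  have h1 : HasDerivAt (fun t : ℝ => t ^ (α + 1 / 2)) ((α + 1 / 2) * t ^ (α + 1 / 2 - 1)) t :=
    Real.hasDerivAt_rpow_const (Or.inl ht.ne')
  have h2 : HasDerivAt (fun t : ℝ => Real.exp (-t * (x - x₀) ^ 2))
      (Real.exp (-t * (x - x₀) ^ 2) * (-(x - x₀) ^ 2)) t := by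
    have := ((hasDerivAt_id t).neg.mul_const ((x - x₀) ^ 2)).exp
    exact this.congr_deriv (by simp)
  have h3 : HasDerivAt (fun t => besInt 0 α (t * x * x₀))
      (-2 * besInt 1 α (t * x * x₀) * (x * x₀)) t := by
    have h4 : HasDerivAt (fun t : ℝ => t * x * x₀) (x * x₀) t := by
      simpa using ((hasDerivAt_id t).mul_const x).mul_const x₀
    exact (hasDerivAt_besInt 0 hα _).comp t h4
  refine (((h1.const_mul (heatNorm α)).fun_mul h2).fun_mul h3).congr_deriv ?_
  rw [besselHeatDeriv, Real.rpow_sub_one ht.ne']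
  ring

theorem hasDerivAt_besselHeat {α : ℝ} (hα : 0 < α) {t x : ℝ} (ht : 0 < t) (hx : 0 < x) (x₀ : ℝ) :
    HasDerivAt (besselHeat α x₀ t)
      (-(4 * t ^ 2) * (heatFlux α x₀ t x / x ^ (2 * α))) x := by
  have h2 : HasDerivAt (fun x : ℝ => Real.exp (-t * (x - x₀) ^ 2))
      (Real.exp (-t * (x - x₀) ^ 2) * (-t * (2 * (x - x₀)))) x := by
    have := ((((hasDerivAt_id x).sub_const x₀).pow 2).const_mul (-t)).exp
    exact this.congr_deriv (by simp)
  have h3 : HasDerivAt (fun x => besInt 0 α (t * x * x₀))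
      (-2 * besInt 1 α (t * x * x₀) * (t * x₀)) x := by
    have h4 : HasDerivAt (fun x : ℝ => t * x * x₀) (t * x₀) x := by
      simpa using ((hasDerivAt_id x).const_mul t).mul_const x₀
    exact (hasDerivAt_besInt 0 hα _).comp x h4
  refine ((h2.const_mul (heatNorm α * t ^ (α + 1 / 2))).mul h3).congr_deriv ?_
  have hx' : x ^ (2 * α) ≠ 0 := (Real.rpow_pos_of_pos hx _).ne'
  rw [heatFlux, show α + 1 / 2 = α - 1 / 2 + 1 by ring, Real.rpow_add_one ht.ne']
  field_simp
  ring

/-- The heat equation, in divergence form. -/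
theorem hasDerivAt_heatFlux {α : ℝ} (hα : 0 < α) {t x : ℝ} (ht : 0 < t) (hx : 0 < x) (x₀ : ℝ) :
    HasDerivAt (heatFlux α x₀ t) (x ^ (2 * α) * besselHeatDeriv α x₀ t x) x := by
  have h1 : HasDerivAt (fun x : ℝ => x ^ (2 * α)) (2 * α * x ^ (2 * α - 1)) x :=
    Real.hasDerivAt_rpow_const (Or.inl hx.ne')
  have h2 : HasDerivAt (fun x : ℝ => Real.exp (-t * (x - x₀) ^ 2))
      (Real.exp (-t * (x - x₀) ^ 2) * (-t * (2 * (x - x₀)))) x := by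
    have := ((((hasDerivAt_id x).sub_const x₀).pow 2).const_mul (-t)).exp
    exact this.congr_deriv (by simp)
  have h4 : HasDerivAt (fun x : ℝ => t * x * x₀) (t * x₀) x := by
    simpa using ((hasDerivAt_id x).const_mul t).mul_const x₀
  have h3 : HasDerivAt (fun x => besInt 0 α (t * x * x₀))
      (-2 * besInt 1 α (t * x * x₀) * (t * x₀)) x := (hasDerivAt_besInt 0 hα _).comp x h4
  have h5 : HasDerivAt (fun x => besInt 1 α (t * x * x₀))
      (-2 * besInt 2 α (t * x * x₀) * (t * x₀)) x := (hasDerivAt_besInt 1 hα _).comp x h4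
  refine (((h1.const_mul (heatNorm α / 2 * t ^ (α - 1 / 2))).fun_mul h2).fun_mul
    ((((hasDerivAt_id' x).sub_const x₀).fun_mul h3).fun_add (h5.const_mul x₀))).congr_deriv ?_
  -- The Bessel equation divided by x. It trades the 1/x term coming from the derivative of the
  -- weight for `besInt 2`, and so closes the computation.
  have hr : α * (besInt 0 α (t * x * x₀) - besInt 1 α (t * x * x₀)) * x⁻¹
      = t * x₀ * (2 * besInt 1 α (t * x * x₀) - besInt 2 α (t * x * x₀)) := by
    have := besInt_relation hα (t * x * x₀)
    field_simp
    linarith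
  have hxx : x * x⁻¹ = 1 := mul_inv_cancel₀ hx.ne'
  have htt : t * ((α - 1 / 2 + 1) / t) = α + 1 / 2 := by field_simp; ring
  rw [besselHeatDeriv, show α + 1 / 2 = α - 1 / 2 + 1 by ring, Real.rpow_add_one ht.ne',
    Real.rpow_sub_one hx.ne', div_eq_mul_inv (x ^ (2 * α)) x]
  generalize heatNorm α = N, besInt 0 α (t * x * x₀) = L0, besInt 1 α (t * x * x₀) = L1,
    besInt 2 α (t * x * x₀) = L2, Real.exp (-t * (x - x₀) ^ 2) = E, t ^ (α - 1 / 2) = T,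
    x ^ (2 * α) = X, x⁻¹ = u, (α - 1 / 2 + 1) / t = v at *
  linear_combination (-N * T * X * E * x₀) * hr + (N * T * X * E * α * L0) * hxx
    - (N * T * X * E * L0) * htt

theorem heatCDF_integrable {α : ℝ} (hα : 0 < α) (x₀ t u v : ℝ) :
    IntervalIntegrable (fun s => s ^ (2 * α) * besselHeat α x₀ t s) volume u v := by
  apply Continuous.intervalIntegrable
  have := continuous_besselHeat hα x₀ t
  exact (Real.continuous_rpow_const (by linarith)).mul this

theorem hasDerivAt_heatCDF {α : ℝ} (hα : 0 < α) (x₀ t x : ℝ) :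
    HasDerivAt (heatCDF α x₀ t) (x ^ (2 * α) * besselHeat α x₀ t x) x := by
  have : Continuous (fun s => s ^ (2 * α) * besselHeat α x₀ t s) :=
    (Real.continuous_rpow_const (by linarith)).mul (continuous_besselHeat hα x₀ t)
  exact intervalIntegral.integral_hasDerivAt_right (this.intervalIntegrable _ _)
    (this.stronglyMeasurableAtFilter _ _) this.continuousAt

theorem continuous_besselHeatDeriv {α : ℝ} (hα : 0 < α) (x₀ t : ℝ) :
    Continuous (besselHeatDeriv α x₀ t) := by
  unfold besselHeatDeriv
  have := continuous_besInt 0 hα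
  have := continuous_besInt 1 hα
  fun_prop

theorem continuous_heatFlux {α : ℝ} (hα : 0 < α) (x₀ t : ℝ) :
    Continuous (heatFlux α x₀ t) := by
  unfold heatFlux
  have := continuous_besInt 0 hα
  have := continuous_besInt 1 hα
  have : Continuous fun x : ℝ => x ^ (2 * α) := Real.continuous_rpow_const (by linarith)
  fun_prop

theorem continuousOn_besselHeatDeriv {α : ℝ} (hα : 0 < α) (x₀ : ℝ) :
    ContinuousOn (fun q : ℝ × ℝ => besselHeatDeriv α x₀ q.1 q.2) (Ioi 0 ×ˢ univ) := by
  unfold besselHeatDeriv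
  have := continuous_besInt 0 hα
  have := continuous_besInt 1 hα
  have h1 : ContinuousOn (fun q : ℝ × ℝ => q.1 ^ (α + 1 / 2)) (Ioi 0 ×ˢ univ) :=
    continuousOn_fst.rpow_const fun q hq => Or.inl (ne_of_gt hq.1)
  have h2 : ContinuousOn (fun q : ℝ × ℝ => (α + 1 / 2) / q.1) (Ioi 0 ×ˢ univ) :=
    continuousOn_const.div continuousOn_fst fun q hq => ne_of_gt hq.1
  fun_prop

theorem continuousOn_besselHeat {α : ℝ} (hα : 0 < α) (x₀ : ℝ) :
    ContinuousOn (fun q : ℝ × ℝ => besselHeat α x₀ q.1 q.2) (Ioi 0 ×ˢ univ) := by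
  unfold besselHeat
  have := continuous_besInt 0 hα
  have h1 : ContinuousOn (fun q : ℝ × ℝ => q.1 ^ (α + 1 / 2)) (Ioi 0 ×ˢ univ) :=
    continuousOn_fst.rpow_const fun q hq => Or.inl (ne_of_gt hq.1)
  fun_prop

theorem continuousOn_heatFlux {α : ℝ} (hα : 0 < α) (x₀ : ℝ) :
    ContinuousOn (fun q : ℝ × ℝ => heatFlux α x₀ q.1 q.2) (Ioi 0 ×ˢ univ) := by
  unfold heatFlux
  have := continuous_besInt 0 hα
  have := continuous_besInt 1 hα
  have h1 : ContinuousOn (fun q : ℝ × ℝ => q.1 ^ (α - 1 / 2)) (Ioi 0 ×ˢ univ) :=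
    continuousOn_fst.rpow_const fun q hq => Or.inl (ne_of_gt hq.1)
  have : Continuous fun x : ℝ => x ^ (2 * α) := Real.continuous_rpow_const (by linarith)
  fun_prop

/-- Under the integral sign the t-derivative of the kernel times the weight is the x-derivative of
the flux, by the heat equation. The flux vanishes at 0 because of its factor x^(2α), so only the
upper end contributes. -/
theorem hasDerivAt_heatCDF_left {α : ℝ} (hα : 0 < α) {t x : ℝ} (ht : 0 < t) (hx : 0 ≤ x) (x₀ : ℝ) :
    HasDerivAt (fun t => heatCDF α x₀ t x) (heatFlux α x₀ t x) t := by
  have hrp : Continuous fun x : ℝ => x ^ (2 * α) := Real.continuous_rpow_const (by linarith)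
  have hFTC : ∫ s in (0 : ℝ)..x, s ^ (2 * α) * besselHeatDeriv α x₀ t s = heatFlux α x₀ t x := by
    rw [intervalIntegral.integral_eq_sub_of_hasDerivAt_of_le hx
      (continuous_heatFlux hα x₀ t).continuousOn
      (fun s hs => hasDerivAt_heatFlux hα ht hs.1 x₀)
      ((hrp.mul (continuous_besselHeatDeriv hα x₀ t)).intervalIntegrable _ _)]
    simp [heatFlux, Real.zero_rpow (by linarith : 2 * α ≠ 0)]
  have hsub : Icc (t / 2) (2 * t) ×ˢ uIcc 0 x ⊆ Ioi (0 : ℝ) ×ˢ (univ : Set ℝ) :=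
    fun q hq => ⟨lt_of_lt_of_le (by linarith) hq.1.1, mem_univ _⟩
  obtain ⟨C, hC⟩ := (isCompact_Icc (a := t / 2) (b := 2 * t)).prod (isCompact_uIcc (a := 0) (b := x))
    |>.exists_bound_of_continuousOn (f := fun q : ℝ × ℝ => q.2 ^ (2 * α) *
      besselHeatDeriv α x₀ q.1 q.2)
    ((hrp.comp continuous_snd).continuousOn.mul ((continuousOn_besselHeatDeriv hα x₀).mono hsub))
  have hs : Icc (t / 2) (2 * t) ∈ 𝓝 t := Icc_mem_nhds (by linarith) (by linarith)
  rw [← hFTC]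
  refine (intervalIntegral.hasDerivAt_integral_of_dominated_loc_of_deriv_le
    (F := fun t s => s ^ (2 * α) * besselHeat α x₀ t s)
    (F' := fun t s => s ^ (2 * α) * besselHeatDeriv α x₀ t s)
    (bound := fun _ => C) hs
    (Eventually.of_forall fun t => (hrp.mul (continuous_besselHeat hα x₀ t)).aestronglyMeasurable)
    (heatCDF_integrable hα x₀ t 0 x)
    (hrp.mul (continuous_besselHeatDeriv hα x₀ t)).aestronglyMeasurable
    (Eventually.of_forall fun _ hs t ht => hC (t, _) ⟨ht, uIoc_subset_uIcc hs⟩)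
    (by simp) (Eventually.of_forall fun s _ v hv => ?_)).2
  exact (hasDerivAt_besselHeat_left hα (lt_of_lt_of_le (by linarith) hv.1) x₀ s).const_mul _

theorem heatCDF_nonneg {α t x : ℝ} (hα : 0 < α) (ht : 0 < t) (hx : 0 ≤ x) (x₀ : ℝ) :
    0 ≤ heatCDF α x₀ t x :=
  intervalIntegral.integral_nonneg hx fun _ hs =>
    mul_nonneg (Real.rpow_nonneg hs.1 _) (besselHeat_nonneg hα ht.le _ _)

theorem one_sub_heatCDF {α t x : ℝ} (hα : 0 < α) (ht : 0 < t) (hx : 0 ≤ x) (x₀ : ℝ) :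
    1 - heatCDF α x₀ t x = ∫ s in Ioi x, s ^ (2 * α) * besselHeat α x₀ t s := by
  have h := intervalIntegral.integral_interval_add_Ioi
    (f := fun s => s ^ (2 * α) * besselHeat α x₀ t s)
    (integrableOn_rpow_mul_besselHeat hα ht x₀)
    ((integrableOn_rpow_mul_besselHeat hα ht x₀).mono_set (Ioi_subset_Ioi hx))
  rw [integral_rpow_mul_besselHeat hα ht x₀] at h
  rw [heatCDF]
  linarith

theorem heatCDF_le_one {α t x : ℝ} (hα : 0 < α) (ht : 0 < t) (hx : 0 ≤ x) (x₀ : ℝ) :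
    heatCDF α x₀ t x ≤ 1 := by
  have h := one_sub_heatCDF hα ht hx x₀
  have : 0 ≤ ∫ s in Ioi x, s ^ (2 * α) * besselHeat α x₀ t s :=
    setIntegral_nonneg measurableSet_Ioi fun s hs =>
      mul_nonneg (Real.rpow_nonneg (hx.trans (le_of_lt hs)) _) (besselHeat_nonneg hα ht.le _ _)
  linarith

/-! ### Bounds for the kernel -/

theorem integrableOn_rpow_mul_exp {s d : ℝ} (hs : -1 < s) (hd : 0 < d) :
    IntegrableOn (fun t : ℝ => t ^ s * Real.exp (-d * t)) (Ioi 0) := by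
  simpa using integrableOn_rpow_mul_exp_neg_mul_rpow hs one_pos hd

/-- The constant in the upper bounds for `besselHeat`, `besselHeatDeriv` and `heatFlux`. -/
noncomputable def heatBound (α : ℝ) : ℝ := heatNorm α * besInt 0 α 0

theorem heatBound_pos {α : ℝ} (hα : 0 < α) : 0 < heatBound α :=
  mul_pos (heatNorm_pos hα) (besInt_zero_zero_pos hα)

theorem besselHeat_le {α t x x₀ : ℝ} (hα : 0 < α) (ht : 0 < t) (hx : 0 ≤ x) (hx₀ : 0 ≤ x₀) :
    besselHeat α x₀ t x ≤ heatBound α * t ^ (α + 1 / 2) * Real.exp (-t * (x - x₀) ^ 2) := by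
  have := heatNorm_pos hα
  have h : besInt 0 α (t * x * x₀) ≤ besInt 0 α 0 := besInt_zero_le hα (by positivity)
  calc besselHeat α x₀ t x ≤
      heatNorm α * t ^ (α + 1 / 2) * Real.exp (-t * (x - x₀) ^ 2) * besInt 0 α 0 := by
        unfold besselHeat; gcongr
    _ = _ := by rw [heatBound]; ring

theorem abs_heatFlux_le {α t x x₀ : ℝ} (hα : 0 < α) (ht : 0 < t) (hx : 0 ≤ x) (hx₀ : 0 ≤ x₀) :
    |heatFlux α x₀ t x| ≤ heatBound α * (x + 3 * x₀) * x ^ (2 * α) *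
      (t ^ (α - 1 / 2) * Real.exp (-t * (x - x₀) ^ 2)) := by
  have hN := heatNorm_pos hα
  have h0 : besInt 0 α (t * x * x₀) ≤ besInt 0 α 0 := besInt_zero_le hα (by positivity)
  have h1 : besInt 1 α (t * x * x₀) ≤ 2 * besInt 0 α 0 := besInt_one_le hα (by positivity)
  have p0 := besInt_nonneg 0 α (t * x * x₀)
  have p1 := besInt_nonneg 1 α (t * x * x₀)
  have h2 : |(x - x₀) * besInt 0 α (t * x * x₀) + x₀ * besInt 1 α (t * x * x₀)|
      ≤ (x + 3 * x₀) * besInt 0 α 0 := by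
    rw [abs_le]
    constructor <;> nlinarith [mul_nonneg hx p0, mul_nonneg hx₀ p0, mul_nonneg hx₀ p1,
      mul_le_mul_of_nonneg_left h0 hx, mul_le_mul_of_nonneg_left h0 hx₀,
      mul_le_mul_of_nonneg_left h1 hx₀]
  have h3 : 0 ≤ x ^ (2 * α) := Real.rpow_nonneg hx _
  rw [heatFlux, abs_mul, abs_of_nonneg (a := heatNorm α / 2 * t ^ (α - 1 / 2) * x ^ (2 * α) *
    Real.exp (-t * (x - x₀) ^ 2)) (by positivity)]
  calc heatNorm α / 2 * t ^ (α - 1 / 2) * x ^ (2 * α) * Real.exp (-t * (x - x₀) ^ 2) *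
      |(x - x₀) * besInt 0 α (t * x * x₀) + x₀ * besInt 1 α (t * x * x₀)|
      ≤ heatNorm α * t ^ (α - 1 / 2) * x ^ (2 * α) * Real.exp (-t * (x - x₀) ^ 2) *
      ((x + 3 * x₀) * besInt 0 α 0) := by gcongr; linarith
    _ = _ := by rw [heatBound]; ring

theorem abs_besselHeatDeriv_le {α t x x₀ : ℝ} (hα : 0 < α) (ht : 0 < t) (hx : 0 ≤ x)
    (hx₀ : 0 ≤ x₀) :
    |besselHeatDeriv α x₀ t x| ≤ heatBound α * (α + 1 + 4 * (x + x₀) ^ 2) *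
      ((t ^ (α - 1 / 2) + t ^ (α + 1 / 2)) * Real.exp (-t * (x - x₀) ^ 2)) := by
  have hN := heatNorm_pos hα
  have h0 : besInt 0 α (t * x * x₀) ≤ besInt 0 α 0 := besInt_zero_le hα (by positivity)
  have h1 : besInt 1 α (t * x * x₀) ≤ 2 * besInt 0 α 0 := besInt_one_le hα (by positivity)
  have p0 := besInt_nonneg 0 α (t * x * x₀)
  have p1 := besInt_nonneg 1 α (t * x * x₀)
  have hm := besInt_zero_zero_pos hα
  have hxx := mul_nonneg hx hx₀
  have ha : 0 ≤ (α + 1 / 2) / t := by positivity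
  have h2 : |((α + 1 / 2) / t - (x - x₀) ^ 2) * besInt 0 α (t * x * x₀)
      - 2 * (x * x₀) * besInt 1 α (t * x * x₀)|
      ≤ ((α + 1 / 2) / t + 4 * (x + x₀) ^ 2) * besInt 0 α 0 := by
    have e1 := mul_le_mul_of_nonneg_left h0 ha
    have e2 := mul_le_mul_of_nonneg_left h0 (sq_nonneg (x - x₀))
    have e3 := mul_le_mul_of_nonneg_left h1 hxx
    have e4 := mul_nonneg (sq_nonneg (x - x₀)) p0
    have e5 := mul_nonneg hxx p1
    have e6 := mul_nonneg ha p0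
    have e7 := mul_nonneg hxx hm.le
    have e8 := mul_nonneg (sq_nonneg (x - x₀)) hm.le
    have e9 := mul_nonneg ha hm.le
    rw [abs_le]
    constructor <;> nlinarith
  rw [besselHeatDeriv, abs_mul, abs_of_nonneg (a := heatNorm α * t ^ (α + 1 / 2) *
    Real.exp (-t * (x - x₀) ^ 2)) (by positivity)]
  have e : t ^ (α + 1 / 2) = t ^ (α - 1 / 2) * t := by
    rw [← Real.rpow_add_one ht.ne']; ring_nf
  have hT : 0 < t ^ (α - 1 / 2) := by positivity
  have h4 : t ^ (α + 1 / 2) * ((α + 1 / 2) / t + 4 * (x + x₀) ^ 2)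
      ≤ (α + 1 + 4 * (x + x₀) ^ 2) * (t ^ (α - 1 / 2) + t ^ (α + 1 / 2)) := by
    have e2 : t ^ (α + 1 / 2) * ((α + 1 / 2) / t + 4 * (x + x₀) ^ 2)
      = t ^ (α - 1 / 2) * (α + 1 / 2) + t ^ (α + 1 / 2) * (4 * (x + x₀) ^ 2) := by
      rw [e]; field_simp
    rw [e2]
    have hT2 : 0 < t ^ (α + 1 / 2) := by positivity
    nlinarith [mul_nonneg hT.le (sq_nonneg (x + x₀)), mul_nonneg hT2.le hα.le]
  calc heatNorm α * t ^ (α + 1 / 2) * Real.exp (-t * (x - x₀) ^ 2) *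
      |((α + 1 / 2) / t - (x - x₀) ^ 2) * besInt 0 α (t * x * x₀)
        - 2 * (x * x₀) * besInt 1 α (t * x * x₀)|
      ≤ heatNorm α * t ^ (α + 1 / 2) * Real.exp (-t * (x - x₀) ^ 2) *
        (((α + 1 / 2) / t + 4 * (x + x₀) ^ 2) * besInt 0 α 0) := by gcongr
    _ = heatNorm α * besInt 0 α 0 * Real.exp (-t * (x - x₀) ^ 2) *
        (t ^ (α + 1 / 2) * ((α + 1 / 2) / t + 4 * (x + x₀) ^ 2)) := by ring
    _ ≤ heatNorm α * besInt 0 α 0 * Real.exp (-t * (x - x₀) ^ 2) *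
        ((α + 1 + 4 * (x + x₀) ^ 2) * (t ^ (α - 1 / 2) + t ^ (α + 1 / 2))) := by gcongr
    _ = _ := by rw [heatBound]; ring

theorem heatCDF_le {α t x x₀ : ℝ} (hα : 0 < α) (ht : 0 < t) (hx : 0 ≤ x) (hx₀ : 0 ≤ x₀) :
    heatCDF α x₀ t x ≤ heatBound α * x ^ (2 * α + 1) * t ^ (α + 1 / 2) := by
  have hK := heatBound_pos hα
  have h : heatCDF α x₀ t x ≤ ∫ s in (0 : ℝ)..x, x ^ (2 * α) * (heatBound α * t ^ (α + 1 / 2)) := by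
    refine intervalIntegral.integral_mono_on hx (heatCDF_integrable hα _ _ _ _) (by simp)
      fun s hs => ?_
    have h1 : s ^ (2 * α) ≤ x ^ (2 * α) := Real.rpow_le_rpow hs.1 hs.2 (by linarith)
    have h2 : besselHeat α x₀ t s ≤ heatBound α * t ^ (α + 1 / 2) := by
      refine (besselHeat_le hα ht hs.1 hx₀).trans ?_
      have : Real.exp (-t * (s - x₀) ^ 2) ≤ 1 := by
        rw [Real.exp_le_one_iff]
        nlinarith [sq_nonneg (s - x₀)]
      exact mul_le_of_le_one_right (by positivity) this
    exact mul_le_mul h1 h2 (besselHeat_nonneg hα ht.le _ _) (Real.rpow_nonneg hx _)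
  refine h.trans (le_of_eq ?_)
  rw [intervalIntegral.integral_const, smul_eq_mul, Real.rpow_add_one' hx (by linarith)]
  ring

/-- Comparison with t = 1: at squared distance at least d from the pole the Gaussian loses exp(-(t -
1)d), while `besInt` decreases in t. As the kernel at t = 1 has mass one, integrating this bounds
the tails on either side of the pole. -/
theorem besselHeat_le_of_le {α t s x₀ d : ℝ} (hα : 0 < α) (ht : 1 ≤ t) (hs : 0 ≤ s) (hx₀ : 0 ≤ x₀)
    (hd : d ≤ (s - x₀) ^ 2) :
    besselHeat α x₀ t s ≤ t ^ (α + 1 / 2) * Real.exp (-(t - 1) * d) * besselHeat α x₀ 1 s := by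
  have hN := heatNorm_pos hα
  have h1 : besInt 0 α (t * s * x₀) ≤ besInt 0 α (1 * s * x₀) :=
    besInt_antitone 0 hα (by gcongr)
  have h2 : Real.exp (-t * (s - x₀) ^ 2) ≤ Real.exp (-(t - 1) * d) *
      Real.exp (-1 * (s - x₀) ^ 2) := by
    rw [← Real.exp_add, Real.exp_le_exp]
    nlinarith
  have := besInt_nonneg 0 α (t * s * x₀)
  calc besselHeat α x₀ t s ≤ heatNorm α * t ^ (α + 1 / 2) * (Real.exp (-(t - 1) * d) *
      Real.exp (-1 * (s - x₀) ^ 2)) * besInt 0 α (1 * s * x₀) := by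
        unfold besselHeat; gcongr
    _ = _ := by rw [besselHeat, Real.one_rpow]; ring

theorem heatCDF_le_of_lt {α t x x₀ : ℝ} (hα : 0 < α) (ht : 1 ≤ t) (hx : 0 ≤ x) (hx₀ : x ≤ x₀) :
    heatCDF α x₀ t x ≤ t ^ (α + 1 / 2) * Real.exp (-(t - 1) * (x - x₀) ^ 2) := by
  have ht0 : 0 < t := by linarith
  have h : heatCDF α x₀ t x ≤ ∫ s in (0 : ℝ)..x, (t ^ (α + 1 / 2) *
      Real.exp (-(t - 1) * (x - x₀) ^ 2)) * (s ^ (2 * α) * besselHeat α x₀ 1 s) := by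
    refine intervalIntegral.integral_mono_on hx (heatCDF_integrable hα _ _ _ _)
      ((heatCDF_integrable hα _ _ _ _).const_mul _) fun s hs => ?_
    have h1 := besselHeat_le_of_le hα ht hs.1 (hx.trans hx₀) (d := (x - x₀) ^ 2)
      (by nlinarith [hs.1, hs.2])
    have := mul_le_mul_of_nonneg_left h1 (Real.rpow_nonneg hs.1 (2 * α))
    linarith
  rw [intervalIntegral.integral_const_mul] at h
  refine h.trans (mul_le_of_le_one_right (by positivity) ?_)
  exact heatCDF_le_one hα one_pos hx x₀

theorem one_sub_heatCDF_le_of_lt {α t x x₀ : ℝ} (hα : 0 < α) (ht : 1 ≤ t) (hx₀ : 0 ≤ x₀)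
    (hx : x₀ ≤ x) :
    1 - heatCDF α x₀ t x ≤ t ^ (α + 1 / 2) * Real.exp (-(t - 1) * (x - x₀) ^ 2) := by
  have ht0 : 0 < t := by linarith
  have hx' := hx₀.trans hx
  have hI : ∀ t : ℝ, 0 < t →
      IntegrableOn (fun s => s ^ (2 * α) * besselHeat α x₀ t s) (Ioi x) := fun t ht =>
    (integrableOn_rpow_mul_besselHeat hα ht x₀).mono_set (Ioi_subset_Ioi hx')
  rw [one_sub_heatCDF hα ht0 hx']
  have h : ∫ s in Ioi x, s ^ (2 * α) * besselHeat α x₀ t s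
      ≤ ∫ s in Ioi x, (t ^ (α + 1 / 2) *
      Real.exp (-(t - 1) * (x - x₀) ^ 2)) * (s ^ (2 * α) * besselHeat α x₀ 1 s) := by
    refine setIntegral_mono_on (hI t ht0) ((hI 1 one_pos).const_mul _) measurableSet_Ioi
      fun s hs => ?_
    have hs : x < s := hs
    have h1 := besselHeat_le_of_le hα ht (hx'.trans hs.le) hx₀ (d := (x - x₀) ^ 2)
      (by nlinarith)
    have := mul_le_mul_of_nonneg_left h1 (Real.rpow_nonneg (hx'.trans hs.le) (2 * α))
    linarith
  rw [integral_const_mul, ← one_sub_heatCDF hα one_pos hx'] at h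
  refine h.trans (mul_le_of_le_one_right (by positivity) ?_)
  linarith [heatCDF_nonneg hα one_pos hx' x₀]

theorem tendsto_rpow_mul_exp_shift {s d : ℝ} (hd : 0 < d) :
    Tendsto (fun t : ℝ => t ^ s * Real.exp (-(t - 1) * d)) atTop (𝓝 0) := by
  have h := (tendsto_rpow_mul_exp_neg_mul_atTop_nhds_zero s d hd).mul_const (Real.exp d)
  rw [zero_mul] at h
  refine h.congr fun t => ?_
  rw [mul_assoc, ← Real.exp_add]
  ring_nf

theorem tendsto_heatCDF_atTop_of_lt {α x x₀ : ℝ} (hα : 0 < α) (hx : 0 ≤ x) (hx₀ : x < x₀) :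
    Tendsto (fun t => heatCDF α x₀ t x) atTop (𝓝 0) := by
  refine tendsto_of_tendsto_of_tendsto_of_le_of_le' tendsto_const_nhds
    (tendsto_rpow_mul_exp_shift (s := α + 1 / 2) (d := (x - x₀) ^ 2)
      (sq_pos_of_neg (by linarith))) ?_ ?_
  · filter_upwards [eventually_gt_atTop 0] with t ht using heatCDF_nonneg hα ht hx x₀
  · filter_upwards [eventually_ge_atTop 1] with t ht using heatCDF_le_of_lt hα ht hx hx₀.le

theorem tendsto_heatCDF_atTop_of_gt {α x x₀ : ℝ} (hα : 0 < α) (hx₀ : 0 ≤ x₀) (hx : x₀ < x) :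
    Tendsto (fun t => heatCDF α x₀ t x) atTop (𝓝 1) := by
  have h : Tendsto (fun t => 1 - heatCDF α x₀ t x) atTop (𝓝 0) := by
    refine tendsto_of_tendsto_of_tendsto_of_le_of_le' tendsto_const_nhds
      (tendsto_rpow_mul_exp_shift (s := α + 1 / 2) (d := (x - x₀) ^ 2)
        (pow_pos (by linarith) 2)) ?_ ?_
    · filter_upwards [eventually_gt_atTop 0] with t ht
      linarith [heatCDF_le_one hα ht (hx₀.trans hx.le) x₀]
    · filter_upwards [eventually_ge_atTop 1] with t ht using
        one_sub_heatCDF_le_of_lt hα ht hx₀ hx.le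
  simpa using h.const_sub 1

theorem tendsto_heatCDF_zero {α x x₀ : ℝ} (hα : 0 < α) (hx : 0 ≤ x) (hx₀ : 0 ≤ x₀) :
    Tendsto (fun t => heatCDF α x₀ t x) (𝓝[>] 0) (𝓝 0) := by
  have h : Tendsto (fun t : ℝ => heatBound α * x ^ (2 * α + 1) * t ^ (α + 1 / 2)) (𝓝[>] 0)
      (𝓝 0) := by
    have : Continuous fun t : ℝ => heatBound α * x ^ (2 * α + 1) * t ^ (α + 1 / 2) :=
      continuous_const.mul (Real.continuous_rpow_const (by linarith))
    refine (this.tendsto' 0 0 ?_).mono_left nhdsWithin_le_nhds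
    rw [Real.zero_rpow (by linarith), mul_zero]
  refine tendsto_of_tendsto_of_tendsto_of_le_of_le' tendsto_const_nhds h ?_ ?_
  · filter_upwards [self_mem_nhdsWithin] with t ht using heatCDF_nonneg hα ht hx x₀
  · filter_upwards [self_mem_nhdsWithin] with t ht using heatCDF_le hα ht hx hx₀

theorem continuousOn_heatFlux_left {α : ℝ} (hα : 0 < α) (x₀ x : ℝ) :
    ContinuousOn (fun t => heatFlux α x₀ t x) (Ioi 0) :=
  (continuousOn_heatFlux hα x₀).comp (f := fun t : ℝ => (t, x)) (by fun_prop)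
    fun _ ht => ⟨ht, mem_univ _⟩

theorem continuousOn_besselHeat_left {α : ℝ} (hα : 0 < α) (x₀ x : ℝ) :
    ContinuousOn (fun t => besselHeat α x₀ t x) (Ioi 0) :=
  (continuousOn_besselHeat hα x₀).comp (f := fun t : ℝ => (t, x)) (by fun_prop)
    fun _ ht => ⟨ht, mem_univ _⟩

theorem continuousOn_besselHeatDeriv_left {α : ℝ} (hα : 0 < α) (x₀ x : ℝ) :
    ContinuousOn (fun t => besselHeatDeriv α x₀ t x) (Ioi 0) :=
  (continuousOn_besselHeatDeriv hα x₀).comp (f := fun t : ℝ => (t, x)) (by fun_prop)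
    fun _ ht => ⟨ht, mem_univ _⟩

theorem continuousOn_heatCDF_left {α x : ℝ} (hα : 0 < α) (hx : 0 ≤ x) (x₀ : ℝ) :
    ContinuousOn (fun t => heatCDF α x₀ t x) (Ioi 0) := fun _ ht =>
  (hasDerivAt_heatCDF_left hα ht hx x₀).continuousAt.continuousWithinAt

/-! ### The stream function -/

/-- The stream function of the product heat kernel. -/
noncomputable def heatStream (α β x₀ y₀ x y : ℝ) : ℝ :=
  ∫ t in Ioi (0 : ℝ), heatFlux α x₀ t x * heatCDF β y₀ t y

/-- Up to the factor `-x^(2α)`, the `x`-derivative of the fundamental solution. -/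
noncomputable def heatGrad (α β x₀ y₀ x y : ℝ) : ℝ :=
  ∫ t in Ioi (0 : ℝ), heatFlux α x₀ t x * besselHeat β y₀ t y

theorem abs_heatFlux_mul_besselHeat_le {α β t x y x₀ y₀ : ℝ} (hα : 0 < α) (hβ : 0 < β) (ht : 0 < t)
    (hx : 0 ≤ x) (hy : 0 ≤ y) (hx₀ : 0 ≤ x₀) (hy₀ : 0 ≤ y₀) :
    |heatFlux α x₀ t x * besselHeat β y₀ t y| ≤
      (heatBound α * (x + 3 * x₀) * x ^ (2 * α) * heatBound β) *
        (t ^ (α + β) * Real.exp (-((x - x₀) ^ 2 + (y - y₀) ^ 2) * t)) := by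
  have hK := heatBound_pos hα
  have hx2 : 0 ≤ x ^ (2 * α) := Real.rpow_nonneg hx _
  rw [abs_mul, abs_of_nonneg (besselHeat_nonneg hβ ht.le y₀ y)]
  refine (mul_le_mul (abs_heatFlux_le hα ht hx hx₀) (besselHeat_le hβ ht hy hy₀)
    (besselHeat_nonneg hβ ht.le y₀ y) (by positivity)).trans (le_of_eq ?_)
  have e1 : t ^ (α + β) = t ^ (α - 1 / 2) * t ^ (β + 1 / 2) := by
    rw [← Real.rpow_add ht]; ring_nf
  have e2 : Real.exp (-((x - x₀) ^ 2 + (y - y₀) ^ 2) * t)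
      = Real.exp (-t * (x - x₀) ^ 2) * Real.exp (-t * (y - y₀) ^ 2) := by
    rw [← Real.exp_add]; ring_nf
  rw [e1, e2]
  ring

theorem continuousOn_heatFlux_mul_besselHeat {α β : ℝ} (hα : 0 < α) (hβ : 0 < β)
    (x₀ y₀ x y : ℝ) :
    ContinuousOn (fun t => heatFlux α x₀ t x * besselHeat β y₀ t y) (Ioi 0) :=
  (continuousOn_heatFlux_left hα _ _).mul (continuousOn_besselHeat_left hβ _ _)

theorem integrableOn_heatGrad {α β x y x₀ y₀ : ℝ} (hα : 0 < α) (hβ : 0 < β)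
    (hx : 0 ≤ x) (hy : 0 ≤ y) (hx₀ : 0 ≤ x₀) (hy₀ : 0 ≤ y₀)
    (hr : 0 < (x - x₀) ^ 2 + (y - y₀) ^ 2) :
    IntegrableOn (fun t => heatFlux α x₀ t x * besselHeat β y₀ t y) (Ioi 0) := by
  refine Integrable.mono' ((integrableOn_rpow_mul_exp (s := α + β) (by linarith) hr).const_mul
    (heatBound α * (x + 3 * x₀) * x ^ (2 * α) * heatBound β))
    ((continuousOn_heatFlux_mul_besselHeat hα hβ _ _ _ _).aestronglyMeasurable measurableSet_Ioi) ?_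
  filter_upwards [ae_restrict_mem measurableSet_Ioi] with t ht
  exact abs_heatFlux_mul_besselHeat_le hα hβ ht hx hy hx₀ hy₀

/-- Dominated convergence, using half the squared distance to the pole in the exponent. It makes the
flux form continuous, hence measurable, along the arc. -/
theorem continuousAt_heatGrad {α β x y x₀ y₀ : ℝ} (hα : 0 < α) (hβ : 0 < β)
    (hx : 0 < x) (hy : 0 < y) (hx₀ : 0 ≤ x₀) (hy₀ : 0 ≤ y₀)
    (hr : 0 < (x - x₀) ^ 2 + (y - y₀) ^ 2) :
    ContinuousAt (fun z : ℝ × ℝ => heatGrad α β x₀ y₀ z.1 z.2) (x, y) := by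
  set d := ((x - x₀) ^ 2 + (y - y₀) ^ 2) / 2 with hd
  have hd0 : 0 < d := by positivity
  have hK := heatBound_pos hα
  have hK' := heatBound_pos hβ
  have hnear : ∀ᶠ z : ℝ × ℝ in 𝓝 (x, y), 0 < z.1 ∧ z.1 < 2 * x ∧ 0 < z.2 ∧
      d < (z.1 - x₀) ^ 2 + (z.2 - y₀) ^ 2 := by
    have c1 : ContinuousAt (fun z : ℝ × ℝ => z.1) (x, y) := continuousAt_fst
    have c2 : ContinuousAt (fun z : ℝ × ℝ => z.2) (x, y) := continuousAt_snd
    have c3 : ContinuousAt (fun z : ℝ × ℝ => (z.1 - x₀) ^ 2 + (z.2 - y₀) ^ 2) (x, y) := by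
      fun_prop
    exact ((c1.eventually_const_lt hx).and ((c1.eventually_lt_const
      (show x < 2 * x by linarith)).and ((c2.eventually_const_lt hy).and
      (c3.eventually_const_lt (show d < (x - x₀) ^ 2 + (y - y₀) ^ 2 by rw [hd]; linarith)))))
  refine continuousAt_of_dominated (bound := fun t =>
    (heatBound α * (2 * x + 3 * x₀) * (2 * x) ^ (2 * α) * heatBound β) *
        (t ^ (α + β) * Real.exp (-d * t))) ?_ ?_ ?_ ?_
  · exact Eventually.of_forall fun z =>
      (continuousOn_heatFlux_mul_besselHeat hα hβ _ _ _ _).aestronglyMeasurable measurableSet_Ioi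
  · filter_upwards [hnear] with z hz
    filter_upwards [ae_restrict_mem measurableSet_Ioi] with t ht
    have ht : 0 < t := ht
    refine (abs_heatFlux_mul_besselHeat_le hα hβ ht hz.1.le hz.2.2.1.le hx₀ hy₀).trans ?_
    have h1 : z.1 ^ (2 * α) ≤ (2 * x) ^ (2 * α) :=
      Real.rpow_le_rpow hz.1.le hz.2.1.le (by linarith)
    have h2 : Real.exp (-((z.1 - x₀) ^ 2 + (z.2 - y₀) ^ 2) * t) ≤ Real.exp (-d * t) := by
      rw [Real.exp_le_exp]
      nlinarith [hz.2.2.2]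
    have h3 : z.1 ≤ 2 * x := hz.2.1.le
    have h4 := hz.1
    gcongr
  · exact (integrableOn_rpow_mul_exp (by linarith) hd0).const_mul _
  · filter_upwards [ae_restrict_mem measurableSet_Ioi] with t ht
    exact ((continuous_heatFlux hα x₀ t).comp continuous_fst).continuousAt.mul
      ((continuous_besselHeat hβ y₀ t).comp continuous_snd).continuousAt

theorem continuousOn_heatStream_integrand {α β y : ℝ} (hα : 0 < α) (hβ : 0 < β) (hy : 0 ≤ y)
    (x₀ y₀ x : ℝ) :
    ContinuousOn (fun t => heatFlux α x₀ t x * heatCDF β y₀ t y) (Ioi 0) :=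
  (continuousOn_heatFlux_left hα _ _).mul (continuousOn_heatCDF_left hβ hy _)

theorem abs_heatFlux_mul_heatCDF_le {α β t x y x₀ y₀ : ℝ} (hα : 0 < α) (hβ : 0 < β) (ht : 0 < t)
    (hx : 0 ≤ x) (hy : 0 ≤ y) (hx₀ : 0 ≤ x₀) :
    |heatFlux α x₀ t x * heatCDF β y₀ t y| ≤
      (heatBound α * (x + 3 * x₀) * x ^ (2 * α)) *
        (t ^ (α - 1 / 2) * Real.exp (-(x - x₀) ^ 2 * t)) := by
  rw [abs_mul, abs_of_nonneg (heatCDF_nonneg hβ ht hy y₀)]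
  refine (mul_le_of_le_one_right (abs_nonneg _) (heatCDF_le_one hβ ht hy y₀)).trans
    ((abs_heatFlux_le hα ht hx hx₀).trans (le_of_eq ?_))
  ring_nf

/-- The distribution function in y is merely bounded as t → ∞, so the decay has to come from the
Gaussian in x. This is why the whole line x = x₀ is excluded and not only the pole. -/
theorem integrableOn_heatStream {α β x y x₀ : ℝ} (hα : 0 < α) (hβ : 0 < β)
    (hx : 0 ≤ x) (hy : 0 ≤ y) (hx₀ : 0 ≤ x₀) (y₀ : ℝ) (hne : x ≠ x₀) :
    IntegrableOn (fun t => heatFlux α x₀ t x * heatCDF β y₀ t y) (Ioi 0) := by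
  have hr : 0 < (x - x₀) ^ 2 := by
    have := sub_ne_zero.2 hne
    positivity
  refine Integrable.mono' ((integrableOn_rpow_mul_exp (s := α - 1 / 2) (by linarith) hr).const_mul
    (heatBound α * (x + 3 * x₀) * x ^ (2 * α)))
    ((continuousOn_heatStream_integrand hα hβ hy _ _ _).aestronglyMeasurable measurableSet_Ioi) ?_
  filter_upwards [ae_restrict_mem measurableSet_Ioi] with t ht
  exact abs_heatFlux_mul_heatCDF_le hα hβ ht hx hy hx₀

theorem integrableOn_besselHeatDeriv_mul_heatCDF {α β x y x₀ : ℝ} (hα : 0 < α) (hβ : 0 < β)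
    (hx : 0 ≤ x) (hy : 0 ≤ y) (hx₀ : 0 ≤ x₀) (y₀ : ℝ) (hne : x ≠ x₀) :
    IntegrableOn (fun t => heatCDF β y₀ t y * besselHeatDeriv α x₀ t x) (Ioi 0) := by
  have hr : 0 < (x - x₀) ^ 2 := by
    have := sub_ne_zero.2 hne
    positivity
  refine Integrable.mono' (((integrableOn_rpow_mul_exp (s := α - 1 / 2) (by linarith) hr).add
    (integrableOn_rpow_mul_exp (s := α + 1 / 2) (by linarith) hr)).const_mul
    (heatBound α * (α + 1 + 4 * (x + x₀) ^ 2)))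
    (((continuousOn_heatCDF_left hβ hy _).mul
      (continuousOn_besselHeatDeriv_left hα x₀ x)).aestronglyMeasurable measurableSet_Ioi) ?_
  filter_upwards [ae_restrict_mem measurableSet_Ioi] with t ht
  rw [Real.norm_eq_abs, abs_mul, abs_of_nonneg (heatCDF_nonneg hβ ht hy y₀)]
  refine (mul_le_of_le_one_left (abs_nonneg _) (heatCDF_le_one hβ ht hy y₀)).trans
    ((abs_besselHeatDeriv_le hα ht hx hx₀).trans (le_of_eq ?_))
  simp only [Pi.add_apply]
  ring_nf

theorem tendsto_besselHeat_zero {α x x₀ : ℝ} (hα : 0 < α) (hx : 0 ≤ x) (hx₀ : 0 ≤ x₀) :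
    Tendsto (fun t => besselHeat α x₀ t x) (𝓝[>] 0) (𝓝 0) := by
  have h : Tendsto (fun t : ℝ => heatBound α * t ^ (α + 1 / 2) * Real.exp (-t * (x - x₀) ^ 2))
      (𝓝[>] 0) (𝓝 0) := by
    have : Continuous fun t : ℝ =>
        heatBound α * t ^ (α + 1 / 2) * Real.exp (-t * (x - x₀) ^ 2) :=
      (continuous_const.mul (Real.continuous_rpow_const (by linarith))).mul (by fun_prop)
    refine (this.tendsto' 0 0 ?_).mono_left nhdsWithin_le_nhds
    rw [Real.zero_rpow (by linarith)]
    ring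
  refine tendsto_of_tendsto_of_tendsto_of_le_of_le' tendsto_const_nhds h ?_ ?_
  · filter_upwards [self_mem_nhdsWithin] with t ht using besselHeat_nonneg hα (le_of_lt ht) _ _
  · filter_upwards [self_mem_nhdsWithin] with t ht using besselHeat_le hα ht hx hx₀

theorem tendsto_besselHeat_atTop {α x x₀ : ℝ} (hα : 0 < α) (hx : 0 ≤ x) (hx₀ : 0 ≤ x₀)
    (hne : x ≠ x₀) :
    Tendsto (fun t => besselHeat α x₀ t x) atTop (𝓝 0) := by
  have hr : 0 < (x - x₀) ^ 2 := by
    have := sub_ne_zero.2 hne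
    positivity
  have h := (tendsto_rpow_mul_exp_neg_mul_atTop_nhds_zero (α + 1 / 2) _ hr).const_mul (heatBound α)
  rw [mul_zero] at h
  refine tendsto_of_tendsto_of_tendsto_of_le_of_le' tendsto_const_nhds h ?_ ?_
  · filter_upwards [eventually_gt_atTop 0] with t ht using besselHeat_nonneg hα (le_of_lt ht) _ _
  · filter_upwards [eventually_gt_atTop 0] with t ht
    refine (besselHeat_le hα ht hx hx₀).trans (le_of_eq ?_)
    ring_nf

/-- Integration by parts in t. The boundary terms vanish because the x-kernel tends to 0 at both
ends (at infinity since x ≠ x₀) and the distribution function stays in [0, 1]. -/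
theorem integral_besselHeatDeriv_mul_heatCDF {α β x y x₀ y₀ : ℝ} (hα : 0 < α) (hβ : 0 < β)
    (hx : 0 ≤ x) (hy : 0 ≤ y) (hx₀ : 0 ≤ x₀) (hy₀ : 0 ≤ y₀) (hne : x ≠ x₀) :
    ∫ t in Ioi (0 : ℝ), heatCDF β y₀ t y * besselHeatDeriv α x₀ t x
      = -heatGrad β α y₀ x₀ y x := by
  have hr : 0 < (x - x₀) ^ 2 := by
    have := sub_ne_zero.2 hne
    positivity
  have hz : ∀ l : Filter ℝ, (∀ᶠ t in l, 0 < t) → Tendsto (fun t => besselHeat α x₀ t x) l (𝓝 0) →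
      Tendsto ((fun t => heatCDF β y₀ t y) * fun t => besselHeat α x₀ t x) l (𝓝 0) := by
    intro l hl h
    refine tendsto_of_tendsto_of_tendsto_of_le_of_le' tendsto_const_nhds h ?_ ?_
    · filter_upwards [hl] with t ht
      exact mul_nonneg (heatCDF_nonneg hβ ht hy _) (besselHeat_nonneg hα ht.le _ _)
    · filter_upwards [hl] with t ht
      exact mul_le_of_le_one_left (besselHeat_nonneg hα ht.le _ _) (heatCDF_le_one hβ ht hy _)
  rw [integral_Ioi_mul_deriv_eq_deriv_mul (a' := 0) (b' := 0)
    (u := fun t => heatCDF β y₀ t y) (u' := fun t => heatFlux β y₀ t y)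
    (v := fun t => besselHeat α x₀ t x)
    (fun t ht => hasDerivAt_heatCDF_left hβ ht hy y₀)
    (fun t ht => hasDerivAt_besselHeat_left hα ht x₀ x)
    (integrableOn_besselHeatDeriv_mul_heatCDF hα hβ hx hy hx₀ y₀ hne)
    (integrableOn_heatGrad hβ hα hy hx hy₀ hx₀ (by nlinarith [sq_nonneg (y - y₀)]))
    (hz _ self_mem_nhdsWithin (tendsto_besselHeat_zero hα hx hx₀))
    (hz _ (eventually_gt_atTop 0) (tendsto_besselHeat_atTop hα hx hx₀ hne))]
  rw [heatGrad]
  ring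

/-- In y the distribution function differentiates to y^(2β) times the kernel. In x the flux
differentiates to x^(2α) ∂ₜ of the kernel, and the integration by parts moves ∂ₜ onto the
distribution function. Both partial derivatives thus become weighted derivatives of the fundamental
solution: the stream function is a primitive of the conormal form. -/
theorem hasFDerivAt_heatStream {α β x y x₀ y₀ : ℝ} (hα : 0 < α) (hβ : 0 < β)
    (hx : 0 < x) (hy : 0 < y) (hx₀ : 0 ≤ x₀) (hy₀ : 0 ≤ y₀) (hne : x ≠ x₀) :
    HasFDerivAt (fun z : ℝ × ℝ => heatStream α β x₀ y₀ z.1 z.2)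
      ((-(x ^ (2 * α) * heatGrad β α y₀ x₀ y x)) • ContinuousLinearMap.fst ℝ ℝ ℝ
        + (y ^ (2 * β) * heatGrad α β x₀ y₀ x y) • ContinuousLinearMap.snd ℝ ℝ ℝ) (x, y) := by
  have hsub := sub_ne_zero.2 hne
  -- Half the squared distance to the singular line; it survives in the exponent throughout a
  -- neighbourhood and supplies the dominating function.
  set d := (x - x₀) ^ 2 / 2 with hd
  have hd0 : 0 < d := by positivity
  have hK := heatBound_pos hα
  have hK' := heatBound_pos hβ
  have hnear : {z : ℝ × ℝ | 0 < z.1 ∧ z.1 < 2 * x ∧ 0 < z.2 ∧ z.2 < 2 * y ∧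
      d < (z.1 - x₀) ^ 2} ∈ 𝓝 (x, y) := by
    have c1 : ContinuousAt (fun z : ℝ × ℝ => z.1) (x, y) := continuousAt_fst
    have c2 : ContinuousAt (fun z : ℝ × ℝ => z.2) (x, y) := continuousAt_snd
    have c3 : ContinuousAt (fun z : ℝ × ℝ => (z.1 - x₀) ^ 2) (x, y) := by
      fun_prop
    exact ((c1.eventually_const_lt hx).and ((c1.eventually_lt_const
      (show x < 2 * x by linarith)).and ((c2.eventually_const_lt hy).and
      ((c2.eventually_lt_const (show y < 2 * y by linarith)).and
      (c3.eventually_const_lt (show d < (x - x₀) ^ 2 by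
        have : 0 < (x - x₀) ^ 2 := by positivity
        rw [hd]; linarith))))))
  set F' : ℝ × ℝ → ℝ → (ℝ × ℝ →L[ℝ] ℝ) := fun z t =>
    (z.1 ^ (2 * α) * (heatCDF β y₀ t z.2 * besselHeatDeriv α x₀ t z.1)) •
        ContinuousLinearMap.fst ℝ ℝ ℝ
      + (z.2 ^ (2 * β) * (heatFlux α x₀ t z.1 * besselHeat β y₀ t z.2)) •
        ContinuousLinearMap.snd ℝ ℝ ℝ with hF'
  have key := (hasFDerivAt_integral_of_dominated_of_fderiv_le (𝕜 := ℝ)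
    (μ := volume.restrict (Ioi (0 : ℝ)))
    (F := fun (z : ℝ × ℝ) t => heatFlux α x₀ t z.1 * heatCDF β y₀ t z.2) (F' := F')
    (bound := fun t => (2 * x) ^ (2 * α) * (heatBound α * (α + 1 + 4 * (2 * x + x₀) ^ 2) *
        (t ^ (α - 1 / 2) * Real.exp (-d * t) + t ^ (α + 1 / 2) * Real.exp (-d * t)))
      + (2 * y) ^ (2 * β) * ((heatBound α * (2 * x + 3 * x₀) * (2 * x) ^ (2 * α) * heatBound β) *
        (t ^ (α + β) * Real.exp (-d * t))))
    hnear ?_ (integrableOn_heatStream hα hβ hx.le hy.le hx₀ y₀ hne) ?_ ?_ ?_ ?_)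
  · have hI1 := integrableOn_besselHeatDeriv_mul_heatCDF hα hβ hx.le hy.le hx₀ y₀ hne
    have hI2 := integrableOn_heatGrad hα hβ hx.le hy.le hx₀ hy₀
      (show 0 < (x - x₀) ^ 2 + (y - y₀) ^ 2 by positivity)
    have e : ∫ t in Ioi (0 : ℝ), F' (x, y) t
        = (-(x ^ (2 * α) * heatGrad β α y₀ x₀ y x)) • ContinuousLinearMap.fst ℝ ℝ ℝ
        + (y ^ (2 * β) * heatGrad α β x₀ y₀ x y) • ContinuousLinearMap.snd ℝ ℝ ℝ := by
      simp only [hF']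
      rw [integral_add ((hI1.const_mul _).smul_const _) ((hI2.const_mul _).smul_const _),
        integral_smul_const, integral_smul_const, integral_const_mul, integral_const_mul,
        integral_besselHeatDeriv_mul_heatCDF hα hβ hx.le hy.le hx₀ hy₀ hne, ← heatGrad.eq_1, mul_neg]
    rw [← e]
    exact key
  · filter_upwards [hnear] with z hz
    exact (continuousOn_heatStream_integrand hα hβ hz.2.2.1.le _ _ _).aestronglyMeasurable
      measurableSet_Ioi
  · apply ContinuousOn.aestronglyMeasurable _ measurableSet_Ioi
    have h1 := (continuousOn_heatCDF_left hβ hy.le y₀).mul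
      (continuousOn_besselHeatDeriv_left hα x₀ x)
    have h2 := continuousOn_heatFlux_mul_besselHeat hα hβ x₀ y₀ x y
    exact ((continuousOn_const.mul h1).smul continuousOn_const).add
      ((continuousOn_const.mul h2).smul continuousOn_const)
  · filter_upwards [ae_restrict_mem measurableSet_Ioi] with t ht z hz
    have ht : 0 < t := ht
    obtain ⟨hz1, hz2, hz3, hz4, hz5⟩ := hz
    have h1 : z.1 ^ (2 * α) ≤ (2 * x) ^ (2 * α) := Real.rpow_le_rpow hz1.le hz2.le (by linarith)
    have h2 : z.2 ^ (2 * β) ≤ (2 * y) ^ (2 * β) := Real.rpow_le_rpow hz3.le hz4.le (by linarith)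
    have n1 : |z.1 ^ (2 * α) * (heatCDF β y₀ t z.2 * besselHeatDeriv α x₀ t z.1)|
        ≤ (2 * x) ^ (2 * α) * (heatBound α * (α + 1 + 4 * (2 * x + x₀) ^ 2) *
        (t ^ (α - 1 / 2) * Real.exp (-d * t) + t ^ (α + 1 / 2) * Real.exp (-d * t))) := by
      rw [abs_mul, abs_mul, abs_of_nonneg (Real.rpow_nonneg hz1.le _),
        abs_of_nonneg (heatCDF_nonneg hβ ht hz3.le y₀)]
      refine mul_le_mul h1 ?_ (mul_nonneg (heatCDF_nonneg hβ ht hz3.le y₀) (abs_nonneg _))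
        (by positivity)
      refine (mul_le_of_le_one_left (abs_nonneg _) (heatCDF_le_one hβ ht hz3.le y₀)).trans
        ((abs_besselHeatDeriv_le hα ht hz1.le hx₀).trans ?_)
      rw [← add_mul]
      have : Real.exp (-t * (z.1 - x₀) ^ 2) ≤ Real.exp (-d * t) := by
        rw [Real.exp_le_exp]; nlinarith
      gcongr
    have n2 : |z.2 ^ (2 * β) * (heatFlux α x₀ t z.1 * besselHeat β y₀ t z.2)|
        ≤ (2 * y) ^ (2 * β) * ((heatBound α * (2 * x + 3 * x₀) * (2 * x) ^ (2 * α) *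
          heatBound β) * (t ^ (α + β) * Real.exp (-d * t))) := by
      rw [abs_mul, abs_of_nonneg (Real.rpow_nonneg hz3.le _)]
      refine mul_le_mul h2 ?_ (abs_nonneg _) (by positivity)
      refine (abs_heatFlux_mul_besselHeat_le hα hβ ht hz1.le hz3.le hx₀ hy₀).trans ?_
      have : Real.exp (-((z.1 - x₀) ^ 2 + (z.2 - y₀) ^ 2) * t) ≤ Real.exp (-d * t) := by
        rw [Real.exp_le_exp]; nlinarith [sq_nonneg (z.2 - y₀)]
      gcongr
    refine (norm_add_le _ _).trans (add_le_add ?_ ?_)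
    · rw [norm_smul]
      exact (mul_le_of_le_one_right (norm_nonneg _) (ContinuousLinearMap.norm_fst_le ℝ ℝ ℝ)).trans
        n1
    · rw [norm_smul]
      exact (mul_le_of_le_one_right (norm_nonneg _) (ContinuousLinearMap.norm_snd_le ℝ ℝ ℝ)).trans
        n2
  · refine Integrable.add (Integrable.const_mul (Integrable.const_mul (Integrable.add ?_ ?_) _) _)
      (Integrable.const_mul (Integrable.const_mul ?_ _) _)
    · exact integrableOn_rpow_mul_exp (by linarith) hd0
    · exact integrableOn_rpow_mul_exp (by linarith) hd0
    · exact integrableOn_rpow_mul_exp (by linarith) hd0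
  · filter_upwards [ae_restrict_mem measurableSet_Ioi] with t ht z hz
    have d1 : HasFDerivAt (fun z : ℝ × ℝ => heatFlux α x₀ t z.1)
        ((z.1 ^ (2 * α) * besselHeatDeriv α x₀ t z.1) • ContinuousLinearMap.fst ℝ ℝ ℝ) z :=
      (hasDerivAt_heatFlux hα ht hz.1 x₀).comp_hasFDerivAt z hasFDerivAt_fst
    have d2 : HasFDerivAt (fun z : ℝ × ℝ => heatCDF β y₀ t z.2)
        ((z.2 ^ (2 * β) * besselHeat β y₀ t z.2) • ContinuousLinearMap.snd ℝ ℝ ℝ) z :=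
      (hasDerivAt_heatCDF hβ y₀ t z.2).comp_hasFDerivAt z hasFDerivAt_snd
    refine (d1.mul d2).congr_fderiv ?_
    simp only [hF', smul_smul]
    rw [add_comm]
    congr 2 <;> ring

/-- The two integrands add up to the t-derivative of the product of the distribution functions. That
product is 0 at t = 0, so the sum is its limit at infinity. -/
theorem heatStream_add_heatStream {α β x y x₀ y₀ L : ℝ} (hα : 0 < α) (hβ : 0 < β)
    (hx : 0 ≤ x) (hy : 0 ≤ y) (hx₀ : 0 ≤ x₀) (hy₀ : 0 ≤ y₀) (hne : x ≠ x₀) (hne' : y ≠ y₀)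
    (hL : Tendsto (fun t => heatCDF α x₀ t x * heatCDF β y₀ t y) atTop (𝓝 L)) :
    heatStream α β x₀ y₀ x y + heatStream β α y₀ x₀ y x = L := by
  have h1 := integrableOn_heatStream hα hβ hx hy hx₀ y₀ hne
  have h2 := integrableOn_heatStream hβ hα hy hx hy₀ x₀ hne'
  rw [heatStream, heatStream, ← integral_add h1 h2]
  have h0 : Tendsto (fun t => heatCDF α x₀ t x * heatCDF β y₀ t y) (𝓝[>] 0) (𝓝 0) := by
    simpa using (tendsto_heatCDF_zero hα hx hx₀).mul (tendsto_heatCDF_zero hβ hy hy₀)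
  have h3 : (fun t => heatFlux β y₀ t y * heatCDF α x₀ t x)
      = fun t => heatCDF α x₀ t x * heatFlux β y₀ t y := by
    ext t; ring
  have := integral_Ioi_deriv_mul_eq_sub (a' := 0) (b' := L)
    (u := fun t => heatCDF α x₀ t x) (u' := fun t => heatFlux α x₀ t x)
    (v := fun t => heatCDF β y₀ t y) (v' := fun t => heatFlux β y₀ t y)
    (fun t ht => hasDerivAt_heatCDF_left hα ht hx x₀)
    (fun t ht => hasDerivAt_heatCDF_left hβ ht hy y₀)
    (h1.add (by rw [h3] at h2; exact h2)) h0 hL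
  rw [sub_zero] at this
  rw [← this]
  refine integral_congr_ae (Eventually.of_forall fun t => ?_)
  simp only
  ring

theorem heatStream_add_heatStream_of_lt_left {α β x y x₀ y₀ : ℝ} (hα : 0 < α) (hβ : 0 < β)
    (hx : 0 ≤ x) (hy : 0 ≤ y) (hx₀ : 0 ≤ x₀) (hy₀ : 0 ≤ y₀) (hlt : x < x₀) (hne' : y ≠ y₀) :
    heatStream α β x₀ y₀ x y + heatStream β α y₀ x₀ y x = 0 := by
  refine heatStream_add_heatStream hα hβ hx hy hx₀ hy₀ hlt.ne hne' ?_
  refine tendsto_of_tendsto_of_tendsto_of_le_of_le' tendsto_const_nhds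
    (tendsto_heatCDF_atTop_of_lt hα hx hlt) ?_ ?_
  · filter_upwards [eventually_gt_atTop 0] with t ht
    exact mul_nonneg (heatCDF_nonneg hα ht hx _) (heatCDF_nonneg hβ ht hy _)
  · filter_upwards [eventually_gt_atTop 0] with t ht
    exact mul_le_of_le_one_right (heatCDF_nonneg hα ht hx _) (heatCDF_le_one hβ ht hy _)

theorem heatStream_add_heatStream_of_lt_right {α β x y x₀ y₀ : ℝ} (hα : 0 < α) (hβ : 0 < β)
    (hx : 0 ≤ x) (hy : 0 ≤ y) (hx₀ : 0 ≤ x₀) (hy₀ : 0 ≤ y₀) (hne : x ≠ x₀) (hlt : y < y₀) :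
    heatStream α β x₀ y₀ x y + heatStream β α y₀ x₀ y x = 0 := by
  rw [add_comm]
  exact heatStream_add_heatStream_of_lt_left hβ hα hy hx hy₀ hx₀ hlt hne

/-- As t → ∞ both kernels concentrate at their poles, which here lie inside the intervals of
integration. This value 1, against 0 in the other three sectors, is the period of the form around
the pole. -/
theorem heatStream_add_heatStream_of_gt {α β x y x₀ y₀ : ℝ} (hα : 0 < α) (hβ : 0 < β)
    (hx₀ : 0 ≤ x₀) (hy₀ : 0 ≤ y₀) (hlt : x₀ < x) (hlt' : y₀ < y) :
    heatStream α β x₀ y₀ x y + heatStream β α y₀ x₀ y x = 1 := by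
  refine heatStream_add_heatStream hα hβ (hx₀.trans hlt.le) (hy₀.trans hlt'.le) hx₀ hy₀ hlt.ne'
    hlt'.ne' ?_
  simpa using (tendsto_heatCDF_atTop_of_gt hα hx₀ hlt).mul (tendsto_heatCDF_atTop_of_gt hβ hy₀ hlt')

/-- The stream function vanishes on the axis `x = 0`. -/
theorem abs_heatStream_le_left {α β x y x₀ d : ℝ} (hα : 0 < α) (hβ : 0 < β)
    (hx : 0 ≤ x) (hy : 0 ≤ y) (hx₀ : 0 ≤ x₀) (y₀ : ℝ) (hd : 0 < d) (hne : d ≤ (x - x₀) ^ 2) :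
    |heatStream α β x₀ y₀ x y| ≤ (heatBound α * (x + 3 * x₀) *
      ∫ t in Ioi (0 : ℝ), t ^ (α - 1 / 2) * Real.exp (-d * t)) * x ^ (2 * α) := by
  have hK := heatBound_pos hα
  have hx2 : 0 ≤ x ^ (2 * α) := Real.rpow_nonneg hx _
  rw [heatStream, mul_right_comm, ← integral_const_mul, ← Real.norm_eq_abs]
  refine norm_integral_le_of_norm_le
    ((integrableOn_rpow_mul_exp (by linarith) hd).const_mul _) ?_
  filter_upwards [ae_restrict_mem measurableSet_Ioi] with t ht
  have ht : 0 < t := ht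
  refine (abs_heatFlux_mul_heatCDF_le hα hβ ht hx hy hx₀).trans ?_
  have : Real.exp (-(x - x₀) ^ 2 * t) ≤ Real.exp (-d * t) := by
    rw [Real.exp_le_exp]; nlinarith
  gcongr

/-- Away from the line `x = x₀` the stream function vanishes on the axis `y = 0`. -/
theorem abs_heatStream_le_right {α β x y x₀ y₀ d : ℝ} (hα : 0 < α) (hβ : 0 < β)
    (hx : 0 ≤ x) (hy : 0 ≤ y) (hx₀ : 0 ≤ x₀) (hy₀ : 0 ≤ y₀) (hd : 0 < d)
    (hne : d ≤ (x - x₀) ^ 2) :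
    |heatStream α β x₀ y₀ x y| ≤ (heatBound α * (x + 3 * x₀) * x ^ (2 * α) * heatBound β *
      ∫ t in Ioi (0 : ℝ), t ^ (α + β) * Real.exp (-d * t)) * y ^ (2 * β + 1) := by
  have hK := heatBound_pos hα
  have hK' := heatBound_pos hβ
  have hx2 : 0 ≤ x ^ (2 * α) := Real.rpow_nonneg hx _
  have hy2 : 0 ≤ y ^ (2 * β + 1) := Real.rpow_nonneg hy _
  rw [heatStream, mul_right_comm, ← integral_const_mul, ← Real.norm_eq_abs]
  refine norm_integral_le_of_norm_le
    ((integrableOn_rpow_mul_exp (by linarith) hd).const_mul _) ?_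
  filter_upwards [ae_restrict_mem measurableSet_Ioi] with t ht
  have ht : 0 < t := ht
  rw [Real.norm_eq_abs, abs_mul, abs_of_nonneg (heatCDF_nonneg hβ ht hy y₀)]
  refine (mul_le_mul (abs_heatFlux_le hα ht hx hx₀) (heatCDF_le hβ ht hy hy₀)
    (heatCDF_nonneg hβ ht hy y₀) (by positivity)).trans ?_
  have : Real.exp (-t * (x - x₀) ^ 2) ≤ Real.exp (-d * t) := by
    rw [Real.exp_le_exp]; nlinarith
  have e1 : t ^ (α + β) = t ^ (α - 1 / 2) * t ^ (β + 1 / 2) := by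
    rw [← Real.rpow_add ht]; ring_nf
  calc heatBound α * (x + 3 * x₀) * x ^ (2 * α) *
        (t ^ (α - 1 / 2) * Real.exp (-t * (x - x₀) ^ 2)) *
        (heatBound β * y ^ (2 * β + 1) * t ^ (β + 1 / 2))
      ≤ heatBound α * (x + 3 * x₀) * x ^ (2 * α) *
        (t ^ (α - 1 / 2) * Real.exp (-d * t)) *
        (heatBound β * y ^ (2 * β + 1) * t ^ (β + 1 / 2)) := by gcongr
    _ = _ := by rw [e1]; ring

/-! ### Concentration of the kernel -/

/-- The factor of `x^(2α) * besselHeat` that remains when the Gaussian is removed. -/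
noncomputable def heatProfile (α x₀ t x : ℝ) : ℝ :=
  heatNorm α * t ^ (α + 1 / 2) * x ^ (2 * α) * besInt 0 α (t * x * x₀)

theorem rpow_mul_besselHeat (α x₀ t x : ℝ) :
    x ^ (2 * α) * besselHeat α x₀ t x = heatProfile α x₀ t x * Real.exp (-t * (x - x₀) ^ 2) := by
  rw [heatProfile, besselHeat]
  ring

theorem heatProfile_nonneg {α t x : ℝ} (hα : 0 < α) (ht : 0 ≤ t) (hx : 0 ≤ x) (x₀ : ℝ) :
    0 ≤ heatProfile α x₀ t x := by
  have := besInt_nonneg 0 α (t * x * x₀)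
  have := heatNorm_pos hα
  unfold heatProfile
  positivity

theorem rpow_neg_mul_two_div {α t x₀ : ℝ} (ht : 0 < t) (hx₀ : 0 < x₀) (s : ℝ) :
    (t * (x₀ / 2) * x₀) ^ (-α - s) = (x₀ ^ 2 / 2) ^ (-α - s) * t ^ (-α - s) := by
  rw [← Real.mul_rpow (by positivity) ht.le]
  ring_nf

/-- The decay w^(-α) of `besInt 0` cancels all but √t of the prefactor t^(α+1/2). Differentiating
`besInt 0` in x costs a factor t but gains a factor 1/w, so the Lipschitz constant has the same
order √t. -/
theorem exists_heatProfile_bounds {α x₀ : ℝ} (hα : 0 < α) (hx₀ : 0 < x₀) :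
    ∃ C, 0 < C ∧ ∀ t, 0 < t → ∀ x ∈ Icc (x₀ / 2) (3 * x₀ / 2),
      heatProfile α x₀ t x ≤ C * √t ∧
      ∀ x' ∈ Icc (x₀ / 2) (3 * x₀ / 2),
        |heatProfile α x₀ t x - heatProfile α x₀ t x'| ≤ C * √t * |x - x'| := by
  obtain ⟨C0, hC0, h0⟩ := exists_besInt_zero_le_rpow hα
  obtain ⟨C1, hC1, h1⟩ := exists_besInt_one_le_rpow hα
  have hN := heatNorm_pos hα
  set X := (2 * x₀) ^ (2 * α) with hX
  have hX0 : 0 < X := by positivity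
  set D0 := C0 * (x₀ ^ 2 / 2) ^ (-α - 0) with hD0
  set D1 := C1 * (x₀ ^ 2 / 2) ^ (-α - 1) with hD1
  have hD0' : 0 < D0 := by positivity
  have hD1' : 0 < D1 := by positivity
  have bX : ∀ x ∈ Icc (x₀ / 2) (3 * x₀ / 2), x ^ (2 * α) ≤ X := fun x hx =>
    Real.rpow_le_rpow (by linarith [hx.1]) (by linarith [hx.2]) (by linarith)
  have b0 : ∀ t, 0 < t → ∀ x ∈ Icc (x₀ / 2) (3 * x₀ / 2),
      besInt 0 α (t * x * x₀) ≤ D0 * t ^ (-α) := by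
    intro t ht x hx
    refine (besInt_antitone 0 hα (show t * (x₀ / 2) * x₀ ≤ t * x * x₀ by
      have := hx.1; gcongr)).trans ((h0 _ (by positivity)).trans (le_of_eq ?_))
    have := rpow_neg_mul_two_div (α := α) ht hx₀ 0
    simp only [sub_zero] at this
    rw [hD0, sub_zero, this]
    ring
  have b1 : ∀ t, 0 < t → ∀ x ∈ Icc (x₀ / 2) (3 * x₀ / 2),
      besInt 1 α (t * x * x₀) ≤ D1 * t ^ (-α - 1) := by
    intro t ht x hx
    refine (besInt_antitone 1 hα (show t * (x₀ / 2) * x₀ ≤ t * x * x₀ by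
      have := hx.1; gcongr)).trans ((h1 _ (by positivity)).trans (le_of_eq ?_))
    rw [hD1, rpow_neg_mul_two_div (α := α) ht hx₀ 1]
    ring
  have et : ∀ t : ℝ, 0 < t → t ^ (α + 1 / 2) * t ^ (-α) = √t := by
    intro t ht
    rw [← Real.rpow_add ht, Real.sqrt_eq_rpow]
    ring_nf
  have et1 : ∀ t : ℝ, 0 < t → t ^ (α + 1 / 2) * (t * t ^ (-α - 1)) = √t := by
    intro t ht
    rw [mul_comm t, ← Real.rpow_add_one ht.ne', ← et t ht]
    ring_nf
  set C := heatNorm α * (X * D0) + heatNorm α * (X * (4 * α / x₀) * D0 + 2 * x₀ * X * D1) with hC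
  have hCpos : 0 < C := by positivity
  refine ⟨C, hCpos, fun t ht x hx => ⟨?_, ?_⟩⟩
  · have hx0 : 0 ≤ x := by linarith [hx.1]
    have p0 := besInt_nonneg 0 α (t * x * x₀)
    calc heatProfile α x₀ t x
        ≤ heatNorm α * t ^ (α + 1 / 2) * X * (D0 * t ^ (-α)) := by
          unfold heatProfile
          have := bX x hx
          have := b0 t ht x hx
          gcongr
      _ = heatNorm α * (X * D0) * (t ^ (α + 1 / 2) * t ^ (-α)) := by ring
      _ = heatNorm α * (X * D0) * √t := by rw [et t ht]
      _ ≤ C * √t := by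
          gcongr
          rw [hC]
          have : 0 ≤ heatNorm α * (X * (4 * α / x₀) * D0 + 2 * x₀ * X * D1) := by positivity
          linarith
  · intro x' hx'
    have hderiv : ∀ s ∈ Icc (x₀ / 2) (3 * x₀ / 2), HasDerivWithinAt (heatProfile α x₀ t)
        (heatNorm α * t ^ (α + 1 / 2) * (2 * α * s ^ (2 * α - 1)) * besInt 0 α (t * s * x₀)
          + heatNorm α * t ^ (α + 1 / 2) * s ^ (2 * α) *
            (-2 * besInt 1 α (t * s * x₀) * (t * x₀))) (Icc (x₀ / 2) (3 * x₀ / 2)) s := by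
      intro s hs
      have hs0 : 0 < s := by linarith [hs.1]
      have d1 : HasDerivAt (fun x : ℝ => x ^ (2 * α)) (2 * α * s ^ (2 * α - 1)) s :=
        Real.hasDerivAt_rpow_const (Or.inl hs0.ne')
      have d2 : HasDerivAt (fun x : ℝ => t * x * x₀) (t * x₀) s := by
        simpa using ((hasDerivAt_id s).const_mul t).mul_const x₀
      have d3 : HasDerivAt (fun x => besInt 0 α (t * x * x₀))
        (-2 * besInt 1 α (t * s * x₀) * (t * x₀)) s := (hasDerivAt_besInt 0 hα _).comp s d2
      exact ((d1.const_mul (heatNorm α * t ^ (α + 1 / 2))).fun_mul d3).hasDerivWithinAt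
    refine (convex_Icc _ _).norm_image_sub_le_of_norm_hasDerivWithin_le hderiv ?_ hx' hx
    intro s hs
    have hs0 : 0 < s := by linarith [hs.1]
    have p0 := besInt_nonneg 0 α (t * s * x₀)
    have p1 := besInt_nonneg 1 α (t * s * x₀)
    have hT : 0 < t ^ (α + 1 / 2) := by positivity
    have e1 : s ^ (2 * α - 1) ≤ X * (2 / x₀) := by
      rw [Real.rpow_sub_one hs0.ne', div_eq_mul_inv]
      have h3 : s⁻¹ ≤ 2 / x₀ := by
        rw [inv_le_comm₀ hs0 (by positivity), inv_div]
        exact hs.1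
      exact mul_le_mul (bX s hs) h3 (by positivity) hX0.le
    have e2 : heatNorm α * t ^ (α + 1 / 2) * (2 * α * s ^ (2 * α - 1)) * besInt 0 α (t * s * x₀)
        ≤ heatNorm α * (X * (4 * α / x₀) * D0) * √t := by
      calc _ ≤ heatNorm α * t ^ (α + 1 / 2) * (2 * α * (X * (2 / x₀))) * (D0 * t ^ (-α)) := by
            have := b0 t ht s hs
            gcongr
        _ = heatNorm α * (X * (4 * α / x₀) * D0) * (t ^ (α + 1 / 2) * t ^ (-α)) := by ring
        _ = _ := by rw [et t ht]
    have e3 : heatNorm α * t ^ (α + 1 / 2) * s ^ (2 * α) * (2 * besInt 1 α (t * s * x₀) * (t * x₀))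
        ≤ heatNorm α * (2 * x₀ * X * D1) * √t := by
      calc _ ≤ heatNorm α * t ^ (α + 1 / 2) * X * (2 * (D1 * t ^ (-α - 1)) * (t * x₀)) := by
            have := b1 t ht s hs
            have := bX s hs
            gcongr
        _ = heatNorm α * (2 * x₀ * X * D1) * (t ^ (α + 1 / 2) * (t * t ^ (-α - 1))) := by ring
        _ = _ := by rw [et1 t ht]
    have q2 : 0 ≤ heatNorm α * t ^ (α + 1 / 2) * (2 * α * s ^ (2 * α - 1)) *
      besInt 0 α (t * s * x₀) := by positivity
    have q3 : 0 ≤ heatNorm α * t ^ (α + 1 / 2) * s ^ (2 * α) *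
      (2 * besInt 1 α (t * s * x₀) * (t * x₀)) := by positivity
    have q4 : 0 ≤ heatNorm α * (X * D0) * √t := by positivity
    rw [Real.norm_eq_abs, abs_le, hC]
    constructor <;> linarith

/-- For large t the decay of `besInt 1` gives t^(-3/2). The weaker exponent -5/4 covers small t too,
and after multiplication by a profile of order √t it leaves t^(-3/4), which is integrable at 0,
whereas -3/2 would leave 1/t. -/
theorem exists_besInt_one_profile_bound {α x₀ : ℝ} (hα : 0 < α) (hx₀ : 0 < x₀) :
    ∃ C, 0 < C ∧ ∀ t, 0 < t → ∀ x ∈ Icc (x₀ / 2) (3 * x₀ / 2),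
      heatNorm α * t ^ (α - 1 / 2) * x ^ (2 * α) * besInt 1 α (t * x * x₀)
        ≤ C * t ^ (-(5 / 4) : ℝ) := by
  obtain ⟨C1, hC1, h1⟩ := exists_besInt_one_le_rpow hα
  have hN := heatNorm_pos hα
  have hm := besInt_zero_zero_pos hα
  set X := (2 * x₀) ^ (2 * α) with hX
  have hX0 : 0 < X := by positivity
  set D1 := C1 * (x₀ ^ 2 / 2) ^ (-α - 1) + 2 * besInt 0 α 0 with hD1
  have hD1' : 0 < D1 := by positivity
  refine ⟨heatNorm α * X * D1, by positivity, fun t ht x hx => ?_⟩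
  have hx0 : 0 < x := by linarith [hx.1]
  have bX : x ^ (2 * α) ≤ X :=
    Real.rpow_le_rpow (by linarith [hx.1]) (by linarith [hx.2]) (by linarith)
  have p1 := besInt_nonneg 1 α (t * x * x₀)
  have b1 : besInt 1 α (t * x * x₀) ≤ D1 * t ^ (-α - 3 / 4) := by
    rcases le_total t 1 with h | h
    · have h2 : besInt 1 α (t * x * x₀) ≤ 2 * besInt 0 α 0 := besInt_one_le hα (by positivity)
      have h3 : 1 ≤ t ^ (-α - 3 / 4) :=
        Real.one_le_rpow_of_pos_of_le_one_of_nonpos ht h (by linarith)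
      have h4 : 2 * besInt 0 α 0 ≤ D1 := by
        rw [hD1]
        have : 0 < C1 * (x₀ ^ 2 / 2) ^ (-α - 1) := by positivity
        linarith
      calc _ ≤ D1 * 1 := by linarith
        _ ≤ _ := by gcongr
    · have h2 : besInt 1 α (t * x * x₀) ≤ C1 * (x₀ ^ 2 / 2) ^ (-α - 1) * t ^ (-α - 1) := by
        refine (besInt_antitone 1 hα (show t * (x₀ / 2) * x₀ ≤ t * x * x₀ by
          have := hx.1; gcongr)).trans ((h1 _ (by positivity)).trans (le_of_eq ?_))
        rw [rpow_neg_mul_two_div (α := α) ht hx₀ 1]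
        ring
      have h3 : t ^ (-α - 1) ≤ t ^ (-α - 3 / 4) :=
        Real.rpow_le_rpow_of_exponent_le h (by linarith)
      refine h2.trans (mul_le_mul ?_ h3 (by positivity) hD1'.le)
      rw [hD1]
      linarith
  calc _ ≤ heatNorm α * t ^ (α - 1 / 2) * X * (D1 * t ^ (-α - 3 / 4)) := by gcongr
    _ = heatNorm α * X * D1 * (t ^ (α - 1 / 2) * t ^ (-α - 3 / 4)) := by ring
    _ = _ := by
      rw [← Real.rpow_add ht]
      ring_nf

theorem integral_id_mul_gaussian_le {t c : ℝ} (ht : 0 < t) :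
    ∫ r in (0 : ℝ)..c, r * Real.exp (-t * r ^ 2) ≤ 1 / (2 * t) := by
  have hd : ∀ r : ℝ, HasDerivAt (fun r => -Real.exp (-t * r ^ 2) / (2 * t))
      (r * Real.exp (-t * r ^ 2)) r := by
    intro r
    have := ((((hasDerivAt_pow 2 r).const_mul (-t)).exp).neg).div_const (2 * t)
    refine this.congr_deriv ?_
    field_simp
    simp [mul_comm]
  rw [intervalIntegral.integral_eq_sub_of_hasDerivAt (fun r _ => hd r)
    (Continuous.intervalIntegrable (by fun_prop) _ _)]
  have : 0 < Real.exp (-t * c ^ 2) := Real.exp_pos _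
  simp only [ne_eq, OfNat.ofNat_ne_zero, not_false_eq_true, zero_pow, mul_zero, Real.exp_zero]
  rw [← sub_nonneg]
  have e : 1 / (2 * t) - (-Real.exp (-t * c ^ 2) / (2 * t) - -1 / (2 * t))
    = Real.exp (-t * c ^ 2) / (2 * t) := by ring
  rw [e]
  positivity

/-- Half of the mass of the heat kernel lies on either side of the pole, in the limit. -/
theorem tendsto_heatCDF_self {α x₀ : ℝ} (hα : 0 < α) (hx₀ : 0 < x₀) :
    Tendsto (fun t => heatCDF α x₀ t x₀) atTop (𝓝 (1 / 2)) := by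
  obtain ⟨C, hC, hb⟩ := exists_heatProfile_bounds hα hx₀
  have hcont : ∀ t, Continuous (heatProfile α x₀ t) := fun t => by
    have := continuous_besInt 0 hα
    have : Continuous fun x : ℝ => x ^ (2 * α) := Real.continuous_rpow_const (by linarith)
    unfold heatProfile
    fun_prop
  -- The masses of [x₀/2, x₀] and [x₀, 3x₀/2] are compared by reflection in x₀. The Gaussian is
  -- symmetric and the profile Lipschitz, so they differ by at most a constant times √t ∫ r exp(-t
  -- r²) dr.
  have key : ∀ t, 0 < t →
      |2 * heatCDF α x₀ t x₀ - heatCDF α x₀ t (x₀ / 2) - heatCDF α x₀ t (3 * x₀ / 2)|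
        ≤ C * (√t / t) := by
    intro t ht
    have e1 : heatCDF α x₀ t x₀ - heatCDF α x₀ t (x₀ / 2)
        = ∫ r in (0 : ℝ)..x₀ / 2, heatProfile α x₀ t (x₀ - r) * Real.exp (-t * r ^ 2) := by
      rw [heatCDF, heatCDF, intervalIntegral.integral_interval_sub_left
        (heatCDF_integrable hα _ _ _ _) (heatCDF_integrable hα _ _ _ _)]
      have := intervalIntegral.integral_comp_sub_left (a := 0) (b := x₀ / 2)
        (fun s => s ^ (2 * α) * besselHeat α x₀ t s) x₀
      rw [sub_zero, show x₀ - x₀ / 2 = x₀ / 2 by ring] at this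
      rw [← this]
      refine intervalIntegral.integral_congr fun r _ => ?_
      rw [rpow_mul_besselHeat]
      ring_nf
    have e2 : heatCDF α x₀ t (3 * x₀ / 2) - heatCDF α x₀ t x₀
        = ∫ r in (0 : ℝ)..x₀ / 2, heatProfile α x₀ t (x₀ + r) * Real.exp (-t * r ^ 2) := by
      rw [heatCDF, heatCDF, intervalIntegral.integral_interval_sub_left
        (heatCDF_integrable hα _ _ _ _) (heatCDF_integrable hα _ _ _ _)]
      have := intervalIntegral.integral_comp_add_left (a := 0) (b := x₀ / 2)
        (fun s => s ^ (2 * α) * besselHeat α x₀ t s) x₀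
      rw [add_zero, show x₀ + x₀ / 2 = 3 * x₀ / 2 by ring] at this
      rw [← this]
      refine intervalIntegral.integral_congr fun r _ => ?_
      rw [rpow_mul_besselHeat]
      ring_nf
    have c1 : Continuous fun r => heatProfile α x₀ t (x₀ - r) * Real.exp (-t * r ^ 2) :=
      ((hcont t).comp (by fun_prop)).mul (by fun_prop)
    have c2 : Continuous fun r => heatProfile α x₀ t (x₀ + r) * Real.exp (-t * r ^ 2) :=
      ((hcont t).comp (by fun_prop)).mul (by fun_prop)
    have e3 : 2 * heatCDF α x₀ t x₀ - heatCDF α x₀ t (x₀ / 2) - heatCDF α x₀ t (3 * x₀ / 2)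
        = ∫ r in (0 : ℝ)..x₀ / 2, (heatProfile α x₀ t (x₀ - r) * Real.exp (-t * r ^ 2)
          - heatProfile α x₀ t (x₀ + r) * Real.exp (-t * r ^ 2)) := by
      rw [intervalIntegral.integral_sub (c1.intervalIntegrable _ _) (c2.intervalIntegrable _ _),
        ← e1, ← e2]
      ring
    rw [e3]
    have hx2 : 0 ≤ x₀ / 2 := by linarith
    have h4 : |∫ r in (0 : ℝ)..x₀ / 2, (heatProfile α x₀ t (x₀ - r) * Real.exp (-t * r ^ 2)
          - heatProfile α x₀ t (x₀ + r) * Real.exp (-t * r ^ 2))|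
        ≤ ∫ r in (0 : ℝ)..x₀ / 2, (2 * C * √t) * (r * Real.exp (-t * r ^ 2)) := by
      rw [← Real.norm_eq_abs]
      refine intervalIntegral.norm_integral_le_of_norm_le hx2
        (Eventually.of_forall fun r hr => ?_) (Continuous.intervalIntegrable (by fun_prop) _ _)
      have := (hb t ht (x₀ - r) ⟨by linarith [hr.2], by linarith [hr.1]⟩).2 (x₀ + r)
        ⟨by linarith [hr.1], by linarith [hr.2]⟩
      rw [show x₀ - r - (x₀ + r) = -(2 * r) by ring, abs_neg,
        abs_of_nonneg (show 0 ≤ 2 * r by linarith [hr.1])] at this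
      rw [← sub_mul, Real.norm_eq_abs, abs_mul, Real.abs_exp]
      calc _ ≤ C * √t * (2 * r) * Real.exp (-t * r ^ 2) := by gcongr
        _ = _ := by ring
    refine h4.trans ?_
    rw [intervalIntegral.integral_const_mul]
    calc 2 * C * √t * ∫ r in (0 : ℝ)..x₀ / 2, r * Real.exp (-t * r ^ 2)
        ≤ 2 * C * √t * (1 / (2 * t)) := by gcongr; exact integral_id_mul_gaussian_le ht
      _ = C * (√t / t) := by field_simp
  have hlim : Tendsto (fun t : ℝ => C * (√t / t)) atTop (𝓝 0) := by
    have h1 : Tendsto (fun t : ℝ => t ^ (-(1 / 2) : ℝ)) atTop (𝓝 0) :=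
      tendsto_rpow_neg_atTop (by norm_num)
    have h2 := h1.const_mul C
    rw [mul_zero] at h2
    refine h2.congr' ?_
    filter_upwards [eventually_gt_atTop 0] with t ht
    rw [Real.sqrt_eq_rpow, ← Real.rpow_sub_one ht.ne']
    norm_num
  have h1 : Tendsto (fun t => 2 * heatCDF α x₀ t x₀ - heatCDF α x₀ t (x₀ / 2)
      - heatCDF α x₀ t (3 * x₀ / 2)) atTop (𝓝 0) := by
    refine squeeze_zero_norm' ?_ hlim
    filter_upwards [eventually_gt_atTop 0] with t ht using key t ht
  have h2 := tendsto_heatCDF_atTop_of_lt hα (x := x₀ / 2) (by linarith) (by linarith : _ < x₀)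
  have h3 := tendsto_heatCDF_atTop_of_gt hα hx₀.le (x := 3 * x₀ / 2) (by linarith)
  have h4 := ((h1.add h2).add h3).const_mul (1 / 2)
  simp only [zero_add, mul_one] at h4
  refine h4.congr fun t => ?_
  ring

/-- The density near the pole is at most C√t, so moving the end point by o(t^(-1/2)) does not affect
the limit. -/
theorem tendsto_heatCDF_half {ι : Type*} {l : Filter ι} {α x₀ : ℝ} (hα : 0 < α) (hx₀ : 0 < x₀)
    {t x : ι → ℝ} (ht : Tendsto t l atTop) (hx : Tendsto x l (𝓝 x₀))
    (htx : Tendsto (fun i => √(t i) * (x i - x₀)) l (𝓝 0)) :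
    Tendsto (fun i => heatCDF α x₀ (t i) (x i)) l (𝓝 (1 / 2)) := by
  obtain ⟨C, hC, hb⟩ := exists_heatProfile_bounds hα hx₀
  have h0 := (tendsto_heatCDF_self hα hx₀).comp ht
  have h1 : Tendsto (fun i => heatCDF α x₀ (t i) (x i) - heatCDF α x₀ (t i) x₀) l (𝓝 0) := by
    have h2 := htx.abs.const_mul C
    rw [abs_zero, mul_zero] at h2
    refine squeeze_zero_norm' ?_ h2
    filter_upwards [ht.eventually_gt_atTop 0, hx.eventually_mem
      (Icc_mem_nhds (show x₀ / 2 < x₀ by linarith) (show x₀ < 3 * x₀ / 2 by linarith))]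
      with i hti hxi
    have := (convex_Icc (x₀ / 2) (3 * x₀ / 2)).norm_image_sub_le_of_norm_hasDerivWithin_le
      (f := heatCDF α x₀ (t i)) (C := C * √(t i))
      (fun s _ => (hasDerivAt_heatCDF hα x₀ (t i) s).hasDerivWithinAt) (fun s hs => ?_)
      (show x₀ ∈ Icc (x₀ / 2) (3 * x₀ / 2) from ⟨by linarith, by linarith⟩) hxi
    · refine this.trans (le_of_eq ?_)
      rw [abs_mul, abs_of_nonneg (Real.sqrt_nonneg _), Real.norm_eq_abs]
      ring
    · rw [rpow_mul_besselHeat, Real.norm_eq_abs, abs_of_nonneg (mul_nonneg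
        (heatProfile_nonneg hα hti.le (by linarith [hs.1]) _) (Real.exp_pos _).le)]
      refine (mul_le_of_le_one_right (heatProfile_nonneg hα hti.le (by linarith [hs.1]) _)
        ?_).trans (hb _ hti s hs).1
      rw [Real.exp_le_one_iff]
      nlinarith [sq_nonneg (s - x₀)]
  have h3 := h1.add h0
  rw [zero_add] at h3
  refine h3.congr fun i => ?_
  simp

/-- The stream function with pole `(0, y₀)` tends to `1/2` along curves that reach the pole
perpendicularly to the axis `x = 0`. -/
theorem tendsto_heatStream_half {α β y₀ : ℝ} (hα : 0 < α) (hβ : 0 < β) (hy₀ : 0 < y₀)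
    {l : Filter ℝ} [l.IsCountablyGenerated] {x y : ℝ → ℝ} (hx : Tendsto x l (𝓝[>] 0))
    (hy : Tendsto y l (𝓝 y₀)) (hxy : Tendsto (fun s => (y s - y₀) / x s) l (𝓝 0)) :
    Tendsto (fun s => heatStream α β 0 y₀ (x s) (y s)) l (𝓝 (1 / 2)) := by
  have hx0 : ∀ᶠ s in l, 0 < x s := hx.eventually self_mem_nhdsWithin
  set K := heatNorm α / 2 * besInt 0 α 0 with hK
  -- With pole at 0 in the first variable, the flux expressed in w = t x² is a Gamma probability
  -- density that does not depend on x.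
  have hmass : ∫ w in Ioi (0 : ℝ), K * (w ^ (α - 1 / 2) * Real.exp (-1 * w)) = 1 := by
    rw [integral_const_mul]
    have := Real.integral_rpow_mul_exp_neg_mul_Ioi (a := α + 1 / 2) (by linarith) one_pos
    simp only [one_mul, one_div, inv_one, Real.one_rpow] at this
    have e : ∀ w : ℝ, w ^ (α - 1 / 2) * Real.exp (-1 * w)
        = w ^ (α + 2⁻¹ - 1) * Real.exp (-w) := by
      intro w; ring_nf
    simp only [e]
    rw [this, hK, besInt_zero_zero hα, heatNorm]
    have := Real.Gamma_pos_of_pos hα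
    have := Real.Gamma_pos_of_pos (show 0 < α + 1 / 2 by linarith)
    have := Real.pi_pos
    rw [show α + 2⁻¹ = α + 1 / 2 by norm_num]
    field_simp
  -- The substitution w = t x² freezes the flux and moves all dependence on s into the distribution
  -- function at t = w/x².
  have hscale : ∀ᶠ s in l, ∫ w in Ioi (0 : ℝ), K * (w ^ (α - 1 / 2) * Real.exp (-1 * w)) *
      heatCDF β y₀ (w / x s ^ 2) (y s) = heatStream α β 0 y₀ (x s) (y s) := by
    filter_upwards [hx0] with s hs
    have h2 : 0 < (x s ^ 2)⁻¹ := by positivity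
    have := integral_comp_mul_left_Ioi
      (fun t => heatFlux α 0 t (x s) * heatCDF β y₀ t (y s)) 0 h2
    rw [mul_zero, inv_inv, smul_eq_mul] at this
    rw [← inv_mul_cancel_left₀ (pow_pos hs 2).ne' (heatStream α β 0 y₀ (x s) (y s)), heatStream,
      ← this, ← integral_const_mul]
    refine setIntegral_congr_fun measurableSet_Ioi fun w hw => ?_
    have hw : 0 < w := hw
    rw [div_eq_inv_mul w, heatFlux, ← mul_assoc (x s ^ 2)⁻¹]
    congr 1
    simp only [sub_zero, mul_zero, zero_mul, add_zero]
    have hx2 : ((x s) ^ 2)⁻¹ = (x s) ^ (-2 : ℝ) := by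
      rw [Real.rpow_neg hs.le, Real.rpow_two]
    rw [Real.mul_rpow h2.le hw.le, hK]
    have e1 : -((x s ^ 2)⁻¹ * w) * x s ^ 2 = -1 * w := by field_simp
    have e2 : ((x s ^ 2)⁻¹) ^ (α - 1 / 2) = x s / (x s) ^ (2 * α) := by
      rw [hx2, ← Real.rpow_mul hs.le, show -2 * (α - 1 / 2) = 1 - 2 * α by ring, Real.rpow_sub hs,
        Real.rpow_one]
    have : x s ^ (2 * α) ≠ 0 := (Real.rpow_pos_of_pos hs _).ne'
    rw [e1, e2]
    field_simp
  have hdom : Tendsto (fun s => ∫ w in Ioi (0 : ℝ), K * (w ^ (α - 1 / 2) * Real.exp (-1 * w)) *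
      heatCDF β y₀ (w / x s ^ 2) (y s)) l
      (𝓝 (∫ w in Ioi (0 : ℝ), K * (w ^ (α - 1 / 2) * Real.exp (-1 * w)) * (1 / 2))) := by
    have hy0 : ∀ᶠ s in l, 0 < y s := hy.eventually (lt_mem_nhds hy₀)
    have hg : ContinuousOn (fun w : ℝ => K * (w ^ (α - 1 / 2) * Real.exp (-1 * w))) (Ioi 0) :=
      continuousOn_const.mul ((continuousOn_id.rpow_const fun w hw => Or.inl (ne_of_gt hw)).mul
        (by fun_prop))
    have hK0 : 0 ≤ K := by
      have := heatNorm_pos hα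
      have := besInt_zero_zero_pos hα
      positivity
    refine tendsto_integral_filter_of_dominated_convergence
      (fun w => K * (w ^ (α - 1 / 2) * Real.exp (-1 * w))) ?_ ?_ ?_ ?_
    · filter_upwards [hx0, hy0] with s hs hys
      have hm : MapsTo (fun w : ℝ => w / x s ^ 2) (Ioi 0) (Ioi 0) := fun w hw =>
        mem_Ioi.2 (div_pos (mem_Ioi.1 hw) (pow_pos hs 2))
      exact (hg.mul ((continuousOn_heatCDF_left hβ hys.le y₀).comp (by fun_prop)
        hm)).aestronglyMeasurable measurableSet_Ioi
    · filter_upwards [hx0, hy0] with s hs hys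
      filter_upwards [ae_restrict_mem measurableSet_Ioi] with w hw
      have hw : 0 < w := hw
      have hw2 : 0 < w / x s ^ 2 := by positivity
      have h1 := heatCDF_nonneg hβ hw2 hys.le y₀
      rw [Real.norm_eq_abs, abs_of_nonneg (by positivity)]
      exact mul_le_of_le_one_right (by positivity) (heatCDF_le_one hβ hw2 hys.le y₀)
    · exact (integrableOn_rpow_mul_exp (by linarith) one_pos).const_mul _
    · filter_upwards [ae_restrict_mem measurableSet_Ioi] with w hw
      have hw : 0 < w := hw
      refine Tendsto.const_mul _ (tendsto_heatCDF_half hβ hy₀ ?_ hy ?_)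
      · have h1 : Tendsto (fun s => (x s)⁻¹) l atTop := tendsto_inv_nhdsGT_zero.comp hx
        have h2 := ((tendsto_pow_atTop two_ne_zero).comp h1).const_mul_atTop hw
        refine h2.congr fun s => ?_
        simp only [Function.comp]
        rw [inv_pow, div_eq_mul_inv]
      -- Here √t (y - y₀) = √w (y - y₀)/x, and the perpendicular approach makes it tend to 0 for
      -- every fixed w.
      · have h2 := hxy.const_mul (√w)
        rw [mul_zero] at h2
        refine h2.congr' ?_
        filter_upwards [hx0] with s hs
        rw [Real.sqrt_div hw.le, Real.sqrt_sq hs.le]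
        ring
  rw [integral_mul_const, hmass, one_mul] at hdom
  exact hdom.congr' hscale

/-! ### The double series and its continuation -/

theorem hasSum_one_sub_rpow_neg (a : ℝ) {z : ℝ} (hz : |z| < 1) :
    HasSum (fun n : ℕ => (ascPochhammer ℝ n).eval a / n.factorial * z ^ n) ((1 - z) ^ (-a)) := by
  have h := (Real.one_div_one_sub_rpow_hasFPowerSeriesOnBall_zero a).hasSum (y := z)
    (by simpa [enorm_eq_nnnorm, ← NNReal.coe_lt_coe] using hz)
  rw [zero_add, one_div, ← Real.rpow_neg (by linarith [(abs_lt.1 hz).2])] at h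
  refine h.congr_fun fun n => ?_
  rw [FormalMultilinearSeries.ofScalars_apply_eq, ← Ring.multichoose_eq, smul_eq_mul]
  congr 1
  rw [div_eq_iff (by positivity), ← Polynomial.ascPochhammer_smeval_eq_eval,
    ← Ring.factorial_nsmul_multichoose_eq_ascPochhammer]
  simp [mul_comm]

/-- The coefficients of the double binomial series. -/
noncomputable def binomTerm (a X Y : ℝ) (p : ℕ × ℕ) : ℝ :=
  (ascPochhammer ℝ (p.1 + p.2)).eval a / (p.1.factorial * p.2.factorial) * X ^ p.1 * Y ^ p.2

theorem sum_antidiagonal_binomTerm (a X Y : ℝ) (n : ℕ) :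
    ∑ p ∈ Finset.HasAntidiagonal.antidiagonal n, binomTerm a X Y p
      = (ascPochhammer ℝ n).eval a / n.factorial * (X + Y) ^ n := by
  rw [add_pow, Finset.mul_sum, Finset.Nat.sum_antidiagonal_eq_sum_range_succ_mk]
  refine Finset.sum_congr rfl fun k hk => ?_
  have hk : k ≤ n := Nat.lt_succ_iff.1 (Finset.mem_range.1 hk)
  simp only [binomTerm]
  rw [Nat.add_sub_of_le hk, Nat.cast_choose ℝ hk]
  field_simp

theorem ascPochhammer_eval_nonneg {a : ℝ} (ha : 0 ≤ a) (n : ℕ) :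
    0 ≤ (ascPochhammer ℝ n).eval a := by
  induction n with
  | zero => simp
  | succ n ih =>
    rw [ascPochhammer_succ_eval]
    positivity

/-- The terms are nonnegative and can be grouped by antidiagonals, where the binomial theorem leaves
the one-variable series at |X| + |Y| < 1. -/
theorem summable_binomTerm_abs {a X Y : ℝ} (ha : 0 ≤ a) (h : |X| + |Y| < 1) :
    Summable (fun p : ℕ × ℕ => binomTerm a |X| |Y| p) := by
  rw [← Finset.HasAntidiagonal.sigmaAntidiagonalEquivProd.summable_iff]
  have hnn : ∀ p, 0 ≤ binomTerm a |X| |Y| p := fun p => by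
    have := ascPochhammer_eval_nonneg ha (p.1 + p.2)
    unfold binomTerm
    positivity
  refine (summable_sigma_of_nonneg fun p => hnn _).2 ?_
  refine ⟨fun n => (hasSum_fintype _).summable, ?_⟩
  have hs := (hasSum_one_sub_rpow_neg a (z := |X| + |Y|)
    (by rwa [abs_of_nonneg (by positivity)])).summable
  refine hs.congr fun n => ?_
  rw [tsum_fintype, ← sum_antidiagonal_binomTerm]
  exact (Finset.sum_coe_sort (Finset.HasAntidiagonal.antidiagonal n) (fun p => binomTerm a |X| |Y| p)).symm

theorem abs_binomTerm {a : ℝ} (ha : 0 ≤ a) (X Y : ℝ) (p : ℕ × ℕ) :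
    |binomTerm a X Y p| = binomTerm a |X| |Y| p := by
  have := ascPochhammer_eval_nonneg ha (p.1 + p.2)
  rw [binomTerm, binomTerm, abs_mul, abs_mul, abs_pow, abs_pow, abs_of_nonneg
    (show 0 ≤ Polynomial.eval a (ascPochhammer ℝ (p.1 + p.2)) /
      (p.1.factorial * p.2.factorial) by positivity)]

theorem hasSum_binomTerm {a X Y : ℝ} (ha : 0 ≤ a) (h : |X| + |Y| < 1) :
    HasSum (binomTerm a X Y) ((1 - (X + Y)) ^ (-a)) := by
  have hs : Summable (binomTerm a X Y) := by
    refine Summable.of_norm ?_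
    simp only [Real.norm_eq_abs, abs_binomTerm ha]
    exact summable_binomTerm_abs ha h
  rw [← Finset.HasAntidiagonal.sigmaAntidiagonalEquivProd.hasSum_iff]
  refine HasSum.sigma_of_hasSum (hasSum_one_sub_rpow_neg a
    ((abs_add_le X Y).trans_lt h)) (fun n => ?_)
    (Finset.HasAntidiagonal.sigmaAntidiagonalEquivProd.summable_iff.2 hs)
  rw [← sum_antidiagonal_binomTerm, ← Finset.sum_coe_sort (Finset.HasAntidiagonal.antidiagonal n)
    (binomTerm a X Y)]
  exact hasSum_fintype _

/-- `∫ (1 + t c)^(-a)` is analytic in `t` when `0 ≤ c ≤ K`. -/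
theorem analyticOnNhd_integral_one_add_mul_rpow {Ω : Type*} [MeasurableSpace Ω] (M : Measure Ω)
    [IsFiniteMeasure M] {c : Ω → ℝ} (hc : Measurable c) {K a : ℝ} (hK : 0 ≤ K) (ha : 0 < a)
    (h0 : ∀ ω, 0 ≤ c ω) (h1 : ∀ ω, c ω ≤ K) :
    AnalyticOnNhd ℝ (fun t : ℝ => ∫ ω, (1 + t * c ω) ^ (-a) ∂M) (Icc 0 1) := by
  -- A half-plane containing [0, 1] on which Re(1 + z c) ≥ 1 - K/(K + 1) = δ > 0 for all c in [0,
  -- K]. The power stays off its branch cut and is uniformly bounded, so the integral is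
  -- holomorphic, and analyticity in real t follows by restriction.
  set U : Set ℂ := {z | -(1 / (K + 1)) < z.re} with hU
  have hUo : IsOpen U := isOpen_lt continuous_const Complex.continuous_re
  set δ : ℝ := 1 / (K + 1) with hδ
  have hδ0 : 0 < δ := by positivity
  have hδ1 : 1 - K * δ = δ := by rw [hδ]; field_simp; ring_nf
  have hre : ∀ z ∈ U, ∀ ω, δ ≤ (1 + z * (c ω : ℂ)).re := by
    intro z hz ω
    simp only [hU, mem_ofPred_eq] at hz
    simp only [Complex.add_re, Complex.one_re, Complex.mul_re, Complex.ofReal_re,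
      Complex.ofReal_im, mul_zero, sub_zero]
    have := h0 ω
    have := h1 ω
    nlinarith
  have hslit : ∀ z ∈ U, ∀ ω, (1 + z * (c ω : ℂ)) ∈ Complex.slitPlane := fun z hz ω =>
    Or.inl (hδ0.trans_le (hre z hz ω))
  have hnorm : ∀ z ∈ U, ∀ ω, δ ≤ ‖1 + z * (c ω : ℂ)‖ := fun z hz ω =>
    (hre z hz ω).trans (Complex.re_le_norm _)
  set F : ℂ → ℂ := fun z => ∫ ω, (1 + z * (c ω : ℂ)) ^ ((-a : ℝ) : ℂ) ∂M with hF
  have hmeas : ∀ z : ℂ, ∀ s : ℂ, AEStronglyMeasurable (fun ω => (1 + z * (c ω : ℂ)) ^ s) M :=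
    fun z s => by
      have : Measurable (fun ω => (1 + z * (c ω : ℂ)) ^ s) := by fun_prop
      exact this.aestronglyMeasurable
  have hbd : ∀ r : ℝ, r ≤ 0 → ∀ z ∈ U, ∀ ω,
      ‖(1 + z * (c ω : ℂ)) ^ ((r : ℝ) : ℂ)‖ ≤ δ ^ r := by
    intro r hr z hz ω
    rw [Complex.norm_cpow_real]
    exact Real.rpow_le_rpow_of_nonpos hδ0 (hnorm z hz ω) hr
  have hdiff : DifferentiableOn ℂ F U := by
    intro z hz
    refine DifferentiableAt.differentiableWithinAt ?_
    have := (hasDerivAt_integral_of_dominated_loc_of_deriv_le (μ := M) (𝕜 := ℂ)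
      (F := fun z ω => (1 + z * (c ω : ℂ)) ^ ((-a : ℝ) : ℂ))
      (F' := fun z ω => ((-a : ℝ) : ℂ) * (1 + z * (c ω : ℂ)) ^ (((-a : ℝ) : ℂ) - 1) * (c ω : ℂ))
      (x₀ := z) (s := U) (bound := fun _ => a * δ ^ (-a - 1) * K)
      (hUo.mem_nhds hz) (Eventually.of_forall fun z => hmeas z _) ?_ ?_ ?_ (integrable_const _)
      ?_).2
    · exact this.differentiableAt
    · exact Integrable.mono' (integrable_const (δ ^ (-a))) (hmeas z _)
        (Eventually.of_forall fun ω => hbd _ (by linarith) z hz ω)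
    · have : Measurable (fun ω => (c ω : ℂ)) := by fun_prop
      exact ((hmeas z _).const_mul _).mul this.aestronglyMeasurable
    · refine Eventually.of_forall fun ω z hz => ?_
      rw [norm_mul, norm_mul, Complex.norm_real, Complex.norm_real, Real.norm_eq_abs,
        Real.norm_eq_abs, abs_neg, abs_of_pos ha, abs_of_nonneg (h0 ω)]
      have h2 := hbd (-a - 1) (by linarith) z hz ω
      rw [show (((-a - 1 : ℝ)) : ℂ) = ((-a : ℝ) : ℂ) - 1 by push_cast; ring] at h2
      have := h1 ω
      have := h0 ω
      gcongr
    · refine Eventually.of_forall fun ω z hz => ?_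
      have h2 : HasDerivAt (fun z : ℂ => 1 + z * (c ω : ℂ)) (c ω : ℂ) z := by
        simpa using ((hasDerivAt_id z).mul_const (c ω : ℂ)).const_add 1
      exact h2.cpow_const (hslit z hz ω)
  intro t ht
  have htU : (t : ℂ) ∈ U := by
    simp only [hU, mem_ofPred_eq, Complex.ofReal_re]
    have := ht.1
    linarith
  have hFa : AnalyticAt ℝ F (t : ℂ) := (hdiff.analyticAt (hUo.mem_nhds htU)).restrictScalars
  have h3 : AnalyticAt ℝ (fun s : ℝ => (F (s : ℂ)).re) t :=
    (Complex.reCLM.analyticAt _).comp (hFa.comp (Complex.ofRealCLM.analyticAt t))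
  refine h3.congr ?_
  have hev : ∀ᶠ s : ℝ in 𝓝 t, (s : ℂ) ∈ U :=
    Complex.continuous_ofReal.continuousAt.eventually (hUo.mem_nhds htU)
  filter_upwards [hev] with s hs
  have e : ∀ ω, (1 + (s : ℂ) * (c ω : ℂ)) ^ ((-a : ℝ) : ℂ) = (((1 + s * c ω) ^ (-a) : ℝ) : ℂ) := by
    intro ω
    have h4 := hre _ hs ω
    simp only [Complex.add_re, Complex.one_re, Complex.mul_re, Complex.ofReal_re,
      Complex.ofReal_im, mul_zero, sub_zero] at h4
    rw [Complex.ofReal_cpow (by linarith)]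
    push_cast
    ring_nf
  simp only [hF, e]
  rw [integral_complex_ofReal, Complex.ofReal_re]

/-- The moments of `(1 - cos φ)/2`. -/
theorem integral_half_one_sub_cos_pow {α : ℝ} (hα : 0 < α) (m : ℕ) :
    ∫ φ, ((1 - Real.cos φ) / 2) ^ m ∂angMeasure α
      = besInt 0 α 0 * ((ascPochhammer ℝ m).eval α / (ascPochhammer ℝ m).eval (2 * α)) := by
  induction m with
  | zero => simp [besInt]
  | succ m ih =>
    have h := integral_half_one_sub_cos_pow_succ hα m
    rw [ih] at h
    have h1 : (ascPochhammer ℝ m).eval (2 * α) ≠ 0 := (ascPochhammer_pos m _ (by linarith)).ne'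
    have h2 : 2 * α + m ≠ 0 := by positivity
    rw [ascPochhammer_succ_eval, ascPochhammer_succ_eval]
    field_simp at h ⊢
    linarith

theorem appellF2Term_eq_binomTerm (a b₁ b₂ c₁ c₂ X Y : ℝ) (p : ℕ × ℕ) :
    appellF2Term a b₁ b₂ c₁ c₂ X Y p = binomTerm a X Y p *
      ((ascPochhammer ℝ p.1).eval b₁ / (ascPochhammer ℝ p.1).eval c₁ *
        ((ascPochhammer ℝ p.2).eval b₂ / (ascPochhammer ℝ p.2).eval c₂)) := by
  rw [appellF2Term, binomTerm]
  simp only [div_eq_mul_inv, mul_inv]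
  ring

/-- Euler's double integral for the Appell function. -/
theorem appellF2_eq_integral {α β ξ η : ℝ} (hα : 0 < α) (hβ : 0 < β) (hξ : ξ ≤ 0) (hη : η ≤ 0) :
    appellF2 (α + β) α β (2 * α) (2 * β) ξ η = 1 / (besInt 0 α 0 * besInt 0 β 0) *
      ∫ q, (1 - ((1 - Real.cos q.1) / 2 * ξ + (1 - Real.cos q.2) / 2 * η)) ^ (-(α + β))
        ∂((angMeasure α).prod (angMeasure β)) := by
  have := Fact.mk hα
  have := Fact.mk hβ
  have hm := besInt_zero_zero_pos hα
  have hm' := besInt_zero_zero_pos hβ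
  set M := (angMeasure α).prod (angMeasure β)
  set u : ℝ → ℝ := fun φ => (1 - Real.cos φ) / 2 with hu
  have hu0 : ∀ φ, 0 ≤ u φ := fun φ => by
    have := Real.cos_le_one φ
    simp only [hu]; linarith
  have hu1 : ∀ φ, u φ ≤ 1 := fun φ => by
    have := Real.neg_one_le_cos φ
    simp only [hu]; linarith
  have huc : Continuous u := by fun_prop
  -- As ξ and η are nonpositive, c ≥ 0, so 1 + t c stays positive for 0 ≤ t ≤ 1 however large |ξ|
  -- and |η| are. This is what continues the series along the whole segment.
  set c : ℝ × ℝ → ℝ := fun q => -(u q.1 * ξ + u q.2 * η) with hc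
  have hc0 : ∀ q, 0 ≤ c q := fun q => by
    have := mul_nonneg (hu0 q.1) (neg_nonneg.2 hξ)
    have := mul_nonneg (hu0 q.2) (neg_nonneg.2 hη)
    simp only [hc]; linarith
  have hc1 : ∀ q, c q ≤ -ξ - η := fun q => by
    have := mul_le_of_le_one_left (neg_nonneg.2 hξ) (hu1 q.1)
    have := mul_le_of_le_one_left (neg_nonneg.2 hη) (hu1 q.2)
    simp only [hc]; linarith
  set g : ℝ → ℝ := fun t => 1 / (besInt 0 α 0 * besInt 0 β 0) *
    ∫ q, (1 + t * c q) ^ (-(α + β)) ∂M with hg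
  have hcont : IsAppellF2Continuation (α + β) α β (2 * α) (2 * β) ξ η g := by
    refine ⟨analyticOnNhd_const.mul (analyticOnNhd_integral_one_add_mul_rpow M (K := -ξ - η)
      (by simp only [hc]; fun_prop) (by linarith) (by linarith) hc0 hc1), ?_⟩
    have hsmall : ∀ᶠ t : ℝ in 𝓝 0, |t * ξ| + |t * η| < 1 := by
      have : Continuous fun t : ℝ => |t * ξ| + |t * η| := by fun_prop
      exact (this.tendsto' 0 0 (by simp)).eventually (gt_mem_nhds one_pos)
    filter_upwards [hsmall] with t ht
    have hle : ∀ φ z, |z * u φ| ≤ |z| := fun φ z => by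
      rw [abs_mul, abs_of_nonneg (hu0 φ)]
      exact mul_le_of_le_one_right (abs_nonneg _) (hu1 φ)
    have hterm : ∀ p : ℕ × ℕ, Integrable
        (fun q : ℝ × ℝ => binomTerm (α + β) (t * ξ * u q.1) (t * η * u q.2) p) M := by
      intro p
      have hcc : Continuous fun q : ℝ × ℝ =>
          binomTerm (α + β) (t * ξ * u q.1) (t * η * u q.2) p := by
        unfold binomTerm; fun_prop
      refine Integrable.mono' (integrable_const (binomTerm (α + β) |t * ξ| |t * η| p))
        hcc.aestronglyMeasurable (Eventually.of_forall fun q => ?_)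
      rw [Real.norm_eq_abs, abs_binomTerm (by linarith)]
      have := ascPochhammer_eval_nonneg (show 0 ≤ α + β by linarith) (p.1 + p.2)
      have := hle q.1 (t * ξ)
      have := hle q.2 (t * η)
      unfold binomTerm
      gcongr
    -- Sum and integral may be exchanged because the terms are dominated by those at |tξ| and |tη|,
    -- as the angular factors lie in [0, 1].
    have hsum := hasSum_integral_of_summable_integral_norm hterm (by
      refine Summable.of_nonneg_of_le (fun p => integral_nonneg fun q => norm_nonneg _)
        (fun p => ?_) ((summable_binomTerm_abs (a := α + β) (by linarith) ht).mul_right (M.real univ))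
      have h1 : ∫ q, ‖binomTerm (α + β) (t * ξ * u q.1) (t * η * u q.2) p‖ ∂M
          ≤ ∫ q, binomTerm (α + β) |t * ξ| |t * η| p ∂M := by
        refine integral_mono (hterm p).norm (integrable_const _) fun q => ?_
        rw [Real.norm_eq_abs, abs_binomTerm (by linarith)]
        have := ascPochhammer_eval_nonneg (show 0 ≤ α + β by linarith) (p.1 + p.2)
        have := hle q.1 (t * ξ)
        have := hle q.2 (t * η)
        unfold binomTerm
        gcongr
      refine h1.trans (le_of_eq ?_)
      simp [mul_comm])
    have e1 : ∀ q : ℝ × ℝ, ∑' p, binomTerm (α + β) (t * ξ * u q.1) (t * η * u q.2) p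
        = (1 + t * c q) ^ (-(α + β)) := by
      intro q
      rw [(hasSum_binomTerm (by linarith)
        ((add_le_add (hle q.1 (t * ξ)) (hle q.2 (t * η))).trans_lt ht)).tsum_eq]
      congr 1
      simp only [hc]
      ring
    simp only [e1] at hsum
    simp only [hg]
    rw [← hsum.tsum_eq, appellF2Series, ← tsum_mul_left]
    refine tsum_congr fun p => ?_
    have e2 : ∀ q : ℝ × ℝ, binomTerm (α + β) (t * ξ * u q.1) (t * η * u q.2) p
        = binomTerm (α + β) (t * ξ) (t * η) p * (u q.1 ^ p.1 * u q.2 ^ p.2) := by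
      intro q
      unfold binomTerm
      ring_nf
    simp only [e2]
    -- Each term factors into two moments, and these are the Pochhammer quotients of the series.
    rw [integral_const_mul, integral_prod_mul (fun φ => u φ ^ p.1) (fun φ => u φ ^ p.2)]
    simp only [hu]
    rw [integral_half_one_sub_cos_pow hα, integral_half_one_sub_cos_pow hβ,
      appellF2Term_eq_binomTerm]
    generalize binomTerm (α + β) (t * ξ) (t * η) p = B
    generalize Polynomial.eval α (ascPochhammer ℝ p.1) / _ = R
    generalize Polynomial.eval β (ascPochhammer ℝ p.2) / _ = R'
    field_simp
  rw [hcont.appellF2_eq, hg]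
  simp only [one_mul, hc]
  rfl

/-! ### The fundamental solution as an integral of heat kernels -/

/-- Legendre's duplication formula, for α and for β, removes Γ(2α) and Γ(2β). What remains is the
normalization of two heat kernels, the 1/4 of dt/(4t²), and the Γ(α + β) absorbed by the Gamma
integral. -/
theorem k1_eq {α β : ℝ} (hα : 0 < α) (hβ : 0 < β) :
    k1 α β / (besInt 0 α 0 * besInt 0 β 0)
      = heatNorm α * heatNorm β / 4 * Real.Gamma (α + β) := by
  have h1 := Real.Gamma_mul_Gamma_add_half α
  have h2 := Real.Gamma_mul_Gamma_add_half β
  have g1 := Real.Gamma_pos_of_pos hα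
  have g2 := Real.Gamma_pos_of_pos hβ
  have g3 := Real.Gamma_pos_of_pos (show 0 < α + 1 / 2 by linarith)
  have g4 := Real.Gamma_pos_of_pos (show 0 < β + 1 / 2 by linarith)
  have g5 := Real.Gamma_pos_of_pos (show 0 < 2 * α by linarith)
  have g6 := Real.Gamma_pos_of_pos (show 0 < 2 * β by linarith)
  have hpi := Real.pi_pos
  have hs : √Real.pi * √Real.pi = Real.pi := Real.mul_self_sqrt hpi.le
  have hs0 : 0 < √Real.pi := Real.sqrt_pos.2 hpi
  have e1 : Real.Gamma (α + 1 / 2)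
      = Real.Gamma (2 * α) * (2 / (2 : ℝ) ^ (2 * α)) * √Real.pi / Real.Gamma α := by
    rw [eq_div_iff g1.ne', mul_comm, h1, Real.rpow_sub two_pos, Real.rpow_one]
  have e2 : Real.Gamma (β + 1 / 2)
      = Real.Gamma (2 * β) * (2 / (2 : ℝ) ^ (2 * β)) * √Real.pi / Real.Gamma β := by
    rw [eq_div_iff g2.ne', mul_comm, h2, Real.rpow_sub two_pos, Real.rpow_one]
  have hp1 : 0 < (2 : ℝ) ^ (2 * α) := by positivity
  have hp2 : 0 < (2 : ℝ) ^ (2 * β) := by positivity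
  rw [k1, besInt_zero_zero hα, besInt_zero_zero hβ, heatNorm, heatNorm, e1, e2,
    Real.rpow_add two_pos, ← hs]
  field_simp
  rw [Real.sqrt_sq hs0.le]

/-- Euler's double integral gives an average of D^(-(α+β)) over two angles; a Gamma integral writes
this power as an integral of t^(α+β-1) exp(-D t). After Fubini the angles separate, and each angular
integral is the `besInt` factor of one kernel. -/
theorem q1_eq_integral {α β x y x₀ y₀ : ℝ} (hα : 0 < α) (hβ : 0 < β) (hx : 0 ≤ x) (hy : 0 ≤ y)
    (hx₀ : 0 ≤ x₀) (hy₀ : 0 ≤ y₀) (hr : 0 < rSq x y x₀ y₀) :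
    q1 α β x y x₀ y₀
      = ∫ t in Ioi (0 : ℝ), besselHeat α x₀ t x * besselHeat β y₀ t y / (4 * t ^ 2) := by
  have := Fact.mk hα
  have := Fact.mk hβ
  set M := (angMeasure α).prod (angMeasure β)
  set r := rSq x y x₀ y₀ with hrdef
  have hxx : 0 ≤ x * x₀ := by positivity
  have hyy : 0 ≤ y * y₀ := by positivity
  have hξ : xiVar x y x₀ y₀ = -(4 * (x * x₀)) / r := by
    rw [xiVar, r1Sq, ← hrdef]
    congr 1
    rw [hrdef, rSq]
    ring
  have hη : etaVar x y x₀ y₀ = -(4 * (y * y₀)) / r := by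
    rw [etaVar, r2Sq, ← hrdef]
    congr 1
    rw [hrdef, rSq]
    ring
  -- Here `r` stands for the squared distance, and `D` is `r` times the base of the power in Euler's
  -- integral.
  set D : ℝ × ℝ → ℝ := fun q =>
    r + 2 * (x * x₀) * (1 - Real.cos q.1) + 2 * (y * y₀) * (1 - Real.cos q.2) with hD
  have hDr : ∀ q, r ≤ D q := fun q => by
    have h1 : 0 ≤ 1 - Real.cos q.1 := by linarith [Real.cos_le_one q.1]
    have h2 : 0 ≤ 1 - Real.cos q.2 := by linarith [Real.cos_le_one q.2]
    have := mul_nonneg hxx h1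
    have := mul_nonneg hyy h2
    simp only [hD]
    linarith
  have hab : 0 < α + β := by linarith
  have hΓ := Real.Gamma_pos_of_pos hab
  have e1 : ∀ q : ℝ × ℝ, r ^ (-α - β) *
      (1 - ((1 - Real.cos q.1) / 2 * (-(4 * (x * x₀)) / r)
        + (1 - Real.cos q.2) / 2 * (-(4 * (y * y₀)) / r))) ^ (-(α + β))
      = 1 / Real.Gamma (α + β) *
        ∫ t in Ioi (0 : ℝ), t ^ (α + β - 1) * Real.exp (-(D q * t)) := by
    intro q
    have hDq : 0 < D q := hr.trans_le (hDr q)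
    rw [Real.integral_rpow_mul_exp_neg_mul_Ioi hab hDq, one_div, one_div, Real.inv_rpow hDq.le,
      ← Real.rpow_neg hDq.le]
    have e2 : (1 - ((1 - Real.cos q.1) / 2 * (-(4 * (x * x₀)) / r)
        + (1 - Real.cos q.2) / 2 * (-(4 * (y * y₀)) / r))) = D q / r := by
      simp only [hD]
      field_simp
      ring
    rw [e2, show -α - β = -(α + β) by ring, Real.div_rpow hDq.le hr.le]
    have : r ^ (-(α + β)) ≠ 0 := (Real.rpow_pos_of_pos hr _).ne'
    field_simp
  -- Since D ≥ r, the integrand is dominated by a function of t alone, and the angular measures are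
  -- finite.
  have hint : Integrable (Function.uncurry fun (q : ℝ × ℝ) (t : ℝ) =>
      t ^ (α + β - 1) * Real.exp (-(D q * t))) (M.prod (volume.restrict (Ioi 0))) := by
    have hb : Integrable (fun z : (ℝ × ℝ) × ℝ => (1 : ℝ) * (z.2 ^ (α + β - 1) *
        Real.exp (-r * z.2))) (M.prod (volume.restrict (Ioi 0))) :=
      (integrable_const (1 : ℝ)).mul_prod (integrableOn_rpow_mul_exp (by linarith) hr)
    have hDm : Measurable D := by simp only [hD]; fun_prop
    refine hb.mono' (Measurable.aestronglyMeasurable (by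
      simp only [Function.uncurry_def]
      fun_prop)) ?_
    have hpos : ∀ᵐ z : (ℝ × ℝ) × ℝ ∂(M.prod (volume.restrict (Ioi 0))), 0 < z.2 :=
      Measure.quasiMeasurePreserving_snd.ae (ae_restrict_mem measurableSet_Ioi)
    filter_upwards [hpos] with z hz
    simp only [Function.uncurry_def, one_mul]
    rw [Real.norm_eq_abs, abs_of_nonneg (by positivity)]
    gcongr
    nlinarith [hDr z.1]
  rw [q1, hξ, hη, appellF2_eq_integral hα hβ
    (div_nonpos_of_nonpos_of_nonneg (by linarith) hr.le)
    (div_nonpos_of_nonpos_of_nonneg (by linarith) hr.le)]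
  calc k1 α β * r ^ (-α - β) * (1 / (besInt 0 α 0 * besInt 0 β 0) *
        ∫ q, (1 - ((1 - Real.cos q.1) / 2 * (-(4 * (x * x₀)) / r)
        + (1 - Real.cos q.2) / 2 * (-(4 * (y * y₀)) / r))) ^ (-(α + β)) ∂M)
      = k1 α β / (besInt 0 α 0 * besInt 0 β 0) * ∫ q, r ^ (-α - β) *
      (1 - ((1 - Real.cos q.1) / 2 * (-(4 * (x * x₀)) / r)
        + (1 - Real.cos q.2) / 2 * (-(4 * (y * y₀)) / r))) ^ (-(α + β)) ∂M := by
        rw [integral_const_mul]; ring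
    _ = heatNorm α * heatNorm β / 4 * ∫ q, (∫ t in Ioi (0 : ℝ),
        t ^ (α + β - 1) * Real.exp (-(D q * t))) ∂M := by
        simp only [e1]
        rw [integral_const_mul, k1_eq hα hβ]
        field_simp
    _ = heatNorm α * heatNorm β / 4 * ∫ t in Ioi (0 : ℝ), ∫ q,
        t ^ (α + β - 1) * Real.exp (-(D q * t)) ∂M := by
        rw [integral_integral_swap hint]
    _ = _ := by
        rw [← integral_const_mul]
        refine setIntegral_congr_fun measurableSet_Ioi fun t ht => ?_
        have ht : 0 < t := ht
        have e3 : ∀ q : ℝ × ℝ, t ^ (α + β - 1) * Real.exp (-(D q * t))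
            = t ^ (α + β - 1) * Real.exp (-(r * t)) *
            (((1 - Real.cos q.1) ^ 0 * Real.exp (-2 * (t * x * x₀) * (1 - Real.cos q.1))) *
             ((1 - Real.cos q.2) ^ 0 * Real.exp (-2 * (t * y * y₀) * (1 - Real.cos q.2)))) := by
          intro q
          rw [pow_zero, pow_zero, one_mul, one_mul, mul_assoc, ← Real.exp_add, ← Real.exp_add]
          simp only [hD]
          ring_nf
        simp only [e3]
        rw [integral_const_mul, integral_prod_mul
          (fun φ => (1 - Real.cos φ) ^ 0 * Real.exp (-2 * (t * x * x₀) * (1 - Real.cos φ)))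
          (fun φ => (1 - Real.cos φ) ^ 0 * Real.exp (-2 * (t * y * y₀) * (1 - Real.cos φ))),
          ← besInt.eq_1, ← besInt.eq_1, besselHeat, besselHeat]
        have e4 : t ^ (α + β - 1) = t ^ (α + 1 / 2) * t ^ (β + 1 / 2) / t ^ 2 := by
          rw [← Real.rpow_add ht, ← Real.rpow_natCast, ← Real.rpow_sub ht]
          norm_num
          ring_nf
        have e5 : Real.exp (-(r * t))
            = Real.exp (-t * (x - x₀) ^ 2) * Real.exp (-t * (y - y₀) ^ 2) := by
          rw [← Real.exp_add, hrdef, rSq]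
          ring_nf
        rw [e4, e5]
        field_simp

/-- Visible in the heat kernel integral. It reduces the derivative in y to the derivative in x. -/
theorem q1_swap {α β x y x₀ y₀ : ℝ} (hα : 0 < α) (hβ : 0 < β) (hx : 0 ≤ x) (hy : 0 ≤ y)
    (hx₀ : 0 ≤ x₀) (hy₀ : 0 ≤ y₀) (hr : 0 < rSq x y x₀ y₀) :
    q1 α β x y x₀ y₀ = q1 β α y x y₀ x₀ := by
  have hr' : 0 < rSq y x y₀ x₀ := by
    rw [rSq] at hr ⊢
    linarith
  rw [q1_eq_integral hα hβ hx hy hx₀ hy₀ hr, q1_eq_integral hβ hα hy hx hy₀ hx₀ hr']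
  simp only [mul_comm]

/-- Differentiation under the integral: the derivative of the kernel is -4t² x^(-2α) times the flux,
and 4t² cancels the time density. -/
theorem hasDerivAt_q1_fst {α β x y x₀ y₀ : ℝ} (hα : 0 < α) (hβ : 0 < β) (hx : 0 < x) (hy : 0 ≤ y)
    (hx₀ : 0 ≤ x₀) (hy₀ : 0 ≤ y₀) (hr : 0 < rSq x y x₀ y₀) :
    HasDerivAt (fun x => q1 α β x y x₀ y₀) (-heatGrad α β x₀ y₀ x y / x ^ (2 * α)) x := by
  set d := rSq x y x₀ y₀ / 2 with hd
  have hd0 : 0 < d := by positivity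
  have hK := heatBound_pos hα
  have hK' := heatBound_pos hβ
  have hnear : {z : ℝ | x / 2 < z ∧ z < 2 * x ∧ d < rSq z y x₀ y₀} ∈ 𝓝 x := by
    have c3 : ContinuousAt (fun z : ℝ => rSq z y x₀ y₀) x := by
      unfold rSq; fun_prop
    exact (lt_mem_nhds (by linarith)).and ((gt_mem_nhds (by linarith)).and
      (c3.eventually_const_lt (show d < rSq x y x₀ y₀ by linarith)))
  have hcont : ∀ z, ContinuousOn
      (fun t => besselHeat α x₀ t z * besselHeat β y₀ t y / (4 * t ^ 2)) (Ioi 0) := fun z =>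
    ((continuousOn_besselHeat_left hα x₀ z).mul (continuousOn_besselHeat_left hβ y₀ y)).div
      (by fun_prop) fun t ht => by
        have : 0 < t := ht
        positivity
  have key := (hasDerivAt_integral_of_dominated_loc_of_deriv_le (𝕜 := ℝ)
    (μ := volume.restrict (Ioi (0 : ℝ)))
    (F := fun z t => besselHeat α x₀ t z * besselHeat β y₀ t y / (4 * t ^ 2))
    (F' := fun z t => -(heatFlux α x₀ t z * besselHeat β y₀ t y) / z ^ (2 * α))
    (bound := fun t => ((heatBound α * (2 * x + 3 * x₀) * (2 * x) ^ (2 * α) * heatBound β) *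
        (t ^ (α + β) * Real.exp (-d * t))) / (x / 2) ^ (2 * α))
    hnear (Eventually.of_forall fun z => (hcont z).aestronglyMeasurable measurableSet_Ioi)
    ?_ ?_ ?_ ?_ ?_).2
  · have e : ∫ t in Ioi (0 : ℝ), -(heatFlux α x₀ t x * besselHeat β y₀ t y) / x ^ (2 * α)
        = -heatGrad α β x₀ y₀ x y / x ^ (2 * α) := by
      rw [integral_div, integral_neg, heatGrad]
    rw [← e]
    refine key.congr_of_eventuallyEq ?_
    filter_upwards [hnear] with z hz
    exact q1_eq_integral hα hβ (by linarith [hz.1]) hy hx₀ hy₀ (hd0.trans hz.2.2)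
  · have hr' : 0 < (x - x₀) ^ 2 + (y - y₀) ^ 2 := hr
    refine Integrable.mono' ((integrableOn_rpow_mul_exp (s := α + β - 1) (by linarith)
      hr').const_mul (heatBound α * heatBound β))
      ((hcont x).aestronglyMeasurable measurableSet_Ioi) ?_
    filter_upwards [ae_restrict_mem measurableSet_Ioi] with t ht
    have ht : 0 < t := ht
    have p1 := besselHeat_nonneg hα ht.le x₀ x
    have p2 := besselHeat_nonneg hβ ht.le y₀ y
    have b1 := besselHeat_le hα ht hx.le hx₀
    have b2 := besselHeat_le hβ ht hy hy₀
    rw [Real.norm_eq_abs, abs_of_nonneg (by positivity), div_le_iff₀ (by positivity)]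
    refine (mul_le_mul b1 b2 p2 (by positivity)).trans ?_
    have e1 : t ^ (α + β - 1) * t ^ 2 = t ^ (α + 1 / 2) * t ^ (β + 1 / 2) := by
      rw [← Real.rpow_add ht, ← Real.rpow_natCast, ← Real.rpow_add ht]
      norm_num
      ring_nf
    have e2 : Real.exp (-((x - x₀) ^ 2 + (y - y₀) ^ 2) * t)
        = Real.exp (-t * (x - x₀) ^ 2) * Real.exp (-t * (y - y₀) ^ 2) := by
      rw [← Real.exp_add]; ring_nf
    have e3 : heatBound α * heatBound β * (t ^ (α + β - 1) *
        Real.exp (-((x - x₀) ^ 2 + (y - y₀) ^ 2) * t)) * (4 * t ^ 2)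
        = 4 * (heatBound α * heatBound β * (t ^ (α + β - 1) * t ^ 2) *
          Real.exp (-((x - x₀) ^ 2 + (y - y₀) ^ 2) * t)) := by ring
    rw [e3, e1, e2]
    have : 0 ≤ heatBound α * heatBound β * (t ^ (α + 1 / 2) * t ^ (β + 1 / 2)) *
      (Real.exp (-t * (x - x₀) ^ 2) * Real.exp (-t * (y - y₀) ^ 2)) := by positivity
    linarith
  · exact (((continuousOn_heatFlux_mul_besselHeat hα hβ x₀ y₀ x y).neg).div_const
      _).aestronglyMeasurable measurableSet_Ioi
  · filter_upwards [ae_restrict_mem measurableSet_Ioi] with t ht z hz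
    have ht : 0 < t := ht
    obtain ⟨hz1, hz2, hz3⟩ := hz
    have hz0 : 0 < z := by linarith
    rw [Real.norm_eq_abs, abs_div, abs_neg, abs_of_pos (a := z ^ (2 * α)) (by positivity)]
    have h2 : z ^ (2 * α) ≤ (2 * x) ^ (2 * α) := Real.rpow_le_rpow hz0.le hz2.le (by linarith)
    have h3 : (x / 2) ^ (2 * α) ≤ z ^ (2 * α) :=
      Real.rpow_le_rpow (by linarith) hz1.le (by linarith)
    refine div_le_div₀ (by positivity) ?_ (by positivity) h3
    refine (abs_heatFlux_mul_besselHeat_le hα hβ ht hz0.le hy hx₀ hy₀).trans ?_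
    have h4 : Real.exp (-((z - x₀) ^ 2 + (y - y₀) ^ 2) * t) ≤ Real.exp (-d * t) := by
      rw [Real.exp_le_exp]
      rw [rSq] at hz3
      nlinarith
    gcongr
  · exact ((integrableOn_rpow_mul_exp (by linarith) hd0).const_mul _).div_const _
  · filter_upwards [ae_restrict_mem measurableSet_Ioi] with t ht z hz
    have ht : 0 < t := ht
    have hz0 : 0 < z := by linarith [hz.1]
    refine (((hasDerivAt_besselHeat hα ht hz0 x₀).mul_const (besselHeat β y₀ t y)).div_const
      (4 * t ^ 2)).congr_deriv ?_
    field_simp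

theorem hasDerivAt_q1_snd {α β x y x₀ y₀ : ℝ} (hα : 0 < α) (hβ : 0 < β) (hx : 0 ≤ x) (hy : 0 < y)
    (hx₀ : 0 ≤ x₀) (hy₀ : 0 ≤ y₀) (hr : 0 < rSq x y x₀ y₀) :
    HasDerivAt (fun y => q1 α β x y x₀ y₀) (-heatGrad β α y₀ x₀ y x / y ^ (2 * β)) y := by
  have hr' : 0 < rSq y x y₀ x₀ := by
    rw [rSq] at hr ⊢
    linarith
  refine (hasDerivAt_q1_fst hβ hα hy hx hy₀ hx₀ hr').congr_of_eventuallyEq ?_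
  have c3 : ContinuousAt (fun z : ℝ => rSq x z x₀ y₀) y := by
    unfold rSq; fun_prop
  filter_upwards [lt_mem_nhds hy, c3.eventually_const_lt hr] with z hz hz2
  exact q1_swap hα hβ hx hz.le hx₀ hy₀ hz2

/-- The double layer integrand of density `1`, in terms of `heatGrad`. -/
theorem doubleLayerIntegrand_eq {α β l s x₀ y₀ : ℝ} {x y : ℝ → ℝ} (hα : 0 < α) (hβ : 0 < β)
    (hx : 0 < x s) (hy : 0 < y s) (hx₀ : 0 ≤ x₀) (hy₀ : 0 ≤ y₀)
    (hne : (x s, y s) ≠ (x₀, y₀)) :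
    doubleLayerIntegrand α β l x y (fun _ => 1) x₀ y₀ s =
      x s ^ (2 * α) * heatGrad β α y₀ x₀ (y s) (x s) * derivWithin x (Icc 0 l) s
        - y s ^ (2 * β) * heatGrad α β x₀ y₀ (x s) (y s) * derivWithin y (Icc 0 l) s := by
  have hr : 0 < rSq (x s) (y s) x₀ y₀ := by
    rw [rSq]
    by_contra h
    apply hne
    have h1 : (x s - x₀) ^ 2 = 0 := by nlinarith [sq_nonneg (x s - x₀), sq_nonneg (y s - y₀)]
    have h2 : (y s - y₀) ^ 2 = 0 := by nlinarith [sq_nonneg (x s - x₀), sq_nonneg (y s - y₀)]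
    rw [Prod.mk.injEq]
    exact ⟨by linarith [pow_eq_zero_iff two_ne_zero |>.1 h1],
      by linarith [pow_eq_zero_iff two_ne_zero |>.1 h2]⟩
  rw [doubleLayerIntegrand, normalDerivQ1,
    (hasDerivAt_q1_fst hα hβ hx hy.le hx₀ hy₀ hr).deriv,
    (hasDerivAt_q1_snd hα hβ hx.le hy hx₀ hy₀ hr).deriv]
  have h1 : x s ^ (2 * α) ≠ 0 := (Real.rpow_pos_of_pos hx _).ne'
  have h2 : y s ^ (2 * β) ≠ 0 := (Real.rpow_pos_of_pos hy _).ne'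
  field_simp
  ring

/-! ### Asymptotics at an interior pole -/

theorem continuous_heatProfile {α : ℝ} (hα : 0 < α) (x₀ t : ℝ) :
    Continuous (heatProfile α x₀ t) := by
  have := continuous_besInt 0 hα
  have : Continuous fun x : ℝ => x ^ (2 * α) := Real.continuous_rpow_const (by linarith)
  unfold heatProfile
  fun_prop

theorem continuousOn_heatProfile_left {α : ℝ} (hα : 0 < α) (x₀ x : ℝ) :
    ContinuousOn (fun t => heatProfile α x₀ t x) (Ioi 0) := by
  have := continuous_besInt 0 hα
  have h1 : ContinuousOn (fun t : ℝ => t ^ (α + 1 / 2)) (Ioi 0) := fun t ht =>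
    (Real.continuousAt_rpow_const _ _ (Or.inl (ne_of_gt ht))).continuousWithinAt
  unfold heatProfile
  exact ((continuousOn_const.mul h1).mul continuousOn_const).mul
    (Continuous.continuousOn (by fun_prop))

theorem tendsto_sqrt_mul_integral_gaussian {c : ℝ} (hc : 0 < c) :
    Tendsto (fun t : ℝ => √t * ∫ r in (0 : ℝ)..c, Real.exp (-t * r ^ 2)) atTop
      (𝓝 (√Real.pi / 2)) := by
  have h1 : Tendsto (fun M : ℝ => ∫ u in (0 : ℝ)..M, Real.exp (-1 * u ^ 2)) atTop
      (𝓝 (∫ u in Ioi (0 : ℝ), Real.exp (-1 * u ^ 2))) :=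
    intervalIntegral_tendsto_integral_Ioi 0 (integrable_exp_neg_mul_sq one_pos).integrableOn
      tendsto_id
  rw [integral_gaussian_Ioi, div_one] at h1
  have h2 : Tendsto (fun t : ℝ => √t * c) atTop atTop :=
    Real.tendsto_sqrt_atTop.atTop_mul_const hc
  refine (h1.comp h2).congr' ?_
  filter_upwards [eventually_gt_atTop 0] with t ht
  have h3 := intervalIntegral.mul_integral_comp_mul_left (a := 0) (b := c)
    (f := fun u => Real.exp (-1 * u ^ 2)) (√t)
  rw [mul_zero] at h3
  rw [Function.comp, ← h3]
  congr 1
  refine intervalIntegral.integral_congr fun r _ => ?_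
  simp only [mul_pow, Real.sq_sqrt ht.le]
  ring_nf

/-- The mass on [x₀, 3x₀/2] tends to 1/2. It also equals the profile at x₀ times a Gaussian integral
asymptotic to √π/(2√t), up to O(t^(-1/2)). Dividing gives the constant without any asymptotic
expansion of Bessel functions. -/
theorem tendsto_heatProfile_div_sqrt {α x₀ : ℝ} (hα : 0 < α) (hx₀ : 0 < x₀) :
    Tendsto (fun t => heatProfile α x₀ t x₀ / √t) atTop (𝓝 (1 / √Real.pi)) := by
  obtain ⟨C, hC, hb⟩ := exists_heatProfile_bounds hα hx₀
  have key : ∀ t, 0 < t →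
      |heatCDF α x₀ t (3 * x₀ / 2) - heatCDF α x₀ t x₀
        - heatProfile α x₀ t x₀ * ∫ r in (0 : ℝ)..x₀ / 2, Real.exp (-t * r ^ 2)|
        ≤ C / 2 * (√t / t) := by
    intro t ht
    have e2 : heatCDF α x₀ t (3 * x₀ / 2) - heatCDF α x₀ t x₀
        = ∫ r in (0 : ℝ)..x₀ / 2, heatProfile α x₀ t (x₀ + r) * Real.exp (-t * r ^ 2) := by
      rw [heatCDF, heatCDF, intervalIntegral.integral_interval_sub_left
        (heatCDF_integrable hα _ _ _ _) (heatCDF_integrable hα _ _ _ _)]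
      have := intervalIntegral.integral_comp_add_left (a := 0) (b := x₀ / 2)
        (fun s => s ^ (2 * α) * besselHeat α x₀ t s) x₀
      rw [add_zero, show x₀ + x₀ / 2 = 3 * x₀ / 2 by ring] at this
      rw [← this]
      refine intervalIntegral.integral_congr fun r _ => ?_
      rw [rpow_mul_besselHeat]
      ring_nf
    have c2 : Continuous fun r => heatProfile α x₀ t (x₀ + r) * Real.exp (-t * r ^ 2) :=
      ((continuous_heatProfile hα x₀ t).comp (by fun_prop)).mul (by fun_prop)
    have c3 : Continuous fun r : ℝ => heatProfile α x₀ t x₀ * Real.exp (-t * r ^ 2) := by fun_prop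
    rw [e2, ← intervalIntegral.integral_const_mul,
      ← intervalIntegral.integral_sub (c2.intervalIntegrable _ _) (c3.intervalIntegrable _ _)]
    have h4 : |∫ r in (0 : ℝ)..x₀ / 2, (heatProfile α x₀ t (x₀ + r) * Real.exp (-t * r ^ 2)
          - heatProfile α x₀ t x₀ * Real.exp (-t * r ^ 2))|
        ≤ ∫ r in (0 : ℝ)..x₀ / 2, (C * √t) * (r * Real.exp (-t * r ^ 2)) := by
      rw [← Real.norm_eq_abs]
      refine intervalIntegral.norm_integral_le_of_norm_le (by linarith)
        (Eventually.of_forall fun r hr => ?_) (Continuous.intervalIntegrable (by fun_prop) _ _)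
      have := (hb t ht (x₀ + r) ⟨by linarith [hr.1], by linarith [hr.2]⟩).2 x₀
        ⟨by linarith, by linarith⟩
      rw [add_sub_cancel_left, abs_of_pos hr.1] at this
      rw [← sub_mul, Real.norm_eq_abs, abs_mul, Real.abs_exp]
      calc _ ≤ C * √t * r * Real.exp (-t * r ^ 2) := by gcongr
        _ = _ := by ring
    refine h4.trans ?_
    rw [intervalIntegral.integral_const_mul]
    calc C * √t * ∫ r in (0 : ℝ)..x₀ / 2, r * Real.exp (-t * r ^ 2)
        ≤ C * √t * (1 / (2 * t)) := by gcongr; exact integral_id_mul_gaussian_le ht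
      _ = C / 2 * (√t / t) := by field_simp
  have hlim : Tendsto (fun t : ℝ => C / 2 * (√t / t)) atTop (𝓝 0) := by
    have h1 : Tendsto (fun t : ℝ => t ^ (-(1 / 2) : ℝ)) atTop (𝓝 0) :=
      tendsto_rpow_neg_atTop (by norm_num)
    have h2 := h1.const_mul (C / 2)
    rw [mul_zero] at h2
    refine h2.congr' ?_
    filter_upwards [eventually_gt_atTop 0] with t ht
    rw [Real.sqrt_eq_rpow, ← Real.rpow_sub_one ht.ne']
    norm_num
  have h1 : Tendsto (fun t => heatCDF α x₀ t (3 * x₀ / 2) - heatCDF α x₀ t x₀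
      - heatProfile α x₀ t x₀ * ∫ r in (0 : ℝ)..x₀ / 2, Real.exp (-t * r ^ 2)) atTop (𝓝 0) := by
    refine squeeze_zero_norm' ?_ hlim
    filter_upwards [eventually_gt_atTop 0] with t ht using key t ht
  have h2 := tendsto_heatCDF_self hα hx₀
  have h3 := tendsto_heatCDF_atTop_of_gt hα hx₀.le (x := 3 * x₀ / 2) (by linarith)
  have hpi : √Real.pi ≠ 0 := (Real.sqrt_pos.2 Real.pi_pos).ne'
  have hJ := tendsto_sqrt_mul_integral_gaussian (c := x₀ / 2) (by linarith)
  have h4 := ((h3.sub h2).sub h1).div hJ (by positivity)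
  have e : (1 - 1 / 2 - 0) / (√Real.pi / 2) = 1 / √Real.pi := by
    field_simp; norm_num
  rw [e] at h4
  refine h4.congr' ?_
  filter_upwards [eventually_gt_atTop 0, hJ.eventually_ne (by positivity)] with t ht hne
  have hst : √t ≠ 0 := (Real.sqrt_pos.2 ht).ne'
  have : (∫ r in (0 : ℝ)..x₀ / 2, Real.exp (-t * r ^ 2)) ≠ 0 := right_ne_zero_of_mul hne
  rw [Pi.div_apply, sub_sub_cancel, mul_div_mul_right _ _ this]

/-- The leading coefficient of the flux of the fundamental solution at distance `√R` from an
interior pole. -/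
noncomputable def poleCoeff (α β x₀ y₀ R : ℝ) : ℝ :=
  1 / 2 * ∫ t in Ioi (0 : ℝ),
    heatProfile α x₀ t x₀ * heatProfile β y₀ t y₀ / t * Real.exp (-R * t)

theorem exists_heatProfile_mul_le {α β x₀ y₀ : ℝ} (hα : 0 < α) (hβ : 0 < β) (hx₀ : 0 < x₀)
    (hy₀ : 0 < y₀) : ∃ C, 0 < C ∧ ∀ t, 0 < t →
      |heatProfile α x₀ t x₀ * heatProfile β y₀ t y₀ / t| ≤ C := by
  obtain ⟨C, hC, hb⟩ := exists_heatProfile_bounds hα hx₀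
  obtain ⟨C', hC', hb'⟩ := exists_heatProfile_bounds hβ hy₀
  refine ⟨C * C', by positivity, fun t ht => ?_⟩
  have h1 := (hb t ht x₀ ⟨by linarith, by linarith⟩).1
  have h2 := (hb' t ht y₀ ⟨by linarith, by linarith⟩).1
  have p1 := heatProfile_nonneg hα ht.le hx₀.le x₀
  have p2 := heatProfile_nonneg hβ ht.le hy₀.le y₀
  rw [abs_of_nonneg (by positivity), div_le_iff₀ ht]
  calc _ ≤ C * √t * (C' * √t) := mul_le_mul h1 h2 p2 (by positivity)
    _ = C * C' * (√t * √t) := by ring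
    _ = _ := by rw [Real.mul_self_sqrt ht.le]

theorem continuousOn_poleCoeff_integrand {α β : ℝ} (hα : 0 < α) (hβ : 0 < β) (x₀ y₀ : ℝ) :
    ContinuousOn (fun t => heatProfile α x₀ t x₀ * heatProfile β y₀ t y₀ / t) (Ioi 0) :=
  ((continuousOn_heatProfile_left hα x₀ x₀).mul (continuousOn_heatProfile_left hβ y₀ y₀)).div
    continuousOn_id fun _ ht => ne_of_gt ht

theorem integrableOn_poleCoeff {α β x₀ y₀ R : ℝ} (hα : 0 < α) (hβ : 0 < β) (hx₀ : 0 < x₀)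
    (hy₀ : 0 < y₀) (hR : 0 < R) :
    IntegrableOn (fun t => heatProfile α x₀ t x₀ * heatProfile β y₀ t y₀ / t * Real.exp (-R * t))
      (Ioi 0) := by
  obtain ⟨C, hC, hb⟩ := exists_heatProfile_mul_le hα hβ hx₀ hy₀
  have h1 : IntegrableOn (fun t => C * Real.exp (-R * t)) (Ioi 0) :=
    (exp_neg_integrableOn_Ioi 0 hR).const_mul C
  refine Integrable.mono' h1 (((continuousOn_poleCoeff_integrand hα hβ x₀ y₀).mul
    (Continuous.continuousOn (by fun_prop))).aestronglyMeasurable measurableSet_Ioi) ?_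
  filter_upwards [ae_restrict_mem measurableSet_Ioi] with t ht
  rw [norm_mul, Real.norm_eq_abs, Real.norm_eq_abs, Real.abs_exp]
  have := hb t ht
  gcongr

theorem integral_exp_neg_mul {R : ℝ} (hR : 0 < R) :
    ∫ t in Ioi (0 : ℝ), Real.exp (-R * t) = 1 / R := by
  have := Real.integral_rpow_mul_exp_neg_mul_Ioi one_pos hR
  simp only [sub_self, Real.rpow_zero, one_mul, Real.rpow_one, Real.Gamma_one, mul_one] at this
  rw [← this]
  simp only [neg_mul]

/-- After the substitution u = R t, the large-t behaviour of the integrand decides: each profile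
contributes √t/√π, so the quotient by t tends to 1/π, and dominated convergence applies. The factor
1/2 yields 1/(2π). -/
theorem tendsto_poleCoeff {α β x₀ y₀ : ℝ} (hα : 0 < α) (hβ : 0 < β) (hx₀ : 0 < x₀)
    (hy₀ : 0 < y₀) :
    Tendsto (fun R => poleCoeff α β x₀ y₀ R * R) (𝓝[>] 0) (𝓝 (1 / (2 * Real.pi))) := by
  obtain ⟨C, hC, hb⟩ := exists_heatProfile_mul_le hα hβ hx₀ hy₀
  set k : ℝ → ℝ := fun t => heatProfile α x₀ t x₀ * heatProfile β y₀ t y₀ / t with hk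
  have hkc : ContinuousOn k (Ioi 0) := continuousOn_poleCoeff_integrand hα hβ x₀ y₀
  have hklim : Tendsto k atTop (𝓝 (1 / Real.pi)) := by
    have h := (tendsto_heatProfile_div_sqrt hα hx₀).mul (tendsto_heatProfile_div_sqrt hβ hy₀)
    rw [div_mul_div_comm, one_mul, Real.mul_self_sqrt Real.pi_pos.le] at h
    refine h.congr' ?_
    filter_upwards [eventually_gt_atTop 0] with t ht
    rw [div_mul_div_comm, Real.mul_self_sqrt ht.le]
  have h1 : Tendsto (fun R : ℝ => ∫ u in Ioi (0 : ℝ), k (u / R) * Real.exp (-u)) (𝓝[>] 0)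
      (𝓝 (∫ u in Ioi (0 : ℝ), 1 / Real.pi * Real.exp (-u))) := by
    refine tendsto_integral_filter_of_dominated_convergence (fun u => C * Real.exp (-u)) ?_ ?_ ?_ ?_
    · filter_upwards [self_mem_nhdsWithin] with R hR
      have hR : 0 < R := hR
      refine ContinuousOn.aestronglyMeasurable (ContinuousOn.mul (hkc.comp (by fun_prop)
        fun u hu => ?_) (Continuous.continuousOn (by fun_prop))) measurableSet_Ioi
      exact div_pos (mem_Ioi.1 hu) hR
    · filter_upwards [self_mem_nhdsWithin] with R hR
      have hR : 0 < R := hR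
      filter_upwards [ae_restrict_mem measurableSet_Ioi] with u hu
      rw [norm_mul, Real.norm_eq_abs, Real.norm_eq_abs, Real.abs_exp]
      have := hb (u / R) (div_pos (mem_Ioi.1 hu) hR)
      gcongr
    · have := (exp_neg_integrableOn_Ioi 0 one_pos).const_mul C
      simpa using this
    · filter_upwards [ae_restrict_mem measurableSet_Ioi] with u hu
      refine Tendsto.mul_const _ (hklim.comp ?_)
      have : Tendsto (fun R : ℝ => u * R⁻¹) (𝓝[>] 0) atTop :=
        tendsto_inv_nhdsGT_zero.const_mul_atTop (mem_Ioi.1 hu)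
      exact this.congr fun R => (div_eq_mul_inv u R).symm
  rw [integral_const_mul, integral_exp_neg_Ioi_zero, mul_one] at h1
  have h2 := h1.const_mul (1 / 2)
  have e : 1 / 2 * (1 / Real.pi) = 1 / (2 * Real.pi) := by
    field_simp
  rw [e] at h2
  refine h2.congr' ?_
  filter_upwards [self_mem_nhdsWithin] with R hR
  have hR : 0 < R := hR
  have h3 := integral_comp_mul_left_Ioi (fun u => k (u / R) * Real.exp (-u)) 0 hR
  rw [mul_zero, smul_eq_mul] at h3
  have h4 : ∫ u in Ioi (0 : ℝ), k (u / R) * Real.exp (-u)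
      = R * ∫ t in Ioi (0 : ℝ), k (R * t / R) * Real.exp (-(R * t)) := by
    rw [h3]
    field_simp
  rw [h4, poleCoeff]
  simp only [mul_div_cancel_left₀ _ hR.ne', neg_mul, hk]
  ring

/-- Freezing both profiles at the pole costs, by the Lipschitz bounds, at most a multiple of |x -
x₀|(|x - x₀| + |y - y₀|) ≤ 2R. The part of the flux containing `besInt 1` is of order t^(-3/4). -/
theorem abs_poleCoeff_integrand_sub_le {α β x₀ y₀ : ℝ} (hα : 0 < α) (hβ : 0 < β) (hx₀ : 0 < x₀)
    (hy₀ : 0 < y₀) :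
    ∃ K, 0 < K ∧ ∀ t, 0 < t → ∀ x ∈ Icc (x₀ / 2) (3 * x₀ / 2), ∀ y ∈ Icc (y₀ / 2) (3 * y₀ / 2),
      |y ^ (2 * β) * (heatFlux α x₀ t x * besselHeat β y₀ t y)
        - 1 / 2 * (x - x₀) * (heatProfile α x₀ t x₀ * heatProfile β y₀ t y₀ / t
          * Real.exp (-((x - x₀) ^ 2 + (y - y₀) ^ 2) * t))|
      ≤ K * ((((x - x₀) ^ 2 + (y - y₀) ^ 2) + t ^ (-(3 / 4) : ℝ))
          * Real.exp (-((x - x₀) ^ 2 + (y - y₀) ^ 2) * t)) := by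
  obtain ⟨C, hC, hb⟩ := exists_heatProfile_bounds hα hx₀
  obtain ⟨C', hC', hb'⟩ := exists_heatProfile_bounds hβ hy₀
  obtain ⟨C1, hC1, h1⟩ := exists_besInt_one_profile_bound hα hx₀
  refine ⟨C * C' + x₀ * C1 * C', by positivity, fun t ht x hx y hy => ?_⟩
  set R := (x - x₀) ^ 2 + (y - y₀) ^ 2 with hR
  have hx0 : 0 < x := by linarith [hx.1]
  have hy0 : 0 < y := by linarith [hy.1]
  have mx₀ : x₀ ∈ Icc (x₀ / 2) (3 * x₀ / 2) := ⟨by linarith, by linarith⟩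
  have my₀ : y₀ ∈ Icc (y₀ / 2) (3 * y₀ / 2) := ⟨by linarith, by linarith⟩
  set ψ := heatNorm α * t ^ (α - 1 / 2) * x ^ (2 * α) * besInt 1 α (t * x * x₀) with hψ
  have hψ0 : 0 ≤ ψ := by
    have := besInt_nonneg 1 α (t * x * x₀)
    have := heatNorm_pos hα
    positivity
  have hψ1 := h1 t ht x hx
  have e1 : y ^ (2 * β) * (heatFlux α x₀ t x * besselHeat β y₀ t y)
      = (1 / 2 * (x - x₀) * (heatProfile α x₀ t x * heatProfile β y₀ t y / t)
        + 1 / 2 * x₀ * (ψ * heatProfile β y₀ t y)) * Real.exp (-R * t) := by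
    have e2 : Real.exp (-R * t) = Real.exp (-t * (x - x₀) ^ 2) * Real.exp (-t * (y - y₀) ^ 2) := by
      rw [← Real.exp_add, hR]; ring_nf
    have e3 : y ^ (2 * β) * (heatFlux α x₀ t x * besselHeat β y₀ t y)
        = heatFlux α x₀ t x * (y ^ (2 * β) * besselHeat β y₀ t y) := by ring
    have e4 : heatProfile α x₀ t x
        = heatNorm α * (t ^ (α - 1 / 2) * t) * x ^ (2 * α) * besInt 0 α (t * x * x₀) := by
      rw [heatProfile, ← Real.rpow_add_one ht.ne']
      ring_nf
    rw [e3, rpow_mul_besselHeat, e2, e4, heatFlux, hψ]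
    field_simp
  rw [e1]
  have p2 := heatProfile_nonneg hβ ht.le hy0.le y₀
  have p3 := heatProfile_nonneg hα ht.le hx₀.le x₀
  have b1 := (hb' t ht y hy).1
  have b2 := (hb t ht x₀ mx₀).1
  have b3 := (hb t ht x hx).2 x₀ mx₀
  have b4 := (hb' t ht y hy).2 y₀ my₀
  have hst : √t * √t = t := Real.mul_self_sqrt ht.le
  have d1 : |heatProfile α x₀ t x * heatProfile β y₀ t y / t
      - heatProfile α x₀ t x₀ * heatProfile β y₀ t y₀ / t| ≤ C * C' * (|x - x₀| + |y - y₀|) := by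
    have : heatProfile α x₀ t x * heatProfile β y₀ t y / t
      - heatProfile α x₀ t x₀ * heatProfile β y₀ t y₀ / t
      = ((heatProfile α x₀ t x - heatProfile α x₀ t x₀) * heatProfile β y₀ t y
        + heatProfile α x₀ t x₀ * (heatProfile β y₀ t y - heatProfile β y₀ t y₀)) / t := by ring
    rw [this, abs_div, abs_of_pos ht, div_le_iff₀ ht]
    refine (abs_add_le _ _).trans ?_
    rw [abs_mul, abs_mul, abs_of_nonneg p2, abs_of_nonneg p3]
    calc _ ≤ C * √t * |x - x₀| * (C' * √t) + C * √t * (C' * √t * |y - y₀|) := by gcongr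
      _ = C * C' * (|x - x₀| + |y - y₀|) * (√t * √t) := by ring
      _ = _ := by rw [hst]
  have d2 : ψ * heatProfile β y₀ t y ≤ C1 * C' * t ^ (-(3 / 4) : ℝ) := by
    calc _ ≤ C1 * t ^ (-(5 / 4) : ℝ) * (C' * √t) := mul_le_mul hψ1 b1 p2 (by positivity)
      _ = C1 * C' * (t ^ (-(5 / 4) : ℝ) * t ^ (1 / 2 : ℝ)) := by rw [Real.sqrt_eq_rpow]; ring
      _ = _ := by rw [← Real.rpow_add ht]; norm_num
  have e5 : (1 / 2 * (x - x₀) * (heatProfile α x₀ t x * heatProfile β y₀ t y / t)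
        + 1 / 2 * x₀ * (ψ * heatProfile β y₀ t y)) * Real.exp (-R * t)
      - 1 / 2 * (x - x₀) * (heatProfile α x₀ t x₀ * heatProfile β y₀ t y₀ / t * Real.exp (-R * t))
      = (1 / 2 * (x - x₀) * (heatProfile α x₀ t x * heatProfile β y₀ t y / t
      - heatProfile α x₀ t x₀ * heatProfile β y₀ t y₀ / t)
        + 1 / 2 * x₀ * (ψ * heatProfile β y₀ t y)) * Real.exp (-R * t) := by ring
  rw [e5, abs_mul, Real.abs_exp, ← mul_assoc (C * C' + x₀ * C1 * C')]
  refine mul_le_mul_of_nonneg_right ?_ (Real.exp_pos _).le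
  refine (abs_add_le _ _).trans ?_
  rw [abs_mul, abs_mul, abs_of_nonneg (show 0 ≤ 1 / 2 * x₀ * (ψ * heatProfile β y₀ t y) by
    positivity), abs_of_pos (show (0 : ℝ) < 1 / 2 by norm_num)]
  have q1 : |x - x₀| * (|x - x₀| + |y - y₀|) ≤ 2 * R := by
    rw [hR, ← sq_abs (x - x₀), ← sq_abs (y - y₀)]
    nlinarith [sq_nonneg (|x - x₀| - |y - y₀|), sq_nonneg (|y - y₀|), sq_nonneg (|x - x₀|)]
  have q2 : 0 < t ^ (-(3 / 4) : ℝ) := by positivity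
  have q3 : 0 ≤ R := by positivity
  calc _ ≤ 1 / 2 * |x - x₀| * (C * C' * (|x - x₀| + |y - y₀|))
        + 1 / 2 * x₀ * (C1 * C' * t ^ (-(3 / 4) : ℝ)) := by gcongr
    _ = 1 / 2 * (C * C') * (|x - x₀| * (|x - x₀| + |y - y₀|))
        + 1 / 2 * (x₀ * C1 * C') * t ^ (-(3 / 4) : ℝ) := by ring
    _ ≤ 1 / 2 * (C * C') * (2 * R) + 1 / 2 * (x₀ * C1 * C') * t ^ (-(3 / 4) : ℝ) := by gcongr
    _ ≤ _ := by
      have g1 : 0 ≤ C * C' * t ^ (-(3 / 4) : ℝ) := by positivity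
      have g2 : 0 ≤ x₀ * C1 * C' * R := by positivity
      have g3 : 0 ≤ x₀ * C1 * C' * t ^ (-(3 / 4) : ℝ) := by positivity
      linarith

/-- Integrated in t, the two errors give R · (1/R) = 1 and Γ(1/4) R^(-1/4). Both are weaker than the
main term, which is of order |x - x₀|/R. -/
theorem exists_abs_rpow_mul_heatGrad_sub_le {α β x₀ y₀ : ℝ} (hα : 0 < α) (hβ : 0 < β)
    (hx₀ : 0 < x₀) (hy₀ : 0 < y₀) :
    ∃ K, 0 < K ∧ ∀ x ∈ Icc (x₀ / 2) (3 * x₀ / 2), ∀ y ∈ Icc (y₀ / 2) (3 * y₀ / 2),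
      0 < (x - x₀) ^ 2 + (y - y₀) ^ 2 →
      |y ^ (2 * β) * heatGrad α β x₀ y₀ x y
        - poleCoeff α β x₀ y₀ ((x - x₀) ^ 2 + (y - y₀) ^ 2) * (x - x₀)|
      ≤ K * (1 + ((x - x₀) ^ 2 + (y - y₀) ^ 2) ^ (-(1 / 4) : ℝ)) := by
  obtain ⟨K, hK, hb⟩ := abs_poleCoeff_integrand_sub_le hα hβ hx₀ hy₀
  have hΓ := Real.Gamma_pos_of_pos (show (0 : ℝ) < 1 / 4 by norm_num)
  refine ⟨K * (1 + Real.Gamma (1 / 4)), by positivity, fun x hx y hy hr => ?_⟩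
  set R := (x - x₀) ^ 2 + (y - y₀) ^ 2 with hR
  have hx0 : 0 < x := by linarith [hx.1]
  have hy0 : 0 < y := by linarith [hy.1]
  have i1 := (integrableOn_heatGrad hα hβ hx0.le hy0.le hx₀.le hy₀.le hr).const_mul (y ^ (2 * β))
  have i2 := (integrableOn_poleCoeff hα hβ hx₀ hy₀ hr).const_mul (1 / 2 * (x - x₀))
  have i3 : IntegrableOn (fun t => R * Real.exp (-R * t)) (Ioi 0) :=
    (exp_neg_integrableOn_Ioi 0 hr).const_mul R
  have i4 : IntegrableOn (fun t : ℝ => t ^ (-(3 / 4) : ℝ) * Real.exp (-R * t)) (Ioi 0) :=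
    integrableOn_rpow_mul_exp (by norm_num) hr
  have e1 : y ^ (2 * β) * heatGrad α β x₀ y₀ x y - poleCoeff α β x₀ y₀ R * (x - x₀)
      = ∫ t in Ioi (0 : ℝ), (y ^ (2 * β) * (heatFlux α x₀ t x * besselHeat β y₀ t y)
        - 1 / 2 * (x - x₀) * (heatProfile α x₀ t x₀ * heatProfile β y₀ t y₀ / t
          * Real.exp (-R * t))) := by
    rw [integral_sub i1 i2, integral_const_mul, integral_const_mul, heatGrad, poleCoeff]
    ring
  have i5 : ∫ t in Ioi (0 : ℝ), t ^ (-(3 / 4) : ℝ) * Real.exp (-R * t)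
      = R ^ (-(1 / 4) : ℝ) * Real.Gamma (1 / 4) := by
    have := Real.integral_rpow_mul_exp_neg_mul_Ioi (a := 1 / 4) (by norm_num) hr
    rw [one_div R, Real.inv_rpow hr.le, ← Real.rpow_neg hr.le] at this
    rw [← this]
    refine setIntegral_congr_fun measurableSet_Ioi fun t _ => ?_
    norm_num
  rw [e1, ← Real.norm_eq_abs]
  have i6 : IntegrableOn (fun t => K * ((R + t ^ (-(3 / 4) : ℝ)) * Real.exp (-R * t))) (Ioi 0) := by
    simp only [add_mul]
    exact (i3.add i4).const_mul K
  refine (norm_integral_le_of_norm_le i6 ?_).trans ?_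
  · filter_upwards [ae_restrict_mem measurableSet_Ioi] with t ht using hb t ht x hx y hy
  · simp only [add_mul]
    rw [integral_const_mul, integral_add i3 i4, integral_const_mul, integral_exp_neg_mul hr, i5,
      mul_one_div_cancel hr.ne']
    have : 0 < R ^ (-(1 / 4) : ℝ) := by positivity
    have g1 : 0 < K * Real.Gamma (1 / 4) := by positivity
    have g2 : 0 < K * R ^ (-(1 / 4) : ℝ) := by positivity
    linarith

/-! ### The flux form and its potential -/

/-- The flux of the fundamental solution with pole `p`, as a linear form in `v` at the point `z`. -/
noncomputable def streamForm (α β : ℝ) (p z v : ℂ) : ℝ :=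
  z.re ^ (2 * α) * heatGrad β α p.im p.re z.im z.re * v.re
    - z.im ^ (2 * β) * heatGrad α β p.re p.im z.re z.im * v.im

theorem poleCoeff_comm (α β x₀ y₀ R : ℝ) : poleCoeff β α y₀ x₀ R = poleCoeff α β x₀ y₀ R := by
  simp only [poleCoeff, mul_comm]

theorem re_sub_sq_add_im_sub_sq (z p : ℂ) :
    (z.re - p.re) ^ 2 + (z.im - p.im) ^ 2 = ‖z - p‖ ^ 2 := by
  rw [Complex.sq_norm, Complex.normSq_apply, Complex.sub_re, Complex.sub_im]
  ring

theorem im_div_eq (v w : ℂ) : (v / w).im = (w.re * v.im - w.im * v.re) / ‖w‖ ^ 2 := by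
  rw [Complex.div_im, Complex.sq_norm]
  ring

/-- The leading parts of the two components share one coefficient, by `poleCoeff_comm`, and combine
into a multiple of the angle form Im(v/(z - p)). The error r^(-1/2) is integrable along an arc
through the pole. -/
theorem exists_streamForm_bound {α β : ℝ} (hα : 0 < α) (hβ : 0 < β) {p : ℂ} (hp : 0 < p.re)
    (hp' : 0 < p.im) :
    ∃ K, 0 < K ∧ ∃ δ, 0 < δ ∧ ∀ z, z ≠ p → ‖z - p‖ < δ → ∀ v,
      |streamForm α β p z v + poleCoeff α β p.re p.im (‖z - p‖ ^ 2) * ‖z - p‖ ^ 2 *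
        (v / (z - p)).im| ≤ K * ‖z - p‖ ^ (-(1 / 2) : ℝ) * ‖v‖ := by
  obtain ⟨K, hK, hb⟩ := exists_abs_rpow_mul_heatGrad_sub_le hα hβ hp hp'
  obtain ⟨K', hK', hb'⟩ := exists_abs_rpow_mul_heatGrad_sub_le hβ hα hp' hp
  refine ⟨2 * K + 2 * K', by positivity, min 1 (min (p.re / 2) (p.im / 2)), by positivity,
    fun z hz hzδ v => ?_⟩
  have hw : 0 < ‖z - p‖ := norm_pos_iff.2 (sub_ne_zero.2 hz)
  have hR := re_sub_sq_add_im_sub_sq z p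
  have hR' : (z.im - p.im) ^ 2 + (z.re - p.re) ^ 2 = ‖z - p‖ ^ 2 := by rw [← hR]; ring
  have h1 := (Complex.abs_re_le_norm (z - p)).trans_lt hzδ
  have h2 := (Complex.abs_im_le_norm (z - p)).trans_lt hzδ
  rw [Complex.sub_re, abs_lt] at h1
  rw [Complex.sub_im, abs_lt] at h2
  have m1 : min 1 (min (p.re / 2) (p.im / 2)) ≤ p.re / 2 :=
    (min_le_right _ _).trans (min_le_left _ _)
  have m2 : min 1 (min (p.re / 2) (p.im / 2)) ≤ p.im / 2 :=
    (min_le_right _ _).trans (min_le_right _ _)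
  have b1 := hb z.re ⟨by linarith, by linarith⟩ z.im ⟨by linarith, by linarith⟩
    (by rw [hR]; positivity)
  have b2 := hb' z.im ⟨by linarith, by linarith⟩ z.re ⟨by linarith, by linarith⟩
    (by rw [hR']; positivity)
  rw [hR] at b1
  rw [hR', poleCoeff_comm] at b2
  have e1 : (‖z - p‖ ^ 2) ^ (-(1 / 4) : ℝ) = ‖z - p‖ ^ (-(1 / 2) : ℝ) := by
    rw [← Real.rpow_natCast, ← Real.rpow_mul hw.le]
    norm_num
  rw [e1] at b1 b2
  have h3 : 1 ≤ ‖z - p‖ ^ (-(1 / 2) : ℝ) := Real.one_le_rpow_of_pos_of_le_one_of_nonpos hw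
    (hzδ.le.trans (min_le_left _ _)) (by norm_num)
  set N := ‖z - p‖ ^ (-(1 / 2) : ℝ)
  set h := poleCoeff α β p.re p.im (‖z - p‖ ^ 2)
  have e2 : streamForm α β p z v + h * ‖z - p‖ ^ 2 * (v / (z - p)).im
      = (z.re ^ (2 * α) * heatGrad β α p.im p.re z.im z.re - h * (z.im - p.im)) * v.re
        - (z.im ^ (2 * β) * heatGrad α β p.re p.im z.re z.im - h * (z.re - p.re)) * v.im := by
    rw [streamForm, im_div_eq, Complex.sub_re, Complex.sub_im]
    field_simp
    ring
  rw [e2]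
  refine (abs_sub _ _).trans ?_
  rw [abs_mul, abs_mul]
  have v1 := Complex.abs_re_le_norm v
  have v2 := Complex.abs_im_le_norm v
  calc _ ≤ K' * (1 + N) * ‖v‖ + K * (1 + N) * ‖v‖ := by gcongr
    _ = (K' + K) * (1 + N) * ‖v‖ := by ring
    _ ≤ (K' + K) * (N + N) * ‖v‖ := by gcongr
    _ = _ := by ring

/-- Replacing the coefficient by its limit 1/(2π) identifies the singular part exactly: the flux
form is -dθ/(2π) up to o(1/r). -/
theorem eventually_abs_streamForm_add_le {α β : ℝ} (hα : 0 < α) (hβ : 0 < β) {p : ℂ}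
    (hp : 0 < p.re) (hp' : 0 < p.im) {ε : ℝ} (hε : 0 < ε) :
    ∃ δ, 0 < δ ∧ ∀ z, z ≠ p → ‖z - p‖ < δ → ∀ v,
      |streamForm α β p z v + (v / (z - p)).im / (2 * Real.pi)| ≤ ε / ‖z - p‖ * ‖v‖ := by
  obtain ⟨K, hK, δ₁, hδ₁, hb⟩ := exists_streamForm_bound hα hβ hp hp'
  have h1 := tendsto_poleCoeff hα hβ hp hp'
  have h2 : Tendsto (fun r : ℝ => r ^ 2) (𝓝[>] 0) (𝓝[>] 0) := by
    refine tendsto_nhdsWithin_iff.2 ⟨?_, ?_⟩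
    · have : Tendsto (fun r : ℝ => r ^ 2) (𝓝 0) (𝓝 (0 ^ 2)) := (continuous_pow 2).tendsto 0
      rw [zero_pow two_ne_zero] at this
      exact this.mono_left nhdsWithin_le_nhds
    · filter_upwards [self_mem_nhdsWithin] with r hr
      exact pow_pos (mem_Ioi.1 hr) 2
  have h3 := (Metric.tendsto_nhds.1 (h1.comp h2)) (ε / 2) (by positivity)
  have h4 : ∀ᶠ r : ℝ in 𝓝[>] 0, K * r ^ (1 / 2 : ℝ) < ε / 2 := by
    have : Tendsto (fun r : ℝ => K * r ^ (1 / 2 : ℝ)) (𝓝 0) (𝓝 (K * 0 ^ (1 / 2 : ℝ))) :=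
      (continuous_const.mul (Real.continuous_rpow_const (by norm_num))).tendsto 0
    rw [Real.zero_rpow (by norm_num), mul_zero] at this
    exact (this.mono_left nhdsWithin_le_nhds).eventually_lt_const (by positivity)
  obtain ⟨δ₂, hδ₂, h5⟩ := mem_nhdsGT_iff_exists_Ioo_subset.1 (h3.and h4)
  refine ⟨min δ₁ δ₂, lt_min hδ₁ hδ₂, fun z hz hzδ v => ?_⟩
  have hw : 0 < ‖z - p‖ := norm_pos_iff.2 (sub_ne_zero.2 hz)
  obtain ⟨h6, h7⟩ := h5 ⟨hw, hzδ.trans_le (min_le_right _ _)⟩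
  have h8 := hb z hz (hzδ.trans_le (min_le_left _ _)) v
  rw [Function.comp, Real.dist_eq] at h6
  set c := poleCoeff α β p.re p.im (‖z - p‖ ^ 2) * ‖z - p‖ ^ 2
  have h9 : |(v / (z - p)).im| ≤ ‖v‖ / ‖z - p‖ := by
    rw [← norm_div]
    exact Complex.abs_im_le_norm _
  have e1 : ‖z - p‖ ^ (-(1 / 2) : ℝ) = ‖z - p‖ ^ (1 / 2 : ℝ) / ‖z - p‖ := by
    rw [← Real.rpow_sub_one hw.ne']
    norm_num
  rw [e1] at h8
  have e2 : streamForm α β p z v + (v / (z - p)).im / (2 * Real.pi)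
      = (streamForm α β p z v + c * (v / (z - p)).im)
        - (c - 1 / (2 * Real.pi)) * (v / (z - p)).im := by ring
  rw [e2]
  refine (abs_sub _ _).trans ?_
  rw [abs_mul]
  calc _ ≤ K * (‖z - p‖ ^ (1 / 2 : ℝ) / ‖z - p‖) * ‖v‖ + ε / 2 * (‖v‖ / ‖z - p‖) := by
        gcongr
    _ = (K * ‖z - p‖ ^ (1 / 2 : ℝ) + ε / 2) * (‖v‖ / ‖z - p‖) := by ring
    _ ≤ (ε / 2 + ε / 2) * (‖v‖ / ‖z - p‖) := by gcongr
    _ = _ := by ring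

theorem hasDerivAt_re_comp {z : ℝ → ℂ} {v : ℂ} {τ : ℝ} (hz : HasDerivAt z v τ) :
    HasDerivAt (fun τ => (z τ).re) v.re τ :=
  Complex.reCLM.hasFDerivAt.comp_hasDerivAt τ hz

theorem hasDerivAt_im_comp {z : ℝ → ℂ} {v : ℂ} {τ : ℝ} (hz : HasDerivAt z v τ) :
    HasDerivAt (fun τ => (z τ).im) v.im τ :=
  Complex.imCLM.hasFDerivAt.comp_hasDerivAt τ hz

theorem hasDerivAt_comp_complex_pair {F : ℝ × ℝ → ℝ} {A B : ℝ} {z : ℝ → ℂ} {v : ℂ} {τ : ℝ}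
    (hz : HasDerivAt z v τ)
    (hF : HasFDerivAt F (A • ContinuousLinearMap.fst ℝ ℝ ℝ + B • ContinuousLinearMap.snd ℝ ℝ ℝ)
      ((z τ).re, (z τ).im)) :
    HasDerivAt (fun τ => F ((z τ).re, (z τ).im)) (A * v.re + B * v.im) τ := by
  refine (hF.comp_hasDerivAt τ
    ((hasDerivAt_re_comp hz).prodMk (hasDerivAt_im_comp hz))).congr_deriv ?_
  simp

theorem hasDerivAt_heatStream_comp {α β : ℝ} (hα : 0 < α) (hβ : 0 < β) {p : ℂ} (hp : 0 ≤ p.re)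
    (hp' : 0 ≤ p.im) {z : ℝ → ℂ} {v : ℂ} {τ : ℝ} (hz : HasDerivAt z v τ) (hre : 0 < (z τ).re)
    (him : 0 < (z τ).im) (hne : (z τ).re ≠ p.re) :
    HasDerivAt (fun τ => heatStream α β p.re p.im (z τ).re (z τ).im)
      (-streamForm α β p (z τ) v) τ := by
  refine (hasDerivAt_comp_complex_pair hz
    (hasFDerivAt_heatStream hα hβ hre him hp hp' hne)).congr_deriv ?_
  rw [streamForm]
  ring

/-- The second local potential, valid off the horizontal line through the pole, obtained from the
first by reflection in the diagonal. The two domains cover the punctured quadrant. -/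
theorem hasDerivAt_heatStream_comp_swap {α β : ℝ} (hα : 0 < α) (hβ : 0 < β) {p : ℂ}
    (hp : 0 ≤ p.re) (hp' : 0 ≤ p.im) {z : ℝ → ℂ} {v : ℂ} {τ : ℝ} (hz : HasDerivAt z v τ)
    (hre : 0 < (z τ).re) (him : 0 < (z τ).im) (hne : (z τ).im ≠ p.im) :
    HasDerivAt (fun τ => heatStream β α p.im p.re (z τ).im (z τ).re)
      (streamForm α β p (z τ) v) τ := by
  have h1 : HasDerivAt (fun τ => (⟨(z τ).im, (z τ).re⟩ : ℂ)) ⟨v.im, v.re⟩ τ := by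
    have h2 := (hasDerivAt_re_comp hz).ofReal_comp
    have h3 := (hasDerivAt_im_comp hz).ofReal_comp
    refine ((h3.fun_add (h2.mul_const Complex.I)).congr_deriv ?_).congr_of_eventuallyEq
      (Eventually.of_forall fun t => ?_)
    · simp [Complex.ext_iff]
    · simp [Complex.ext_iff]
  have h4 := hasDerivAt_heatStream_comp hβ hα (p := ⟨p.im, p.re⟩) hp' hp h1 him hre hne
  refine h4.congr_deriv ?_
  simp only [streamForm]
  ring

theorem hasDerivAt_arg_comp {p c : ℂ} {z : ℝ → ℂ} {v : ℂ} {τ : ℝ} (hz : HasDerivAt z v τ)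
    (hc : c ≠ 0) (hs : c * (z τ - p) ∈ Complex.slitPlane) :
    HasDerivAt (fun τ => Complex.arg (c * (z τ - p))) (v / (z τ - p)).im τ := by
  have h1 := ((hz.sub_const p).const_mul c).clog_real hs
  have h2 := hasDerivAt_im_comp h1
  simp only [Complex.log_im] at h2
  rwa [mul_div_mul_left _ _ hc] at h2

theorem I_mul_mem_slitPlane {w : ℂ} (h : w.im < 0 ∨ w.re ≠ 0) :
    Complex.I * w ∈ Complex.slitPlane := by
  rw [Complex.mem_slitPlane_iff]
  simpa using h

theorem neg_I_mul_mem_slitPlane {w : ℂ} (h : 0 < w.im) :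
    -Complex.I * w ∈ Complex.slitPlane := by
  rw [Complex.mem_slitPlane_iff]
  left
  simpa using h

/-- A single-valued potential on the punctured quadrant of the flux form with pole `p`, corrected
by the form of the angle around `p`. -/
noncomputable def fluxPotential (α β : ℝ) (p z : ℂ) : ℝ :=
  if z.im < p.im then
    heatStream β α p.im p.re z.im z.re + Complex.arg (Complex.I * (z - p)) / (2 * Real.pi)
  else if p.im < z.im then
    heatStream β α p.im p.re z.im z.re - 1 / 2
      + Complex.arg (-Complex.I * (z - p)) / (2 * Real.pi)
  else
    -heatStream α β p.re p.im z.re z.im + Complex.arg (Complex.I * (z - p)) / (2 * Real.pi)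

/-- Off the vertical line through the pole the three branches agree. Changing the stream function
introduces the constant 0 or 1, and rotating the branch of the argument by a half turn introduces +π
or -π; divided by 2π and combined with the offset 1/2 these cancel. -/
theorem fluxPotential_of_re_ne {α β : ℝ} (hα : 0 < α) (hβ : 0 < β) {p z : ℂ} (hp : 0 ≤ p.re)
    (hp' : 0 ≤ p.im) (hre : 0 ≤ z.re) (him : 0 ≤ z.im) (hne : z.re ≠ p.re) :
    fluxPotential α β p z =
      -heatStream α β p.re p.im z.re z.im
        + Complex.arg (Complex.I * (z - p)) / (2 * Real.pi) := by
  have hpi := Real.pi_pos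
  rw [fluxPotential]
  split_ifs with h1 h2
  · have := heatStream_add_heatStream_of_lt_right hα hβ hre him hp hp' hne h1
    rw [show heatStream β α p.im p.re z.im z.re = -heatStream α β p.re p.im z.re z.im by linarith]
  · have e : -Complex.I * (z - p) = -(Complex.I * (z - p)) := by ring
    have hIm : (Complex.I * (z - p)).im = z.re - p.re := by simp
    rcases lt_or_gt_of_ne hne with h3 | h3
    · have h4 := heatStream_add_heatStream_of_lt_left hα hβ hre him hp hp' h3 h2.ne'
      rw [e, Complex.arg_neg_eq_arg_add_pi_of_im_neg (by rw [hIm]; linarith),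
        show heatStream β α p.im p.re z.im z.re = -heatStream α β p.re p.im z.re z.im by linarith]
      field_simp
      ring
    · have h4 := heatStream_add_heatStream_of_gt hα hβ hp hp' h3 h2
      rw [e, Complex.arg_neg_eq_arg_sub_pi_of_im_pos (by rw [hIm]; linarith),
        show heatStream β α p.im p.re z.im z.re = 1 - heatStream α β p.re p.im z.re z.im by
          linarith]
      field_simp
      ring
  · rfl

/-- On the vertical line through the pole the branches below and above are differentiated directly
with the swapped stream function; elsewhere the common formula of `fluxPotential_of_re_ne` applies.
-/
theorem hasDerivAt_fluxPotential {α β : ℝ} (hα : 0 < α) (hβ : 0 < β) {p : ℂ} (hp : 0 ≤ p.re)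
    (hp' : 0 ≤ p.im) {z : ℝ → ℂ} {v : ℂ} {τ : ℝ} (hz : HasDerivAt z v τ) (hre : 0 < (z τ).re)
    (him : 0 < (z τ).im) (hne : z τ ≠ p) :
    HasDerivAt (fun τ => fluxPotential α β p (z τ))
      (streamForm α β p (z τ) v + (v / (z τ - p)).im / (2 * Real.pi)) τ := by
  have cre : ContinuousAt (fun τ => (z τ).re) τ :=
    Complex.continuous_re.continuousAt.comp hz.continuousAt
  have cim : ContinuousAt (fun τ => (z τ).im) τ :=
    Complex.continuous_im.continuousAt.comp hz.continuousAt
  by_cases h : (z τ).re = p.re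
  · have h' : (z τ).im ≠ p.im := fun h' => hne (Complex.ext h h')
    have hS := hasDerivAt_heatStream_comp_swap hα hβ hp hp' hz hre him h'
    rcases lt_or_gt_of_ne h' with h1 | h1
    · have hA := hasDerivAt_arg_comp (p := p) hz Complex.I_ne_zero
        (I_mul_mem_slitPlane (Or.inl (by rw [Complex.sub_im]; linarith)))
      refine (hS.fun_add (hA.div_const (2 * Real.pi))).congr_of_eventuallyEq ?_
      filter_upwards [cim.eventually_lt_const h1] with t ht
      rw [fluxPotential, if_pos ht]
    · have hA := hasDerivAt_arg_comp (p := p) hz (neg_ne_zero.2 Complex.I_ne_zero)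
        (neg_I_mul_mem_slitPlane (by rw [Complex.sub_im]; linarith))
      refine ((hS.sub_const (1 / 2)).fun_add
        (hA.div_const (2 * Real.pi))).congr_of_eventuallyEq ?_
      filter_upwards [cim.eventually_const_lt h1] with t ht
      rw [fluxPotential, if_neg (not_lt.2 (le_of_lt ht)), if_pos ht]
  · have hS := hasDerivAt_heatStream_comp hα hβ hp hp' hz hre him h
    have hA := hasDerivAt_arg_comp (p := p) hz Complex.I_ne_zero
      (I_mul_mem_slitPlane (Or.inr (by rw [Complex.sub_re, sub_ne_zero]; exact h)))
    have h2 := hS.fun_neg.fun_add (hA.div_const (2 * Real.pi))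
    rw [neg_neg] at h2
    refine h2.congr_of_eventuallyEq ?_
    filter_upwards [cre.eventually_const_lt hre, cim.eventually_const_lt him,
      cre.eventually_ne h] with t h3 h4 h5
    exact fluxPotential_of_re_ne hα hβ hp hp' (le_of_lt h3) (le_of_lt h4) h5

/-- Two points at comparable distance r from the pole are joined by a spiral of length O(r), along
which the derivative of the corrected potential is o(1/r). So the potential cannot jump when an arc
passes through the pole. -/
theorem abs_fluxPotential_sub_le {α β : ℝ} (hα : 0 < α) (hβ : 0 < β) {p : ℂ}
    (hp : 0 < p.re) (hp' : 0 < p.im) {ε : ℝ} (hε : 0 < ε) :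
    ∃ δ, 0 < δ ∧ ∀ z z', z ≠ p → z' ≠ p → ‖z - p‖ < δ → ‖z' - p‖ < δ →
      ‖z' - p‖ ≤ 2 * ‖z - p‖ → ‖z - p‖ ≤ 2 * ‖z' - p‖ →
      |fluxPotential α β p z' - fluxPotential α β p z| ≤ ε := by
  have hpi := Real.pi_pos
  -- The spiral has speed at most 1 + 2π times its current radius.
  obtain ⟨δ, hδ, hb⟩ := eventually_abs_streamForm_add_le hα hβ hp hp'
    (show 0 < ε / (1 + 2 * Real.pi) by positivity)
  refine ⟨min δ (min p.re p.im), by positivity, fun z z' hz hz' h1 h2 h3 h4 => ?_⟩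
  set r := ‖z - p‖ with hr
  set r' := ‖z' - p‖ with hr'
  have hr0 : 0 < r := norm_pos_iff.2 (sub_ne_zero.2 hz)
  have hr0' : 0 < r' := norm_pos_iff.2 (sub_ne_zero.2 hz')
  set θ := Complex.arg (z - p)
  set θ' := Complex.arg (z' - p)
  -- Radius and angle are interpolated linearly, so the path avoids the pole; as r and r' are
  -- smaller than both coordinates of p, it stays in the quadrant.
  set ρ : ℝ → ℝ := fun τ => r + τ * (r' - r) with hρ
  set E : ℝ → ℂ := fun τ => Complex.exp (((θ + τ * (θ' - θ) : ℝ) : ℂ) * Complex.I) with hE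
  set c : ℝ → ℂ := fun τ => p + (ρ τ : ℂ) * E τ with hc
  have hEn : ∀ τ, ‖E τ‖ = 1 := fun τ => Complex.norm_exp_ofReal_mul_I _
  have c0 : c 0 = z := by
    simp only [hc, hρ, hE, zero_mul, add_zero]
    rw [hr, Complex.norm_mul_exp_arg_mul_I]
    ring
  have c1 : c 1 = z' := by
    simp only [hc, hρ, hE, one_mul, add_sub_cancel]
    rw [hr', Complex.norm_mul_exp_arg_mul_I]
    ring
  have hρd : ∀ τ, HasDerivAt ρ (r' - r) τ := fun τ => by
    have := ((hasDerivAt_id τ).mul_const (r' - r)).const_add r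
    rwa [one_mul] at this
  have hEd : ∀ τ, HasDerivAt E (E τ * ((θ' - θ : ℝ) * Complex.I)) τ := fun τ => by
    have h5 : HasDerivAt (fun τ : ℝ => θ + τ * (θ' - θ)) (θ' - θ) τ := by
      simpa using ((hasDerivAt_id τ).mul_const (θ' - θ)).const_add θ
    exact (h5.ofReal_comp.mul_const Complex.I).cexp
  have hcd : ∀ τ, HasDerivAt c
      (((r' - r : ℝ) : ℂ) * E τ + (ρ τ : ℂ) * (E τ * ((θ' - θ : ℝ) * Complex.I))) τ := fun τ =>
    ((hρd τ).ofReal_comp.fun_mul (hEd τ)).const_add p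
  have hρmin : ∀ τ ∈ Icc (0 : ℝ) 1, min r r' ≤ ρ τ ∧ ρ τ ≤ max r r' := fun τ hτ => by
    have e : ρ τ = (1 - τ) * r + τ * r' := by simp only [hρ]; ring
    have a1 := hτ.1
    have a2 : 0 ≤ 1 - τ := by linarith [hτ.2]
    rw [e]
    constructor
    · calc min r r' = (1 - τ) * min r r' + τ * min r r' := by ring
        _ ≤ _ := by gcongr; exacts [min_le_left _ _, min_le_right _ _]
    · calc (1 - τ) * r + τ * r' ≤ (1 - τ) * max r r' + τ * max r r' := by
            gcongr; exacts [le_max_left _ _, le_max_right _ _]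
        _ = _ := by ring
  have hρ0 : ∀ τ ∈ Icc (0 : ℝ) 1, 0 < ρ τ := fun τ hτ =>
    (lt_min hr0 hr0').trans_le (hρmin τ hτ).1
  have hcn : ∀ τ ∈ Icc (0 : ℝ) 1, ‖c τ - p‖ = ρ τ := fun τ hτ => by
    simp only [hc, add_sub_cancel_left, norm_mul, hEn, mul_one, Complex.norm_real,
      Real.norm_eq_abs, abs_of_pos (hρ0 τ hτ)]
  have hlt : ∀ τ ∈ Icc (0 : ℝ) 1, ‖c τ - p‖ < min δ (min p.re p.im) := fun τ hτ => by
    rw [hcn τ hτ]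
    exact (hρmin τ hτ).2.trans_lt (max_lt h1 h2)
  have hθ : |θ' - θ| ≤ 2 * Real.pi := by
    have := Complex.arg_mem_Ioc (z - p)
    have := Complex.arg_mem_Ioc (z' - p)
    rw [abs_le]
    constructor <;> linarith [this.1, this.2, (Complex.arg_mem_Ioc (z - p)).1,
      (Complex.arg_mem_Ioc (z - p)).2]
  -- This is where the factor 2 between the distances is used.
  have hmin : |r' - r| ≤ min r r' := by
    rw [abs_le]
    constructor <;> rcases le_total r r' with h | h <;> simp only [min_eq_left, min_eq_right, h] <;>
      linarith
  have key := (convex_Icc (0 : ℝ) 1).norm_image_sub_le_of_norm_hasDerivWithin_le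
    (f := fun τ => fluxPotential α β p (c τ)) (C := ε)
    (f' := fun τ => streamForm α β p (c τ)
        (((r' - r : ℝ) : ℂ) * E τ + (ρ τ : ℂ) * (E τ * ((θ' - θ : ℝ) * Complex.I)))
      + ((((r' - r : ℝ) : ℂ) * E τ + (ρ τ : ℂ) * (E τ * ((θ' - θ : ℝ) * Complex.I)))
        / (c τ - p)).im / (2 * Real.pi))
    (fun τ hτ => ?_) (fun τ hτ => ?_) (left_mem_Icc.2 zero_le_one) (right_mem_Icc.2 zero_le_one)
  · simpa [c0, c1] using key
  · have a0 : c τ ≠ p := by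
      have := hρ0 τ hτ
      rw [← hcn τ hτ, norm_pos_iff, sub_ne_zero] at this
      exact this
    have a1 := (Complex.abs_re_le_norm (c τ - p)).trans_lt ((hlt τ hτ).trans_le
      ((min_le_right _ _).trans (min_le_left _ _)))
    have a2 := (Complex.abs_im_le_norm (c τ - p)).trans_lt ((hlt τ hτ).trans_le
      ((min_le_right _ _).trans (min_le_right _ _)))
    rw [Complex.sub_re, abs_lt] at a1
    rw [Complex.sub_im, abs_lt] at a2
    exact (hasDerivAt_fluxPotential hα hβ hp.le hp'.le (hcd τ) (by linarith) (by linarith)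
      a0).hasDerivWithinAt
  · have a0 : c τ ≠ p := by
      have := hρ0 τ hτ
      rw [← hcn τ hτ, norm_pos_iff, sub_ne_zero] at this
      exact this
    refine (hb (c τ) a0 ((hlt τ hτ).trans_le (min_le_left _ _)) _).trans ?_
    rw [hcn τ hτ]
    have a3 : ‖((r' - r : ℝ) : ℂ) * E τ + (ρ τ : ℂ) * (E τ * ((θ' - θ : ℝ) * Complex.I))‖
        ≤ ρ τ * (1 + 2 * Real.pi) := by
      refine (norm_add_le _ _).trans ?_
      rw [norm_mul, norm_mul, norm_mul, norm_mul, hEn, Complex.norm_I, Complex.norm_real,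
        Complex.norm_real, Complex.norm_real, Real.norm_eq_abs, Real.norm_eq_abs,
        Real.norm_eq_abs, abs_of_pos (hρ0 τ hτ)]
      have := hmin.trans (hρmin τ hτ).1
      have := hρ0 τ hτ
      nlinarith
    have a4 := hρ0 τ hτ
    calc _ ≤ ε / (1 + 2 * Real.pi) / ρ τ * (ρ τ * (1 + 2 * Real.pi)) := by gcongr
      _ = ε := by field_simp

/-! ### Arcs across the quadrant -/

/-- A simple arc in the quadrant from the real to the imaginary axis, parametrized by arc length,
with Lipschitz tangent `v`, and orthogonal to the axes. -/
structure IsQuadrantArc (l : ℝ) (γ v : ℝ → ℂ) : Prop where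
  l_pos : 0 < l
  hasDeriv : ∀ s ∈ Icc 0 l, HasDerivWithinAt γ (v s) (Icc 0 l) s
  norm_v : ∀ s ∈ Icc 0 l, ‖v s‖ = 1
  lipschitz : ∃ K, 0 < K ∧ ∀ s ∈ Icc 0 l, ∀ t ∈ Icc 0 l, ‖v s - v t‖ ≤ K * |s - t|
  inj : InjOn γ (Icc 0 l)
  re_pos : ∀ s ∈ Ico 0 l, 0 < (γ s).re
  im_pos : ∀ s ∈ Ioc 0 l, 0 < (γ s).im
  start_im : (γ 0).im = 0
  end_re : (γ l).re = 0
  start_v : (v 0).re = 0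
  end_v : (v l).im = 0

/-- The reflection in the diagonal. -/
def swapC (z : ℂ) : ℂ := ⟨z.im, z.re⟩

theorem swapC_eq (z : ℂ) : swapC z = Complex.I * (starRingEnd ℂ) z := by
  simp [swapC, Complex.ext_iff]

theorem norm_swapC (z : ℂ) : ‖swapC z‖ = ‖z‖ := by
  rw [swapC_eq, norm_mul, Complex.norm_I, one_mul, RCLike.norm_conj]

theorem swapC_sub (z w : ℂ) : swapC z - swapC w = swapC (z - w) := by
  simp [swapC, Complex.ext_iff]

/-- Reflection exchanges the two terms of the form; the sign of the velocity is that of the reversed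
parametrization. -/
theorem streamForm_swapC (α β : ℝ) (p z v : ℂ) :
    streamForm β α (swapC p) (swapC z) (-swapC v) = streamForm α β p z v := by
  simp only [streamForm, swapC, Complex.neg_re, Complex.neg_im]
  ring

namespace IsQuadrantArc

variable {l : ℝ} {γ v : ℝ → ℂ}

/-- Allows everything proved at the real axis to be used at the imaginary axis, with α and β
exchanged. -/
theorem reverse (h : IsQuadrantArc l γ v) :
    IsQuadrantArc l (fun s => swapC (γ (l - s))) (fun s => -swapC (v (l - s))) := by
  have hm : ∀ s ∈ Icc 0 l, l - s ∈ Icc 0 l := fun s hs =>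
    ⟨by linarith [hs.2], by linarith [hs.1]⟩
  obtain ⟨K, hK, hb⟩ := h.lipschitz
  refine ⟨h.l_pos, fun s hs => ?_, fun s hs => ?_, ⟨K, hK, fun s hs t ht => ?_⟩, fun s hs t ht hst =>
    ?_, fun s hs => ?_, fun s hs => ?_, ?_, ?_, ?_, ?_⟩
  · have h1 : HasDerivWithinAt (fun s => l - s) (-1 : ℝ) (Icc 0 l) s := by
      simpa using (hasDerivWithinAt_id s (Icc 0 l)).const_sub l
    have h2 := (h.hasDeriv (l - s) (hm s hs)).scomp s h1 hm
    have h3 : HasDerivWithinAt (fun s => Complex.I * (starRingEnd ℂ) (γ (l - s)))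
        (Complex.I * (starRingEnd ℂ) ((-1 : ℝ) • v (l - s))) (Icc 0 l) s :=
      (Complex.conjCLE.toContinuousLinearMap.hasFDerivAt.comp_hasDerivWithinAt s h2).const_mul
        Complex.I
    simp only [swapC_eq]
    refine h3.congr_deriv ?_
    simp
  · rw [norm_neg, norm_swapC]
    exact h.norm_v _ (hm s hs)
  · rw [neg_sub_neg, swapC_sub, norm_swapC]
    refine (hb _ (hm t ht) _ (hm s hs)).trans (le_of_eq ?_)
    ring_nf
  · have h1 := h.inj (hm s hs) (hm t ht) (by
      have := congrArg swapC hst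
      simpa [swapC] using this)
    linarith
  · exact h.im_pos (l - s) ⟨by linarith [hs.2], by linarith [hs.1]⟩
  · exact h.re_pos (l - s) ⟨by linarith [hs.2], by linarith [hs.1]⟩
  · simp [swapC, h.end_re]
  · simp [swapC, h.start_im]
  · simp [swapC, h.end_v]
  · simp [swapC, h.start_v]

theorem continuousOn (h : IsQuadrantArc l γ v) : ContinuousOn γ (Icc 0 l) := fun s hs =>
  (h.hasDeriv s hs).continuousWithinAt

theorem continuousOn_v (h : IsQuadrantArc l γ v) : ContinuousOn v (Icc 0 l) := by
  obtain ⟨K, hK, hb⟩ := h.lipschitz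
  refine LipschitzOnWith.continuousOn (K := K.toNNReal) (LipschitzOnWith.of_dist_le_mul
    fun s hs t ht => ?_)
  rw [dist_eq_norm, Real.dist_eq, Real.coe_toNNReal _ hK.le]
  exact hb s hs t ht

theorem hasDerivAt (h : IsQuadrantArc l γ v) {s : ℝ} (hs : s ∈ Ioo 0 l) : HasDerivAt γ (v s) s :=
  (h.hasDeriv s (Ioo_subset_Icc_self hs)).hasDerivAt (Icc_mem_nhds hs.1 hs.2)

theorem re_nonneg (h : IsQuadrantArc l γ v) {s : ℝ} (hs : s ∈ Icc 0 l) : 0 ≤ (γ s).re := by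
  rcases hs.2.lt_or_eq with h1 | h1
  · exact (h.re_pos s ⟨hs.1, h1⟩).le
  · rw [h1, h.end_re]

theorem im_nonneg (h : IsQuadrantArc l γ v) {s : ℝ} (hs : s ∈ Icc 0 l) : 0 ≤ (γ s).im := by
  rcases hs.1.lt_or_eq with h1 | h1
  · exact (h.im_pos s ⟨h1, hs.2⟩).le
  · rw [← h1, h.start_im]

/-- First order Taylor expansion with quadratic remainder. -/
theorem exists_taylor (h : IsQuadrantArc l γ v) : ∃ K, 0 < K ∧ ∀ s ∈ Icc 0 l, ∀ t ∈ Icc 0 l,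
    ‖γ t - γ s - ((t - s : ℝ) : ℂ) * v s‖ ≤ K * (t - s) ^ 2 := by
  obtain ⟨K, hK, hb⟩ := h.lipschitz
  refine ⟨K, hK, fun s hs t ht => ?_⟩
  have hsub : uIcc s t ⊆ Icc 0 l := uIcc_subset_Icc hs ht
  have key := (convex_uIcc s t).norm_image_sub_le_of_norm_hasDerivWithin_le
    (f := fun u : ℝ => γ u - ((u - s : ℝ) : ℂ) * v s) (f' := fun u => v u - v s)
    (C := K * |t - s|) (fun u hu => ?_) (fun u hu => ?_) left_mem_uIcc right_mem_uIcc
  · rw [Real.norm_eq_abs] at key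
    calc _ = ‖γ t - ((t - s : ℝ) : ℂ) * v s - (γ s - ((s - s : ℝ) : ℂ) * v s)‖ := by
          congr 1
          push_cast
          ring
      _ ≤ K * |t - s| * |t - s| := key
      _ = K * (|t - s| * |t - s|) := by ring
      _ = _ := by rw [abs_mul_abs_self]; ring
  · have h1 := ((h.hasDeriv u (hsub hu)).mono hsub)
    have h2 : HasDerivWithinAt (fun u : ℝ => u - s) 1 (uIcc s t) u :=
      (hasDerivWithinAt_id u _).sub_const s
    have h3 : HasDerivWithinAt (fun u : ℝ => ((u - s : ℝ) : ℂ)) ((1 : ℝ) : ℂ) (uIcc s t) u :=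
      Complex.ofRealCLM.hasFDerivAt.comp_hasDerivWithinAt u h2
    refine (h1.sub (h3.mul_const (v s))).congr_deriv ?_
    simp
  · refine (hb u (hsub hu) s hs).trans ?_
    refine mul_le_mul_of_nonneg_left ?_ hK.le
    rcases le_total s t with h1 | h1
    · rw [uIcc_of_le h1] at hu
      rw [abs_of_nonneg (by linarith [hu.1]), abs_of_nonneg (by linarith)]
      linarith [hu.2]
    · rw [uIcc_of_ge h1] at hu
      rw [abs_of_nonpos (by linarith [hu.2]), abs_of_nonpos (by linarith)]
      linarith [hu.1]

/-- For nearby parameters the Taylor expansion with unit tangent gives the constant 1/2; for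
parameters at least η apart, injectivity and compactness give a positive minimum. -/
theorem exists_le_norm_sub (h : IsQuadrantArc l γ v) :
    ∃ c, 0 < c ∧ ∀ s₀ ∈ Icc 0 l, ∀ s ∈ Icc 0 l, c * |s - s₀| ≤ ‖γ s - γ s₀‖ := by
  obtain ⟨K, hK, hT⟩ := h.exists_taylor
  have hl := h.l_pos
  -- Within this distance the quadratic remainder is at most half of the linear term.
  set η := 1 / (2 * K) with hη
  have hη0 : 0 < η := by positivity
  set S : Set (ℝ × ℝ) := (Icc 0 l ×ˢ Icc 0 l) ∩ {q | η ≤ |q.2 - q.1|} with hS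
  have hcomp : IsCompact S :=
    (isCompact_Icc.prod isCompact_Icc).inter_right (isClosed_le continuous_const (by fun_prop))
  have hcont : ContinuousOn (fun q : ℝ × ℝ => ‖γ q.2 - γ q.1‖) S :=
    ((h.continuousOn.comp continuousOn_snd fun q hq => hq.1.2).sub
      (h.continuousOn.comp continuousOn_fst fun q hq => hq.1.1)).norm
  have hpos : ∀ q ∈ S, 0 < ‖γ q.2 - γ q.1‖ := fun q hq => by
    rw [norm_pos_iff, sub_ne_zero]
    intro h1
    have h2 := h.inj hq.1.2 hq.1.1 h1
    have h3 : η ≤ |q.2 - q.1| := hq.2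
    rw [h2, sub_self, abs_zero] at h3
    linarith
  obtain ⟨m, hm, hm2⟩ := hcomp.exists_forall_le' hcont hpos
  refine ⟨min (1 / 2) (m / l), by positivity, fun s₀ hs₀ s hs => ?_⟩
  rcases le_total η |s - s₀| with h1 | h1
  · have h2 : |s - s₀| ≤ l := by
      rw [abs_le]
      constructor <;> linarith [hs.1, hs.2, hs₀.1, hs₀.2]
    calc _ ≤ m / l * l := by
          gcongr
          exact min_le_right _ _
      _ = m := by field_simp
      _ ≤ _ := hm2 (s₀, s) ⟨⟨hs₀, hs⟩, h1⟩
  · have h2 := hT s₀ hs₀ s hs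
    have h3 := norm_sub_norm_le (((s - s₀ : ℝ) : ℂ) * v s₀) (γ s - γ s₀)
    rw [norm_sub_rev _ (γ s - γ s₀), norm_mul, h.norm_v s₀ hs₀, mul_one, Complex.norm_real,
      Real.norm_eq_abs] at h3
    have h4 : K * (s - s₀) ^ 2 ≤ 1 / 2 * |s - s₀| := by
      rw [← sq_abs]
      have : K * |s - s₀| ≤ 1 / 2 := by
        calc _ ≤ K * η := by gcongr
          _ = 1 / 2 := by rw [hη]; field_simp
      nlinarith [abs_nonneg (s - s₀)]
    have h5 : min (1 / 2) (m / l) * |s - s₀| ≤ 1 / 2 * |s - s₀| := by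
      gcongr
      exact min_le_left _ _
    linarith

/-- The angular speed seen from a point of the arc is bounded. -/
theorem exists_abs_im_div_le (h : IsQuadrantArc l γ v) :
    ∃ M, 0 < M ∧ ∀ s₀ ∈ Icc 0 l, ∀ s ∈ Icc 0 l, |(v s / (γ s - γ s₀)).im| ≤ M := by
  obtain ⟨K, hK, hT⟩ := h.exists_taylor
  obtain ⟨c, hc, hlow⟩ := h.exists_le_norm_sub
  refine ⟨K / c ^ 2, by positivity, fun s₀ hs₀ s hs => ?_⟩
  -- At s = s₀ the quotient is 0 by the convention for division by zero.
  rcases eq_or_ne s s₀ with h1 | h1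
  · rw [h1, sub_self, div_zero, Complex.zero_im, abs_zero]
    positivity
  have h2 : 0 < |s - s₀| := abs_pos.2 (sub_ne_zero.2 h1)
  have h3 := hlow s₀ hs₀ s hs
  have h4 : 0 < ‖γ s - γ s₀‖ := lt_of_lt_of_le (by positivity) h3
  have h5 := hT s hs s₀ hs₀
  set e := γ s₀ - γ s - ((s₀ - s : ℝ) : ℂ) * v s with he
  have hw : γ s - γ s₀ = ((s - s₀ : ℝ) : ℂ) * v s - e := by
    rw [he]; push_cast; ring
  -- The linear part of the chord is parallel to v s and drops out of the determinant. The quadratic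
  -- remainder is left, over a squared chord of the same order.
  have e1 : (γ s - γ s₀).re * (v s).im - (γ s - γ s₀).im * (v s).re
      = -((starRingEnd ℂ) e * v s).im := by
    rw [hw]
    generalize s - s₀ = δ
    simp only [Complex.sub_re, Complex.sub_im, Complex.mul_re, Complex.ofReal_re, Complex.ofReal_im,
      Complex.mul_im, Complex.conj_re, Complex.conj_im]
    ring
  rw [im_div_eq, e1, abs_div, abs_neg, abs_of_pos (a := ‖γ s - γ s₀‖ ^ 2) (by positivity),
    div_le_div_iff₀ (by positivity) (by positivity)]
  have h6 : |((starRingEnd ℂ) e * v s).im| ≤ K * (s₀ - s) ^ 2 := by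
    refine (Complex.abs_im_le_norm _).trans ?_
    rw [norm_mul, RCLike.norm_conj, h.norm_v s hs, mul_one]
    exact h5
  have h7 : (c * |s - s₀|) ^ 2 ≤ ‖γ s - γ s₀‖ ^ 2 := by gcongr
  rw [mul_pow, sq_abs] at h7
  calc _ ≤ K * (s₀ - s) ^ 2 * c ^ 2 := by gcongr
    _ = K * (c ^ 2 * (s - s₀) ^ 2) := by ring
    _ ≤ _ := by gcongr

theorem exists_norm_le (h : IsQuadrantArc l γ v) : ∃ M, 0 < M ∧ ∀ s ∈ Icc 0 l, ‖γ s‖ ≤ M := by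
  obtain ⟨M, hM⟩ := isCompact_Icc.exists_bound_of_continuousOn h.continuousOn
  exact ⟨max M 1, by positivity, fun s hs => (hM s hs).trans (le_max_left _ _)⟩

end IsQuadrantArc

theorem intervalIntegrable_of_abs_le {l s₀ M C : ℝ} {f : ℝ → ℝ} (hs₀ : s₀ ∈ Icc 0 l)
    (hf : ContinuousOn f (Ioo 0 l \ {s₀}))
    (hb : ∀ s ∈ Ioo 0 l, s ≠ s₀ → |f s| ≤ M + C * |s - s₀| ^ (-(1 / 2) : ℝ)) :
    IntervalIntegrable f volume 0 l := by
  have h1 : IntervalIntegrable (fun s : ℝ => M + C * (s₀ - s) ^ (-(1 / 2) : ℝ)) volume 0 s₀ := by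
    have h2 : IntervalIntegrable (fun s : ℝ => s ^ (-(1 / 2) : ℝ)) volume s₀ 0 :=
      intervalIntegral.intervalIntegrable_rpow' (by norm_num)
    have h3 := h2.comp_sub_left s₀
    rw [sub_self, sub_zero] at h3
    exact intervalIntegrable_const.add (h3.const_mul C)
  have h2 : IntervalIntegrable (fun s : ℝ => M + C * (s - s₀) ^ (-(1 / 2) : ℝ)) volume s₀ l := by
    have h2 : IntervalIntegrable (fun s : ℝ => s ^ (-(1 / 2) : ℝ)) volume 0 (l - s₀) :=
      intervalIntegral.intervalIntegrable_rpow' (by norm_num)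
    have h3 := h2.comp_sub_right s₀
    rw [zero_add, sub_add_cancel] at h3
    exact intervalIntegrable_const.add (h3.const_mul C)
  refine IntervalIntegrable.trans (b := s₀) ?_ ?_
  · rw [intervalIntegrable_iff_integrableOn_Ioo_of_le hs₀.1] at h1 ⊢
    refine Integrable.mono' h1 (ContinuousOn.aestronglyMeasurable (hf.mono fun s hs => ?_)
      measurableSet_Ioo) ?_
    · exact ⟨⟨hs.1, hs.2.trans_le hs₀.2⟩, ne_of_lt hs.2⟩
    · filter_upwards [ae_restrict_mem measurableSet_Ioo] with s hs
      have := hb s ⟨hs.1, hs.2.trans_le hs₀.2⟩ (ne_of_lt hs.2)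
      rwa [abs_of_neg (sub_neg.2 hs.2), neg_sub] at this
  · rw [intervalIntegrable_iff_integrableOn_Ioo_of_le hs₀.2] at h2 ⊢
    refine Integrable.mono' h2 (ContinuousOn.aestronglyMeasurable (hf.mono fun s hs => ?_)
      measurableSet_Ioo) ?_
    · exact ⟨⟨hs₀.1.trans_lt hs.1, hs.2⟩, ne_of_gt hs.1⟩
    · filter_upwards [ae_restrict_mem measurableSet_Ioo] with s hs
      have := hb s ⟨hs₀.1.trans_lt hs.1, hs.2⟩ (ne_of_gt hs.1)
      rwa [abs_of_pos (sub_pos.2 hs.1)] at this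

/-- The flux form is bounded away from the pole. -/
theorem exists_abs_streamForm_le {α β : ℝ} (hα : 0 < α) (hβ : 0 < β) {p : ℂ} (hp : 0 ≤ p.re)
    (hp' : 0 ≤ p.im) {d : ℝ} (hd : 0 < d) (M : ℝ) :
    ∃ C, ∀ z v : ℂ, 0 ≤ z.re → 0 ≤ z.im → ‖z‖ ≤ M → d ≤ ‖z - p‖ → ‖v‖ ≤ 1 →
      |streamForm α β p z v| ≤ C := by
  have bound : ∀ {α β x₀ y₀ x y : ℝ}, 0 < α → 0 < β → 0 ≤ x₀ → 0 ≤ y₀ → 0 ≤ x → 0 ≤ y →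
      x ≤ M → d ^ 2 ≤ (x - x₀) ^ 2 + (y - y₀) ^ 2 → |heatGrad α β x₀ y₀ x y| ≤
        (heatBound α * (M + 3 * x₀) * M ^ (2 * α) * heatBound β) *
          ∫ t in Ioi (0 : ℝ), t ^ (α + β) * Real.exp (-(d ^ 2) * t) := by
    intro α β x₀ y₀ x y hα hβ hx₀ hy₀ hx hy hxM hr
    have h1 := heatBound_pos hα
    have h2 := heatBound_pos hβ
    rw [heatGrad, ← Real.norm_eq_abs, ← integral_const_mul]
    refine norm_integral_le_of_norm_le ((integrableOn_rpow_mul_exp (by linarith)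
      (by positivity)).const_mul _) ?_
    filter_upwards [ae_restrict_mem measurableSet_Ioi] with t ht
    have ht : 0 < t := ht
    refine (abs_heatFlux_mul_besselHeat_le hα hβ ht hx hy hx₀ hy₀).trans ?_
    have h3 : Real.exp (-((x - x₀) ^ 2 + (y - y₀) ^ 2) * t) ≤ Real.exp (-(d ^ 2) * t) := by
      rw [Real.exp_le_exp]
      nlinarith
    have h4 : 0 ≤ M := hx.trans hxM
    gcongr
  set B₁ := (heatBound β * (M + 3 * p.im) * M ^ (2 * β) * heatBound α) *
          ∫ t in Ioi (0 : ℝ), t ^ (β + α) * Real.exp (-(d ^ 2) * t)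
  set B₂ := (heatBound α * (M + 3 * p.re) * M ^ (2 * α) * heatBound β) *
          ∫ t in Ioi (0 : ℝ), t ^ (α + β) * Real.exp (-(d ^ 2) * t)
  refine ⟨M ^ (2 * α) * B₁ * 1 + M ^ (2 * β) * B₂ * 1, fun z v hre him hM hz hv => ?_⟩
  have hM0 : 0 ≤ M := (norm_nonneg _).trans hM
  have x1 : z.re ≤ M := (Complex.re_le_norm z).trans hM
  have x2 : z.im ≤ M := ((le_abs_self _).trans (Complex.abs_im_le_norm z)).trans hM
  have hR := re_sub_sq_add_im_sub_sq z p
  have hd2 : d ^ 2 ≤ ‖z - p‖ ^ 2 := by gcongr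
  have b1 : |heatGrad β α p.im p.re z.im z.re| ≤ B₁ :=
    bound hβ hα hp' hp him hre x2 (by rw [add_comm, hR]; exact hd2)
  have b2 : |heatGrad α β p.re p.im z.re z.im| ≤ B₂ :=
    bound hα hβ hp hp' hre him x1 (by rw [hR]; exact hd2)
  have v1 := (Complex.abs_re_le_norm v).trans hv
  have v2 := (Complex.abs_im_le_norm v).trans hv
  have g1 := (abs_nonneg _).trans b1
  have g2 := (abs_nonneg _).trans b2
  rw [streamForm]
  refine (abs_sub _ _).trans ?_
  rw [abs_mul, abs_mul, abs_mul, abs_mul, abs_of_nonneg (a := z.re ^ (2 * α)) (by positivity),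
    abs_of_nonneg (a := z.im ^ (2 * β)) (by positivity)]
  gcongr

theorem IsQuadrantArc.continuousOn_streamForm {l : ℝ} {γ v : ℝ → ℂ} (h : IsQuadrantArc l γ v)
    {α β : ℝ} (hα : 0 < α) (hβ : 0 < β) {p : ℂ} (hp : 0 ≤ p.re) (hp' : 0 ≤ p.im) :
    ContinuousOn (fun s => streamForm α β p (γ s) (v s)) (Ioo 0 l \ {s | γ s = p}) := by
  rintro s ⟨hs, hne⟩
  have hx := h.re_pos s ⟨hs.1.le, hs.2⟩
  have hy := h.im_pos s ⟨hs.1, hs.2.le⟩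
  have hr : 0 < ((γ s).re - p.re) ^ 2 + ((γ s).im - p.im) ^ 2 := by
    rw [re_sub_sq_add_im_sub_sq]
    have : 0 < ‖γ s - p‖ := norm_pos_iff.2 (sub_ne_zero.2 hne)
    positivity
  have cγ : ContinuousAt γ s := (h.hasDerivAt hs).continuousAt
  have cv : ContinuousAt v s := h.continuousOn_v.continuousAt (Icc_mem_nhds hs.1 hs.2)
  have cre : ContinuousAt (fun s => (γ s).re) s := Complex.continuous_re.continuousAt.comp cγ
  have cim : ContinuousAt (fun s => (γ s).im) s := Complex.continuous_im.continuousAt.comp cγ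
  have vre : ContinuousAt (fun s => (v s).re) s := Complex.continuous_re.continuousAt.comp cv
  have vim : ContinuousAt (fun s => (v s).im) s := Complex.continuous_im.continuousAt.comp cv
  have g1 : ContinuousAt (fun s => heatGrad α β p.re p.im (γ s).re (γ s).im) s :=
    ContinuousAt.comp (f := fun s => ((γ s).re, (γ s).im))
      (continuousAt_heatGrad hα hβ hx hy hp hp' hr) (cre.prodMk cim)
  have g2 : ContinuousAt (fun s => heatGrad β α p.im p.re (γ s).im (γ s).re) s :=
    ContinuousAt.comp (f := fun s => ((γ s).im, (γ s).re))
      (continuousAt_heatGrad hβ hα hy hx hp' hp (by rwa [add_comm])) (cim.prodMk cre)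
  exact ((((cre.rpow_const (Or.inl hx.ne')).mul g2).mul vre).sub
    (((cim.rpow_const (Or.inl hy.ne')).mul g1).mul vim)).continuousWithinAt

/-! ### The double layer potential of density one along an arc -/

theorem tendsto_heatStream_left {ι : Type*} {L : Filter ι} {α β x₀ : ℝ} (hα : 0 < α) (hβ : 0 < β)
    (hx₀ : 0 < x₀) (y₀ : ℝ) {x y : ι → ℝ} (hx : Tendsto x L (𝓝 0)) (hx0 : ∀ᶠ i in L, 0 ≤ x i)
    (hy0 : ∀ᶠ i in L, 0 ≤ y i) :
    Tendsto (fun i => heatStream α β x₀ y₀ (x i) (y i)) L (𝓝 0) := by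
  have hd : 0 < (x₀ / 2) ^ 2 := by positivity
  have h1 : Tendsto (fun i => (heatBound α * (x i + 3 * x₀) *
      ∫ t in Ioi (0 : ℝ), t ^ (α - 1 / 2) * Real.exp (-(x₀ / 2) ^ 2 * t)) * x i ^ (2 * α)) L
      (𝓝 0) := by
    have h2 := (((hx.add_const (3 * x₀)).const_mul (heatBound α)).mul_const
      (∫ t in Ioi (0 : ℝ), t ^ (α - 1 / 2) * Real.exp (-(x₀ / 2) ^ 2 * t))).mul
      (hx.rpow_const (p := 2 * α) (Or.inr (by linarith)))
    rwa [Real.zero_rpow (by linarith), mul_zero] at h2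
  refine squeeze_zero_norm' ?_ h1
  filter_upwards [hx0, hy0, hx.eventually_lt_const (show 0 < x₀ / 2 by linarith)] with i h2 h3 h4
  exact abs_heatStream_le_left hα hβ h2 h3 hx₀.le y₀ hd (by nlinarith)

theorem tendsto_heatStream_right {ι : Type*} {L : Filter ι} {α β x₀ y₀ X : ℝ} (hα : 0 < α)
    (hβ : 0 < β) (hx₀ : 0 ≤ x₀) (hy₀ : 0 ≤ y₀) (hX : X ≠ x₀) {x y : ι → ℝ}
    (hx : Tendsto x L (𝓝 X)) (hx0 : ∀ᶠ i in L, 0 ≤ x i)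
    (hy : Tendsto y L (𝓝 0)) (hy0 : ∀ᶠ i in L, 0 ≤ y i) :
    Tendsto (fun i => heatStream α β x₀ y₀ (x i) (y i)) L (𝓝 0) := by
  have hd : 0 < (X - x₀) ^ 2 := by
    have := sub_ne_zero.2 hX
    positivity
  have h1 : Tendsto (fun i => (heatBound α * (x i + 3 * x₀) * x i ^ (2 * α) * heatBound β *
      ∫ t in Ioi (0 : ℝ), t ^ (α + β) * Real.exp (-((X - x₀) ^ 2 / 2) * t)) *
        y i ^ (2 * β + 1)) L (𝓝 0) := by
    have h2 := ((((((hx.add_const (3 * x₀)).const_mul (heatBound α)).mul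
      (hx.rpow_const (p := 2 * α) (Or.inr (by linarith)))).mul_const (heatBound β))).mul_const
      (∫ t in Ioi (0 : ℝ), t ^ (α + β) * Real.exp (-((X - x₀) ^ 2 / 2) * t))).mul
      (hy.rpow_const (p := 2 * β + 1) (Or.inr (by linarith)))
    rwa [Real.zero_rpow (by linarith), mul_zero] at h2
  refine squeeze_zero_norm' ?_ h1
  filter_upwards [hx0, hy0, ((hx.sub_const x₀).pow 2).eventually_const_lt
    (show (X - x₀) ^ 2 / 2 < (X - x₀) ^ 2 by linarith)] with i h2 h3 h4
  exact abs_heatStream_le_right hα hβ h2 h3 hx₀ hy₀ (by positivity) h4.le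

theorem abs_poleCoeff_mul_le {α β x₀ y₀ : ℝ} (hα : 0 < α) (hβ : 0 < β) (hx₀ : 0 < x₀)
    (hy₀ : 0 < y₀) : ∃ C, 0 < C ∧ ∀ R, 0 < R → |poleCoeff α β x₀ y₀ R * R| ≤ C := by
  obtain ⟨C, hC, hb⟩ := exists_heatProfile_mul_le hα hβ hx₀ hy₀
  refine ⟨C, hC, fun R hR => ?_⟩
  have h1 : |∫ t in Ioi (0 : ℝ), heatProfile α x₀ t x₀ * heatProfile β y₀ t y₀ / t *
      Real.exp (-R * t)| ≤ ∫ t in Ioi (0 : ℝ), C * Real.exp (-R * t) := by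
    rw [← Real.norm_eq_abs]
    refine norm_integral_le_of_norm_le ((exp_neg_integrableOn_Ioi 0 hR).const_mul C) ?_
    filter_upwards [ae_restrict_mem measurableSet_Ioi] with t ht
    rw [norm_mul, Real.norm_eq_abs, Real.norm_eq_abs, Real.abs_exp]
    have := hb t ht
    gcongr
  rw [integral_const_mul, integral_exp_neg_mul hR] at h1
  rw [poleCoeff, abs_mul, abs_mul, abs_of_pos hR, abs_of_pos (show (0 : ℝ) < 1 / 2 by norm_num)]
  calc _ ≤ 1 / 2 * (C * (1 / R)) * R := by gcongr
    _ = C / 2 := by field_simp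
    _ ≤ C := by linarith

/-- The index of `p` with respect to the closed curve formed by the arc and two segments on the
axes. -/
noncomputable def arcIndex (l : ℝ) (γ v : ℝ → ℂ) (p : ℂ) : ℝ :=
  ((∫ s in (0 : ℝ)..l, (v s / (γ s - p)).im) + Complex.arg (Complex.I * (γ 0 - p))
    - Complex.arg (Complex.I * (γ l - p))) / (2 * Real.pi)

namespace IsQuadrantArc

variable {l : ℝ} {γ v : ℝ → ℂ}

theorem exists_le_norm_sub_of_notMem (h : IsQuadrantArc l γ v) {p : ℂ} (hp : p ∉ γ '' Icc 0 l) :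
    ∃ d, 0 < d ∧ ∀ s ∈ Icc 0 l, d ≤ ‖γ s - p‖ :=
  isCompact_Icc.exists_forall_le' (h.continuousOn.sub continuousOn_const).norm fun s hs =>
    norm_pos_iff.2 (sub_ne_zero.2 fun e => hp ⟨s, hs, e⟩)

theorem intervalIntegrable_streamForm_of_notMem (h : IsQuadrantArc l γ v) {α β : ℝ} (hα : 0 < α)
    (hβ : 0 < β) {p : ℂ} (hp : 0 ≤ p.re) (hp' : 0 ≤ p.im) (hpγ : p ∉ γ '' Icc 0 l) :
    IntervalIntegrable (fun s => streamForm α β p (γ s) (v s)) volume 0 l := by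
  obtain ⟨d, hd, hlow⟩ := h.exists_le_norm_sub_of_notMem hpγ
  obtain ⟨M, hM, hM'⟩ := h.exists_norm_le
  obtain ⟨C, hC⟩ := exists_abs_streamForm_le hα hβ hp hp' hd M
  refine intervalIntegrable_of_abs_le (s₀ := 0) (M := C) (C := 0) (left_mem_Icc.2 h.l_pos.le)
    ((h.continuousOn_streamForm hα hβ hp hp').mono fun s hs => ⟨hs.1, fun e =>
      hpγ ⟨s, Ioo_subset_Icc_self hs.1, e⟩⟩) fun s hs _ => ?_
  have hs := Ioo_subset_Icc_self hs
  rw [zero_mul, add_zero]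
  exact hC _ _ (h.re_nonneg hs) (h.im_nonneg hs) (hM' s hs) (hlow s hs) (h.norm_v s hs).le

/-- Near the pole the form splits into a bounded coefficient times the angular speed, bounded by the
curvature estimate, and an error of order |s - s₀|^(-1/2). Away from the pole it is bounded. -/
theorem intervalIntegrable_streamForm_of_mem (h : IsQuadrantArc l γ v) {α β : ℝ} (hα : 0 < α)
    (hβ : 0 < β) {s₀ : ℝ} (hs₀ : s₀ ∈ Ioo 0 l) :
    IntervalIntegrable (fun s => streamForm α β (γ s₀) (γ s) (v s)) volume 0 l := by
  have hs₀' := Ioo_subset_Icc_self hs₀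
  have hp := h.re_pos s₀ ⟨hs₀.1.le, hs₀.2⟩
  have hp' := h.im_pos s₀ ⟨hs₀.1, hs₀.2.le⟩
  obtain ⟨K, hK, δ, hδ, hb⟩ := exists_streamForm_bound hα hβ hp hp'
  obtain ⟨C₁, hC₁, hb₁⟩ := abs_poleCoeff_mul_le hα hβ hp hp'
  obtain ⟨C₂, hC₂, hb₂⟩ := h.exists_abs_im_div_le
  obtain ⟨c, hc, hlow⟩ := h.exists_le_norm_sub
  obtain ⟨M, hM, hM'⟩ := h.exists_norm_le
  obtain ⟨C, hC⟩ := exists_abs_streamForm_le hα hβ hp.le hp'.le hδ M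
  refine intervalIntegrable_of_abs_le (s₀ := s₀) (M := |C| + C₁ * C₂)
    (C := K * c ^ (-(1 / 2) : ℝ)) hs₀'
    ((h.continuousOn_streamForm hα hβ hp.le hp'.le).mono fun s hs => ⟨hs.1, fun e =>
      hs.2 (h.inj (Ioo_subset_Icc_self hs.1) hs₀' e)⟩) fun s hs hne => ?_
  have hs := Ioo_subset_Icc_self hs
  have hpos : 0 < |s - s₀| := abs_pos.2 (sub_ne_zero.2 hne)
  rcases le_or_gt δ ‖γ s - γ s₀‖ with h1 | h1
  · have h2 := hC _ _ (h.re_nonneg hs) (h.im_nonneg hs) (hM' s hs) h1 (h.norm_v s hs).le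
    have h3 : 0 ≤ K * c ^ (-(1 / 2) : ℝ) * |s - s₀| ^ (-(1 / 2) : ℝ) := by positivity
    have h4 : 0 ≤ C₁ * C₂ := by positivity
    linarith [le_abs_self C]
  · have hne' : γ s ≠ γ s₀ := fun e => hne (h.inj hs hs₀' e)
    have hr : 0 < ‖γ s - γ s₀‖ := norm_pos_iff.2 (sub_ne_zero.2 hne')
    have h2 := hb (γ s) hne' h1 (v s)
    rw [h.norm_v s hs, mul_one] at h2
    have h3 : ‖γ s - γ s₀‖ ^ (-(1 / 2) : ℝ) ≤ c ^ (-(1 / 2) : ℝ) * |s - s₀| ^ (-(1 / 2) : ℝ) := by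
      rw [← Real.mul_rpow hc.le hpos.le]
      exact Real.rpow_le_rpow_of_nonpos (by positivity) (hlow s₀ hs₀' s hs) (by norm_num)
    have h4 := hb₁ (‖γ s - γ s₀‖ ^ 2) (by positivity)
    have h5 : |poleCoeff α β (γ s₀).re (γ s₀).im (‖γ s - γ s₀‖ ^ 2) * ‖γ s - γ s₀‖ ^ 2 *
        (v s / (γ s - γ s₀)).im| ≤ C₁ * C₂ := by
      rw [abs_mul]
      exact mul_le_mul h4 (hb₂ s₀ hs₀' s hs) (abs_nonneg _) hC₁.le
    have h6 := abs_sub (streamForm α β (γ s₀) (γ s) (v s) + poleCoeff α β (γ s₀).re (γ s₀).im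
      (‖γ s - γ s₀‖ ^ 2) * ‖γ s - γ s₀‖ ^ 2 * (v s / (γ s - γ s₀)).im)
      (poleCoeff α β (γ s₀).re (γ s₀).im
      (‖γ s - γ s₀‖ ^ 2) * ‖γ s - γ s₀‖ ^ 2 * (v s / (γ s - γ s₀)).im)
    rw [add_sub_cancel_right] at h6
    have h7 : K * ‖γ s - γ s₀‖ ^ (-(1 / 2) : ℝ)
        ≤ K * (c ^ (-(1 / 2) : ℝ) * |s - s₀| ^ (-(1 / 2) : ℝ)) := by gcongr
    linarith [abs_nonneg C]

theorem tendsto_nhdsGT_zero (h : IsQuadrantArc l γ v) : Tendsto γ (𝓝[>] 0) (𝓝 (γ 0)) := by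
  refine (h.continuousOn 0 (left_mem_Icc.2 h.l_pos.le)).mono_left ?_
  rw [← nhdsWithin_Ioo_eq_nhdsGT h.l_pos]
  exact nhdsWithin_mono _ Ioo_subset_Icc_self

theorem tendsto_nhdsLT (h : IsQuadrantArc l γ v) : Tendsto γ (𝓝[<] l) (𝓝 (γ l)) := by
  refine (h.continuousOn l (right_mem_Icc.2 h.l_pos.le)).mono_left ?_
  rw [← nhdsWithin_Ioo_eq_nhdsLT h.l_pos]
  exact nhdsWithin_mono _ Ioo_subset_Icc_self

theorem eventually_nhdsGT_zero (h : IsQuadrantArc l γ v) :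
    ∀ᶠ s in 𝓝[>] 0, 0 < (γ s).re ∧ 0 < (γ s).im := by
  filter_upwards [Ioo_mem_nhdsGT h.l_pos] with s hs
  exact ⟨h.re_pos s ⟨hs.1.le, hs.2⟩, h.im_pos s ⟨hs.1, hs.2.le⟩⟩

theorem eventually_nhdsLT (h : IsQuadrantArc l γ v) :
    ∀ᶠ s in 𝓝[<] l, 0 < (γ s).re ∧ 0 < (γ s).im := by
  filter_upwards [Ioo_mem_nhdsLT h.l_pos] with s hs
  exact ⟨h.re_pos s ⟨hs.1.le, hs.2⟩, h.im_pos s ⟨hs.1, hs.2.le⟩⟩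

/-- The start lies below the pole, where the potential is built from the swapped stream function;
this vanishes on the real axis, so only the argument survives. At the other end the unswapped
function plays the same role. -/
theorem tendsto_fluxPotential_start (h : IsQuadrantArc l γ v) {α β : ℝ} (hα : 0 < α) (hβ : 0 < β)
    {p : ℂ} (hp' : 0 < p.im) :
    Tendsto (fun s => fluxPotential α β p (γ s)) (𝓝[>] 0)
      (𝓝 (Complex.arg (Complex.I * (γ 0 - p)) / (2 * Real.pi))) := by
  have hγ := h.tendsto_nhdsGT_zero
  have him : Tendsto (fun s => (γ s).im) (𝓝[>] 0) (𝓝 0) := by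
    have := (Complex.continuous_im.tendsto _).comp hγ
    rwa [h.start_im] at this
  have hS := tendsto_heatStream_left hβ hα hp' p.re him
    (h.eventually_nhdsGT_zero.mono fun s hs => hs.2.le)
    (h.eventually_nhdsGT_zero.mono fun s hs => hs.1.le)
  have hA : Tendsto (fun s => Complex.arg (Complex.I * (γ s - p))) (𝓝[>] 0)
      (𝓝 (Complex.arg (Complex.I * (γ 0 - p)))) :=
    (Complex.continuousAt_arg (I_mul_mem_slitPlane (Or.inl (by
      rw [Complex.sub_im, h.start_im]; linarith)))).tendsto.comp
      ((hγ.sub_const p).const_mul Complex.I)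
  have h1 := hS.add (hA.div_const (2 * Real.pi))
  rw [zero_add] at h1
  refine h1.congr' ?_
  filter_upwards [him.eventually_lt_const hp'] with s hs
  rw [fluxPotential, if_pos hs]

theorem tendsto_fluxPotential_end (h : IsQuadrantArc l γ v) {α β : ℝ} (hα : 0 < α) (hβ : 0 < β)
    {p : ℂ} (hp : 0 < p.re) (hp' : 0 ≤ p.im) :
    Tendsto (fun s => fluxPotential α β p (γ s)) (𝓝[<] l)
      (𝓝 (Complex.arg (Complex.I * (γ l - p)) / (2 * Real.pi))) := by
  have hγ := h.tendsto_nhdsLT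
  have hre : Tendsto (fun s => (γ s).re) (𝓝[<] l) (𝓝 0) := by
    have := (Complex.continuous_re.tendsto _).comp hγ
    rwa [h.end_re] at this
  have hS := tendsto_heatStream_left hα hβ hp p.im hre
    (h.eventually_nhdsLT.mono fun s hs => hs.1.le)
    (h.eventually_nhdsLT.mono fun s hs => hs.2.le)
  have hA : Tendsto (fun s => Complex.arg (Complex.I * (γ s - p))) (𝓝[<] l)
      (𝓝 (Complex.arg (Complex.I * (γ l - p)))) :=
    (Complex.continuousAt_arg (I_mul_mem_slitPlane (Or.inr (by
      rw [Complex.sub_re, h.end_re]; linarith)))).tendsto.comp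
      ((hγ.sub_const p).const_mul Complex.I)
  have h1 := hS.neg.add (hA.div_const (2 * Real.pi))
  rw [neg_zero, zero_add] at h1
  refine h1.congr' ?_
  filter_upwards [hre.eventually_lt_const hp, h.eventually_nhdsLT] with s hs hs'
  rw [fluxPotential_of_re_ne hα hβ hp.le hp' hs'.1.le hs'.2.le hs.ne]

theorem intervalIntegrable_im_div_of_notMem (h : IsQuadrantArc l γ v) {p : ℂ}
    (hpγ : p ∉ γ '' Icc 0 l) :
    IntervalIntegrable (fun s => (v s / (γ s - p)).im) volume 0 l := by
  refine ContinuousOn.intervalIntegrable ?_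
  rw [uIcc_of_le h.l_pos.le]
  exact Complex.continuous_im.comp_continuousOn (h.continuousOn_v.div
    (h.continuousOn.sub continuousOn_const) fun s hs => sub_ne_zero.2 fun e => hpγ ⟨s, hs, e⟩)

theorem intervalIntegrable_im_div_of_mem (h : IsQuadrantArc l γ v) {s₀ : ℝ} (hs₀ : s₀ ∈ Icc 0 l) :
    IntervalIntegrable (fun s => (v s / (γ s - γ s₀)).im) volume 0 l := by
  obtain ⟨M, hM, hb⟩ := h.exists_abs_im_div_le
  refine intervalIntegrable_of_abs_le (s₀ := s₀) (M := M) (C := 0) hs₀ ?_ fun s hs hne => ?_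
  · refine Complex.continuous_im.comp_continuousOn (ContinuousOn.div (h.continuousOn_v.mono ?_)
      ((h.continuousOn.mono ?_).sub continuousOn_const) fun s hs => sub_ne_zero.2 fun e =>
        hs.2 (h.inj (Ioo_subset_Icc_self hs.1) hs₀ e))
    · exact sdiff_subset.trans Ioo_subset_Icc_self
    · exact sdiff_subset.trans Ioo_subset_Icc_self
  · rw [zero_mul, add_zero]
    exact hb s₀ hs₀ s (Ioo_subset_Icc_self hs)

/-- Off the arc, the potential equals minus the index. -/
theorem integral_streamForm_of_notMem (h : IsQuadrantArc l γ v) {α β : ℝ} (hα : 0 < α)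
    (hβ : 0 < β) {p : ℂ} (hp : 0 < p.re) (hp' : 0 < p.im) (hpγ : p ∉ γ '' Icc 0 l) :
    ∫ s in (0 : ℝ)..l, streamForm α β p (γ s) (v s) = -arcIndex l γ v p := by
  have i1 := h.intervalIntegrable_streamForm_of_notMem hα hβ hp.le hp'.le hpγ
  have i2 := (h.intervalIntegrable_im_div_of_notMem hpγ).div_const (2 * Real.pi)
  have key := intervalIntegral.integral_eq_sub_of_hasDerivAt_of_tendsto h.l_pos
    (fun s hs => hasDerivAt_fluxPotential hα hβ hp.le hp'.le (h.hasDerivAt hs)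
      (h.re_pos s ⟨hs.1.le, hs.2⟩) (h.im_pos s ⟨hs.1, hs.2.le⟩)
      (fun e => hpγ ⟨s, Ioo_subset_Icc_self hs, e⟩)) (i1.add i2)
    (h.tendsto_fluxPotential_start hα hβ hp') (h.tendsto_fluxPotential_end hα hβ hp hp'.le)
  rw [intervalIntegral.integral_add i1 i2, intervalIntegral.integral_div] at key
  rw [eq_sub_of_add_eq key, arcIndex]
  ring

/-- On the arc, the potential equals minus the index. -/
theorem integral_streamForm_of_mem (h : IsQuadrantArc l γ v) {α β : ℝ} (hα : 0 < α)
    (hβ : 0 < β) {s₀ : ℝ} (hs₀ : s₀ ∈ Ioo 0 l) :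
    ∫ s in (0 : ℝ)..l, streamForm α β (γ s₀) (γ s) (v s) = -arcIndex l γ v (γ s₀) := by
  have hs₀' := Ioo_subset_Icc_self hs₀
  have hp := h.re_pos s₀ ⟨hs₀.1.le, hs₀.2⟩
  have hp' := h.im_pos s₀ ⟨hs₀.1, hs₀.2.le⟩
  have i1 := h.intervalIntegrable_streamForm_of_mem hα hβ hs₀
  have i2 := (h.intervalIntegrable_im_div_of_mem hs₀').div_const (2 * Real.pi)
  set f : ℝ → ℝ := fun s => streamForm α β (γ s₀) (γ s) (v s)
    + (v s / (γ s - γ s₀)).im / (2 * Real.pi) with hf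
  have i3 : IntervalIntegrable f volume 0 l := i1.add i2
  set G : ℝ → ℝ := fun s => fluxPotential α β (γ s₀) (γ s) with hG
  have hd : ∀ s ∈ Ioo 0 l, s ≠ s₀ → HasDerivAt G (f s) s := fun s hs hne =>
    hasDerivAt_fluxPotential hα hβ hp.le hp'.le (h.hasDerivAt hs)
      (h.re_pos s ⟨hs.1.le, hs.2⟩) (h.im_pos s ⟨hs.1, hs.2.le⟩)
      (fun e => hne (h.inj (Ioo_subset_Icc_self hs) hs₀' e))
  set g₀ := Complex.arg (Complex.I * (γ 0 - γ s₀)) / (2 * Real.pi) with hg₀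
  set g₁ := Complex.arg (Complex.I * (γ l - γ s₀)) / (2 * Real.pi) with hg₁
  have l0 : Tendsto G (𝓝[>] 0) (𝓝 g₀) := h.tendsto_fluxPotential_start hα hβ hp'
  have l1 : Tendsto G (𝓝[<] l) (𝓝 g₁) := h.tendsto_fluxPotential_end hα hβ hp hp'.le
  have ileft : ∀ s ∈ Ioo 0 s₀, ∫ u in (0 : ℝ)..s, f u = G s - g₀ := fun s hs => by
    refine intervalIntegral.integral_eq_sub_of_hasDerivAt_of_tendsto hs.1
      (fun u hu => hd u ⟨hu.1, by linarith [hu.2, hs.2, hs₀.2]⟩ (by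
        have := hu.2.trans hs.2
        exact this.ne)) (i3.mono_set ?_) l0 ?_
    · rw [uIcc_of_le hs.1.le, uIcc_of_le h.l_pos.le]
      exact Icc_subset_Icc_right (by linarith [hs.2, hs₀.2])
    · exact ((hd s ⟨hs.1, hs.2.trans hs₀.2⟩ hs.2.ne).continuousAt.tendsto).mono_left
        nhdsWithin_le_nhds
  have iright : ∀ s ∈ Ioo s₀ l, ∫ u in s..l, f u = g₁ - G s := fun s hs => by
    refine intervalIntegral.integral_eq_sub_of_hasDerivAt_of_tendsto hs.2
      (fun u hu => hd u ⟨by linarith [hu.1, hs.1, hs₀.1], hu.2⟩ (by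
        have := hs.1.trans hu.1
        exact this.ne')) (i3.mono_set ?_) ?_ l1
    · rw [uIcc_of_le hs.2.le, uIcc_of_le h.l_pos.le]
      exact Icc_subset_Icc_left (by linarith [hs.1, hs₀.1])
    · exact ((hd s ⟨hs₀.1.trans hs.1, hs.2⟩ hs.1.ne').continuousAt.tendsto).mono_left
        nhdsWithin_le_nhds
  -- the two one-sided values of the potential at the pole agree
  have hjump : Tendsto (fun η : ℝ => G (s₀ + η) - G (s₀ - η)) (𝓝[>] 0) (𝓝 0) := by
    obtain ⟨K, hK, hT⟩ := h.exists_taylor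
    rw [Metric.tendsto_nhds]
    intro ε hε
    obtain ⟨δ, hδ, hb⟩ := abs_fluxPotential_sub_le hα hβ hp hp' (half_pos hε)
    -- With η < 1/(3K) the Taylor remainder is at most η/3, so both points lie at distance between
    -- 2η/3 and 4η/3 from the pole: their ratio is at most 2, and both distances are below δ once η
    -- < δ/2.
    have hm : 0 < min (min s₀ (l - s₀)) (min (δ / 2) (1 / (3 * K))) := by
      have := hs₀.1
      have := sub_pos.2 hs₀.2
      positivity
    filter_upwards [Ioo_mem_nhdsGT hm] with η hη
    obtain ⟨⟨a1, a2⟩, a3, a4⟩ : (η < s₀ ∧ η < l - s₀) ∧ η < δ / 2 ∧ η < 1 / (3 * K) := by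
      have := hη.2
      rwa [lt_min_iff, lt_min_iff, lt_min_iff] at this
    have hη0 := hη.1
    have a5 : K * η ^ 2 ≤ 1 / 3 * η := by
      have : K * η ≤ 1 / 3 := by
        calc K * η ≤ K * (1 / (3 * K)) := by gcongr
          _ = 1 / 3 := by field_simp
      nlinarith
    have near : ∀ s ∈ Icc 0 l, |s - s₀| = η →
        2 / 3 * η ≤ ‖γ s - γ s₀‖ ∧ ‖γ s - γ s₀‖ ≤ 4 / 3 * η := fun s hs he => by
      have b1 := hT s₀ hs₀' s hs
      rw [← sq_abs, he] at b1
      have b2 := abs_norm_sub_norm_le (γ s - γ s₀) (((s - s₀ : ℝ) : ℂ) * v s₀)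
      rw [norm_mul, h.norm_v s₀ hs₀', mul_one, Complex.norm_real, Real.norm_eq_abs, he] at b2
      have b3 := abs_le.1 (b2.trans (b1.trans a5))
      constructor <;> linarith [b3.1, b3.2]
    have m1 : s₀ + η ∈ Icc 0 l := ⟨by linarith [hs₀.1], by linarith⟩
    have m2 : s₀ - η ∈ Icc 0 l := ⟨by linarith, by linarith [hs₀.2]⟩
    have n1 := near _ m1 (by rw [add_sub_cancel_left, abs_of_pos hη0])
    have n2 := near _ m2 (by rw [sub_sub_cancel_left, abs_neg, abs_of_pos hη0])
    have p1 : γ (s₀ + η) ≠ γ s₀ := by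
      rw [← sub_ne_zero, ← norm_pos_iff]; linarith [n1.1]
    have p2 : γ (s₀ - η) ≠ γ s₀ := by
      rw [← sub_ne_zero, ← norm_pos_iff]; linarith [n2.1]
    rw [Real.dist_eq, sub_zero]
    refine (hb _ _ p2 p1 (by linarith [n2.2]) (by linarith [n1.2]) (by linarith [n1.2, n2.1])
      (by linarith [n2.2, n1.1])).trans_lt (by linarith)
  have hprim : ContinuousOn (fun s => ∫ u in (0 : ℝ)..s, f u) (Icc 0 l) := by
    have := intervalIntegral.continuousOn_primitive_interval' i3 left_mem_uIcc
    rwa [uIcc_of_le h.l_pos.le] at this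
  have hpc : ContinuousAt (fun s => ∫ u in (0 : ℝ)..s, f u) s₀ :=
    hprim.continuousAt (Icc_mem_nhds hs₀.1 hs₀.2)
  have t1 : Tendsto (fun η : ℝ => s₀ + η) (𝓝[>] 0) (𝓝 s₀) := by
    have : Tendsto (fun η : ℝ => s₀ + η) (𝓝 0) (𝓝 (s₀ + 0)) :=
      (continuous_const.add continuous_id).tendsto 0
    rw [add_zero] at this
    exact this.mono_left nhdsWithin_le_nhds
  have t2 : Tendsto (fun η : ℝ => s₀ - η) (𝓝[>] 0) (𝓝 s₀) := by
    have : Tendsto (fun η : ℝ => s₀ - η) (𝓝 0) (𝓝 (s₀ - 0)) :=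
      (continuous_const.sub continuous_id).tendsto 0
    rw [sub_zero] at this
    exact this.mono_left nhdsWithin_le_nhds
  have hlim := ((hpc.tendsto.comp t1).sub (hpc.tendsto.comp t2)).sub hjump
  rw [sub_self, sub_zero] at hlim
  -- The fundamental theorem on [0, s₀ - η] and [s₀ + η, l] leaves only the integral over the gap
  -- and the jump across it; both tend to 0.
  have hconst : ∀ᶠ η : ℝ in 𝓝[>] 0, (∫ u in (0 : ℝ)..l, f u) - (g₁ - g₀)
      = (∫ u in (0 : ℝ)..(s₀ + η), f u) - (∫ u in (0 : ℝ)..(s₀ - η), f u)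
        - (G (s₀ + η) - G (s₀ - η)) := by
    have hm : 0 < min s₀ (l - s₀) := lt_min hs₀.1 (sub_pos.2 hs₀.2)
    filter_upwards [Ioo_mem_nhdsGT hm] with η hη
    obtain ⟨a1, a2⟩ := lt_min_iff.1 hη.2
    have e1 := ileft (s₀ - η) ⟨by linarith, by linarith [hη.1]⟩
    have e2 := iright (s₀ + η) ⟨by linarith [hη.1], by linarith⟩
    have e3 : (∫ u in (0 : ℝ)..(s₀ + η), f u) + ∫ u in (s₀ + η)..l, f u
        = ∫ u in (0 : ℝ)..l, f u := by
      refine intervalIntegral.integral_add_adjacent_intervals (i3.mono_set ?_) (i3.mono_set ?_)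
      · rw [uIcc_of_le (by linarith [hs₀.1, hη.1]), uIcc_of_le h.l_pos.le]
        exact Icc_subset_Icc_right (by linarith)
      · rw [uIcc_of_le (by linarith), uIcc_of_le h.l_pos.le]
        exact Icc_subset_Icc_left (by linarith [hs₀.1, hη.1])
    linarith
  have h0 := tendsto_nhds_unique (tendsto_const_nhds.congr' hconst) hlim
  have key : ∫ u in (0 : ℝ)..l, f u = g₁ - g₀ := by linarith
  rw [hf, intervalIntegral.integral_add i1 i2, intervalIntegral.integral_div] at key
  rw [eq_sub_of_add_eq key, arcIndex, hg₀, hg₁]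
  ring

end IsQuadrantArc

/-! ### Poles on the axes -/

theorem integral_rpow_mul_exp_neg_mul {s R : ℝ} (hs : -1 < s) (hR : 0 < R) :
    ∫ t in Ioi (0 : ℝ), t ^ s * Real.exp (-R * t) = Real.Gamma (s + 1) * R ^ (-(s + 1)) := by
  have := Real.integral_rpow_mul_exp_neg_mul_Ioi (a := s + 1) (by linarith) hR
  rw [one_div R, Real.inv_rpow hR.le, ← Real.rpow_neg hR.le, add_sub_cancel_right] at this
  rw [mul_comm, ← this]
  simp only [neg_mul]

/-- With pole on y = 0 the y-kernel is t^(β+1/2) times a Gaussian, with constant angular factor. The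
profile bounds in x reduce the integral to Gamma integrals of t^β and t^(β-3/4). -/
theorem exists_abs_heatGrad_axis_le {α β x₀ : ℝ} (hα : 0 < α) (hβ : 0 < β) (hx₀ : 0 < x₀) :
    ∃ K, 0 < K ∧ ∀ x ∈ Icc (x₀ / 2) (3 * x₀ / 2), ∀ y, 0 < y →
      |heatGrad α β x₀ 0 x y| ≤ K * (|x - x₀| * ((x - x₀) ^ 2 + y ^ 2) ^ (-(β + 1))
        + ((x - x₀) ^ 2 + y ^ 2) ^ (-(β + 1 / 4))) := by
  obtain ⟨C, hC, hb⟩ := exists_heatProfile_bounds hα hx₀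
  obtain ⟨C₁, hC₁, hb₁⟩ := exists_besInt_one_profile_bound hα hx₀
  have hN := heatNorm_pos hβ
  have hm := besInt_zero_zero_pos hβ
  have g1 := Real.Gamma_pos_of_pos (show 0 < β + 1 by linarith)
  have g2 := Real.Gamma_pos_of_pos (show 0 < β + 1 / 4 by linarith)
  set D := heatNorm β * besInt 0 β 0 with hD
  have hD0 : 0 < D := by positivity
  refine ⟨D * C * Real.Gamma (β + 1) + D * x₀ * C₁ * Real.Gamma (β + 1 / 4), by positivity,
    fun x hx y hy => ?_⟩
  set R := (x - x₀) ^ 2 + y ^ 2 with hR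
  have hR0 : 0 < R := by positivity
  have hx0 : 0 < x := by linarith [hx.1]
  have i1 : IntegrableOn (fun t : ℝ => t ^ β * Real.exp (-R * t)) (Ioi 0) :=
    integrableOn_rpow_mul_exp (by linarith) hR0
  have i2 : IntegrableOn (fun t : ℝ => t ^ (β - 3 / 4) * Real.exp (-R * t)) (Ioi 0) :=
    integrableOn_rpow_mul_exp (by linarith) hR0
  have i3 := (i1.const_mul (D * C * |x - x₀|)).add (i2.const_mul (D * x₀ * C₁))
  rw [heatGrad, ← Real.norm_eq_abs]
  refine (norm_integral_le_of_norm_le i3 ?_).trans ?_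
  · filter_upwards [ae_restrict_mem measurableSet_Ioi] with t ht
    have ht : 0 < t := ht
    have b1 := (hb t ht x hx).1
    have b2 := hb₁ t ht x hx
    have p1 := heatProfile_nonneg hα ht.le hx0.le x₀
    set ψ := heatNorm α * t ^ (α - 1 / 2) * x ^ (2 * α) * besInt 1 α (t * x * x₀) with hψ
    have hψ0 : 0 ≤ ψ := by
      have := besInt_nonneg 1 α (t * x * x₀)
      have := heatNorm_pos hα
      positivity
    have e1 : heatFlux α x₀ t x * besselHeat β 0 t y
        = 1 / 2 * D * ((x - x₀) * (heatProfile α x₀ t x / t) + x₀ * ψ) *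
          (t ^ (β + 1 / 2) * Real.exp (-R * t)) := by
      have e2 : Real.exp (-R * t) = Real.exp (-t * (x - x₀) ^ 2) * Real.exp (-t * (y - 0) ^ 2) := by
        rw [← Real.exp_add, hR]; ring_nf
      have e4 : heatProfile α x₀ t x
          = heatNorm α * (t ^ (α - 1 / 2) * t) * x ^ (2 * α) * besInt 0 α (t * x * x₀) := by
        rw [heatProfile, ← Real.rpow_add_one ht.ne']
        ring_nf
      rw [heatFlux, besselHeat, mul_zero (t * y), e2, e4, hψ, hD]
      field_simp
    have q0 : 0 < t ^ (β + 1 / 2) * Real.exp (-R * t) := by positivity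
    rw [e1, Real.norm_eq_abs, abs_mul, abs_mul, abs_of_pos q0,
      abs_of_pos (show 0 < 1 / 2 * D by positivity)]
    have q1 : |(x - x₀) * (heatProfile α x₀ t x / t) + x₀ * ψ|
        ≤ |x - x₀| * (C * √t / t) + x₀ * (C₁ * t ^ (-(5 / 4) : ℝ)) := by
      refine (abs_add_le _ _).trans ?_
      rw [abs_mul, abs_of_nonneg (show 0 ≤ heatProfile α x₀ t x / t by positivity),
        abs_of_nonneg (show 0 ≤ x₀ * ψ by positivity)]
      gcongr
    have q2 : √t / t * t ^ (β + 1 / 2) = t ^ β := by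
      rw [Real.sqrt_eq_rpow, ← Real.rpow_sub_one ht.ne', ← Real.rpow_add ht]
      norm_num
    have q3 : t ^ (-(5 / 4) : ℝ) * t ^ (β + 1 / 2) = t ^ (β - 3 / 4) := by
      rw [← Real.rpow_add ht]
      ring_nf
    calc _ ≤ 1 / 2 * D * (|x - x₀| * (C * √t / t) + x₀ * (C₁ * t ^ (-(5 / 4) : ℝ))) *
          (t ^ (β + 1 / 2) * Real.exp (-R * t)) := by gcongr
      _ = 1 / 2 * (D * C * |x - x₀| * (√t / t * t ^ (β + 1 / 2) * Real.exp (-R * t))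
          + D * x₀ * C₁ * (t ^ (-(5 / 4) : ℝ) * t ^ (β + 1 / 2) * Real.exp (-R * t))) := by ring
      _ = 1 / 2 * (D * C * |x - x₀| * (t ^ β * Real.exp (-R * t))
          + D * x₀ * C₁ * (t ^ (β - 3 / 4) * Real.exp (-R * t))) := by rw [q2, q3]
      _ ≤ _ := by
        have : 0 ≤ D * C * |x - x₀| * (t ^ β * Real.exp (-R * t))
          + D * x₀ * C₁ * (t ^ (β - 3 / 4) * Real.exp (-R * t)) := by positivity
        simp only [Pi.add_apply]
        linarith
  · simp only [Pi.add_apply]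
    rw [integral_add (i1.const_mul _) (i2.const_mul _), integral_const_mul, integral_const_mul,
      integral_rpow_mul_exp_neg_mul (by linarith) hR0,
      integral_rpow_mul_exp_neg_mul (by linarith) hR0,
      show β - 3 / 4 + 1 = β + 1 / 4 by ring]
    have r1 : 0 ≤ D * C * Real.Gamma (β + 1) * R ^ (-(β + 1 / 4)) := by positivity
    have r2 : 0 ≤ D * x₀ * C₁ * Real.Gamma (β + 1 / 4) * (|x - x₀| * R ^ (-(β + 1))) := by
      positivity
    linarith

/-- The flux in y with pole 0 keeps only the term proportional to y, and the x-profile is O(√t), so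
a single Gamma integral of t^β remains. -/
theorem exists_abs_rpow_mul_heatGrad_axis_le {α β x₀ : ℝ} (hα : 0 < α) (hβ : 0 < β)
    (hx₀ : 0 < x₀) :
    ∃ K, 0 < K ∧ ∀ x ∈ Icc (x₀ / 2) (3 * x₀ / 2), ∀ y, 0 < y →
      |x ^ (2 * α) * heatGrad β α 0 x₀ y x|
        ≤ K * (y ^ (2 * β) * y * ((x - x₀) ^ 2 + y ^ 2) ^ (-(β + 1))) := by
  obtain ⟨C, hC, hb⟩ := exists_heatProfile_bounds hα hx₀
  have hN := heatNorm_pos hβ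
  have hm := besInt_zero_zero_pos hβ
  have g1 := Real.Gamma_pos_of_pos (show 0 < β + 1 by linarith)
  set D := heatNorm β / 2 * besInt 0 β 0 * C with hD
  have hD0 : 0 < D := by positivity
  refine ⟨D * Real.Gamma (β + 1), by positivity, fun x hx y hy => ?_⟩
  set R := (x - x₀) ^ 2 + y ^ 2 with hR
  have hR0 : 0 < R := by positivity
  have hx0 : 0 < x := by linarith [hx.1]
  have i1 : IntegrableOn (fun t : ℝ => t ^ β * Real.exp (-R * t)) (Ioi 0) :=
    integrableOn_rpow_mul_exp (by linarith) hR0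
  rw [heatGrad, ← integral_const_mul, ← Real.norm_eq_abs]
  refine (norm_integral_le_of_norm_le (i1.const_mul (D * (y ^ (2 * β) * y))) ?_).trans ?_
  · filter_upwards [ae_restrict_mem measurableSet_Ioi] with t ht
    have ht : 0 < t := ht
    have b1 := (hb t ht x hx).1
    have p1 := heatProfile_nonneg hα ht.le hx0.le x₀
    have e1 : x ^ (2 * α) * (heatFlux β 0 t y * besselHeat α x₀ t x)
        = heatNorm β / 2 * besInt 0 β 0 * (y ^ (2 * β) * y) *
          (heatProfile α x₀ t x * t ^ (β - 1 / 2) * Real.exp (-R * t)) := by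
      have e2 : Real.exp (-R * t) = Real.exp (-t * (x - x₀) ^ 2) * Real.exp (-t * (y - 0) ^ 2) := by
        rw [← Real.exp_add, hR]; ring_nf
      have e3 : x ^ (2 * α) * (heatFlux β 0 t y * besselHeat α x₀ t x)
          = heatFlux β 0 t y * (x ^ (2 * α) * besselHeat α x₀ t x) := by ring
      rw [e3, rpow_mul_besselHeat, heatFlux, mul_zero (t * y), e2]
      ring
    have q2 : √t * t ^ (β - 1 / 2) = t ^ β := by
      rw [Real.sqrt_eq_rpow, ← Real.rpow_add ht]
      ring_nf
    rw [e1, Real.norm_eq_abs, abs_of_nonneg (by positivity)]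
    calc _ ≤ heatNorm β / 2 * besInt 0 β 0 * (y ^ (2 * β) * y) *
          (C * √t * t ^ (β - 1 / 2) * Real.exp (-R * t)) := by gcongr
      _ = D * (y ^ (2 * β) * y) * (√t * t ^ (β - 1 / 2) * Real.exp (-R * t)) := by rw [hD]; ring
      _ = _ := by rw [q2]
  · rw [integral_const_mul, integral_rpow_mul_exp_neg_mul (by linarith) hR0]
    apply le_of_eq
    ring

namespace IsQuadrantArc

variable {l : ℝ} {γ v : ℝ → ℂ}

theorem tendsto_heatStream_end (h : IsQuadrantArc l γ v) {α β : ℝ} (hα : 0 < α) (hβ : 0 < β)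
    {x₀ : ℝ} (hx₀ : 0 ≤ x₀) :
    Tendsto (fun s => heatStream β α 0 x₀ (γ s).im (γ s).re) (𝓝[<] l) (𝓝 0) :=
  tendsto_heatStream_right hβ hα le_rfl hx₀ (h.im_pos l (right_mem_Ioc.2 h.l_pos)).ne'
    ((Complex.continuous_im.tendsto _).comp h.tendsto_nhdsLT)
    (h.eventually_nhdsLT.mono fun s hs => hs.2.le)
    (by simpa [h.end_re, Function.comp_def] using
      (Complex.continuous_re.tendsto _).comp h.tendsto_nhdsLT)
    (h.eventually_nhdsLT.mono fun s hs => hs.1.le)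

/-- The potential at a point of the real axis beyond the start of the arc. -/
theorem integral_streamForm_axis (h : IsQuadrantArc l γ v) {α β : ℝ} (hα : 0 < α) (hβ : 0 < β)
    {x₀ : ℝ} (hx₀ : (γ 0).re < x₀) :
    IntervalIntegrable (fun s => streamForm α β (x₀ : ℂ) (γ s) (v s)) volume 0 l ∧
      ∫ s in (0 : ℝ)..l, streamForm α β (x₀ : ℂ) (γ s) (v s) = 0 := by
  have ha := h.re_pos 0 (left_mem_Ico.2 h.l_pos)
  have hp : 0 ≤ (x₀ : ℂ).re := by rw [Complex.ofReal_re]; linarith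
  have hp' : 0 ≤ (x₀ : ℂ).im := by rw [Complex.ofReal_im]
  have i1 := h.intervalIntegrable_streamForm_of_notMem hα hβ hp hp' (by
    rintro ⟨s, hs, e⟩
    rcases hs.1.lt_or_eq with h1 | h1
    · have := h.im_pos s ⟨h1, hs.2⟩
      rw [e, Complex.ofReal_im] at this
      exact this.false
    · rw [← h1] at e
      rw [e, Complex.ofReal_re] at hx₀
      exact hx₀.false)
  refine ⟨i1, ?_⟩
  have hre : Tendsto (fun s => (γ s).re) (𝓝[>] 0) (𝓝 (γ 0).re) :=
    (Complex.continuous_re.tendsto _).comp h.tendsto_nhdsGT_zero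
  have him : Tendsto (fun s => (γ s).im) (𝓝[>] 0) (𝓝 0) := by
    simpa [h.start_im, Function.comp_def] using
      (Complex.continuous_im.tendsto _).comp h.tendsto_nhdsGT_zero
  -- Near the start x < x₀, so the swapped stream function is minus the unswapped one, which
  -- vanishes on y = 0 away from x₀.
  have l0 : Tendsto (fun s => heatStream β α 0 x₀ (γ s).im (γ s).re) (𝓝[>] 0) (𝓝 0) := by
    have h1 := tendsto_heatStream_right hα hβ (x₀ := x₀) (y₀ := 0) (by linarith) le_rfl hx₀.ne hre
      (h.eventually_nhdsGT_zero.mono fun s hs => hs.1.le) him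
      (h.eventually_nhdsGT_zero.mono fun s hs => hs.2.le)
    have h2 := h1.neg
    rw [neg_zero] at h2
    refine h2.congr' ?_
    filter_upwards [hre.eventually_lt_const hx₀, h.eventually_nhdsGT_zero] with s h3 h4
    have := heatStream_add_heatStream_of_lt_left hα hβ h4.1.le h4.2.le (by linarith) le_rfl h3
      h4.2.ne'
    linarith
  -- The open arc lies above the pole's horizontal line, so the swapped stream function is a
  -- potential along all of it and no angle correction is needed.
  have key := intervalIntegral.integral_eq_sub_of_hasDerivAt_of_tendsto h.l_pos
    (fun s hs => by
      have := hasDerivAt_heatStream_comp_swap hα hβ hp hp' (h.hasDerivAt hs)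
        (h.re_pos s ⟨hs.1.le, hs.2⟩) (h.im_pos s ⟨hs.1, hs.2.le⟩)
        (by rw [Complex.ofReal_im]; exact (h.im_pos s ⟨hs.1, hs.2.le⟩).ne')
      simpa only [Complex.ofReal_re, Complex.ofReal_im] using this) i1 l0
    (h.tendsto_heatStream_end hα hβ (by linarith))
  rw [key, sub_zero]

theorem start_eq (h : IsQuadrantArc l γ v) : ((γ 0).re : ℂ) = γ 0 :=
  Complex.ext (Complex.ofReal_re _) (by rw [Complex.ofReal_im, h.start_im])

/-- Near its start, the arc leaves the real axis vertically. -/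
theorem exists_start_bounds (h : IsQuadrantArc l γ v) :
    ∃ K, 0 < K ∧ ∀ s ∈ Icc 0 l, |(γ s).re - (γ 0).re| ≤ K * s ^ 2 ∧ |(v s).re| ≤ K * s ∧
      (γ s).im ≤ s + K * s ^ 2 := by
  have h0 : (0 : ℝ) ∈ Icc 0 l := left_mem_Icc.2 h.l_pos.le
  obtain ⟨K₁, hK₁, hT⟩ := h.exists_taylor
  obtain ⟨K₂, hK₂, hL⟩ := h.lipschitz
  refine ⟨max K₁ K₂, by positivity, fun s hs => ?_⟩
  have h1 := hT 0 h0 s hs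
  have h2 := hL s hs 0 h0
  rw [sub_zero] at h1 h2
  have h3 := (Complex.abs_re_le_norm _).trans h1
  have h4 := (Complex.abs_im_le_norm _).trans h1
  have h5 := (Complex.abs_re_le_norm _).trans h2
  rw [Complex.sub_re, Complex.sub_re, Complex.re_ofReal_mul, h.start_v, mul_zero, sub_zero] at h3
  rw [Complex.sub_im, Complex.sub_im, Complex.im_ofReal_mul, h.start_im, sub_zero] at h4
  rw [Complex.sub_re, h.start_v, sub_zero, abs_of_nonneg hs.1] at h5
  have h6 : (v 0).im ≤ 1 := by
    rw [← h.norm_v 0 h0]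
    exact (le_abs_self _).trans (Complex.abs_im_le_norm _)
  have m1 : K₁ * s ^ 2 ≤ max K₁ K₂ * s ^ 2 := by gcongr; exact le_max_left _ _
  refine ⟨h3.trans m1, h5.trans (mul_le_mul_of_nonneg_right (le_max_right _ _) hs.1), ?_⟩
  have h7 := (abs_le.1 h4).2
  have h8 : s * (v 0).im ≤ s := by nlinarith [hs.1]
  linarith

/-- Orthogonality to the axis gives |Re γ - a| = O(s²), Re v = O(s) and Im γ = O(s), while the chord
is at least c s. In the axis bounds the powers of s then cancel in the first component, and the
second is O(1) + O(s^(-1/2)). -/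
theorem intervalIntegrable_streamForm_start (h : IsQuadrantArc l γ v) {α β : ℝ} (hα : 0 < α)
    (hβ : 0 < β) :
    IntervalIntegrable (fun s => streamForm α β (γ 0) (γ s) (v s)) volume 0 l := by
  have h0 : (0 : ℝ) ∈ Icc 0 l := left_mem_Icc.2 h.l_pos.le
  have ha := h.re_pos 0 (left_mem_Ico.2 h.l_pos)
  have hp' : 0 ≤ (γ 0).im := h.start_im.ge
  obtain ⟨K, hK, hb⟩ := h.exists_start_bounds
  obtain ⟨c, hc, hlow⟩ := h.exists_le_norm_sub
  obtain ⟨M, hM, hM'⟩ := h.exists_norm_le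
  obtain ⟨K₁, hK₁, hb₁⟩ := exists_abs_heatGrad_axis_le hα hβ ha
  obtain ⟨K₂, hK₂, hb₂⟩ := exists_abs_rpow_mul_heatGrad_axis_le hα hβ ha
  set a := (γ 0).re with ha'
  -- For s < δ the real part differs from a by at most a/2, so the axis bounds apply; s ≤ 1 allows
  -- s² ≤ s.
  set δ := min 1 (a / (2 * K)) with hδ
  have hδ0 : 0 < δ := by positivity
  obtain ⟨C, hC⟩ := exists_abs_streamForm_le hα hβ (p := γ 0) ha.le hp'
    (show 0 < c * δ by positivity) M
  set B := 1 + K with hB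
  set c₁ := (c ^ 2) ^ (-(β + 1)) with hc₁
  set c₂ := (c ^ 2) ^ (-(β + 1 / 4)) with hc₂
  have hc₁0 : 0 < c₁ := by positivity
  have hc₂0 : 0 < c₂ := by positivity
  refine intervalIntegrable_of_abs_le (s₀ := 0)
    (M := |C| + K₂ * (B ^ (2 * β) * B * c₁) * K + B ^ (2 * β) * (K₁ * (K * c₁)))
    (C := B ^ (2 * β) * (K₁ * c₂)) h0
    ((h.continuousOn_streamForm hα hβ ha.le hp').mono fun s hs => ⟨hs.1, fun e =>
      hs.2 (h.inj (Ioo_subset_Icc_self hs.1) h0 e)⟩) fun s hs hne => ?_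
  have hs0 : 0 < s := hs.1
  have him := h.im_pos s ⟨hs.1, hs.2.le⟩
  have hs := Ioo_subset_Icc_self hs
  rw [sub_zero, abs_of_pos hs0]
  have hlow' := hlow 0 h0 s hs
  rw [sub_zero, abs_of_pos hs0] at hlow'
  have n1 : 0 ≤ B ^ (2 * β) * (K₁ * c₂) * s ^ (-(1 / 2) : ℝ) := by positivity
  have n2 : 0 ≤ K₂ * (B ^ (2 * β) * B * c₁) * K := by positivity
  have n3 : 0 ≤ B ^ (2 * β) * (K₁ * (K * c₁)) := by positivity
  rcases le_or_gt δ s with h1 | h1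
  · have h2 := hC (γ s) (v s) (h.re_nonneg hs) him.le (hM' s hs)
      (le_trans (by gcongr) hlow') (h.norm_v s hs).le
    linarith [le_abs_self C]
  · obtain ⟨d1, d2, d3⟩ := hb s hs
    have hs1 : s ≤ 1 := h1.le.trans (min_le_left _ _)
    have hs2 : K * s ≤ a / 2 := by
      calc K * s ≤ K * (a / (2 * K)) := by
            gcongr
            exact h1.le.trans (min_le_right _ _)
        _ = a / 2 := by field_simp
    have d4 : (γ s).im ≤ B * s := by
      have : s ^ 2 ≤ s := by nlinarith
      rw [hB]
      linarith [mul_le_mul_of_nonneg_left this hK.le]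
    have d5 : |(γ s).re - a| ≤ a / 2 := d1.trans (by nlinarith)
    have mem : (γ s).re ∈ Icc (a / 2) (3 * a / 2) := by
      rw [abs_le] at d5
      constructor <;> linarith [d5.1, d5.2]
    set R := ((γ s).re - a) ^ 2 + (γ s).im ^ 2 with hR
    have hR1 : c ^ 2 * s ^ 2 ≤ R := by
      have := re_sub_sq_add_im_sub_sq (γ s) (γ 0)
      rw [h.start_im, sub_zero] at this
      rw [hR, this, ← mul_pow]
      gcongr
    have r1 : R ^ (-(β + 1)) ≤ c₁ * s ^ (-(2 * β + 2)) := by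
      refine (Real.rpow_le_rpow_of_nonpos (by positivity) hR1 (by linarith)).trans (le_of_eq ?_)
      rw [Real.mul_rpow (by positivity) (by positivity), ← Real.rpow_natCast s 2,
        ← Real.rpow_mul hs0.le, hc₁]
      congr 2
      push_cast
      ring
    have r2 : R ^ (-(β + 1 / 4)) ≤ c₂ * s ^ (-(2 * β + 1 / 2)) := by
      refine (Real.rpow_le_rpow_of_nonpos (by positivity) hR1 (by linarith)).trans (le_of_eq ?_)
      rw [Real.mul_rpow (by positivity) (by positivity), ← Real.rpow_natCast s 2,
        ← Real.rpow_mul hs0.le, hc₂]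
      congr 2
      push_cast
      ring
    have r3 : (γ s).im ^ (2 * β) ≤ B ^ (2 * β) * s ^ (2 * β) := by
      rw [← Real.mul_rpow (by positivity) hs0.le]
      exact Real.rpow_le_rpow him.le d4 (by linarith)
    have t1 := hb₂ _ mem _ him
    have t2 := hb₁ _ mem _ him
    have s1 : s ^ (2 * β) * s ^ 2 * s ^ (-(2 * β + 2)) = 1 := by
      rw [← Real.rpow_natCast, ← Real.rpow_add hs0, ← Real.rpow_add hs0]
      push_cast
      rw [show 2 * β + 2 + -(2 * β + 2) = 0 by ring, Real.rpow_zero]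
    have s2 : s ^ (2 * β) * s ^ (-(2 * β + 1 / 2)) = s ^ (-(1 / 2) : ℝ) := by
      rw [← Real.rpow_add hs0]
      ring_nf
    have v1 : |(v s).im| ≤ 1 := (Complex.abs_im_le_norm _).trans (h.norm_v s hs).le
    have u1 : |(γ s).re ^ (2 * α) * heatGrad β α 0 a (γ s).im (γ s).re * (v s).re|
        ≤ K₂ * (B ^ (2 * β) * B * c₁) * K := by
      rw [abs_mul]
      calc _ ≤ K₂ * ((B ^ (2 * β) * s ^ (2 * β)) * (B * s) * (c₁ * s ^ (-(2 * β + 2)))) *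
            (K * s) := by
            refine mul_le_mul (t1.trans ?_) d2 (abs_nonneg _) (by positivity)
            gcongr
        _ = K₂ * (B ^ (2 * β) * B * c₁) * K * (s ^ (2 * β) * s ^ 2 * s ^ (-(2 * β + 2))) := by
            ring
        _ = _ := by rw [s1, mul_one]
    have u2 : |(γ s).im ^ (2 * β) * heatGrad α β a 0 (γ s).re (γ s).im * (v s).im|
        ≤ B ^ (2 * β) * (K₁ * (K * c₁)) + B ^ (2 * β) * (K₁ * c₂) * s ^ (-(1 / 2) : ℝ) := by
      rw [abs_mul, abs_mul, abs_of_nonneg (a := (γ s).im ^ (2 * β)) (by positivity)]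
      calc _ ≤ (B ^ (2 * β) * s ^ (2 * β)) * (K₁ * ((K * s ^ 2) * (c₁ * s ^ (-(2 * β + 2)))
            + c₂ * s ^ (-(2 * β + 1 / 2)))) * 1 := by
            refine mul_le_mul (mul_le_mul r3 (t2.trans ?_) (abs_nonneg _) (by positivity)) v1
              (abs_nonneg _) (by positivity)
            gcongr
        _ = B ^ (2 * β) * (K₁ * (K * c₁)) * (s ^ (2 * β) * s ^ 2 * s ^ (-(2 * β + 2)))
            + B ^ (2 * β) * (K₁ * c₂) * (s ^ (2 * β) * s ^ (-(2 * β + 1 / 2))) := by ring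
        _ = _ := by rw [s1, s2, mul_one]
    rw [streamForm, h.start_im, ← ha']
    have := abs_sub ((γ s).re ^ (2 * α) * heatGrad β α 0 a (γ s).im (γ s).re * (v s).re)
      ((γ s).im ^ (2 * β) * heatGrad α β a 0 (γ s).re (γ s).im * (v s).im)
    linarith [abs_nonneg C]

/-- The potential at the start of the arc. -/
theorem integral_streamForm_start (h : IsQuadrantArc l γ v) {α β : ℝ} (hα : 0 < α) (hβ : 0 < β) :
    ∫ s in (0 : ℝ)..l, streamForm α β (γ 0) (γ s) (v s) = -(1 / 2) := by
  have h0 : (0 : ℝ) ∈ Icc 0 l := left_mem_Icc.2 h.l_pos.le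
  have ha := h.re_pos 0 (left_mem_Ico.2 h.l_pos)
  have i1 := h.intervalIntegrable_streamForm_start hα hβ
  obtain ⟨K, hK, hb⟩ := h.exists_start_bounds
  obtain ⟨c, hc, hlow⟩ := h.exists_le_norm_sub
  have hre : Tendsto (fun s => (γ s).re) (𝓝[>] 0) (𝓝 (γ 0).re) :=
    (Complex.continuous_re.tendsto _).comp h.tendsto_nhdsGT_zero
  have him : Tendsto (fun s => (γ s).im) (𝓝[>] 0) (𝓝[>] 0) := by
    refine tendsto_nhdsWithin_iff.2 ⟨?_, h.eventually_nhdsGT_zero.mono fun s hs => hs.2⟩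
    simpa [h.start_im, Function.comp_def] using
      (Complex.continuous_im.tendsto _).comp h.tendsto_nhdsGT_zero
  -- The horizontal deviation is at most K s² and, by the chord bound, the height is at least c s/2
  -- near the start.
  have hslope : Tendsto (fun s => ((γ s).re - (γ 0).re) / (γ s).im) (𝓝[>] 0) (𝓝 0) := by
    have h1 : Tendsto (fun s : ℝ => 2 * K / c * s) (𝓝[>] 0) (𝓝 0) := by
      have : Tendsto (fun s : ℝ => 2 * K / c * s) (𝓝 0) (𝓝 (2 * K / c * 0)) :=
        (continuous_const.mul continuous_id).tendsto 0
      rw [mul_zero] at this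
      exact this.mono_left nhdsWithin_le_nhds
    refine squeeze_zero_norm' ?_ h1
    have hm : 0 < min l (c / (2 * K)) := lt_min h.l_pos (by positivity)
    filter_upwards [Ioo_mem_nhdsGT hm] with s hs
    obtain ⟨a1, a2⟩ := lt_min_iff.1 hs.2
    have hs0 : 0 < s := hs.1
    have hs' : s ∈ Icc 0 l := ⟨hs0.le, a1.le⟩
    have d1 := (hb s hs').1
    have him0 := h.im_pos s ⟨hs0, a1.le⟩
    have d2 := hlow 0 h0 s hs'
    rw [sub_zero, abs_of_pos hs0] at d2
    have d3 := Complex.norm_le_abs_re_add_abs_im (γ s - γ 0)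
    rw [Complex.sub_re, Complex.sub_im, h.start_im, sub_zero, abs_of_pos him0] at d3
    have d4 : K * s ^ 2 ≤ c / 2 * s := by
      have : K * s ≤ c / 2 := by
        calc K * s ≤ K * (c / (2 * K)) := by gcongr
          _ = c / 2 := by field_simp
      nlinarith
    have d5 : c / 2 * s ≤ (γ s).im := by linarith
    rw [Real.norm_eq_abs, abs_div, abs_of_pos him0, div_le_iff₀ him0]
    calc _ ≤ K * s ^ 2 := d1
      _ = 2 * K / c * s * (c / 2 * s) := by field_simp
      _ ≤ _ := by gcongr
  -- The pole seen from the swapped stream function is (0, a), approached perpendicularly: its limit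
  -- is 1/2 at the start and 0 at the end.
  have l0 := tendsto_heatStream_half hβ hα ha him hre hslope
  have key := intervalIntegral.integral_eq_sub_of_hasDerivAt_of_tendsto h.l_pos
    (fun s hs => by
      have := hasDerivAt_heatStream_comp_swap hα hβ ha.le h.start_im.ge (h.hasDerivAt hs)
        (h.re_pos s ⟨hs.1.le, hs.2⟩) (h.im_pos s ⟨hs.1, hs.2.le⟩)
        (by rw [h.start_im]; exact (h.im_pos s ⟨hs.1, hs.2.le⟩).ne')
      rwa [h.start_im] at this) i1 l0
    (h.tendsto_heatStream_end hα hβ ha.le)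
  rw [key]
  norm_num

end IsQuadrantArc

/-! ### The index of a point with respect to the arc -/

/-- A continuous integer-valued function on a preconnected set is constant. -/
theorem eq_of_isPreconnected_of_int {X : Type*} [TopologicalSpace X] {S : Set X}
    (hS : IsPreconnected S) {f : X → ℝ} (hf : ContinuousOn f S)
    (hint : ∀ x ∈ S, ∃ k : ℤ, f x = k) {x y : X} (hx : x ∈ S) (hy : y ∈ S) : f x = f y := by
  have key : ∀ x ∈ S, ∀ y ∈ S, ¬ f x < f y := by
    intro x hx y hy hlt
    obtain ⟨i, hi⟩ := hint x hx
    obtain ⟨j, hj⟩ := hint y hy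
    rw [hi, hj, Int.cast_lt] at hlt
    have h1 : (i : ℝ) + 1 ≤ j := by exact_mod_cast hlt
    obtain ⟨z, hz, hz'⟩ := hS.intermediate_value hx hy hf
      (show f x + 1 / 2 ∈ Icc (f x) (f y) from ⟨by linarith, by rw [hi, hj]; linarith⟩)
    obtain ⟨k, hk⟩ := hint z hz
    rw [hk, hi] at hz'
    have h2 : (2 * k : ℝ) = 2 * i + 1 := by linarith
    have h3 : 2 * k = 2 * i + 1 := by exact_mod_cast h2
    omega
  exact le_antisymm (not_lt.1 (key y hy x hx)) (not_lt.1 (key x hx y hy))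

/-- A quarter turn carries the second quadrant across the branch cut of the argument, so the
difference is -π/2 + 2π. This is where the full turn of the index originates. -/
theorem arg_sub_arg_I_mul {X : ℂ} (hre : X.re < 0) (him : 0 < X.im) :
    Complex.arg X - Complex.arg (Complex.I * X) = 3 * Real.pi / 2 := by
  set Y := -Complex.I * X with hY
  have hpi := Real.pi_pos
  have Yre : Y.re = X.im := by simp [hY]
  have Yim : Y.im = -X.re := by simp [hY]
  have hX : X = Complex.I * Y := by
    rw [hY, ← mul_assoc, mul_neg, Complex.I_mul_I, neg_neg, one_mul]
  have hIX : Complex.I * X = -Y := by rw [hY]; ring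
  have hY0 : Y ≠ 0 := fun e => by
    rw [e, Complex.zero_re] at Yre
    linarith
  have h1 : |Complex.arg Y| < Real.pi / 2 :=
    Complex.abs_arg_lt_pi_div_two_iff.2 (Or.inl (by rw [Yre]; exact him))
  rw [abs_lt] at h1
  have h2 : Complex.arg (Complex.I * Y) = Real.pi / 2 + Complex.arg Y := by
    rw [Complex.arg_mul Complex.I_ne_zero hY0
      (by rw [Complex.arg_I]; constructor <;> linarith [h1.1, h1.2]), Complex.arg_I]
  rw [hIX, Complex.arg_neg_eq_arg_sub_pi_of_im_pos (by rw [Yim]; linarith), hX, h2]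
  ring

namespace IsQuadrantArc

variable {l : ℝ} {γ v : ℝ → ℂ}

/-- With Φ the primitive of v/(γ - p), the product (γ - p) exp(-Φ) is constant. Hence Im Φ(l) is the
change of the argument modulo 2π, and the two closing arguments cancel it modulo 2π. -/
theorem exists_int_arcIndex (h : IsQuadrantArc l γ v) {p : ℂ} (hpγ : p ∉ γ '' Icc 0 l) :
    ∃ k : ℤ, arcIndex l γ v p = k := by
  have hl := h.l_pos.le
  have hne : ∀ s ∈ Icc 0 l, γ s - p ≠ 0 := fun s hs => sub_ne_zero.2 fun e => hpγ ⟨s, hs, e⟩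
  set f : ℝ → ℂ := fun s => v s / (γ s - p) with hf
  have hfc : ContinuousOn f (Icc 0 l) :=
    h.continuousOn_v.div (h.continuousOn.sub continuousOn_const) hne
  -- A continuous extension to the line makes the primitive differentiable at the end points too.
  set g : ℝ → ℂ := IccExtend hl (domRestrict (Icc 0 l) f) with hg
  have hgc : Continuous g := (continuousOn_iff_continuous_domRestrict.1 hfc).Icc_extend'
  have hgf : ∀ s ∈ Icc 0 l, g s = f s := fun s hs => by
    rw [hg, IccExtend_of_mem hl _ hs, domRestrict_apply]
  set Φ : ℝ → ℂ := fun s => ∫ u in (0 : ℝ)..s, g u with hΦ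
  have hΦd : ∀ s, HasDerivAt Φ (g s) s := fun s =>
    intervalIntegral.integral_hasDerivAt_right (hgc.intervalIntegrable _ _)
      (hgc.stronglyMeasurableAtFilter _ _) hgc.continuousAt
  have hd : ∀ s ∈ Icc 0 l,
      HasDerivWithinAt (fun s => (γ s - p) * Complex.exp (-Φ s)) 0 (Icc 0 l) s := fun s hs => by
    have h1 := ((h.hasDeriv s hs).sub_const p).fun_mul
      ((hΦd s).fun_neg.cexp.hasDerivWithinAt (s := Icc 0 l))
    refine h1.congr_deriv ?_
    rw [hgf s hs, hf]
    have := hne s hs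
    field_simp
    ring
  have hconst := (convex_Icc 0 l).norm_image_sub_le_of_norm_hasDerivWithin_le (C := 0) hd
    (fun s _ => by rw [norm_zero]) (left_mem_Icc.2 hl) (right_mem_Icc.2 hl)
  have hΦ0 : Φ 0 = 0 := intervalIntegral.integral_same
  rw [zero_mul, norm_le_zero_iff, sub_eq_zero, hΦ0, neg_zero, Complex.exp_zero, mul_one,
    Complex.exp_neg] at hconst
  have hend : γ l - p = (γ 0 - p) * Complex.exp (Φ l) := by
    rw [← hconst, mul_assoc, inv_mul_cancel₀ (Complex.exp_ne_zero _), mul_one]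
  have him : ∫ s in (0 : ℝ)..l, (v s / (γ s - p)).im = (Φ l).im := by
    have h1 := Complex.imCLM.intervalIntegral_comp_comm (hgc.intervalIntegrable (μ := volume) 0 l)
    simp only [Complex.imCLM_apply] at h1
    rw [hΦ, ← h1]
    refine intervalIntegral.integral_congr fun s hs => ?_
    rw [uIcc_of_le hl] at hs
    simp only [hgf s hs, hf]
  have hangle : ((Complex.arg (Complex.I * (γ l - p)) : ℝ) : Real.Angle)
      = (Complex.arg (Complex.I * (γ 0 - p)) : ℝ) + ((Φ l).im : ℝ) := by
    rw [hend, ← mul_assoc, Complex.arg_mul_coe_angle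
      (mul_ne_zero Complex.I_ne_zero (hne 0 (left_mem_Icc.2 hl))) (Complex.exp_ne_zero _),
      Complex.arg_exp, Real.Angle.coe_toIocMod]
  have hzero : (((Φ l).im + Complex.arg (Complex.I * (γ 0 - p))
      - Complex.arg (Complex.I * (γ l - p)) : ℝ) : Real.Angle) = 0 := by
    rw [Real.Angle.coe_sub, Real.Angle.coe_add, hangle]
    abel
  obtain ⟨k, hk⟩ := Real.Angle.coe_eq_zero_iff.1 hzero
  refine ⟨k, ?_⟩
  rw [arcIndex, him, ← hk, zsmul_eq_mul]
  have := Real.pi_pos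
  field_simp

theorem continuousAt_integral_im_div (h : IsQuadrantArc l γ v) {p : ℂ} (hpγ : p ∉ γ '' Icc 0 l) :
    ContinuousAt (fun q => ∫ s in (0 : ℝ)..l, (v s / (γ s - q)).im) p := by
  have hl := h.l_pos.le
  obtain ⟨d, hd, hlow⟩ := h.exists_le_norm_sub_of_notMem hpγ
  have hnear : ∀ q ∈ Metric.ball p (d / 2), ∀ s ∈ Icc 0 l, d / 2 ≤ ‖γ s - q‖ := by
    intro q hq s hs
    rw [Metric.mem_ball, dist_eq_norm] at hq
    have h1 := norm_sub_le (γ s - q) (p - q)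
    rw [sub_sub_sub_cancel_right, norm_sub_rev p q] at h1
    have := hlow s hs
    linarith
  have hsub : uIoc 0 l ⊆ Icc 0 l := by
    rw [uIoc_of_le hl]
    exact Ioc_subset_Icc_self
  refine intervalIntegral.continuousAt_of_dominated_interval (bound := fun _ => 1 / (d / 2))
    ?_ ?_ intervalIntegrable_const ?_
  · filter_upwards [Metric.ball_mem_nhds p (half_pos hd)] with q hq
    refine (h.intervalIntegrable_im_div_of_notMem ?_).aestronglyMeasurable_restrict_uIoc
    rintro ⟨s, hs, e⟩
    have := hnear q hq s hs
    rw [e, sub_self, norm_zero] at this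
    linarith
  · filter_upwards [Metric.ball_mem_nhds p (half_pos hd)] with q hq
    refine Eventually.of_forall fun s hs => (Complex.abs_im_le_norm _).trans ?_
    rw [norm_div, h.norm_v s (hsub hs)]
    exact one_div_le_one_div_of_le (half_pos hd) (hnear q hq s (hsub hs))
  · refine Eventually.of_forall fun s hs => Complex.continuous_im.continuousAt.comp
      (ContinuousAt.div continuousAt_const (by fun_prop) ?_)
    exact sub_ne_zero.2 fun e => hpγ ⟨s, hsub hs, e⟩

theorem continuousAt_arg_start {p : ℂ} (hp : Complex.I * (γ 0 - p) ∈ Complex.slitPlane) :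
    ContinuousAt (fun q => Complex.arg (Complex.I * (γ 0 - q))) p :=
  (Complex.continuousAt_arg hp).comp (f := fun q => Complex.I * (γ 0 - q)) (by fun_prop)

theorem continuousAt_arg_end (h : IsQuadrantArc l γ v) {p : ℂ} (hp : 0 < p.re) :
    ContinuousAt (fun q => Complex.arg (Complex.I * (γ l - q))) p :=
  (Complex.continuousAt_arg (I_mul_mem_slitPlane (Or.inr (by
    rw [Complex.sub_re, h.end_re]; linarith)))).comp
    (f := fun q => Complex.I * (γ l - q)) (by fun_prop)

theorem continuousAt_arcIndex (h : IsQuadrantArc l γ v) {p : ℂ} (hpγ : p ∉ γ '' Icc 0 l)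
    (hp : 0 < p.re) (hp' : Complex.I * (γ 0 - p) ∈ Complex.slitPlane) :
    ContinuousAt (arcIndex l γ v) p :=
  (((h.continuousAt_integral_im_div hpγ).add (continuousAt_arg_start hp')).sub
    (h.continuousAt_arg_end hp)).div_const _

theorem start_mem_slitPlane (h : IsQuadrantArc l γ v) {p : ℂ} (hp : 0 < p.im) :
    Complex.I * (γ 0 - p) ∈ Complex.slitPlane :=
  I_mul_mem_slitPlane (Or.inl (by rw [Complex.sub_im, h.start_im]; linarith))

/-- The index equals `1` on the open segment from the origin to the start of the arc. -/
theorem arcIndex_axis (h : IsQuadrantArc l γ v) {x₀ : ℝ} (hx₀ : 0 < x₀) (hx₀' : x₀ < (γ 0).re) :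
    arcIndex l γ v x₀ = 1 := by
  have hl := h.l_pos.le
  -- The arc lies in the upper half-plane, except for its start to the right of x₀, so it avoids the
  -- negative axis seen from x₀ and the principal argument is a primitive.
  have hslit : ∀ s ∈ Icc 0 l, 1 * (γ s - x₀) ∈ Complex.slitPlane := fun s hs => by
    rw [one_mul, Complex.mem_slitPlane_iff]
    rcases hs.1.lt_or_eq with h1 | h1
    · right
      rw [Complex.sub_im, Complex.ofReal_im, sub_zero]
      exact (h.im_pos s ⟨h1, hs.2⟩).ne'
    · left
      rw [← h1, Complex.sub_re, Complex.ofReal_re]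
      linarith
  have hnot : (x₀ : ℂ) ∉ γ '' Icc 0 l := by
    rintro ⟨s, hs, e⟩
    have := hslit s hs
    rw [e, sub_self, mul_zero] at this
    exact Complex.zero_notMem_slitPlane this
  have hFTC := intervalIntegral.integral_eq_sub_of_hasDerivAt_of_le hl
    (f := fun s => Complex.arg (1 * (γ s - x₀))) (f' := fun s => (v s / (γ s - x₀)).im)
    (fun s hs => ContinuousAt.comp_continuousWithinAt (f := fun s => 1 * (γ s - x₀))
      (Complex.continuousAt_arg (hslit s hs))
      (continuousWithinAt_const.mul ((h.continuousOn s hs).sub continuousWithinAt_const)))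
    (fun s hs => hasDerivAt_arg_comp (h.hasDerivAt hs) one_ne_zero
      (hslit s (Ioo_subset_Icc_self hs)))
    (h.intervalIntegrable_im_div_of_notMem hnot)
  simp only [one_mul] at hFTC
  have e0 : γ 0 - x₀ = (((γ 0).re - x₀ : ℝ) : ℂ) := by
    rw [← h.start_eq]
    push_cast
    simp
  have hX := arg_sub_arg_I_mul (X := γ l - x₀)
    (by rw [Complex.sub_re, h.end_re, Complex.ofReal_re]; linarith)
    (by rw [Complex.sub_im, Complex.ofReal_im, sub_zero]; exact h.im_pos l ⟨h.l_pos, le_rfl⟩)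
  have e1 : Complex.arg (Complex.I * (γ 0 - x₀)) = Real.pi / 2 := by
    rw [e0, mul_comm, Complex.arg_real_mul _ (by linarith), Complex.arg_I]
  have e2 : Complex.arg (γ 0 - x₀) = 0 := by
    rw [e0]
    exact Complex.arg_ofReal_of_nonneg (by linarith)
  rw [arcIndex, hFTC, e1, e2]
  have hpi := Real.pi_pos
  rw [show Complex.arg (γ l - x₀) - 0 + Real.pi / 2 - Complex.arg (Complex.I * (γ l - x₀))
    = 2 * Real.pi by linarith, div_self (by positivity)]

/-- The angular speed is bounded uniformly in both parameters, so dominated convergence applies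
although the pole moves along the arc itself. -/
theorem continuousOn_integral_im_div_self (h : IsQuadrantArc l γ v) :
    ContinuousOn (fun s => ∫ u in (0 : ℝ)..l, (v u / (γ u - γ s)).im) (Icc 0 l) := by
  intro s₀ hs₀
  have hl := h.l_pos.le
  obtain ⟨M, hM, hb⟩ := h.exists_abs_im_div_le
  have hsub : uIoc 0 l ⊆ Icc 0 l := by
    rw [uIoc_of_le hl]
    exact Ioc_subset_Icc_self
  refine intervalIntegral.tendsto_integral_filter_of_dominated_convergence (fun _ => M) ?_ ?_
    intervalIntegrable_const ?_
  · filter_upwards [self_mem_nhdsWithin] with s hs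
    exact (h.intervalIntegrable_im_div_of_mem hs).aestronglyMeasurable_restrict_uIoc
  · filter_upwards [self_mem_nhdsWithin] with s hs
    exact Eventually.of_forall fun u hu => hb s hs u (hsub hu)
  · have hne : ∀ᵐ u : ℝ, u ≠ s₀ := Measure.ae_ne volume s₀
    filter_upwards [hne] with u hu hu'
    refine (Complex.continuous_im.continuousAt.tendsto).comp ?_
    exact tendsto_const_nhds.div (tendsto_const_nhds.sub (h.continuousOn s₀ hs₀))
      (sub_ne_zero.2 fun e => hu (h.inj (hsub hu') hs₀ e))

theorem tendsto_slope_start (h : IsQuadrantArc l γ v) :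
    Tendsto (fun s : ℝ => (γ s - γ 0) / s) (𝓝[>] 0) (𝓝 (v 0)) := by
  have h0 : (0 : ℝ) ∈ Icc 0 l := left_mem_Icc.2 h.l_pos.le
  obtain ⟨K, hK, hT⟩ := h.exists_taylor
  rw [tendsto_iff_norm_sub_tendsto_zero]
  have h1 : Tendsto (fun s : ℝ => K * s) (𝓝[>] 0) (𝓝 0) := by
    have : Tendsto (fun s : ℝ => K * s) (𝓝 0) (𝓝 (K * 0)) :=
      (continuous_const.mul continuous_id).tendsto 0
    rw [mul_zero] at this
    exact this.mono_left nhdsWithin_le_nhds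
  refine squeeze_zero' (Eventually.of_forall fun s => norm_nonneg _) ?_ h1
  filter_upwards [Ioo_mem_nhdsGT h.l_pos] with s hs
  have hs0 : 0 < s := hs.1
  have h2 := hT 0 h0 s (Ioo_subset_Icc_self hs)
  rw [sub_zero] at h2
  have hsc : (s : ℂ) ≠ 0 := by exact_mod_cast hs0.ne'
  have e : (γ s - γ 0) / s - v 0 = (γ s - γ 0 - s * v 0) / s := by
    field_simp
  rw [e, norm_div, Complex.norm_real, Real.norm_eq_abs, abs_of_pos hs0, div_le_iff₀ hs0]
  calc _ ≤ K * s ^ 2 := h2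
    _ = _ := by ring

theorem start_v_eq (h : IsQuadrantArc l γ v) : v 0 = Complex.I := by
  have h1 : Tendsto (fun s : ℝ => ((γ s - γ 0) / s).im) (𝓝[>] 0) (𝓝 (v 0).im) :=
    (Complex.continuous_im.tendsto _).comp h.tendsto_slope_start
  have h2 : 0 ≤ (v 0).im := by
    refine ge_of_tendsto h1 ?_
    filter_upwards [h.eventually_nhdsGT_zero, self_mem_nhdsWithin] with s hs hs'
    have hs0 : 0 < s := hs'
    rw [Complex.div_ofReal_im, Complex.sub_im, h.start_im, sub_zero]
    exact div_nonneg hs.2.le hs0.le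
  have h3 := h.norm_v 0 (left_mem_Icc.2 h.l_pos.le)
  have h4 : (v 0).im = 1 := by
    have := Complex.sq_norm (v 0)
    rw [h3, Complex.normSq_apply, h.start_v] at this
    nlinarith
  exact Complex.ext (by rw [h.start_v, Complex.I_re]) (by rw [h4, Complex.I_im])

/-- Since v 0 = i, the angle swept from the start begins at π/2, and the argument of i(γ 0 - γ s)
tends to arg(-i · i) = 0. With the 3π/2 of `arg_sub_arg_I_mul` the total is π, half a turn. -/
theorem tendsto_arcIndex_start (h : IsQuadrantArc l γ v) :
    Tendsto (fun s => arcIndex l γ v (γ s)) (𝓝[>] 0) (𝓝 (1 / 2)) := by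
  have hl := h.l_pos.le
  have h0 : (0 : ℝ) ∈ Icc 0 l := left_mem_Icc.2 hl
  have hpi := Real.pi_pos
  have ha := h.re_pos 0 (left_mem_Ico.2 h.l_pos)
  have hle : 𝓝[>] (0 : ℝ) ≤ 𝓝[Icc 0 l] 0 := by
    rw [← nhdsWithin_Ioo_eq_nhdsGT h.l_pos]
    exact nhdsWithin_mono _ Ioo_subset_Icc_self
  have t1 := (h.continuousOn_integral_im_div_self 0 h0).mono_left hle
  have arg_slope : ∀ c : ℂ, c * v 0 ∈ Complex.slitPlane →
      Tendsto (fun s => Complex.arg (c * (γ s - γ 0))) (𝓝[>] 0) (𝓝 (Complex.arg (c * v 0))) := by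
    intro c hc
    refine ((Complex.continuousAt_arg hc).tendsto.comp
      (h.tendsto_slope_start.const_mul c)).congr' ?_
    filter_upwards [self_mem_nhdsWithin] with s hs
    have hs0 : 0 < s := hs
    have e : c * ((γ s - γ 0) / s) = ((s⁻¹ : ℝ) : ℂ) * (c * (γ s - γ 0)) := by
      push_cast
      ring
    rw [Function.comp, e, Complex.arg_real_mul _ (inv_pos.2 hs0)]
  have t2 : Tendsto (fun s => Complex.arg (Complex.I * (γ 0 - γ s))) (𝓝[>] 0) (𝓝 0) := by
    have e : -Complex.I * v 0 = 1 := by rw [h.start_v_eq]; simp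
    have := arg_slope (-Complex.I) (by rw [e]; exact Complex.one_mem_slitPlane)
    rw [e, Complex.arg_one] at this
    refine this.congr fun s => ?_
    congr 1
    ring
  have t3 : Tendsto (fun s => Complex.arg (Complex.I * (γ l - γ s))) (𝓝[>] 0)
      (𝓝 (Complex.arg (Complex.I * (γ l - γ 0)))) :=
    (h.continuousAt_arg_end ha).tendsto.comp h.tendsto_nhdsGT_zero
  have hFTC : ∫ u in (0 : ℝ)..l, (v u / (γ u - γ 0)).im
      = Complex.arg (γ l - γ 0) - Real.pi / 2 := by
    have hslit : ∀ s ∈ Ioc 0 l, 1 * (γ s - γ 0) ∈ Complex.slitPlane := fun s hs => by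
      rw [one_mul, Complex.mem_slitPlane_iff]
      right
      rw [Complex.sub_im, h.start_im, sub_zero]
      exact (h.im_pos s hs).ne'
    have u0 := arg_slope 1 (by
      rw [h.start_v_eq, one_mul, Complex.mem_slitPlane_iff, Complex.I_im]
      exact Or.inr one_ne_zero)
    rw [h.start_v_eq, one_mul, Complex.arg_I] at u0
    have u1 : Tendsto (fun s => Complex.arg (1 * (γ s - γ 0))) (𝓝[<] l)
        (𝓝 (Complex.arg (1 * (γ l - γ 0)))) :=
      (Complex.continuousAt_arg (hslit l (right_mem_Ioc.2 h.l_pos))).tendsto.comp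
        ((h.tendsto_nhdsLT.sub_const _).const_mul 1)
    have := intervalIntegral.integral_eq_sub_of_hasDerivAt_of_tendsto h.l_pos
      (fun s hs => hasDerivAt_arg_comp (h.hasDerivAt hs) one_ne_zero
        (hslit s (Ioo_subset_Ioc_self hs))) (h.intervalIntegrable_im_div_of_mem h0) u0 u1
    rwa [one_mul] at this
  have hX := arg_sub_arg_I_mul (X := γ l - γ 0)
    (by rw [Complex.sub_re, h.end_re]; linarith)
    (by rw [Complex.sub_im, h.start_im, sub_zero]; exact h.im_pos l ⟨h.l_pos, le_rfl⟩)
  have t4 := ((t1.add t2).sub t3).div_const (2 * Real.pi)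
  simp only [hFTC] at t4
  rw [show Complex.arg (γ l - γ 0) - Real.pi / 2 + 0 - Complex.arg (Complex.I * (γ l - γ 0))
    = Real.pi by linarith, show Real.pi / (2 * Real.pi) = 1 / 2 by field_simp] at t4
  exact t4

end IsQuadrantArc

/-! ### The two sides of the arc -/

/-- Comparison of the arc with its tangent, uniformly in h: the denominators are at least of order
|σ| whatever h is, and the errors K|σ| and Kσ² in V and W are absorbed by one or two such factors.
-/
theorem norm_div_sub_one_div_le {V W : ℂ} {σ h K : ℝ} (hK : 0 < K) (hσ : σ ≠ 0)
    (hKσ : K * |σ| ≤ 1 / 2) (hV : ‖V - 1‖ ≤ K * |σ|) (hW : ‖W - σ‖ ≤ K * σ ^ 2) :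
    ‖V / (W - h * Complex.I) - 1 / (σ - h * Complex.I)‖ ≤ 4 * K := by
  have hσ0 : 0 < |σ| := abs_pos.2 hσ
  set z : ℂ := σ - h * Complex.I with hz
  set Z : ℂ := W - h * Complex.I with hZ
  have h1 : |σ| ≤ ‖z‖ := by
    have := Complex.abs_re_le_norm z
    simpa [hz] using this
  have hz0 : 0 < ‖z‖ := hσ0.trans_le h1
  have h2 : ‖Z - z‖ ≤ K * σ ^ 2 := by
    have : Z - z = W - σ := by rw [hZ, hz]; ring
    rwa [this]
  have h3 : ‖z‖ / 2 ≤ ‖Z‖ := by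
    have h4 := norm_sub_norm_le z Z
    rw [norm_sub_rev z Z] at h4
    have h5 : K * σ ^ 2 ≤ ‖z‖ / 2 := by
      rw [← sq_abs]
      nlinarith
    linarith
  have hZ0 : 0 < ‖Z‖ := lt_of_lt_of_le (by positivity) h3
  have hz' : z ≠ 0 := norm_pos_iff.1 hz0
  have hZ' : Z ≠ 0 := norm_pos_iff.1 hZ0
  have e : V / Z - 1 / z = (V - 1) / Z + (z - Z) / (Z * z) := by
    field_simp
    ring
  rw [e]
  refine (norm_add_le _ _).trans ?_
  rw [norm_div, norm_div, norm_mul, norm_sub_rev z Z]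
  have b1 : ‖V - 1‖ / ‖Z‖ ≤ 2 * K := by
    rw [div_le_iff₀ hZ0]
    nlinarith
  have b2 : ‖Z - z‖ / (‖Z‖ * ‖z‖) ≤ 2 * K := by
    rw [div_le_iff₀ (by positivity)]
    have h6 : σ ^ 2 ≤ ‖z‖ * ‖z‖ := by
      rw [← sq_abs]
      nlinarith
    have h7 : ‖z‖ / 2 * ‖z‖ ≤ ‖Z‖ * ‖z‖ := by gcongr
    nlinarith
  linarith

/-- For a straight line the contributions seen from two points symmetric about it cancel, so only
the error of the comparison with the tangent is left. -/
theorem abs_im_div_add_im_div_le {V W : ℂ} {σ h K : ℝ} (hK : 0 < K) (hσ : σ ≠ 0)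
    (hKσ : K * |σ| ≤ 1 / 2) (hV : ‖V - 1‖ ≤ K * |σ|) (hW : ‖W - σ‖ ≤ K * σ ^ 2) :
    |(V / (W - h * Complex.I)).im + (V / (W + h * Complex.I)).im| ≤ 8 * K := by
  have h1 := (Complex.abs_im_le_norm _).trans (norm_div_sub_one_div_le (h := h) hK hσ hKσ hV hW)
  have h2 := (Complex.abs_im_le_norm _).trans (norm_div_sub_one_div_le (h := -h) hK hσ hKσ hV hW)
  rw [Complex.ofReal_neg, neg_mul, sub_neg_eq_add, sub_neg_eq_add] at h2
  rw [Complex.sub_im] at h1 h2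
  have e : (1 / ((σ : ℂ) - h * Complex.I)).im + (1 / ((σ : ℂ) + h * Complex.I)).im = 0 := by
    simp only [im_div_eq]
    have n1 : ‖(σ : ℂ) - h * Complex.I‖ = ‖(σ : ℂ) + h * Complex.I‖ := by
      rw [← RCLike.norm_conj]
      congr 1
      simp
    rw [n1]
    simp only [Complex.sub_re, Complex.sub_im, Complex.add_re, Complex.add_im, Complex.mul_re,
      Complex.mul_im, Complex.ofReal_re, Complex.ofReal_im, Complex.I_re, Complex.I_im,
      Complex.one_re, Complex.one_im]
    ring
  have h3 := abs_add_le ((V / (W - h * Complex.I)).im - (1 / ((σ : ℂ) - h * Complex.I)).im)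
    ((V / (W + h * Complex.I)).im - (1 / ((σ : ℂ) + h * Complex.I)).im)
  have e2 : (V / (W - h * Complex.I)).im + (V / (W + h * Complex.I)).im
      = ((V / (W - h * Complex.I)).im - (1 / ((σ : ℂ) - h * Complex.I)).im)
    + ((V / (W + h * Complex.I)).im - (1 / ((σ : ℂ) + h * Complex.I)).im) := by linarith
  rw [e2]
  linarith

/-- The open first quadrant. -/
def quadrant : Set ℂ := {z | 0 < z.re ∧ 0 < z.im}

theorem convex_quadrant : Convex ℝ quadrant :=
  (convex_halfSpace_re_gt 0).inter (convex_halfSpace_im_gt 0)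

theorem isOpen_quadrant : IsOpen quadrant :=
  (isOpen_lt continuous_const Complex.continuous_re).inter
    (isOpen_lt continuous_const Complex.continuous_im)

namespace IsQuadrantArc

variable {l : ℝ} {γ v : ℝ → ℂ}

theorem norm_sub_le (h : IsQuadrantArc l γ v) {s t : ℝ} (hs : s ∈ Icc 0 l) (ht : t ∈ Icc 0 l) :
    ‖γ t - γ s‖ ≤ |t - s| := by
  have := (convex_Icc 0 l).norm_image_sub_le_of_norm_hasDerivWithin_le (C := 1) h.hasDeriv
    (fun s hs => (h.norm_v s hs).le) hs ht
  rwa [one_mul] at this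

/-- Locally the complement of the arc has two sides. -/
theorem exists_sides (h : IsQuadrantArc l γ v) {s₀ : ℝ} (hs₀ : s₀ ∈ Ioo 0 l) :
    ∃ L R : Set ℂ, IsPreconnected L ∧ IsPreconnected R ∧ L ⊆ quadrant \ γ '' Icc 0 l ∧
      R ⊆ quadrant \ γ '' Icc 0 l ∧ (∀ᶠ z in 𝓝 (γ s₀), z ∈ L ∨ z ∈ R ∨ z ∈ γ '' Icc 0 l) ∧
      ∀ᶠ δ : ℝ in 𝓝[>] 0, γ s₀ + δ * (Complex.I * v s₀) ∈ L ∧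
        γ s₀ - δ * (Complex.I * v s₀) ∈ R := by
  have hs₀' := Ioo_subset_Icc_self hs₀
  obtain ⟨K, hK, hLip⟩ := h.lipschitz
  obtain ⟨c, hc, hlow⟩ := h.exists_le_norm_sub
  have hre := h.re_pos s₀ ⟨hs₀.1.le, hs₀.2⟩
  have him := h.im_pos s₀ ⟨hs₀.1, hs₀.2.le⟩
  set T := v s₀ with hT
  have hTn : ‖T‖ = 1 := h.norm_v s₀ hs₀'
  have hT0 : T ≠ 0 := by
    rw [← norm_pos_iff, hTn]
    exact one_pos
  -- On this window the tangent deviates from T by at most 1/2, so the tangential coordinate grows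
  -- at speed at least 1/2.
  set η₁ := min (1 / (2 * K)) (min s₀ (l - s₀) / 2) with hη₁
  have hm0 : 0 < min s₀ (l - s₀) := lt_min hs₀.1 (sub_pos.2 hs₀.2)
  have hη₁0 : 0 < η₁ := by positivity
  have hη₁K : K * η₁ ≤ 1 / 2 := by
    calc K * η₁ ≤ K * (1 / (2 * K)) := by gcongr; exact min_le_left _ _
      _ = 1 / 2 := by field_simp
  have hη₁s : η₁ ≤ s₀ / 2 ∧ η₁ ≤ (l - s₀) / 2 := by
    have h1 : η₁ ≤ min s₀ (l - s₀) / 2 := min_le_right _ _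
    constructor
    · linarith [min_le_left s₀ (l - s₀)]
    · linarith [min_le_right s₀ (l - s₀)]
  set J := Icc (s₀ - η₁) (s₀ + η₁) with hJ
  have hJl : J ⊆ Ioo 0 l := fun s hs =>
    ⟨by linarith [hs.1, hη₁s.1, hs₀.1], by linarith [hs.2, hη₁s.2, hs₀.2]⟩
  -- The coordinate along the tangent at s₀.
  set u : ℂ → ℝ := fun z => ((z - γ s₀) / T).re with hu
  have hun : ∀ z, |u z| ≤ ‖z - γ s₀‖ := fun z => by
    have := Complex.abs_re_le_norm ((z - γ s₀) / T)
    rwa [norm_div, hTn, div_one] at this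
  have hgd : ∀ s ∈ J, HasDerivAt (fun s => u (γ s)) (v s / T).re s := fun s hs =>
    hasDerivAt_re_comp (((h.hasDerivAt (hJl hs)).sub_const (γ s₀)).div_const T)
  have hgd2 : ∀ s ∈ J, 1 / 2 ≤ (v s / T).re := fun s hs => by
    have e : v s / T = 1 + (v s - T) / T := by field_simp; ring
    have h1 := hLip s (Ioo_subset_Icc_self (hJl hs)) s₀ hs₀'
    have h2 := Complex.abs_re_le_norm ((v s - T) / T)
    rw [norm_div, hTn, div_one] at h2
    have h3 : |s - s₀| ≤ η₁ := by
      rw [abs_le]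
      constructor <;> linarith [hs.1, hs.2]
    have h4 : K * |s - s₀| ≤ K * η₁ := by gcongr
    rw [e, Complex.add_re, Complex.one_re]
    linarith [(abs_le.1 h2).1]
  have hg : ∀ s ∈ J, ∀ t ∈ J, s ≤ t → 1 / 2 * (t - s) ≤ u (γ t) - u (γ s) :=
    (convex_Icc _ _).mul_sub_le_image_sub_of_le_deriv
      (fun s hs => (hgd s hs).continuousAt.continuousWithinAt)
      (fun s hs => (hgd s (interior_subset hs)).differentiableAt.differentiableWithinAt)
      fun s hs => by
        rw [(hgd s (interior_subset hs)).deriv]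
        exact hgd2 s (interior_subset hs)
  have hginj : ∀ s ∈ J, ∀ t ∈ J, u (γ s) = u (γ t) → s = t := fun s hs t ht e => by
    rcases le_total s t with h1 | h1
    · have := hg s hs t ht h1
      linarith
    · have := hg t ht s hs h1
      linarith
  have hu0 : u (γ s₀) = 0 := by simp [hu]
  -- The tube below lies within 3η of γ s₀. The bound c η₁/4 keeps it away from the parts of the arc
  -- outside the window, and the last two bounds keep it in the quadrant.
  set η := min η₁ (min (c * η₁ / 4) (min ((γ s₀).re / 4) ((γ s₀).im / 4))) with hη
  have hη0 : 0 < η := by positivity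
  obtain ⟨k1, k2, k3, k4⟩ : η ≤ η₁ ∧ η ≤ c * η₁ / 4 ∧ η ≤ (γ s₀).re / 4 ∧ η ≤ (γ s₀).im / 4 := by
    refine ⟨min_le_left _ _, (min_le_right _ _).trans (min_le_left _ _),
      ((min_le_right _ _).trans (min_le_right _ _)).trans (min_le_left _ _),
      ((min_le_right _ _).trans (min_le_right _ _)).trans (min_le_right _ _)⟩
  have hsJ : Ioo (s₀ - η) (s₀ + η) ⊆ J := fun s hs =>
    ⟨by linarith [hs.1], by linarith [hs.2]⟩
  -- The arc is translated along the fixed normal iT; positive and negative heights give the two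
  -- sides.
  set F : ℝ × ℝ → ℂ := fun q => γ q.1 + q.2 * (Complex.I * T) with hF
  have hFc : ∀ A : Set ℝ, ContinuousOn F (Ioo (s₀ - η) (s₀ + η) ×ˢ A) := fun A => by
    refine ContinuousOn.add (h.continuousOn.comp continuousOn_fst fun q hq =>
      Ioo_subset_Icc_self (hJl (hsJ hq.1))) (Continuous.continuousOn (by fun_prop))
  have huF : ∀ q : ℝ × ℝ, u (F q) = u (γ q.1) := fun q => by
    have e : (F q - γ s₀) / T = (γ q.1 - γ s₀) / T + q.2 * Complex.I := by
      simp only [hF]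
      field_simp
      ring
    simp only [hu, e, Complex.add_re, Complex.re_ofReal_mul, Complex.I_re, mul_zero, add_zero]
  have hFn : ∀ q : ℝ × ℝ, q.1 ∈ Ioo (s₀ - η) (s₀ + η) → |q.2| < 2 * η →
      ‖F q - γ s₀‖ < 3 * η := fun q hq hq2 => by
    have h1 := h.norm_sub_le hs₀' (Ioo_subset_Icc_self (hJl (hsJ hq)))
    have h2 : |q.1 - s₀| ≤ η := by
      rw [abs_le]
      constructor <;> linarith [hq.1, hq.2]
    have h3 : ‖F q - γ s₀‖ ≤ ‖γ q.1 - γ s₀‖ + ‖(q.2 : ℂ) * (Complex.I * T)‖ := by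
      have : F q - γ s₀ = γ q.1 - γ s₀ + (q.2 : ℂ) * (Complex.I * T) := by
        simp only [hF]
        ring
      rw [this]
      exact norm_add_le _ _
    rw [norm_mul, norm_mul, hTn, Complex.norm_I, Complex.norm_real, Real.norm_eq_abs] at h3
    linarith
  have hFmem : ∀ q : ℝ × ℝ, q.1 ∈ Ioo (s₀ - η) (s₀ + η) → |q.2| < 2 * η → q.2 ≠ 0 →
      F q ∈ quadrant \ γ '' Icc 0 l := fun q hq hq2 hq0 => by
    have h1 := hFn q hq hq2
    have h2 := (Complex.abs_re_le_norm _).trans_lt h1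
    have h3 := (Complex.abs_im_le_norm _).trans_lt h1
    rw [Complex.sub_re, abs_lt] at h2
    rw [Complex.sub_im, abs_lt] at h3
    refine ⟨⟨by linarith [h2.1], by linarith [h3.1]⟩, ?_⟩
    rintro ⟨t, ht, e⟩
    -- Inside the window equal tangential coordinates force equal parameters, hence height zero;
    -- outside it the chord bound contradicts the size of the tube.
    rcases le_or_gt |t - s₀| η₁ with h4 | h4
    · rw [abs_le] at h4
      have htJ : t ∈ J := ⟨by linarith [h4.1], by linarith [h4.2]⟩
      have h5 := huF q
      rw [← e] at h5
      have h6 := hginj t htJ q.1 (hsJ hq) h5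
      rw [h6] at e
      have h7 : (q.2 : ℂ) * (Complex.I * T) = 0 := by
        simp only [hF] at e
        simpa using e
      rcases mul_eq_zero.1 h7 with h8 | h8
      · exact hq0 (by exact_mod_cast h8)
      · exact mul_ne_zero Complex.I_ne_zero hT0 h8
    · have h5 := hlow s₀ hs₀' t ht
      rw [e] at h5
      have h6 : c * η₁ ≤ c * |t - s₀| := by gcongr
      linarith
  have hs₀η : s₀ ∈ Ioo (s₀ - η) (s₀ + η) := ⟨by linarith, by linarith⟩
  refine ⟨F '' (Ioo (s₀ - η) (s₀ + η) ×ˢ Ioo 0 (2 * η)),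
    F '' (Ioo (s₀ - η) (s₀ + η) ×ˢ Ioo (-(2 * η)) 0),
    (isPreconnected_Ioo.prod isPreconnected_Ioo).image _ (hFc _),
    (isPreconnected_Ioo.prod isPreconnected_Ioo).image _ (hFc _), ?_, ?_, ?_, ?_⟩
  · rintro _ ⟨q, hq, rfl⟩
    exact hFmem q hq.1 (by rw [abs_of_pos hq.2.1]; exact hq.2.2) hq.2.1.ne'
  · rintro _ ⟨q, hq, rfl⟩
    exact hFmem q hq.1 (by rw [abs_of_neg hq.2.2]; linarith [hq.2.1]) hq.2.2.ne
  · filter_upwards [Metric.ball_mem_nhds (γ s₀) (show 0 < η / 2 by positivity)] with z hz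
    rw [Metric.mem_ball, dist_eq_norm] at hz
    have h1 := abs_lt.1 ((hun z).trans_lt hz)
    have mJ1 : s₀ - η ∈ J := ⟨by linarith, by linarith⟩
    have mJ2 : s₀ + η ∈ J := ⟨by linarith, by linarith⟩
    have mJ0 : s₀ ∈ J := ⟨by linarith, by linarith⟩
    have g1 := hg _ mJ1 _ mJ0 (by linarith)
    have g2 := hg _ mJ0 _ mJ2 (by linarith)
    rw [hu0] at g1 g2
    have hsub : Icc (s₀ - η) (s₀ + η) ⊆ J := Icc_subset_Icc (by linarith) (by linarith)
    -- The point of the arc with the same tangential coordinate as z; the difference is then a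
    -- multiple of the normal, and its sign decides the side.
    obtain ⟨σ, hσ, e⟩ := intermediate_value_Icc (show s₀ - η ≤ s₀ + η by linarith)
      (fun s hs => (hgd s (hsub hs)).continuousAt.continuousWithinAt)
      (show u z ∈ Icc _ _ from ⟨by linarith [h1.1], by linarith [h1.2]⟩)
    simp only at e
    have hσ1 : σ ∈ Ioo (s₀ - η) (s₀ + η) := by
      refine ⟨lt_of_le_of_ne hσ.1 fun e2 => ?_, lt_of_le_of_ne hσ.2 fun e2 => ?_⟩
      · rw [← e2] at e
        linarith [h1.1]
      · rw [e2] at e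
        linarith [h1.2]
    set w := (z - γ σ) / T with hw
    have hwre : w.re = 0 := by
      have e2 : w = (z - γ s₀) / T - (γ σ - γ s₀) / T := by rw [hw]; ring
      have e3 : w.re = u z - u (γ σ) := by rw [e2, Complex.sub_re]
      rw [e3, e, sub_self]
    have hwI : w = w.im * Complex.I := by
      apply Complex.ext <;> simp [hwre]
    have hzF : F (σ, w.im) = z := by
      have e2 : (w.im : ℂ) * (Complex.I * T) = z - γ σ := by
        rw [← mul_assoc, ← hwI, hw, div_mul_cancel₀ _ hT0]
      simp only [hF, e2]
      ring
    have hwn : |w.im| < 2 * η := by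
      have h2 := Complex.abs_im_le_norm w
      rw [hw, norm_div, hTn, div_one] at h2
      have h3 := h.norm_sub_le (Ioo_subset_Icc_self (hJl (hsJ hσ1))) hs₀'
      have h4 : |s₀ - σ| ≤ η := by
        rw [abs_le]
        constructor <;> linarith [hσ.1, hσ.2]
      have h5 := norm_add_le (z - γ s₀) (γ s₀ - γ σ)
      rw [sub_add_sub_cancel] at h5
      linarith
    rw [abs_lt] at hwn
    rcases lt_trichotomy w.im 0 with h2 | h2 | h2
    · exact Or.inr (Or.inl ⟨(σ, w.im), ⟨hσ1, hwn.1, h2⟩, hzF⟩)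
    · refine Or.inr (Or.inr ⟨σ, Ioo_subset_Icc_self (hJl (hsJ hσ1)), ?_⟩)
      rw [← hzF, h2]
      simp [hF]
    · exact Or.inl ⟨(σ, w.im), ⟨hσ1, h2, hwn.2⟩, hzF⟩
  · filter_upwards [Ioo_mem_nhdsGT (show 0 < 2 * η by positivity)] with δ hδ
    refine ⟨⟨(s₀, δ), ⟨hs₀η, hδ⟩, rfl⟩, ⟨(s₀, -δ), ⟨hs₀η, ?_⟩, ?_⟩⟩
    · exact ⟨by linarith [hδ.2], by linarith [hδ.1]⟩
    · simp only [hF]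
      push_cast
      ring

/-- The angle integral seen from one side has no integrable majorant uniform in δ, but in the sum
over two points symmetric about the tangent the singular parts cancel. Dominated convergence then
gives twice the integral seen from the arc. -/
theorem tendsto_arcIndex_add (h : IsQuadrantArc l γ v) {s₀ : ℝ} (hs₀ : s₀ ∈ Ioo 0 l) :
    Tendsto (fun δ : ℝ => arcIndex l γ v (γ s₀ + δ * (Complex.I * v s₀))
      + arcIndex l γ v (γ s₀ - δ * (Complex.I * v s₀))) (𝓝[>] 0)
      (𝓝 (2 * arcIndex l γ v (γ s₀))) := by
  have hs₀' := Ioo_subset_Icc_self hs₀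
  have hl := h.l_pos.le
  have hre := h.re_pos s₀ ⟨hs₀.1.le, hs₀.2⟩
  have him := h.im_pos s₀ ⟨hs₀.1, hs₀.2.le⟩
  obtain ⟨L, R, -, -, hL, hR, -, hLR⟩ := h.exists_sides hs₀
  obtain ⟨K₁, hK₁, hLip⟩ := h.lipschitz
  obtain ⟨K₂, hK₂, hTay⟩ := h.exists_taylor
  obtain ⟨c, hc, hlow⟩ := h.exists_le_norm_sub
  set K := max K₁ K₂ with hKdef
  have hK : 0 < K := by positivity
  set T := v s₀ with hT
  have hTn : ‖T‖ = 1 := h.norm_v s₀ hs₀'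
  have hT0 : T ≠ 0 := by
    rw [← norm_pos_iff, hTn]
    exact one_pos
  have hsub : uIoc 0 l ⊆ Icc 0 l := by
    rw [uIoc_of_le hl]
    exact Ioc_subset_Icc_self
  have tz : ∀ e : ℂ, Tendsto (fun δ : ℝ => γ s₀ + δ * e) (𝓝[>] 0) (𝓝 (γ s₀)) := fun e => by
    have : Tendsto (fun δ : ℝ => γ s₀ + δ * e) (𝓝 0) (𝓝 (γ s₀ + ((0 : ℝ) : ℂ) * e)) :=
      Continuous.tendsto (by fun_prop) 0
    rw [Complex.ofReal_zero, zero_mul, add_zero] at this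
    exact this.mono_left nhdsWithin_le_nhds
  have tp := tz (Complex.I * T)
  have tm : Tendsto (fun δ : ℝ => γ s₀ - δ * (Complex.I * T)) (𝓝[>] 0) (𝓝 (γ s₀)) := by
    refine (tz (-(Complex.I * T))).congr fun δ => ?_
    ring
  have tint : Tendsto (fun δ : ℝ => ∫ s in (0 : ℝ)..l,
      ((v s / (γ s - (γ s₀ + δ * (Complex.I * T)))).im
        + (v s / (γ s - (γ s₀ - δ * (Complex.I * T)))).im)) (𝓝[>] 0)
      (𝓝 (∫ s in (0 : ℝ)..l, ((v s / (γ s - γ s₀)).im + (v s / (γ s - γ s₀)).im))) := by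
    refine intervalIntegral.tendsto_integral_filter_of_dominated_convergence
      (fun _ => 8 * K + (4 * K / c + 4 * K / c)) ?_ ?_ intervalIntegrable_const ?_
    · filter_upwards [hLR] with δ hδ
      exact ((h.intervalIntegrable_im_div_of_notMem (hL hδ.1).2).add
        (h.intervalIntegrable_im_div_of_notMem (hR hδ.2).2)).aestronglyMeasurable_restrict_uIoc
    · filter_upwards [Ioo_mem_nhdsGT (show 0 < c / (4 * K) by positivity)] with δ hδ
      have hne : ∀ᵐ s : ℝ, s ≠ s₀ := Measure.ae_ne volume s₀
      filter_upwards [hne] with s hs hs'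
      have hs' := hsub hs'
      have q1 : 0 ≤ 4 * K / c := by positivity
      rw [Real.norm_eq_abs]
      -- Close to s₀ the symmetric cancellation bounds the sum; farther away both denominators are
      -- at least c/(4K), because δ < c/(4K).
      rcases le_or_gt (K * |s - s₀|) (1 / 2) with h1 | h1
      · have hV : ‖v s / T - 1‖ ≤ K * |s - s₀| := by
          have e : v s / T - 1 = (v s - T) / T := by field_simp
          rw [e, norm_div, hTn, div_one]
          refine (hLip s hs' s₀ hs₀').trans ?_
          gcongr
          exact le_max_left _ _
        have hW : ‖(γ s - γ s₀) / T - ((s - s₀ : ℝ) : ℂ)‖ ≤ K * (s - s₀) ^ 2 := by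
          have e : (γ s - γ s₀) / T - ((s - s₀ : ℝ) : ℂ)
              = (γ s - γ s₀ - ((s - s₀ : ℝ) : ℂ) * T) / T := by field_simp
          rw [e, norm_div, hTn, div_one]
          refine (hTay s₀ hs₀' s hs').trans ?_
          gcongr
          exact le_max_right _ _
        have h2 := abs_im_div_add_im_div_le (h := δ) hK (sub_ne_zero.2 hs) h1 hV hW
        have e1 : v s / (γ s - (γ s₀ + δ * (Complex.I * T)))
            = v s / T / ((γ s - γ s₀) / T - δ * Complex.I) := by
          rw [div_div]
          congr 1
          field_simp
          ring
        have e2 : v s / (γ s - (γ s₀ - δ * (Complex.I * T)))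
            = v s / T / ((γ s - γ s₀) / T + δ * Complex.I) := by
          rw [div_div]
          congr 1
          field_simp
          ring
        rw [e1, e2]
        linarith
      · have h2 : c / (2 * K) ≤ ‖γ s - γ s₀‖ := by
          refine le_trans ?_ (hlow s₀ hs₀' s hs')
          rw [div_le_iff₀ (by positivity)]
          have := mul_le_mul_of_nonneg_left h1.le hc.le
          linarith
        have h3 : ‖(δ : ℂ) * (Complex.I * T)‖ ≤ c / (4 * K) := by
          rw [norm_mul, norm_mul, hTn, Complex.norm_I, Complex.norm_real, Real.norm_eq_abs,
            abs_of_pos hδ.1]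
          linarith [hδ.2]
        have h4 : c / (4 * K) + c / (4 * K) = c / (2 * K) := by field_simp; norm_num
        have far : ∀ w : ℂ, c / (4 * K) ≤ ‖w‖ → |(v s / w).im| ≤ 4 * K / c := fun w hw => by
          refine (Complex.abs_im_le_norm _).trans ?_
          rw [norm_div, h.norm_v s hs', div_le_iff₀ (lt_of_lt_of_le (by positivity) hw)]
          calc (1 : ℝ) = 4 * K / c * (c / (4 * K)) := by field_simp
            _ ≤ _ := by gcongr
        have f1 := far (γ s - (γ s₀ + δ * (Complex.I * T))) (by
          have := norm_sub_norm_le (γ s - γ s₀) (δ * (Complex.I * T))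
          rw [sub_sub] at this
          linarith)
        have f2 := far (γ s - (γ s₀ - δ * (Complex.I * T))) (by
          have := norm_sub_norm_le (γ s - γ s₀) (-(δ * (Complex.I * T)))
          rw [norm_neg, sub_neg_eq_add] at this
          rw [← sub_add]
          linarith)
        refine (abs_add_le _ _).trans ?_
        linarith
    · have hne : ∀ᵐ s : ℝ, s ≠ s₀ := Measure.ae_ne volume s₀
      filter_upwards [hne] with s hs hs'
      have hw : γ s - γ s₀ ≠ 0 := sub_ne_zero.2 fun e => hs (h.inj (hsub hs') hs₀' e)
      exact ((Complex.continuous_im.tendsto _).comp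
        (tendsto_const_nhds.div (tendsto_const_nhds.sub tp) hw)).add
        ((Complex.continuous_im.tendsto _).comp
        (tendsto_const_nhds.div (tendsto_const_nhds.sub tm) hw))
  have c0 := (continuousAt_arg_start (h.start_mem_slitPlane him)).tendsto
  have c1 := (h.continuousAt_arg_end hre).tendsto
  have key := (((tint.add (c0.comp tp)).add (c0.comp tm)).sub
    ((c1.comp tp).add (c1.comp tm))).div_const (2 * Real.pi)
  have i0 := h.intervalIntegrable_im_div_of_mem hs₀'
  rw [intervalIntegral.integral_add i0 i0] at key
  have e : 2 * arcIndex l γ v (γ s₀) = ((∫ s in (0 : ℝ)..l, (v s / (γ s - γ s₀)).im)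
      + (∫ s in (0 : ℝ)..l, (v s / (γ s - γ s₀)).im)
      + Complex.arg (Complex.I * (γ 0 - γ s₀)) + Complex.arg (Complex.I * (γ 0 - γ s₀))
      - (Complex.arg (Complex.I * (γ l - γ s₀)) + Complex.arg (Complex.I * (γ l - γ s₀))))
      / (2 * Real.pi) := by
    rw [arcIndex]
    ring
  rw [e]
  refine key.congr' ?_
  filter_upwards [hLR] with δ hδ
  rw [intervalIntegral.integral_add (h.intervalIntegrable_im_div_of_notMem (hL hδ.1).2)
    (h.intervalIntegrable_im_div_of_notMem (hR hδ.2).2), arcIndex, arcIndex]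
  simp only [Function.comp]
  ring

/-- The index of a point of the arc. -/
theorem arcIndex_of_mem (h : IsQuadrantArc l γ v) {s₀ : ℝ} (hs₀ : s₀ ∈ Ioo 0 l) :
    arcIndex l γ v (γ s₀) = 1 / 2 := by
  -- Both side values are integers, and a limit of integers is an integer.
  have hint : ∀ s ∈ Ioo 0 l, ∃ k : ℤ, 2 * arcIndex l γ v (γ s) = k := fun s hs => by
    obtain ⟨L, R, -, -, hL, hR, -, hLR⟩ := h.exists_sides hs
    have h1 : 2 * arcIndex l γ v (γ s) ∈ range ((↑) : ℤ → ℝ) := by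
      refine Int.isClosedEmbedding_coe_real.isClosed_range.mem_of_tendsto
        (h.tendsto_arcIndex_add hs) ?_
      filter_upwards [hLR] with δ hδ
      obtain ⟨i, hi⟩ := h.exists_int_arcIndex (hL hδ.1).2
      obtain ⟨j, hj⟩ := h.exists_int_arcIndex (hR hδ.2).2
      exact ⟨i + j, by rw [hi, hj]; push_cast; ring⟩
    obtain ⟨k, hk⟩ := h1
    exact ⟨k, hk.symm⟩
  have hcont : ContinuousOn (fun s => 2 * arcIndex l γ v (γ s)) (Ioo 0 l) := by
    intro s hs
    have cγ := (h.hasDerivAt hs).continuousAt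
    have c0 := (continuousAt_arg_start (h.start_mem_slitPlane
      (h.im_pos s ⟨hs.1, hs.2.le⟩))).comp (f := γ) cγ
    have c1 := (h.continuousAt_arg_end (h.re_pos s ⟨hs.1.le, hs.2⟩)).comp (f := γ) cγ
    have ci := h.continuousOn_integral_im_div_self.continuousAt (Icc_mem_nhds hs.1 hs.2)
    exact ((((ci.add c0).sub c1).div_const (2 * Real.pi)).const_mul 2).continuousWithinAt
  -- Being integer-valued and continuous, twice the index is constant on the open arc and equals its
  -- limit 1 at the start.
  have hconst : ∀ᶠ s in 𝓝[>] 0, 2 * arcIndex l γ v (γ s) = 2 * arcIndex l γ v (γ s₀) := by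
    filter_upwards [Ioo_mem_nhdsGT h.l_pos] with s hs
    exact eq_of_isPreconnected_of_int isPreconnected_Ioo hcont hint hs hs₀
  have h1 := (h.tendsto_arcIndex_start).const_mul 2
  have h2 := tendsto_nhds_unique (h1.congr' hconst) tendsto_const_nhds
  linarith

/-- The index of a point of the quadrant with respect to an arc bounding the domain `Ω`. -/
theorem arcIndex_of_domain (h : IsQuadrantArc l γ v) {Ω : Set ℂ} (hΩo : IsOpen Ω)
    (hΩc : IsPreconnected Ω) (hΩq : Ω ⊆ quadrant)
    (hΩf : frontier Ω ∩ quadrant = γ '' Ioo 0 l)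
    (hΩa : ∃ x₀ : ℝ, 0 < x₀ ∧ x₀ < (γ 0).re ∧ (x₀ : ℂ) ∈ frontier Ω) :
    ∀ p ∈ quadrant, p ∉ γ '' Ioo 0 l →
      (p ∈ Ω → arcIndex l γ v p = 1) ∧ (p ∉ Ω → arcIndex l γ v p = 0) := by
  have hΓ : ∀ p ∈ quadrant, p ∉ γ '' Ioo 0 l → p ∉ γ '' Icc 0 l := by
    rintro p hp hp' ⟨s, hs, rfl⟩
    refine hp' ⟨s, ⟨lt_of_le_of_ne hs.1 fun e => ?_, lt_of_le_of_ne hs.2 fun e => ?_⟩, rfl⟩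
    · have := hp.2
      rw [← e, h.start_im] at this
      exact this.false
    · have := hp.1
      rw [e, h.end_re] at this
      exact this.false
  have hΩΓ : ∀ p ∈ Ω, p ∉ γ '' Ioo 0 l := fun p hp hp' => by
    rw [← hΩf] at hp'
    rw [hΩo.frontier_eq] at hp'
    exact hp'.1.2 hp
  have hcont : ∀ p ∈ quadrant, p ∉ γ '' Ioo 0 l → ContinuousAt (arcIndex l γ v) p :=
    fun p hp hp' => h.continuousAt_arcIndex (hΓ p hp hp') hp.1 (h.start_mem_slitPlane hp.2)
  -- the index is one in the domain
  have hone : ∀ p ∈ Ω, arcIndex l γ v p = 1 := by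
    obtain ⟨x₀, hx₀, hx₀', hfr⟩ := hΩa
    have hnot : (x₀ : ℂ) ∉ γ '' Icc 0 l := by
      rintro ⟨s, hs, e⟩
      rcases hs.1.lt_or_eq with h1 | h1
      · have := h.im_pos s ⟨h1, hs.2⟩
        rw [e, Complex.ofReal_im] at this
        exact this.false
      · rw [← h1] at e
        rw [e, Complex.ofReal_re] at hx₀'
        exact hx₀'.false
    have c := h.continuousAt_arcIndex hnot (by rwa [Complex.ofReal_re])
      (I_mul_mem_slitPlane (Or.inr (by rw [Complex.sub_re, Complex.ofReal_re]; linarith)))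
    have h1 := h.arcIndex_axis hx₀ hx₀'
    -- The index is continuous at this boundary point, where it equals 1. Points of Ω nearby have
    -- integer index between 1/2 and 3/2.
    have h2 : ∀ᶠ z in 𝓝 (x₀ : ℂ), 1 / 2 < arcIndex l γ v z ∧ arcIndex l γ v z < 3 / 2 :=
      (c.eventually_const_lt (by rw [h1]; norm_num)).and
        (c.eventually_lt_const (by rw [h1]; norm_num))
    obtain ⟨z, hz, hzΩ⟩ := mem_closure_iff_nhds.1 (frontier_subset_closure hfr) _ h2
    have hz1 : arcIndex l γ v z = 1 := by
      obtain ⟨k, hk⟩ := h.exists_int_arcIndex (hΓ z (hΩq hzΩ) (hΩΓ z hzΩ))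
      obtain ⟨a1, a2⟩ := hz
      rw [hk] at a1 a2 ⊢
      have b1 : (0 : ℤ) < k := by
        have : (0 : ℝ) < k := by linarith
        exact_mod_cast this
      have b2 : k < 2 := by
        have : (k : ℝ) < 2 := by linarith
        exact_mod_cast this
      have : k = 1 := by omega
      rw [this, Int.cast_one]
    intro p hp
    rw [← hz1]
    exact eq_of_isPreconnected_of_int hΩc
      (fun q hq => (hcont q (hΩq hq) (hΩΓ q hq)).continuousWithinAt)
      (fun q hq => h.exists_int_arcIndex (hΓ q (hΩq hq) (hΩΓ q hq))) hp hzΩ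
  -- Points of the arc and of Ω belong to D vacuously, so the condition can be propagated across the
  -- arc.
  set D : Set ℂ := {p | p ∉ γ '' Ioo 0 l → p ∉ Ω → arcIndex l γ v p = 0} with hD
  -- membership in `D` is locally constant in the quadrant
  have hloc : ∀ p ∈ quadrant, (∀ᶠ z in 𝓝 p, z ∈ D) ∨ (∀ᶠ z in 𝓝 p, z ∉ D) := by
    intro p hp
    by_cases hpΓ : p ∈ γ '' Ioo 0 l
    · left
      obtain ⟨s₀, hs₀, rfl⟩ := hpΓ
      obtain ⟨L, R, hLc, hRc, hL, hR, hnear, hLR⟩ := h.exists_sides hs₀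
      have hΓ' : ∀ {S : Set ℂ}, S ⊆ quadrant \ γ '' Icc 0 l →
          S ⊆ quadrant \ γ '' Ioo 0 l := fun hS z hz =>
        ⟨(hS hz).1, fun e => (hS hz).2 (image_mono Ioo_subset_Icc_self e)⟩
      -- a side of the arc that meets the domain lies in it
      have hside : ∀ {S : Set ℂ}, IsPreconnected S → S ⊆ quadrant \ γ '' Icc 0 l →
          (S ∩ Ω).Nonempty → S ⊆ Ω := fun {S} hS hSq hne => by
        refine hS.subset_left_of_subset_union hΩo isClosed_closure.isOpen_compl
          (disjoint_compl_right.mono_left subset_closure) (fun z hz => ?_) hne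
        by_cases hzΩ : z ∈ Ω
        · exact Or.inl hzΩ
        · refine Or.inr fun hc => (hΓ' hSq hz).2 ?_
          rw [← hΩf, hΩo.frontier_eq]
          exact ⟨⟨hc, hzΩ⟩, (hSq hz).1⟩
      have hconst : ∀ {S : Set ℂ}, IsPreconnected S → S ⊆ quadrant \ γ '' Icc 0 l →
          ∀ z ∈ S, ∀ w ∈ S, arcIndex l γ v z = arcIndex l γ v w := fun hS hSq z hz w hw =>
        eq_of_isPreconnected_of_int hS
          (fun q hq => (hcont q (hSq hq).1 (hΓ' hSq hq).2).continuousWithinAt)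
          (fun q hq => h.exists_int_arcIndex (hSq hq).2) hz hw
      have hsum : ∀ z ∈ L, ∀ w ∈ R, arcIndex l γ v z + arcIndex l γ v w = 1 := by
        intro z hz w hw
        have h1 := h.tendsto_arcIndex_add hs₀
        rw [h.arcIndex_of_mem hs₀] at h1
        have h2 : ∀ᶠ δ : ℝ in 𝓝[>] 0, arcIndex l γ v (γ s₀ + δ * (Complex.I * v s₀))
            + arcIndex l γ v (γ s₀ - δ * (Complex.I * v s₀))
            = arcIndex l γ v z + arcIndex l γ v w := by
          filter_upwards [hLR] with δ hδ
          rw [hconst hLc hL _ hδ.1 z hz, hconst hRc hR _ hδ.2 w hw]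
        have h3 := tendsto_nhds_unique (h1.congr' h2) tendsto_const_nhds
        linarith
      obtain ⟨δ, hδ⟩ := hLR.exists
      -- The arc lies in the closure of Ω, so at least one side meets Ω and hence lies in it with
      -- index 1. The other side then has index 0.
      have hmeet : (L ∩ Ω).Nonempty ∨ (R ∩ Ω).Nonempty := by
        have h1 : γ s₀ ∈ closure Ω := by
          have : γ s₀ ∈ frontier Ω ∩ quadrant := by
            rw [hΩf]
            exact ⟨s₀, hs₀, rfl⟩
          exact frontier_subset_closure this.1
        obtain ⟨z, hz, hzΩ⟩ := mem_closure_iff_nhds.1 h1 _ hnear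
        rcases hz with hz | hz | hz
        · exact Or.inl ⟨z, hz, hzΩ⟩
        · exact Or.inr ⟨z, hz, hzΩ⟩
        · exact absurd hz (hΓ z (hΩq hzΩ) (hΩΓ z hzΩ))
      filter_upwards [hnear, isOpen_quadrant.mem_nhds hp] with z hz hzq hz1 hz2
      rcases hmeet with hm | hm
      · have hLΩ := hside hLc hL hm
        rcases hz with hz | hz | hz
        · exact absurd (hLΩ hz) hz2
        · have := hsum _ hδ.1 z hz
          rw [hone _ (hLΩ hδ.1)] at this
          linarith
        · exact absurd hz (hΓ z hzq hz1)
      · have hRΩ := hside hRc hR hm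
        rcases hz with hz | hz | hz
        · have := hsum z hz _ hδ.2
          rw [hone _ (hRΩ hδ.2)] at this
          linarith
        · exact absurd (hRΩ hz) hz2
        · exact absurd hz (hΓ z hzq hz1)
    · by_cases hpΩ : p ∈ Ω
      · left
        filter_upwards [hΩo.mem_nhds hpΩ] with z hz _ hz2
        exact absurd hz hz2
      · have hpcl : p ∉ closure Ω := fun hc => hpΓ (by
          rw [← hΩf, hΩo.frontier_eq]
          exact ⟨⟨hc, hpΩ⟩, hp⟩)
        have hball : ∀ᶠ z in 𝓝 p, z ∈ quadrant ∧ z ∉ closure Ω :=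
          Filter.Eventually.and (isOpen_quadrant.mem_nhds hp)
            (isClosed_closure.isOpen_compl.mem_nhds hpcl)
        obtain ⟨ε, hε, hb⟩ := Metric.eventually_nhds_iff_ball.1 hball
        have hbΓ : ∀ z ∈ Metric.ball p ε, z ∉ γ '' Ioo 0 l := fun z hz e => by
          rw [← hΩf] at e
          exact (hb z hz).2 (frontier_subset_closure e.1)
        have hval : ∀ z ∈ Metric.ball p ε, arcIndex l γ v z = arcIndex l γ v p := fun z hz =>
          eq_of_isPreconnected_of_int (convex_ball p ε).isPreconnected
            (fun q hq => (hcont q (hb q hq).1 (hbΓ q hq)).continuousWithinAt)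
            (fun q hq => h.exists_int_arcIndex (hΓ q (hb q hq).1 (hbΓ q hq))) hz
            (Metric.mem_ball_self hε)
        by_cases hp0 : arcIndex l γ v p = 0
        · left
          filter_upwards [Metric.ball_mem_nhds p hε] with z hz _ _
          rw [hval z hz, hp0]
        · right
          filter_upwards [Metric.ball_mem_nhds p hε] with z hz hzD
          exact hp0 (by
            rw [← hval z hz]
            exact hzD (hbΓ z hz) fun e => (hb z hz).2 (subset_closure e))
  have hmid : γ (l / 2) ∈ γ '' Ioo 0 l :=
    ⟨l / 2, ⟨by linarith [h.l_pos], by linarith [h.l_pos]⟩, rfl⟩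
  have hmidq : γ (l / 2) ∈ quadrant := by
    rw [← hΩf] at hmid
    exact hmid.2
  -- The interior of D and that of its complement are disjoint, open and cover the connected
  -- quadrant; the midpoint of the arc lies in the first.
  have hall : quadrant ⊆ {p | ∀ᶠ z in 𝓝 p, z ∈ D} := by
    refine convex_quadrant.isPreconnected.subset_left_of_subset_union
      (v := {p | ∀ᶠ z in 𝓝 p, z ∉ D}) isOpen_setOfPred_eventually_nhds
      isOpen_setOfPred_eventually_nhds
      ?_ hloc ⟨γ (l / 2), hmidq, ?_⟩
    · rw [Set.disjoint_left]
      intro p hp hp'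
      exact hp'.self_of_nhds hp.self_of_nhds
    · rcases hloc _ hmidq with h1 | h1
      · exact h1
      · exact absurd (fun e => absurd hmid e : γ (l / 2) ∈ D) h1.self_of_nhds
  intro p hp hpΓ
  exact ⟨hone p, (hall hp).self_of_nhds hpΓ⟩

end IsQuadrantArc

/-! ### Admissible arcs -/

theorem exists_lipschitz_derivWithin {l : ℝ} (hl : 0 < l) {f : ℝ → ℝ}
    (hf : ContDiffOn ℝ 2 f (Icc 0 l)) : ∃ K, 0 < K ∧ ∀ s ∈ Icc 0 l, ∀ t ∈ Icc 0 l,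
      |derivWithin f (Icc 0 l) s - derivWithin f (Icc 0 l) t| ≤ K * |s - t| := by
  have h1 : ContDiffOn ℝ 1 (derivWithin f (Icc 0 l)) (Icc 0 l) :=
    hf.derivWithin (uniqueDiffOn_Icc hl) (by norm_num)
  obtain ⟨K, hK⟩ := h1.exists_lipschitzOnWith one_ne_zero (convex_Icc 0 l) isCompact_Icc
  refine ⟨K + 1, by positivity, fun s hs t ht => ?_⟩
  have h2 := hK.dist_le_mul s hs t ht
  rw [Real.dist_eq, Real.dist_eq] at h2
  linarith [abs_nonneg (s - t)]

/-- Orthogonality at the ends comes from the end point inequalities: y(0) = 0 forces x'(0) = 0 and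
x(l) = 0 forces y'(l) = 0, because 1 + ε ≠ 0. The Lipschitz tangent comes from the second
derivatives. -/
theorem IsAdmissibleArc.isQuadrantArc {a b l : ℝ} {x y : ℝ → ℝ} (h : IsAdmissibleArc a b l x y) :
    IsQuadrantArc l (fun s => ⟨x s, y s⟩)
      (fun s => ⟨derivWithin x (Icc 0 l) s, derivWithin y (Icc 0 l) s⟩) := by
  have hl := h.l_pos
  obtain ⟨c, ε, δ, hε, -, hδ, hends⟩ := h.near_ends
  have hε' : 1 + ε ≠ 0 := by positivity
  refine ⟨hl, fun s hs => ?_, fun s hs => ?_, ?_, fun s hs t ht e => ?_, fun s hs => ?_,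
    fun s hs => ?_, h.start_y, h.end_x, ?_, ?_⟩
  · have hx := ((h.contDiffOn_x.differentiableOn (by norm_num)) s hs).hasDerivWithinAt
    have hy := ((h.contDiffOn_y.differentiableOn (by norm_num)) s hs).hasDerivWithinAt
    have hx' := Complex.ofRealCLM.hasFDerivAt.comp_hasDerivWithinAt s hx
    have hy' := Complex.ofRealCLM.hasFDerivAt.comp_hasDerivWithinAt s hy
    have e : ∀ u w : ℝ, (⟨u, w⟩ : ℂ) = u + w * Complex.I := fun u w => by
      simp [Complex.ext_iff]
    simp only [e]
    exact hx'.add (hy'.mul_const Complex.I)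
  · have h1 := Complex.sq_norm (⟨derivWithin x (Icc 0 l) s, derivWithin y (Icc 0 l) s⟩ : ℂ)
    rw [Complex.normSq_mk, ← sq, ← sq, h.arcLength s hs] at h1
    exact (pow_eq_one_iff_of_nonneg (norm_nonneg _) two_ne_zero).1 h1
  · obtain ⟨K₁, hK₁, h1⟩ := exists_lipschitz_derivWithin hl h.contDiffOn_x
    obtain ⟨K₂, hK₂, h2⟩ := exists_lipschitz_derivWithin hl h.contDiffOn_y
    refine ⟨K₁ + K₂, by positivity, fun s hs t ht => ?_⟩
    refine (Complex.norm_le_abs_re_add_abs_im _).trans ?_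
    rw [Complex.sub_re, Complex.sub_im, add_mul]
    exact add_le_add (h1 s hs t ht) (h2 s hs t ht)
  · exact h.simple hs ht (by
      simp only [Complex.mk.injEq] at e
      exact Prod.ext e.1 e.2)
  · rcases hs.1.lt_or_eq with h1 | h1
    · exact h.x_pos s ⟨h1, hs.2⟩
    · rw [← h1]
      simpa only [h.start_x] using h.a_pos
  · rcases hs.2.lt_or_eq with h1 | h1
    · exact h.y_pos s ⟨hs.1, h1⟩
    · rw [h1]
      simpa only [h.end_y] using h.b_pos
  · have h1 := (hends 0 (left_mem_Icc.2 hl.le) (Or.inl hδ)).1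
    rw [h.start_y, Real.zero_rpow hε', mul_zero] at h1
    exact abs_nonpos_iff.1 h1
  · have h1 := (hends l (right_mem_Icc.2 hl.le) (Or.inr (by linarith))).2
    rw [h.end_x, Real.zero_rpow hε', mul_zero] at h1
    exact abs_nonpos_iff.1 h1

/-- The two integrands agree except possibly at the ends and at parameters mapped to the pole. The
arc is simple, so there is at most one of the latter and the exceptional set is null. -/
theorem IsAdmissibleArc.doubleLayer_eq {a b l : ℝ} {x y : ℝ → ℝ} (h : IsAdmissibleArc a b l x y)
    {α β x₀ y₀ c : ℝ} (hα : 0 < α) (hβ : 0 < β) (hx₀ : 0 ≤ x₀) (hy₀ : 0 ≤ y₀)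
    (hI : IntervalIntegrable (fun s => streamForm α β ⟨x₀, y₀⟩ ⟨x s, y s⟩
      ⟨derivWithin x (Icc 0 l) s, derivWithin y (Icc 0 l) s⟩) volume 0 l ∧
      ∫ s in (0 : ℝ)..l, streamForm α β ⟨x₀, y₀⟩ ⟨x s, y s⟩
        ⟨derivWithin x (Icc 0 l) s, derivWithin y (Icc 0 l) s⟩ = c) :
    IntervalIntegrable (doubleLayerIntegrand α β l x y (fun _ => 1) x₀ y₀) volume 0 l ∧
      doubleLayer α β l x y (fun _ => 1) x₀ y₀ = c := by
  have hnull : volume {s ∈ Icc 0 l | (x s, y s) = (x₀, y₀)} = 0 :=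
    Set.Subsingleton.measure_zero
      (fun s hs t ht => h.simple hs.1 ht.1 (hs.2.trans ht.2.symm)) _
  have hae : ∀ᵐ s, s ∈ uIoc 0 l → streamForm α β ⟨x₀, y₀⟩ ⟨x s, y s⟩
      ⟨derivWithin x (Icc 0 l) s, derivWithin y (Icc 0 l) s⟩
      = doubleLayerIntegrand α β l x y (fun _ => 1) x₀ y₀ s := by
    have hl : ∀ᵐ s : ℝ, s ≠ l := Measure.ae_ne volume l
    filter_upwards [measure_eq_zero_iff_ae_notMem.1 hnull, hl] with s hs hsl hs'
    rw [uIoc_of_le h.l_pos.le] at hs'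
    have hs2 : s ∈ Ioo 0 l := ⟨hs'.1, lt_of_le_of_ne hs'.2 hsl⟩
    rw [doubleLayerIntegrand_eq hα hβ (h.x_pos s hs2) (h.y_pos s hs2) hx₀ hy₀
      (fun e => hs ⟨Ioo_subset_Icc_self hs2, e⟩), streamForm]
  refine ⟨hI.1.congr_ae ((ae_restrict_iff' measurableSet_uIoc).2 hae), ?_⟩
  rw [doubleLayer, ← hI.2]
  exact intervalIntegral.integral_congr_ae (hae.mono fun s hs hs' => (hs hs').symm)

theorem IsQuadrantArc.integral_streamForm_of_reverse {l : ℝ} {γ v : ℝ → ℂ} {α β c : ℝ} {p : ℂ}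
    (hI : IntervalIntegrable (fun s => streamForm β α (swapC p) (swapC (γ (l - s)))
      (-swapC (v (l - s)))) volume 0 l ∧
      ∫ s in (0 : ℝ)..l, streamForm β α (swapC p) (swapC (γ (l - s))) (-swapC (v (l - s))) = c) :
    IntervalIntegrable (fun s => streamForm α β p (γ s) (v s)) volume 0 l ∧
      ∫ s in (0 : ℝ)..l, streamForm α β p (γ s) (v s) = c := by
  simp only [streamForm_swapC] at hI
  constructor
  · have h1 := (hI.1.comp_sub_left l).symm
    simpa only [sub_sub_cancel, sub_zero, sub_self] using h1
  · have h1 := intervalIntegral.integral_comp_sub_left (a := 0) (b := l)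
      (fun s => streamForm α β p (γ s) (v s)) l
    rw [sub_self, sub_zero] at h1
    rw [← h1, hI.2]

theorem IsDomainBoundedBy.arcIndex_eq {a b l : ℝ} {x y : ℝ → ℝ} {Ω : Set (ℝ × ℝ)}
    (h : IsAdmissibleArc a b l x y) (hΩ : IsDomainBoundedBy Ω a b l x y) {x₀ y₀ : ℝ}
    (hx₀ : 0 < x₀) (hy₀ : 0 < y₀) (hΓ : (x₀, y₀) ∉ arcSet l x y) :
    ((x₀, y₀) ∈ Ω → arcIndex l (fun s => ⟨x s, y s⟩)
      (fun s => ⟨derivWithin x (Icc 0 l) s, derivWithin y (Icc 0 l) s⟩) ⟨x₀, y₀⟩ = 1) ∧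
    ((x₀, y₀) ∉ Ω → arcIndex l (fun s => ⟨x s, y s⟩)
      (fun s => ⟨derivWithin x (Icc 0 l) s, derivWithin y (Icc 0 l) s⟩) ⟨x₀, y₀⟩ = 0) := by
  set e := Complex.equivRealProdCLM.toHomeomorph
  have he : ∀ z : ℂ, e z = (z.re, z.im) := fun z => rfl
  have hfr : frontier (e ⁻¹' Ω) = e ⁻¹' frontier Ω := (e.preimage_frontier Ω).symm
  have ha := h.a_pos
  -- The midpoint of the base segment serves as the boundary point where the index is known to be 1.
  refine h.isQuadrantArc.arcIndex_of_domain (Ω := e ⁻¹' Ω) (hΩ.isOpen.preimage e.continuous)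
    (e.isPreconnected_preimage.2 hΩ.isConnected.isPreconnected) (fun z hz => ?_) ?_
    ⟨a / 2, by linarith, ?_, ?_⟩ ⟨x₀, y₀⟩ ⟨hx₀, hy₀⟩ ?_
  · have := hΩ.subset_quadrant hz
    exact ⟨this.1, this.2⟩
  · rw [hfr, hΩ.frontier_eq]
    ext z
    constructor
    · rintro ⟨(⟨-, hz⟩ | ⟨hz, -⟩) | ⟨s, hs, hz⟩, hq⟩
      · have h1 : z.im = 0 := hz
        have h2 := hq.2
        rw [h1] at h2
        exact absurd h2 (lt_irrefl _)
      · have h1 : z.re = 0 := hz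
        have h2 := hq.1
        rw [h1] at h2
        exact absurd h2 (lt_irrefl _)
      · simp only [he, Prod.mk.injEq] at hz
        refine ⟨s, ⟨lt_of_le_of_ne hs.1 fun e0 => ?_, lt_of_le_of_ne hs.2 fun e0 => ?_⟩,
          Complex.ext hz.1 hz.2⟩
        · have h2 := hq.2
          rw [← hz.2, ← e0, h.start_y] at h2
          exact lt_irrefl _ h2
        · have h2 := hq.1
          rw [← hz.1, e0, h.end_x] at h2
          exact lt_irrefl _ h2
    · rintro ⟨s, hs, rfl⟩
      exact ⟨Or.inr ⟨s, Ioo_subset_Icc_self hs, rfl⟩, h.x_pos s hs, h.y_pos s hs⟩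
  · simp only [h.start_x]
    linarith
  · rw [hfr, hΩ.frontier_eq]
    refine Or.inl (Or.inl ⟨?_, ?_⟩)
    · rw [he]
      simp only [Complex.ofReal_re]
      exact ⟨by linarith, by linarith⟩
    · rw [he]
      simp only [Complex.ofReal_im]
      exact mem_singleton _
  · rintro ⟨s, hs, hz⟩
    rw [Complex.mk.injEq] at hz
    exact hΓ ⟨s, Ioo_subset_Icc_self hs, Prod.ext hz.1 hz.2⟩

end GASPT

/-! ### The three positions of the pole -/

open GASPT in
theorem lemma3p1 (α β : ℝ) (hα : 0 < 2 * α) (hα' : 2 * α < 1) (hβ : 0 < 2 * β) (hβ' : 2 * β < 1)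
    (a b l : ℝ) (x y : ℝ → ℝ) (hΓ : GASPT.IsAdmissibleArc a b l x y)
    (Ω : Set (ℝ × ℝ)) (hΩ : GASPT.IsDomainBoundedBy Ω a b l x y)
    (x₀ y₀ : ℝ) (hx₀ : 0 ≤ x₀) (hy₀ : 0 ≤ y₀) :
    ((x₀, y₀) ∈ Ω →
      IntervalIntegrable (GASPT.doubleLayerIntegrand α β l x y (fun _ => 1) x₀ y₀)
          MeasureTheory.volume 0 l ∧
        GASPT.doubleLayer α β l x y (fun _ => 1) x₀ y₀ = -1) ∧
    ((x₀, y₀) ∈ GASPT.arcSet l x y →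
      IntervalIntegrable (GASPT.doubleLayerIntegrand α β l x y (fun _ => 1) x₀ y₀)
          MeasureTheory.volume 0 l ∧
        GASPT.doubleLayer α β l x y (fun _ => 1) x₀ y₀ = -(1 / 2)) ∧
    ((x₀, y₀) ∉ closure Ω →
      IntervalIntegrable (GASPT.doubleLayerIntegrand α β l x y (fun _ => 1) x₀ y₀)
          MeasureTheory.volume 0 l ∧
        GASPT.doubleLayer α β l x y (fun _ => 1) x₀ y₀ = 0) := by
  have hα : 0 < α := by linarith
  have hβ : 0 < β := by linarith
  have hq := hΓ.isQuadrantArc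
  have hnotΓ : (x₀, y₀) ∉ arcSet l x y → (⟨x₀, y₀⟩ : ℂ) ∉ (fun s => (⟨x s, y s⟩ : ℂ)) '' Icc 0 l := by
    rintro h1 ⟨s, hs, e⟩
    rw [Complex.mk.injEq] at e
    exact h1 ⟨s, hs, Prod.ext e.1 e.2⟩
  have hfrontier : frontier Ω ⊆ closure Ω := frontier_subset_closure
  refine ⟨fun h => ?_, fun h => ?_, fun h => ?_⟩
  · have hpos := hΩ.subset_quadrant h
    have h1 : (x₀, y₀) ∉ arcSet l x y := fun h1 => by
      have h2 : (x₀, y₀) ∈ frontier Ω := by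
        rw [hΩ.frontier_eq]
        exact Or.inr h1
      rw [hΩ.isOpen.frontier_eq] at h2
      exact h2.2 h
    refine hΓ.doubleLayer_eq hα hβ hx₀ hy₀ ⟨hq.intervalIntegrable_streamForm_of_notMem hα hβ hx₀ hy₀
      (hnotΓ h1), ?_⟩
    rw [hq.integral_streamForm_of_notMem hα hβ (p := ⟨x₀, y₀⟩) hpos.1 hpos.2 (hnotΓ h1),
      (hΩ.arcIndex_eq hΓ hpos.1 hpos.2 h1).1 h]
  · obtain ⟨s, hs, e⟩ := h
    rw [Prod.mk.injEq] at e
    obtain ⟨rfl, rfl⟩ := e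
    refine hΓ.doubleLayer_eq hα hβ hx₀ hy₀ ?_
    -- The end points of the arc lie on the axes and need the separate computation; the end on the
    -- y-axis is reduced to the start by reflection.
    rcases hs.1.eq_or_lt with rfl | h1
    · exact ⟨hq.intervalIntegrable_streamForm_start hα hβ, hq.integral_streamForm_start hα hβ⟩
    rcases hs.2.eq_or_lt with rfl | h2
    · refine IsQuadrantArc.integral_streamForm_of_reverse (γ := fun s => ⟨x s, y s⟩)
        (v := fun t => ⟨derivWithin x (Icc 0 s) t, derivWithin y (Icc 0 s) t⟩) ?_
      have i1 := hq.reverse.intervalIntegrable_streamForm_start hβ hα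
      have i2 := hq.reverse.integral_streamForm_start hβ hα
      rw [sub_zero] at i1 i2
      exact ⟨i1, i2⟩
    · refine ⟨hq.intervalIntegrable_streamForm_of_mem hα hβ ⟨h1, h2⟩, ?_⟩
      rw [hq.integral_streamForm_of_mem hα hβ ⟨h1, h2⟩, hq.arcIndex_of_mem ⟨h1, h2⟩]
  · have hfr : (x₀, y₀) ∉ Icc 0 a ×ˢ {0} ∪ {0} ×ˢ Icc 0 b ∪ arcSet l x y := fun h1 => h (by
      rw [← hΩ.frontier_eq] at h1
      exact hfrontier h1)
    rw [mem_union, mem_union, not_or, not_or] at hfr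
    obtain ⟨⟨h1, h2⟩, h3⟩ := hfr
    have h4 : (x₀, y₀) ∉ Ω := fun h4 => h (subset_closure h4)
    refine hΓ.doubleLayer_eq hα hβ hx₀ hy₀ ?_
    -- The segments [0, a] and [0, b] belong to the closure of Ω, so an axis point outside it lies
    -- beyond A or B.
    rcases hy₀.eq_or_lt with rfl | hy
    · have h5 : a < x₀ := not_le.1 fun h5 => h1 ⟨⟨hx₀, h5⟩, rfl⟩
      exact hq.integral_streamForm_axis hα hβ (x₀ := x₀) (by simpa only [hΓ.start_x] using h5)
    rcases hx₀.eq_or_lt with rfl | hx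
    · have h5 : b < y₀ := not_le.1 fun h5 => h2 ⟨rfl, hy.le, h5⟩
      exact IsQuadrantArc.integral_streamForm_of_reverse
        (hq.reverse.integral_streamForm_axis hβ hα (x₀ := y₀)
          (by simpa only [swapC, sub_zero, hΓ.end_y] using h5))
    · refine ⟨hq.intervalIntegrable_streamForm_of_notMem hα hβ hx₀ hy₀ (hnotΓ h3), ?_⟩
      rw [hq.integral_streamForm_of_notMem hα hβ (p := ⟨x₀, y₀⟩) hx hy (hnotΓ h3),
        (hΩ.arcIndex_eq hΓ hx hy h3).2 h4, neg_zero]
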